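/- **Setting.** Let $d\in\{2,3\}$, $L,H>0$, $\Omega=\mathbb T^{d-1}\times[-H,H]$ with $\mathbb T$ the circle of length $2L$, and let $\mu>0$, $\eta\ge 0$, $\kappa>0$, $c_v>0$, $\alpha>-1$ and a bounded measurable $\mathbf g:\Omega\to\mathbb R^d$ be fixed. Put $\lambda=\eta-\frac2d\mu$ and $s(\varrho,\vartheta)=c_v\log\vartheta-\log\varrho$. Let $T>0$ and let $\vartheta_B\in W^{2,\infty}((0,T)\times\Omega)$ be positive. Divide $\Omega$ into uniform cubes $K$ of size $h\in(0,1)$ and $[0,T]$ into $N_T$ steps of length $\Delta t\in(0,1)$, $t_k=k\Delta t$, $t_{N_T}=T$, with $\underline C\,h\le\Delta t\le\overline C\,h$, where $\underline C>0$. $Q_h$ is the space of functions that are constant on each cube, $\Pi_Q$ is the cell-average projection, $\mathcal E_{\rm int},\mathcal E_{\rm ext}$ are the interior and exterior faces and $\mathcal E(K)$ the faces of $K$. On a face with normal $\mathbf n$, $v^{\rm in},v^{\rm out}$ are the one-sided values of $v$ against and along $\mathbf n$, $[\![v]\!]=v^{\rm out}-v^{\rm in}$, $\{v\}=\frac12(v^{\rm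 in}+v^{\rm out})$; on the cells $(\nabla_hv)|_K=\sum_{\sigma\in\mathcal E(K)}\mathbf n\{v\}/h$ (componentwise for vectors), ${\rm div}_h$ is the trace of $\nabla_h$ and $\mathbb D_h$ its symmetric part; $\nabla_{\mathcal E}v$ has the $i$-th component $[\![v]\!]/h$ ($\mathbf n=\mathbf e_i$) on the dual cube centred at each face orthogonal to $\mathbf e_i$. On exterior faces the averages of velocities and of vector test functions are set to $0$, and that of $\vartheta_h^k$ to $\vartheta_{B,h}^k$, the face average of $\vartheta_B(t_k,\cdot)$; this defines $v^{\rm out}$ there. Let $F_h^\alpha(r,\mathbf u)=r^{\rm up}\{\mathbf u\}\cdot\mathbf n-h^\alpha[\![r]\!]$, with $r^{\rm up}=r^{\rm in}$ if $\{\mathbf u\}\cdot\mathbf n\ge0$ and $r^{\rm up}=r^{\rm out}$ otherwise; $\mathbb S_h^k=2\mu\mathbb D_h\mathbf u_h^k+\lambda\,{\rm div}_h\mathbf u_h^k\,\mathbb I$; $p_h^k=\varrho_h^k\vartheta_h^k$; $D_tv^k=(v^k-v^{k-1})/\Delta t$. A *numerical solution* is a sequence $(\varrho_h^k,\mathbf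 u_h^k,\vartheta_h^k)_{k=0}^{N_T}$ in $Q_h\times Q_h^d\times Q_h$ whose term $k=0$ is $\Pi_Q(\varrho_0,\mathbf u_0,\vartheta_0)$ for integrable initial data, such that for $k=1,\dots,N_T$ and all $\phi_h\in Q_h$, $\boldsymbol\Phi_h\in Q_h^d$ $$\int_\Omega D_t\varrho_h^k\phi_h\,dx-\int_{\mathcal E_{\rm int}}F_h^\alpha(\varrho_h^k,\mathbf u_h^k)[\![\phi_h]\!]\,dS=0,$$ $$\int_\Omega D_t(\varrho_h^k\mathbf u_h^k)\cdot\boldsymbol\Phi_h\,dx-\int_{\mathcal E_{\rm int}}F_h^\alpha(\varrho_h^k\mathbf u_h^k,\mathbf u_h^k)\cdot[\![\boldsymbol\Phi_h]\!]\,dS+\int_\Omega(\mathbb S_h^k-p_h^k\mathbb I):\mathbb D_h\boldsymbol\Phi_h\,dx=\int_\Omega\varrho_h^k\mathbf g\cdot\boldsymbol\Phi_h\,dx,$$ $$c_v\int_\Omega D_t(\varrho_h^k\vartheta_h^k)\phi_h\,dx-c_v\int_{\mathcal E_{\rm int}}F_h^\alpha(\varrho_h^k\vartheta_h^k,\mathbf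 u_h^k)[\![\phi_h]\!]\,dS+\int_{\mathcal E_{\rm int}}\frac\kappa h[\![\vartheta_h^k]\!][\![\phi_h]\!]\,dS+2\int_{\mathcal E_{\rm ext}}\frac\kappa h\big((\vartheta_h^k)^{\rm in}-\vartheta_B(t_k,\cdot)\big)\phi_h^{\rm in}\,dS=\int_\Omega(\mathbb S_h^k-p_h^k\mathbb I):\nabla_h\mathbf u_h^k\,\phi_h\,dx.$$ Assume the bounds $0<\underline\varrho\le\varrho_h^k\le\overline\varrho$, $0<\underline\vartheta\le\vartheta_h^k\le\overline\vartheta$, $|\mathbf u_h^k|\le\overline u$ for $k=0,\dots,N_T$, and put $$\Lambda=T+\|\vartheta_B\|_{W^{2,\infty}((0,T)\times\Omega)}+\tfrac1{\underline\varrho}+\overline\varrho+\tfrac1{\underline\vartheta}+\overline\vartheta+\overline u+\tfrac1{\underline C}+\overline C.$$ Let $(\varrho_h,\mathbf u_h,\vartheta_h)(t)=(\varrho_h^k,\mathbf u_h^k,\vartheta_h^k)$ for $t\in(t_{k-1},t_k]$, with $\mathbb S_h$ and $s_h=s(\varrho_h,\vartheta_h)$ accordingly. For $\Theta$, $\psi$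 and a function $\chi_h$ on $(0,T)\times\Omega$ define $$\begin{aligned}\langle error_{BE};\psi\rangle={}&\psi(0)\int_\Omega\Big(\tfrac12\varrho_h^0|\mathbf u_h^0|^2+c_v\varrho_h^0\vartheta_h^0-\varrho_h^0s(\varrho_h^0,\vartheta_h^0)\Theta(0,\cdot)\Big)dx+\int_0^T\psi\int_\Omega\varrho_h\mathbf g\cdot\mathbf u_h\,dx\,dt\\&+\int_0^T\partial_t\psi\int_\Omega\Big(\tfrac12\varrho_h|\mathbf u_h|^2+c_v\varrho_h\vartheta_h-\varrho_hs_h\Theta\Big)dx\,dt-\int_0^T\psi\int_\Omega\Big(\frac{\kappa\Theta\chi_h}{\vartheta_h^2}|\nabla_{\mathcal E}\vartheta_h|^2+\frac\Theta{\vartheta_h}\mathbb S_h:\nabla_h\mathbf u_h\Big)dx\,dt\\&-\int_0^T\psi\int_\Omega\Big(\varrho_hs_h\partial_t\Theta+\varrho_hs_h\mathbf u_h\cdot\nabla_x\Theta-\frac\kappa{\vartheta_h}\nabla_{\mathcal E}\vartheta_h\cdot\nabla_x\Theta\Big)dx\,dt.\end{aligned}$$ **Lemma.** There are functions $C(\cdot,\cdot)$,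 $\underline\chi(\cdot)>0$, $\overline\chi(\cdot)$ and $\varepsilon(\cdot,\cdot)$ with $\varepsilon(\Lambda,h)\to0$ as $h\to0^+$ for each $\Lambda$, depending only on the fixed data $d,L,H,\mu,\eta,\kappa,c_v,\alpha,\mathbf g$, such that for every numerical solution as above there is a measurable $\chi_h$ with $$\underline\chi(\Lambda)\le\chi_h\le\overline\chi(\Lambda),\qquad\|\chi_h-1\|_{L^1((0,T)\times\Omega)}\le\varepsilon(\Lambda,h),$$ for which, for every positive $\Theta\in W^{2,\infty}((0,T)\times\Omega)$ with $\Theta|_{\partial\Omega}=\vartheta_B$ and every $\psi\in W^{1,2}(0,T)$ with $\psi\ge0$ and $\psi(T)=0$, $$\langle error_{BE};\psi\rangle\ge-C\big(\Lambda,\|\Theta\|_{W^{2,\infty}((0,T)\times\Omega)}\big)\,\|\psi\|_{W^{1,2}(0,T)}\Big(h^{(1-\alpha)/2}+h^{(1+\alpha)/2}\Big).$$ -/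

import Mathlib

open MeasureTheory Filter Topology
open scoped ContDiff

noncomputable section

namespace BallisticFV

/-! ## Weak derivatives and Sobolev classes -/

section Weak

variable {E : Type*} [NormedAddCommGroup E] [NormedSpace ℝ E] [MeasureSpace E]

/-- `g` is the weak derivative of `f` in the direction `v` on the open set `U`. -/
def HasWeakDeriv (U : Set E) (v : E) (f g : E → ℝ) : Prop :=
  LocallyIntegrableOn f U ∧ LocallyIntegrableOn g U ∧
    ∀ φ : E → ℝ, ContDiff ℝ ∞ φ → HasCompactSupport φ → tsupport φ ⊆ U →
      ∫ x in U, f x * fderiv ℝ φ x v = -∫ x in U, g x * φ x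

open Classical in
/-- The weak derivative of `f` in the direction `v` on `U`: determined almost everywhere on `U`
if it exists, and `0` if it does not. -/
def weakDeriv (U : Set E) (v : E) (f : E → ℝ) : E → ℝ :=
  if hg : ∃ g, HasWeakDeriv U v f g then hg.choose else 0

end Weak

/-- `ψ ∈ W^{1,2}(0,T)`, given by its continuous representative on `[0,T]`. -/
structure MemW12 (T : ℝ) (ψ : ℝ → ℝ) : Prop where
  cont : ContinuousOn ψ (Set.Icc 0 T)
  memLp : MemLp ψ 2 (volume.restrict (Set.Ioo 0 T))
  exists_deriv : ∃ g, HasWeakDeriv (Set.Ioo 0 T) 1 ψ g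
  deriv_memLp : MemLp (weakDeriv (Set.Ioo 0 T) 1 ψ) 2 (volume.restrict (Set.Ioo 0 T))

/-- The norm of `W^{1,2}(0,T)`. -/
def normW12 (T : ℝ) (ψ : ℝ → ℝ) : ℝ :=
  Real.sqrt ((∫ t in Set.Ioo 0 T, ψ t ^ 2) +
    ∫ t in Set.Ioo 0 T, weakDeriv (Set.Ioo 0 T) 1 ψ t ^ 2)

/-- The space `ℝ^d` with `d = n + 1`; the first `n` coordinates are the horizontal (periodic)
ones, the last one is the vertical one. -/
abbrev Space (n : ℕ) := Fin (n + 1) → ℝ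

/-- Points `(t, x)`. -/
abbrev SpaceTime (n : ℕ) := ℝ × Space n

/-- The open set `(0,T) × ℝ^n × (-H,H)`, on which functions on `(0,T) × Ω` live as horizontally
periodic functions. -/
def stSlab (n : ℕ) (H T : ℝ) : Set (SpaceTime n) :=
  {z | z.1 ∈ Set.Ioo 0 T ∧ z.2 (Fin.last n) ∈ Set.Ioo (-H) H}

/-- The closed set `[0,T] × ℝ^n × [-H,H]`. -/
def stSlabClosed (n : ℕ) (H T : ℝ) : Set (SpaceTime n) :=
  {z | z.1 ∈ Set.Icc 0 T ∧ z.2 (Fin.last n) ∈ Set.Icc (-H) H}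

/-- The coordinate directions of space-time: `none` is time, `some i` the `i`-th space
direction. -/
def stDir {n : ℕ} : Option (Fin (n + 1)) → SpaceTime n
  | none => (1, 0)
  | some i => (0, Pi.single i 1)

/-- The weak partial derivative on `(0,T) × Ω` in the coordinate direction `a`. -/
def stPartial {n : ℕ} (H T : ℝ) (a : Option (Fin (n + 1))) (f : SpaceTime n → ℝ) :
    SpaceTime n → ℝ :=
  weakDeriv (stSlab n H T) (stDir a) f

/-- `f ∈ W^{2,∞}((0,T) × Ω)`, where `Ω = 𝕋^n × [-H,H]` and `𝕋` is the circle of length `2L`,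
given by its continuous representative on `[0,T] × Ω`: `f` is `2L`-periodic in the horizontal
variables, and its weak derivatives of order at most two are essentially bounded. -/
structure MemW2Inf {n : ℕ} (L H T : ℝ) (f : SpaceTime n → ℝ) : Prop where
  periodic : ∀ z ∈ stSlabClosed n H T, ∀ i : Fin n,
    f (z.1, z.2 + Pi.single i.castSucc (2 * L)) = f z
  cont : ContinuousOn f (stSlabClosed n H T)
  memLp : MemLp f ⊤ (volume.restrict (stSlab n H T))
  exists_deriv : ∀ a, ∃ g, HasWeakDeriv (stSlab n H T) (stDir a) f g
  deriv_memLp : ∀ a, MemLp (stPartial H T a f) ⊤ (volume.restrict (stSlab n H T))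
  exists_deriv2 : ∀ a b, ∃ g, HasWeakDeriv (stSlab n H T) (stDir b) (stPartial H T a f) g
  deriv2_memLp : ∀ a b,
    MemLp (stPartial H T b (stPartial H T a f)) ⊤ (volume.restrict (stSlab n H T))

/-- The norm of `L^∞((0,T) × Ω)`. -/
def normLInf {n : ℕ} (H T : ℝ) (f : SpaceTime n → ℝ) : ℝ :=
  (eLpNorm f ⊤ (volume.restrict (stSlab n H T))).toReal

/-- The norm of `W^{2,∞}((0,T) × Ω)`. -/
def normW2Inf {n : ℕ} (H T : ℝ) (f : SpaceTime n → ℝ) : ℝ :=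
  normLInf H T f + (∑ a, normLInf H T (stPartial H T a f)) +
    ∑ a, ∑ b, normLInf H T (stPartial H T b (stPartial H T a f))

/-! ## The model -/

/-- The data of the fluid in the periodic slab: geometry (half-lengths `L`, `H`), viscosities,
heat conductivity, specific heat, gravitational force, and the exponent of the numerical
diffusion. -/
structure Model (n : ℕ) where
  L : ℝ
  H : ℝ
  mu : ℝ
  eta : ℝ
  kappa : ℝ
  cv : ℝ
  alpha : ℝ
  g : Space n → Space n
  L_pos : 0 < L
  H_pos : 0 < H
  mu_pos : 0 < mu
  eta_nonneg : 0 ≤ eta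
  kappa_pos : 0 < kappa
  cv_pos : 0 < cv
  alpha_gt : -1 < alpha
  g_meas : Measurable g
  g_bdd : ∃ B : ℝ, ∀ x i, |g x i| ≤ B

/-- A fundamental domain of `Ω = 𝕋^n × [-H,H]`. -/
def Model.Omega {n : ℕ} (P : Model n) : Set (Space n) :=
  {x | (∀ i : Fin n, x i.castSucc ∈ Set.Icc (-P.L) P.L) ∧ x (Fin.last n) ∈ Set.Icc (-P.H) P.H}

/-- The entropy `s(ρ,ϑ) = c_v log ϑ - log ρ`. -/
def Model.entropy {n : ℕ} (P : Model n) (r θ : ℝ) : ℝ := P.cv * Real.log θ - Real.log r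

/-- A uniform cubic mesh of size `h` of `Ω`, with `N` cells in each horizontal and `M` cells in
the vertical direction, and a partition of `[0,T]` into `NT` steps of length `dt`. -/
structure Discretization {n : ℕ} (P : Model n) (T : ℝ) where
  N : ℕ
  M : ℕ
  NT : ℕ
  h : ℝ
  dt : ℝ
  h_pos : 0 < h
  h_lt_one : h < 1
  dt_pos : 0 < dt
  dt_lt_one : dt < 1
  N_mul_h : N * h = 2 * P.L
  M_mul_h : M * h = 2 * P.H
  NT_mul_dt : NT * dt = T

/-! ## Cells, faces and difference operators -/

/-- The cells: horizontal position (periodic) and vertical position. An element of `Q_h` is a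
function on the cells. -/
abbrev Cell (n N M : ℕ) := (Fin n → Fin N) × Fin M

section Grid

variable {n N M : ℕ}

/-- The neighbour of `K` in the direction `+e_i`; `none` if the face in between is exterior
(the top of the slab). -/
def up (i : Fin (n + 1)) (K : Cell n N M) : Option (Cell n N M) :=
  Fin.lastCases (motive := fun _ => Option (Cell n N M))
    (if hj : K.2.val + 1 < M then some (K.1, ⟨K.2.val + 1, hj⟩) else none)
    (fun i => some (Function.update K.1 i (finRotate N (K.1 i)), K.2)) i

/-- The neighbour of `K` in the direction `-e_i`; `none` if the face in between is exterior
(the bottom of the slab). -/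
def down (i : Fin (n + 1)) (K : Cell n N M) : Option (Cell n N M) :=
  Fin.lastCases (motive := fun _ => Option (Cell n N M))
    (if 0 < K.2.val then
      some (K.1, ⟨K.2.val - 1, lt_of_le_of_lt (Nat.sub_le _ _) K.2.isLt⟩) else none)
    (fun i => some (Function.update K.1 i ((finRotate N).symm (K.1 i)), K.2)) i

/-- Values attached to the exterior faces: `b true a` on the top face and `b false a` on the
bottom face of the column `a` of cells. -/
abbrev BdryData (n N : ℕ) := Bool → (Fin n → Fin N) → ℝ

/-- The average `{v}` on the face of `K` in the direction `+e_i`; it is prescribed to be `b` on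
exterior faces. -/
def avgUp (b : BdryData n N) (v : Cell n N M → ℝ) (i : Fin (n + 1)) (K : Cell n N M) : ℝ :=
  match up i K with
  | some K' => (v K + v K') / 2
  | none => b true K.1

/-- The average `{v}` on the face of `K` in the direction `-e_i`. -/
def avgDown (b : BdryData n N) (v : Cell n N M → ℝ) (i : Fin (n + 1)) (K : Cell n N M) : ℝ :=
  match down i K with
  | some K' => (v K + v K') / 2
  | none => b false K.1

/-- The `i`-th component on `K` of `∇_h v = ∑_{σ ∈ E(K)} n {v} / h`. -/
def dcell (h : ℝ) (b : BdryData n N) (v : Cell n N M → ℝ) (i : Fin (n + 1))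
    (K : Cell n N M) : ℝ :=
  (avgUp b v i K - avgDown b v i K) / h

/-- The jump quotient `⟦v⟧ / h`, oriented along `+e_i`, on the face of `K` in the direction
`+e_i`. On an exterior face the outer value is `2 b - v_K`, so that the average is `b`. -/
def dfaceUp (h : ℝ) (b : BdryData n N) (v : Cell n N M → ℝ) (i : Fin (n + 1))
    (K : Cell n N M) : ℝ :=
  match up i K with
  | some K' => (v K' - v K) / h
  | none => ((2 * b true K.1 - v K) - v K) / h

/-- The jump quotient `⟦v⟧ / h`, oriented along `+e_i`, on the face of `K` in the direction
`-e_i`. -/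
def dfaceDown (h : ℝ) (b : BdryData n N) (v : Cell n N M → ℝ) (i : Fin (n + 1))
    (K : Cell n N M) : ℝ :=
  match down i K with
  | some K' => (v K - v K') / h
  | none => (v K - (2 * b false K.1 - v K)) / h

/-- The component `∂_i v_j` of the discrete gradient of a velocity, with `{v} = 0` on exterior
faces. -/
def gradH (h : ℝ) (v : Cell n N M → Space n) (K : Cell n N M) (i j : Fin (n + 1)) : ℝ :=
  dcell h (fun _ _ => 0) (fun K => v K j) i K

/-- The discrete symmetric gradient `D_h v`. -/
def symGradH (h : ℝ) (v : Cell n N M → Space n) (K : Cell n N M) (i j : Fin (n + 1)) : ℝ :=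
  (gradH h v K i j + gradH h v K j i) / 2

/-- The discrete viscous stress `S_h = 2 μ D_h v + λ tr (D_h v) I`, `λ = η - 2 μ / d`. -/
def stress (P : Model n) (h : ℝ) (v : Cell n N M → Space n) (K : Cell n N M)
    (i j : Fin (n + 1)) : ℝ :=
  2 * P.mu * symGradH h v K i j +
    if i = j then (P.eta - 2 / ((n : ℝ) + 1) * P.mu) * ∑ k, symGradH h v K k k else 0

/-- `S_h : ∇_h v` on `K`. -/
def stressPower (P : Model n) (h : ℝ) (v : Cell n N M → Space n) (K : Cell n N M) : ℝ :=
  ∑ i, ∑ j, stress P h v K i j * gradH h v K i j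

/-- The integral over `Ω` of the piecewise constant function `f` (a cell has volume
`h^(n+1)`). -/
def intCells (h : ℝ) (f : Cell n N M → ℝ) : ℝ := ∑ K, h ^ (n + 1) * f K

/-- The integral over the interior faces (each of area `h^n`): `f i K K'` is the value on the
face between `K` (inner cell) and `K'` (outer cell), whose normal is `e_i`. -/
def intFacesInt (h : ℝ) (f : Fin (n + 1) → Cell n N M → Cell n N M → ℝ) : ℝ :=
  ∑ i, ∑ K, match up i K with
    | some K' => h ^ n * f i K K'
    | none => 0

/-- The integral over the exterior faces (each of area `h^n`): `f s K` is the value on the top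
(`s = true`) or bottom (`s = false`) face of the boundary cell `K`. -/
def intFacesExt (h : ℝ) (f : Bool → Cell n N M → ℝ) : ℝ :=
  ∑ K, ((if up (Fin.last n) K = none then h ^ n * f true K else 0) +
    if down (Fin.last n) K = none then h ^ n * f false K else 0)

/-- The diffusive upwind flux `F_h^α (r, v)` on the face between `K` and `K'` with normal
`e_i`. -/
def flux (h α : ℝ) (r : Cell n N M → ℝ) (v : Cell n N M → Space n) (i : Fin (n + 1))
    (K K' : Cell n N M) : ℝ :=
  (if 0 ≤ (v K i + v K' i) / 2 then r K else r K') * ((v K i + v K' i) / 2) -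
    h ^ α * (r K' - r K)

end Grid

/-! ## The mesh in space -/

section Mesh

variable {n : ℕ} {P : Model n} {T : ℝ} (D : Discretization P T)

/-- The corner of the cell `K` with the smallest coordinates. -/
def Discretization.corner (K : Cell n D.N D.M) : Space n :=
  Fin.snoc (α := fun _ => ℝ) (fun i : Fin n => -P.L + ((K.1 i).val : ℝ) * D.h)
    (-P.H + (K.2.val : ℝ) * D.h)

/-- The cube `K`. -/
def Discretization.box (K : Cell n D.N D.M) : Set (Space n) :=
  {x | ∀ i, D.corner K i ≤ x i ∧ x i < D.corner K i + D.h}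

/-- The half of the cube `K` adjacent to its face in the direction `+e_i`: the part of the dual
cell of that face that lies in `K`. -/
def Discretization.halfUp (i : Fin (n + 1)) (K : Cell n D.N D.M) : Set (Space n) :=
  {x | x ∈ D.box K ∧ D.corner K i + D.h / 2 ≤ x i}

/-- The half of the cube `K` adjacent to its face in the direction `-e_i`. -/
def Discretization.halfDown (i : Fin (n + 1)) (K : Cell n D.N D.M) : Set (Space n) :=
  {x | x ∈ D.box K ∧ x i < D.corner K i + D.h / 2}

/-- The piecewise constant function with the value `v K` on the cell `K`. -/
def Discretization.pw (v : Cell n D.N D.M → ℝ) (x : Space n) : ℝ :=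
  ∑ K, (D.box K).indicator (fun _ => v K) x

/-- The `i`-th component of `∇_E v`, constant on the dual cells of the faces orthogonal to
`e_i`, for `v ∈ Q_h` with exterior averages `b`. -/
def Discretization.gradE (b : BdryData n D.N) (v : Cell n D.N D.M → ℝ) (i : Fin (n + 1))
    (x : Space n) : ℝ :=
  ∑ K, ((D.halfUp i K).indicator (fun _ => dfaceUp D.h b v i K) x +
    (D.halfDown i K).indicator (fun _ => dfaceDown D.h b v i K) x)

/-- The cell average projection `Π_Q`. -/
def Discretization.cellAvg (v : Space n → ℝ) (K : Cell n D.N D.M) : ℝ :=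
  (D.h ^ (n + 1))⁻¹ * ∫ x in D.box K, v x

/-- The averages `ϑ_{B,h}` of the boundary temperature over the exterior faces at time `t`. -/
def Discretization.bdryAvg (θB : SpaceTime n → ℝ) (t : ℝ) : BdryData n D.N := fun s a =>
  (D.h ^ n)⁻¹ * ∫ y in {y : Fin n → ℝ | ∀ i, -P.L + ((a i).val : ℝ) * D.h ≤ y i ∧
      y i < -P.L + ((a i).val : ℝ) * D.h + D.h},
    θB (t, Fin.snoc (α := fun _ => ℝ) y (if s then P.H else -P.H))

/-- The index of the time step at time `t`: it is `k` on `(t_{k-1}, t_k]`, and `0` for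
`t ≤ 0`. -/
def Discretization.idx (t : ℝ) : ℕ := ⌈t / D.dt⌉₊

/-- A sequence of discrete densities, velocities and temperatures; only the indices
`k = 0, …, NT` matter. -/
structure Fields where
  rho : ℕ → Cell n D.N D.M → ℝ
  u : ℕ → Cell n D.N D.M → Space n
  theta : ℕ → Cell n D.N D.M → ℝ

variable {D}

/-- The finite volume method with boundary temperature `θB` and initial data
`(ρ₀, u₀, ϑ₀)`. -/
structure Fields.IsSolution (F : Fields D) (θB : SpaceTime n → ℝ) (ρ₀ : Space n → ℝ)
    (u₀ : Space n → Space n) (θ₀ : Space n → ℝ) : Prop where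
  init_rho : F.rho 0 = D.cellAvg ρ₀
  init_u : ∀ K i, F.u 0 K i = D.cellAvg (fun x => u₀ x i) K
  init_theta : F.theta 0 = D.cellAvg θ₀
  mass : ∀ k, 1 ≤ k → k ≤ D.NT → ∀ φ : Cell n D.N D.M → ℝ,
    intCells D.h (fun K => (F.rho k K - F.rho (k - 1) K) / D.dt * φ K)
      - intFacesInt D.h (fun i K K' =>
          flux D.h P.alpha (F.rho k) (F.u k) i K K' * (φ K' - φ K)) = 0
  momentum : ∀ k, 1 ≤ k → k ≤ D.NT → ∀ Φ : Cell n D.N D.M → Space n,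
    intCells D.h (fun K => ∑ j,
        (F.rho k K * F.u k K j - F.rho (k - 1) K * F.u (k - 1) K j) / D.dt * Φ K j)
      - intFacesInt D.h (fun i K K' => ∑ j,
          flux D.h P.alpha (fun K => F.rho k K * F.u k K j) (F.u k) i K K' * (Φ K' j - Φ K j))
      + intCells D.h (fun K => ∑ i, ∑ j,
          (stress P D.h (F.u k) K i j - if i = j then F.rho k K * F.theta k K else 0)
            * symGradH D.h Φ K i j)
      = ∑ K, ∑ j, F.rho k K * Φ K j * ∫ x in D.box K, P.g x j
  energy : ∀ k, 1 ≤ k → k ≤ D.NT → ∀ φ : Cell n D.N D.M → ℝ,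
    P.cv * intCells D.h (fun K =>
        (F.rho k K * F.theta k K - F.rho (k - 1) K * F.theta (k - 1) K) / D.dt * φ K)
      - P.cv * intFacesInt D.h (fun i K K' =>
          flux D.h P.alpha (fun K => F.rho k K * F.theta k K) (F.u k) i K K' * (φ K' - φ K))
      + intFacesInt D.h (fun _ K K' =>
          P.kappa / D.h * (F.theta k K' - F.theta k K) * (φ K' - φ K))
      + 2 * intFacesExt D.h (fun s K =>
          P.kappa / D.h * (F.theta k K - D.bdryAvg θB (k * D.dt) s K.1) * φ K)
      = intCells D.h (fun K => (stressPower P D.h (F.u k) K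
          - F.rho k K * F.theta k K * ∑ i, gradH D.h (F.u k) K i i) * φ K)

/-- The uniform bounds on the numerical solution. -/
def Fields.Bounded (F : Fields D) (ρlo ρhi θlo θhi uhi : ℝ) : Prop :=
  ∀ k, k ≤ D.NT → ∀ K, (ρlo ≤ F.rho k K ∧ F.rho k K ≤ ρhi) ∧
    (θlo ≤ F.theta k K ∧ F.theta k K ≤ θhi) ∧ Real.sqrt (∑ i, F.u k K i ^ 2) ≤ uhi

/-! ## The consistency error -/

/-- `∫_Ω (½ ρ_h |u_h|² + c_v ρ_h ϑ_h - ρ_h s_h Θ(t,·)) dx` with the discrete fields at step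
`k`. -/
def Fields.ballisticEnergy (F : Fields D) (Θ : SpaceTime n → ℝ) (k : ℕ) (t : ℝ) : ℝ :=
  ∫ x in P.Omega,
    (1 / 2 * D.pw (F.rho k) x * ∑ i, D.pw (fun K => F.u k K i) x ^ 2
      + P.cv * D.pw (F.rho k) x * D.pw (F.theta k) x
      - D.pw (F.rho k) x * P.entropy (D.pw (F.rho k) x) (D.pw (F.theta k) x) * Θ (t, x))

/-- `∇_E ϑ_h(t,x)`, with the exterior averages `ϑ_{B,h}`. -/
def Fields.gradTheta (F : Fields D) (θB : SpaceTime n → ℝ) (i : Fin (n + 1)) (t : ℝ)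
    (x : Space n) : ℝ :=
  D.gradE (D.bdryAvg θB (D.idx t * D.dt)) (F.theta (D.idx t)) i x

/-- The consistency error `⟨error_BE ; ψ⟩` of the ballistic energy inequality. -/
def Fields.errorBE (F : Fields D) (θB : SpaceTime n → ℝ) (χ Θ : SpaceTime n → ℝ)
    (ψ : ℝ → ℝ) : ℝ :=
  ψ 0 * F.ballisticEnergy Θ 0 0
  + (∫ t in (0 : ℝ)..T, ψ t * ∫ x in P.Omega,
      D.pw (F.rho (D.idx t)) x * ∑ i, P.g x i * D.pw (fun K => F.u (D.idx t) K i) x)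
  + (∫ t in (0 : ℝ)..T, weakDeriv (Set.Ioo 0 T) 1 ψ t * F.ballisticEnergy Θ (D.idx t) t)
  - (∫ t in (0 : ℝ)..T, ψ t * ∫ x in P.Omega,
      (P.kappa * Θ (t, x) * χ (t, x) / D.pw (F.theta (D.idx t)) x ^ 2
          * ∑ i, F.gradTheta θB i t x ^ 2
        + Θ (t, x) / D.pw (F.theta (D.idx t)) x
          * D.pw (stressPower P D.h (F.u (D.idx t))) x))
  - ∫ t in (0 : ℝ)..T, ψ t * ∫ x in P.Omega,
      (D.pw (F.rho (D.idx t)) x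
          * P.entropy (D.pw (F.rho (D.idx t)) x) (D.pw (F.theta (D.idx t)) x)
          * (stPartial P.H T none Θ (t, x)
            + ∑ i, D.pw (fun K => F.u (D.idx t) K i) x * stPartial P.H T (some i) Θ (t, x))
        - P.kappa / D.pw (F.theta (D.idx t)) x
          * ∑ i, F.gradTheta θB i t x * stPartial P.H T (some i) Θ (t, x))

end Mesh

/-- The quantity `Λ`. -/
def Lam {n : ℕ} (H T : ℝ) (θB : SpaceTime n → ℝ) (ρlo ρhi θlo θhi uhi Clo Chi : ℝ) : ℝ :=
  T + normW2Inf H T θB + 1 / ρlo + ρhi + 1 / θlo + θhi + uhi + 1 / Clo + Chi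

end BallisticFV

end

/-!
# Consistency of a finite volume method with the ballistic energy inequality

Testing the discrete momentum equation with `u`, the continuity equation with `-|u|²/2` and with
`-Z (s - c_v - 1)`, and the internal energy equation with `1 - Z/ϑ`, where `Z ≥ 0` is any cell
function, gives a discrete ballistic energy inequality (`StepEq.ballistic`). Its sign properties
rest on the concavity of `(ρ, ρϑ) ↦ ρ s(ρ, ϑ)` (`entropy_tangent`): it handles the implicit time
derivative and the upwind fluxes at once, while the `h^α`-diffusion controls `h^α |⟦ρ⟧|²` and
`h^α |⟦u⟧|²` (`diffusion_lower`, `upwind_kinetic`). What one face contributes is `faceTerm`.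

The inequality is used twice.

* With `Z = max (Π_Q ϑ_B) (2Λ)⁻¹` every face term is coercive, also on the boundary, where `Z`
  nearly equals the prescribed temperature unless that lies below all admissible temperatures
  (`exists_faceTerm_coercive`, `exists_extTerm_coercive`). Summation over the time steps, by parts,
  bounds the total dissipation: the weighted squared jumps of density and velocity, the squared
  temperature gradient and the stress power (`exists_sum_dissipation_le`).

* With `Z` the cell averages of `Θ` at the beginning of the time step, it is compared with the
  integrals in the consistency error. In time nothing is lost: integration by parts against `ψ`
  reproduces the discrete rate exactly (`RegularRep.sum_integral_parts`, `RegularRep.errorBE_eq`).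
  In space the comparison is made on half cells (`exists_faceTerm_consistent`,
  `exists_extTerm_consistent`, `exists_stepIntegral_le`). All differences are at most
  `h^((1-α)/2) + h^((1+α)/2)` times one plus the dissipation, because a jump is at most this rate
  times one plus its square with the weight `h^(α-1)` (`le_rate_mul`). The rate is at least
  `h^(1/2)`, which also covers the boundary half cells and the oscillation of `ψ` within a time
  step.

The function `χ_h` is needed because the scheme produces entropy `κ Z |⟦ϑ⟧|²/(h² ϑ ϑ')`, with the
temperatures `ϑ`, `ϑ'` of both cells at a face, whereas the error contains `ϑ⁻²`, with the
temperature on one side. So `χ_h ϑ' ≤ ϑ` is required on every face of a cell, and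
`χ_h = max Λ⁻² (1 - Λ ∑ |⟦ϑ⟧|)`, the sum being over the faces of the cell, has this property
(`isCutoff_cutoff`). It does not depend on `Θ` or `ψ`, and by the bound of the dissipation it
differs from `1` by `O(h)` in `L¹`.

The test functions are of class `W^{2,∞}` in the sense of weak derivatives. Mollification turns them
into `C^{1,1}` functions (`MemW2Inf.exists_regularRep`), and this is how they enter the estimates.
-/

noncomputable section

namespace BallisticFV

/-! ### Summation over cells and faces -/

section GridSums

variable {n N M : ℕ}

theorem up_eq_some_iff (i : Fin (n + 1)) (K K' : Cell n N M) :
    up i K = some K' ↔ down i K' = some K := by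
  refine Fin.lastCases ?_ (fun j => ?_) i
  · obtain ⟨a, k⟩ := K
    obtain ⟨a', k'⟩ := K'
    simp only [up, down, Fin.lastCases_last]
    constructor
    · intro h
      split_ifs at h with h1
      simp only [Option.some.injEq, Prod.mk.injEq] at h
      obtain ⟨rfl, rfl⟩ := h
      simp
    · intro h
      split_ifs at h with h1
      simp only [Option.some.injEq, Prod.mk.injEq] at h
      obtain ⟨rfl, rfl⟩ := h
      have h2 : k'.val - 1 + 1 = k'.val := by omega
      have h3 := k'.isLt
      simp [h2]
  · obtain ⟨a, k⟩ := K
    obtain ⟨a', k'⟩ := K'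
    simp only [up, down, Fin.lastCases_castSucc, Option.some.injEq, Prod.mk.injEq]
    constructor
    · rintro ⟨rfl, rfl⟩
      simp only [Function.update_idem, Function.update_self, Equiv.symm_apply_apply,
        Function.update_eq_self, and_self]
    · rintro ⟨rfl, rfl⟩
      simp only [Function.update_idem, Function.update_self, Equiv.apply_symm_apply,
        Function.update_eq_self, and_self]

theorem up_castSucc (i : Fin n) (K : Cell n N M) :
    up i.castSucc K = some (Function.update K.1 i (finRotate N (K.1 i)), K.2) := by
  simp [up]

theorem down_castSucc (i : Fin n) (K : Cell n N M) :
    down i.castSucc K = some (Function.update K.1 i ((finRotate N).symm (K.1 i)), K.2) := by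
  simp [down]

/-- The sum over the cells of a quantity living on their upper faces in direction `i`. -/
def sumUp (i : Fin (n + 1)) (f : Cell n N M → Cell n N M → ℝ) (K : Cell n N M) : ℝ :=
  match up i K with
  | some K' => f K K'
  | none => 0

/-- As `sumUp`, for the lower face; the inner cell of that face is the neighbour of `K`. -/
def sumDown (i : Fin (n + 1)) (f : Cell n N M → Cell n N M → ℝ) (K : Cell n N M) : ℝ :=
  match down i K with
  | some K' => f K' K
  | none => 0

theorem sumUp_some {i : Fin (n + 1)} {f : Cell n N M → Cell n N M → ℝ} {K K' : Cell n N M}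
    (h : up i K = some K') : sumUp i f K = f K K' := by simp [sumUp, h]

theorem sumUp_none {i : Fin (n + 1)} {f : Cell n N M → Cell n N M → ℝ} {K : Cell n N M}
    (h : up i K = none) : sumUp i f K = 0 := by simp [sumUp, h]

theorem sumDown_some {i : Fin (n + 1)} {f : Cell n N M → Cell n N M → ℝ} {K K' : Cell n N M}
    (h : down i K = some K') : sumDown i f K = f K' K := by simp [sumDown, h]

theorem sumDown_none {i : Fin (n + 1)} {f : Cell n N M → Cell n N M → ℝ} {K : Cell n N M}
    (h : down i K = none) : sumDown i f K = 0 := by simp [sumDown, h]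

/-- Every interior face is the upper face of one cell and the lower face of another. -/
theorem sum_sumDown (i : Fin (n + 1)) (f : Cell n N M → Cell n N M → ℝ) :
    ∑ K, sumDown i f K = ∑ K, sumUp i f K := by
  have h1 : ∀ K, sumUp i f K = ∑ K', if up i K = some K' then f K K' else 0 := by
    intro K
    rcases h : up i K with _ | K'
    · simp [sumUp_none h]
    · simp [sumUp_some h]
  have h2 : ∀ K, sumDown i f K = ∑ K', if up i K' = some K then f K' K else 0 := by
    intro K
    simp only [up_eq_some_iff]
    rcases h : down i K with _ | K'
    · simp [sumDown_none h]
    · simp [sumDown_some h]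
  simp only [h1, h2]
  exact Finset.sum_comm

theorem intFacesInt_eq (h : ℝ) (f : Fin (n + 1) → Cell n N M → Cell n N M → ℝ) :
    intFacesInt h f = ∑ i, ∑ K, sumUp i (fun K K' => h ^ n * f i K K') K := rfl

/-- Each interior face is shared evenly between its two cells. -/
theorem intFacesInt_eq_half (h : ℝ) (f : Fin (n + 1) → Cell n N M → Cell n N M → ℝ) :
    intFacesInt h f = ∑ K, ∑ i, (1 / 2) * (sumUp i (fun K K' => h ^ n * f i K K') K
      + sumDown i (fun K K' => h ^ n * f i K K') K) := by
  rw [Finset.sum_comm, intFacesInt_eq]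
  refine Finset.sum_congr rfl fun i _ => ?_
  rw [← Finset.mul_sum, Finset.sum_add_distrib, sum_sumDown]
  ring

theorem intFacesInt_add (h : ℝ) (f g : Fin (n + 1) → Cell n N M → Cell n N M → ℝ) :
    intFacesInt h (fun i K K' => f i K K' + g i K K') = intFacesInt h f + intFacesInt h g := by
  simp only [intFacesInt_eq, ← Finset.sum_add_distrib]
  refine Finset.sum_congr rfl fun i _ => Finset.sum_congr rfl fun K _ => ?_
  rcases hK : up i K with _ | K'
  · simp [sumUp_none hK]
  · simp [sumUp_some hK, mul_add]

theorem intFacesInt_const_mul (h c : ℝ) (f : Fin (n + 1) → Cell n N M → Cell n N M → ℝ) :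
    intFacesInt h (fun i K K' => c * f i K K') = c * intFacesInt h f := by
  simp only [intFacesInt_eq, Finset.mul_sum]
  refine Finset.sum_congr rfl fun i _ => Finset.sum_congr rfl fun K _ => ?_
  rcases hK : up i K with _ | K'
  · simp [sumUp_none hK]
  · simp [sumUp_some hK, mul_left_comm]

theorem intFacesInt_mono {h : ℝ} (hh : 0 ≤ h)
    {f g : Fin (n + 1) → Cell n N M → Cell n N M → ℝ} (hfg : ∀ i K K', f i K K' ≤ g i K K') :
    intFacesInt h f ≤ intFacesInt h g := by
  simp only [intFacesInt_eq]
  refine Finset.sum_le_sum fun i _ => Finset.sum_le_sum fun K _ => ?_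
  rcases hK : up i K with _ | K'
  · simp [sumUp_none hK]
  · simp only [sumUp_some hK]
    exact mul_le_mul_of_nonneg_left (hfg i K K') (pow_nonneg hh n)

/-- Discrete integration by parts for the divergence of a velocity which vanishes on exterior
faces. -/
theorem sum_mul_div_eq {h : ℝ} (hh : h ≠ 0) (f : Cell n N M → ℝ) (v : Cell n N M → Space n) :
    ∑ K, h ^ (n + 1) * (f K * ∑ i, gradH h v K i i)
      = -intFacesInt h (fun i K K' => (v K i + v K' i) / 2 * (f K' - f K)) := by
  have hup : ∀ i K, avgUp (fun _ _ => 0) (fun K => v K i) i K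
      = sumUp i (fun K K' => (v K i + v K' i) / 2) K := fun i K => rfl
  have hdown : ∀ i K, avgDown (fun _ _ => 0) (fun K => v K i) i K
      = sumDown i (fun K K' => (v K i + v K' i) / 2) K := by
    intro i K
    rcases hK : down i K with _ | K'
    · simp [avgDown, sumDown, hK]
    · simp [avgDown, sumDown, hK, add_comm]
  have h1 : ∀ K, h ^ (n + 1) * (f K * ∑ i, gradH h v K i i) = ∑ i,
      (sumUp i (fun K K' => h ^ n * (f K * ((v K i + v K' i) / 2))) K
        - sumDown i (fun K K' => h ^ n * (f K' * ((v K i + v K' i) / 2))) K) := by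
    intro K
    rw [Finset.mul_sum, Finset.mul_sum]
    refine Finset.sum_congr rfl fun i _ => ?_
    rw [gradH, dcell, hup, hdown]
    have e1 : sumUp i (fun K K' => h ^ n * (f K * ((v K i + v K' i) / 2))) K
        = h ^ n * (f K * sumUp i (fun K K' => (v K i + v K' i) / 2) K) := by
      rcases hK : up i K with _ | K' <;> simp [sumUp, hK]
    have e2 : sumDown i (fun K K' => h ^ n * (f K' * ((v K i + v K' i) / 2))) K
        = h ^ n * (f K * sumDown i (fun K K' => (v K i + v K' i) / 2) K) := by
      rcases hK : down i K with _ | K' <;> simp [sumDown, hK]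
    rw [e1, e2]
    field_simp
    ring
  simp only [h1]
  rw [Finset.sum_comm, intFacesInt_eq, ← Finset.sum_neg_distrib]
  refine Finset.sum_congr rfl fun i _ => ?_
  rw [Finset.sum_sub_distrib, sum_sumDown, ← Finset.sum_sub_distrib, ← Finset.sum_neg_distrib]
  refine Finset.sum_congr rfl fun K _ => ?_
  rcases hK : up i K with _ | K'
  · simp [sumUp, hK]
  · simp [sumUp, hK]; ring

/-- The viscous dissipation is nonnegative: `2 μ |𝔻|² + λ (tr 𝔻)² ≥ η (tr 𝔻)²` since
`(tr 𝔻)² ≤ d |𝔻|²`. -/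
theorem stressPower_nonneg (P : Model n) (h : ℝ) (v : Cell n N M → Space n) (K : Cell n N M) :
    0 ≤ stressPower P h v K := by
  set D : Fin (n + 1) → Fin (n + 1) → ℝ := fun i j => symGradH h v K i j with hD
  have hsymm : ∀ i j, D i j = D j i := fun i j => by simp [hD, symGradH, add_comm]
  set tr := ∑ k, D k k with htr
  have h0 : stressPower P h v K = 2 * P.mu * ∑ i, ∑ j, D i j ^ 2
      + (P.eta - 2 / ((n : ℝ) + 1) * P.mu) * tr ^ 2 := by
    have e1 : ∀ i j, stress P h v K i j = 2 * P.mu * D i j +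
        if i = j then (P.eta - 2 / ((n : ℝ) + 1) * P.mu) * tr else 0 := fun i j => rfl
    have e2 : ∑ i, ∑ j, D i j * gradH h v K i j = ∑ i, ∑ j, D i j ^ 2 := by
      have : ∑ i, ∑ j, D i j * gradH h v K i j = ∑ i, ∑ j, D i j * gradH h v K j i := by
        rw [Finset.sum_comm]
        exact Finset.sum_congr rfl fun i _ => Finset.sum_congr rfl fun j _ => by rw [hsymm]
      have h2 : ∑ i, ∑ j, D i j ^ 2 = (∑ i, ∑ j, D i j * gradH h v K i j
          + ∑ i, ∑ j, D i j * gradH h v K j i) / 2 := by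
        rw [← Finset.sum_add_distrib, Finset.sum_div]
        refine Finset.sum_congr rfl fun i _ => ?_
        rw [← Finset.sum_add_distrib, Finset.sum_div]
        refine Finset.sum_congr rfl fun j _ => ?_
        simp only [hD, symGradH]; ring
      linarith
    have e3 : ∑ k, gradH h v K k k = tr := by
      simp only [htr, hD, symGradH]
      exact Finset.sum_congr rfl fun k _ => by ring
    calc stressPower P h v K = ∑ i, ∑ j, (2 * P.mu * (D i j * gradH h v K i j)
          + if i = j then (P.eta - 2 / ((n : ℝ) + 1) * P.mu) * tr * gradH h v K i j else 0) := by
          unfold stressPower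
          refine Finset.sum_congr rfl fun i _ => Finset.sum_congr rfl fun j _ => ?_
          rw [e1]; split_ifs <;> ring
      _ = _ := by
          simp only [Finset.sum_add_distrib, Finset.sum_ite_eq, Finset.mem_univ, if_true,
            ← Finset.mul_sum, e2, e3]
          ring
  have h1 : tr ^ 2 ≤ ((n : ℝ) + 1) * ∑ i, ∑ j, D i j ^ 2 := by
    have h2 : tr ^ 2 ≤ ((n : ℝ) + 1) * ∑ i, D i i ^ 2 := by
      have := sq_sum_le_card_mul_sum_sq (s := Finset.univ) (f := fun i => D i i)
      simpa using this
    have h3 : ∑ i, D i i ^ 2 ≤ ∑ i, ∑ j, D i j ^ 2 := Finset.sum_le_sum fun i _ =>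
      Finset.single_le_sum (f := fun j => D i j ^ 2) (fun j _ => sq_nonneg _) (Finset.mem_univ i)
    exact h2.trans (mul_le_mul_of_nonneg_left h3 (by positivity))
  have hn : (0 : ℝ) < (n : ℝ) + 1 := by positivity
  have h4 : 2 / ((n : ℝ) + 1) * tr ^ 2 ≤ 2 * ∑ i, ∑ j, D i j ^ 2 := by
    rw [div_mul_eq_mul_div, div_le_iff₀ hn]; nlinarith
  rw [h0]
  nlinarith [mul_nonneg P.eta_nonneg (sq_nonneg tr), mul_le_mul_of_nonneg_left h4 P.mu_pos.le]

/-- The momentum equation tested with the velocity produces the same stress power as the one which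
heats the fluid in the energy equation. -/
theorem sum_stress_mul_symGradH (P : Model n) (h : ℝ) (v : Cell n N M → Space n)
    (K : Cell n N M) (p : ℝ) :
    ∑ i, ∑ j, (stress P h v K i j - if i = j then p else 0) * symGradH h v K i j
      = stressPower P h v K - p * ∑ i, gradH h v K i i := by
  have hsymm : ∀ i j, stress P h v K i j = stress P h v K j i := fun i j => by
    simp only [stress, symGradH, add_comm (gradH h v K i j), eq_comm (a := i)]
  have h1 : ∑ i, ∑ j, stress P h v K i j * symGradH h v K i j = stressPower P h v K := by
    have : stressPower P h v K = ∑ i, ∑ j, stress P h v K i j * gradH h v K j i := by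
      unfold stressPower
      rw [Finset.sum_comm]
      exact Finset.sum_congr rfl fun i _ => Finset.sum_congr rfl fun j _ => by rw [hsymm]
    have h2 : ∑ i, ∑ j, stress P h v K i j * symGradH h v K i j = (stressPower P h v K +
        ∑ i, ∑ j, stress P h v K i j * gradH h v K j i) / 2 := by
      unfold stressPower
      rw [← Finset.sum_add_distrib, Finset.sum_div]
      refine Finset.sum_congr rfl fun i _ => ?_
      rw [← Finset.sum_add_distrib, Finset.sum_div]
      refine Finset.sum_congr rfl fun j _ => ?_
      simp only [symGradH]; ring
    linarith
  have h3 : ∑ i, ∑ j, (if i = j then p else 0) * symGradH h v K i j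
      = p * ∑ i, gradH h v K i i := by
    simp only [ite_mul, zero_mul, Finset.sum_ite_eq, Finset.mem_univ, if_true, Finset.mul_sum]
    refine Finset.sum_congr rfl fun i _ => ?_
    simp only [symGradH]; ring
  simp only [sub_mul, Finset.sum_sub_distrib, h1, h3]

end GridSums

/-! ### The discrete ballistic energy inequality -/

/-- Concavity of `(ρ, ρϑ) ↦ ρ s(ρ,ϑ)`, written as a tangent plane inequality. -/
theorem entropy_tangent {cv r₁ r₂ θ₁ θ₂ : ℝ} (hcv : 0 ≤ cv) (hr₁ : 0 < r₁) (hr₂ : 0 < r₂)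
    (hθ₁ : 0 < θ₁) (hθ₂ : 0 < θ₂) :
    r₁ * (cv * Real.log θ₁ - Real.log r₁)
      ≤ r₁ * (cv * Real.log θ₂ - Real.log r₂ - cv - 1) + cv * (r₁ * θ₁) / θ₂ + r₂ := by
  have h1 := Real.log_le_sub_one_of_pos (div_pos hθ₁ hθ₂)
  have h2 := Real.log_le_sub_one_of_pos (div_pos hr₂ hr₁)
  rw [Real.log_div hθ₁.ne' hθ₂.ne'] at h1
  rw [Real.log_div hr₂.ne' hr₁.ne'] at h2
  have h3 := mul_le_mul_of_nonneg_left h1 (mul_nonneg hr₁.le hcv)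
  have h4 := mul_le_mul_of_nonneg_left h2 hr₁.le
  have e3 : r₁ * cv * (θ₁ / θ₂ - 1) = cv * (r₁ * θ₁) / θ₂ - r₁ * cv := by ring
  have e4 : r₁ * (r₂ / r₁ - 1) = r₂ - r₁ := by field_simp
  rw [e3] at h3
  rw [e4] at h4
  nlinarith

/-- The upwind part of the entropy flux, tested with `Z ∇(ρ s)`, against the entropy flux tested
with `Z`; the term `w ⟦ρ Z⟧` comes from the pressure. -/
theorem upwind_entropy {cv r r' θ θ' Z Z' w : ℝ} (hcv : 0 ≤ cv) (hr : 0 < r) (hr' : 0 < r')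
    (hθ : 0 < θ) (hθ' : 0 < θ') (hZ : 0 ≤ Z) (hZ' : 0 ≤ Z') :
    w * (if 0 ≤ w then r * (cv * Real.log θ - Real.log r)
        else r' * (cv * Real.log θ' - Real.log r')) * (Z' - Z)
      ≤ cv * ((if 0 ≤ w then r * θ else r' * θ') * w) * (Z' / θ' - Z / θ)
        + (if 0 ≤ w then r else r') * w * (Z' * (cv * Real.log θ' - Real.log r' - cv - 1)
          - Z * (cv * Real.log θ - Real.log r - cv - 1)) + w * (r' * Z' - r * Z) := by
  split_ifs with h
  · have h1 := mul_le_mul_of_nonneg_left (entropy_tangent hcv hr hr' hθ hθ') (mul_nonneg h hZ')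
    have e : cv * (r * θ * w) * (Z' / θ' - Z / θ)
        = w * Z' * (cv * (r * θ) / θ') - w * Z * cv * r := by
      field_simp
    rw [e]
    nlinarith
  · have hw : 0 ≤ -w := by linarith
    have h1 := mul_le_mul_of_nonneg_left (entropy_tangent hcv hr' hr hθ' hθ) (mul_nonneg hw hZ)
    have e : cv * (r' * θ' * w) * (Z' / θ' - Z / θ)
        = w * Z' * cv * r' - w * Z * (cv * (r' * θ') / θ) := by
      field_simp
    rw [e]
    nlinarith

/-- The dissipation of kinetic energy by the numerical flux. -/
theorem upwind_kinetic {r r' w a : ℝ} (hr : 0 ≤ r) (hr' : 0 ≤ r') (v v' : ℝ) :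
    a * ((r + r') / 2 * (v' - v) ^ 2)
      ≤ -(((if 0 ≤ w then r * v else r' * v') * w - a * (r' * v' - r * v)) * (v' - v))
        + ((if 0 ≤ w then r else r') * w - a * (r' - r)) * (v' ^ 2 / 2 - v ^ 2 / 2) := by
  split_ifs with h
  · nlinarith [mul_nonneg (mul_nonneg hr h) (sq_nonneg (v' - v))]
  · have hw : 0 ≤ -w := by linarith
    nlinarith [mul_nonneg (mul_nonneg hr' hw) (sq_nonneg (v' - v))]

section Step

variable {n N M : ℕ}

/-- The discrete mass, momentum and internal energy balances of one time step from
`(r₀, u₀, θ₀)` to `(r, u, θ)`, with exterior temperature averages `b` and cell integrals `gI` of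
the force. -/
structure StepEq (P : Model n) (h dt : ℝ) (r₀ r θ₀ θ : Cell n N M → ℝ)
    (u₀ u : Cell n N M → Space n) (b : BdryData n N) (gI : Cell n N M → Space n) : Prop where
  mass : ∀ φ : Cell n N M → ℝ,
    intCells h (fun K => (r K - r₀ K) / dt * φ K)
      - intFacesInt h (fun i K K' => flux h P.alpha r u i K K' * (φ K' - φ K)) = 0
  momentum : ∀ Φ : Cell n N M → Space n,
    intCells h (fun K => ∑ j, (r K * u K j - r₀ K * u₀ K j) / dt * Φ K j)
      - intFacesInt h (fun i K K' => ∑ j,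
          flux h P.alpha (fun K => r K * u K j) u i K K' * (Φ K' j - Φ K j))
      + intCells h (fun K => ∑ i, ∑ j,
          (stress P h u K i j - if i = j then r K * θ K else 0) * symGradH h Φ K i j)
      = ∑ K, ∑ j, r K * Φ K j * gI K j
  energy : ∀ φ : Cell n N M → ℝ,
    P.cv * intCells h (fun K => (r K * θ K - r₀ K * θ₀ K) / dt * φ K)
      - P.cv * intFacesInt h (fun i K K' =>
          flux h P.alpha (fun K => r K * θ K) u i K K' * (φ K' - φ K))
      + intFacesInt h (fun _ K K' => P.kappa / h * (θ K' - θ K) * (φ K' - φ K))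
      + 2 * intFacesExt h (fun s K => P.kappa / h * (θ K - b s K.1) * φ K)
      = intCells h (fun K => (stressPower P h u K
          - r K * θ K * ∑ i, gradH h u K i i) * φ K)

/-- The contribution of an interior face to the discrete ballistic energy inequality with the
test function `Z`. -/
def faceTerm (P : Model n) (h : ℝ) (r θ : Cell n N M → ℝ) (u : Cell n N M → Space n)
    (Z : Cell n N M → ℝ) (i : Fin (n + 1)) (K K' : Cell n N M) : ℝ :=
  h ^ P.alpha * ((r K + r K') / 2 * ∑ j, (u K' j - u K j) ^ 2)
    - h ^ P.alpha * (P.cv * (r K' * θ K' - r K * θ K) * (Z K' / θ K' - Z K / θ K)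
      + (r K' - r K) * (Z K' * (P.entropy (r K') (θ K') - P.cv - 1)
        - Z K * (P.entropy (r K) (θ K) - P.cv - 1)))
    + (u K i + u K' i) / 2 * (if 0 ≤ (u K i + u K' i) / 2 then r K * P.entropy (r K) (θ K)
        else r K' * P.entropy (r K') (θ K')) * (Z K' - Z K)
    - P.kappa / h * (θ K' - θ K) * (Z K' / θ K' - Z K / θ K)

/-- The density `½ ρ |u|² + c_v ρ ϑ` of the total energy. -/
def Model.energyDensity (P : Model n) (r θ : ℝ) (u : Space n) : ℝ :=
  1 / 2 * r * ∑ j, u j ^ 2 + P.cv * r * θ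

/-- The discrete time derivative of total energy minus `Z` times that of the entropy. -/
def ballisticRate (P : Model n) (h dt : ℝ) (r₀ r θ₀ θ : Cell n N M → ℝ)
    (u₀ u : Cell n N M → Space n) (Z : Cell n N M → ℝ) : ℝ :=
  intCells h (fun K => (P.energyDensity (r K) (θ K) (u K)
      - P.energyDensity (r₀ K) (θ₀ K) (u₀ K)) / dt
    - Z K * ((r K * P.entropy (r K) (θ K) - r₀ K * P.entropy (r₀ K) (θ₀ K)) / dt))

theorem intCells_add (h : ℝ) (f g : Cell n N M → ℝ) :
    intCells h (fun K => f K + g K) = intCells h f + intCells h g := by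
  simp only [intCells, mul_add, Finset.sum_add_distrib]

theorem intCells_const_mul (h c : ℝ) (f : Cell n N M → ℝ) :
    intCells h (fun K => c * f K) = c * intCells h f := by
  simp only [intCells, Finset.mul_sum]
  exact Finset.sum_congr rfl fun K _ => by ring

theorem intCells_mono {h : ℝ} (hh : 0 ≤ h) {f g : Cell n N M → ℝ} (hfg : ∀ K, f K ≤ g K) :
    intCells h f ≤ intCells h g :=
  Finset.sum_le_sum fun K _ => mul_le_mul_of_nonneg_left (hfg K) (pow_nonneg hh _)

/-- `faceTerm` is bounded by the face terms which arise when the momentum equation is tested with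
`u`, the continuity equation with `-|u|²/2` and with `-Z (s - c_v - 1)`, and the energy equation
with `1 - Z/ϑ`. The last summand comes from the pressure, through `sum_mul_div_eq`. -/
theorem faceTerm_le {P : Model n} {h : ℝ} {r θ Z : Cell n N M → ℝ} {u : Cell n N M → Space n}
    (hr : ∀ K, 0 < r K) (hθ : ∀ K, 0 < θ K) (hZ : ∀ K, 0 ≤ Z K)
    (i : Fin (n + 1)) (K K' : Cell n N M) :
    faceTerm P h r θ u Z i K K' ≤
      -1 * (∑ j, flux h P.alpha (fun K => r K * u K j) u i K K' * (u K' j - u K j))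
      + flux h P.alpha r u i K K' * ((∑ j, u K' j ^ 2) / 2 - (∑ j, u K j ^ 2) / 2)
      + P.cv * (flux h P.alpha (fun K => r K * θ K) u i K K' * (Z K' / θ K' - Z K / θ K))
      + -1 * (P.kappa / h * (θ K' - θ K) * (Z K' / θ K' - Z K / θ K))
      + flux h P.alpha r u i K K' * (Z K' * (P.entropy (r K') (θ K') - P.cv - 1)
        - Z K * (P.entropy (r K) (θ K) - P.cv - 1))
      + (u K i + u K' i) / 2 * (r K' * Z K' - r K * Z K) := by
  have h1 := upwind_entropy (w := (u K i + u K' i) / 2) P.cv_pos.le (hr K) (hr K') (hθ K) (hθ K')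
    (hZ K) (hZ K')
  have h2 : h ^ P.alpha * ((r K + r K') / 2 * ∑ j, (u K' j - u K j) ^ 2)
      ≤ -1 * (∑ j, flux h P.alpha (fun K => r K * u K j) u i K K' * (u K' j - u K j))
      + flux h P.alpha r u i K K' * ((∑ j, u K' j ^ 2) / 2 - (∑ j, u K j ^ 2) / 2) := by
    rw [Finset.sum_div, Finset.sum_div, ← Finset.sum_sub_distrib, Finset.mul_sum, Finset.mul_sum,
      Finset.mul_sum, Finset.mul_sum, ← Finset.sum_add_distrib]
    refine Finset.sum_le_sum fun j _ => ?_
    have := upwind_kinetic (w := (u K i + u K' i) / 2) (a := h ^ P.alpha) (hr K).le (hr K').le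
      (u K j) (u K' j)
    simp only [flux]
    linarith
  have e1 : flux h P.alpha (fun K => r K * θ K) u i K K' =
    (if 0 ≤ (u K i + u K' i) / 2 then r K * θ K else r K' * θ K') * ((u K i + u K' i) / 2)
      - h ^ P.alpha * (r K' * θ K' - r K * θ K) := rfl
  have e2 : flux h P.alpha r u i K K' =
    (if 0 ≤ (u K i + u K' i) / 2 then r K else r K') * ((u K i + u K' i) / 2)
      - h ^ P.alpha * (r K' - r K) := rfl
  have e3 : ∀ a b, P.entropy a b = P.cv * Real.log b - Real.log a := fun _ _ => rfl
  unfold faceTerm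
  rw [e1]
  rw [e2] at h2 ⊢
  simp only [e3]
  linarith

/-- The time derivatives which arise from the same test functions as in `faceTerm_le` dominate
`ballisticRate`: implicit time stepping only adds dissipation, by convexity of the kinetic energy
and concavity of the entropy. -/
theorem ballisticRate_le_sum {P : Model n} {h dt : ℝ} {r₀ r θ₀ θ Z : Cell n N M → ℝ}
    {u₀ u : Cell n N M → Space n} (hh : 0 ≤ h) (hdt : 0 < dt)
    (hr₀ : ∀ K, 0 < r₀ K) (hr : ∀ K, 0 < r K) (hθ₀ : ∀ K, 0 < θ₀ K)
    (hθ : ∀ K, 0 < θ K) (hZ : ∀ K, 0 ≤ Z K) :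
    ballisticRate P h dt r₀ r θ₀ θ u₀ u Z ≤
      intCells h (fun K => ∑ j, (r K * u K j - r₀ K * u₀ K j) / dt * u K j)
      + -1 * intCells h (fun K => (r K - r₀ K) / dt * ((∑ j, u K j ^ 2) / 2))
      + P.cv * intCells h (fun K => (r K * θ K - r₀ K * θ₀ K) / dt * 1)
      + (-P.cv) * intCells h (fun K => (r K * θ K - r₀ K * θ₀ K) / dt * (Z K / θ K))
      + -1 * intCells h (fun K => (r K - r₀ K) / dt
          * (Z K * (P.entropy (r K) (θ K) - P.cv - 1))) := by
  simp only [← intCells_const_mul, ← intCells_add, ballisticRate]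
  refine intCells_mono hh fun K => ?_
  have h1 := mul_le_mul_of_nonneg_left
    (entropy_tangent P.cv_pos.le (hr₀ K) (hr K) (hθ₀ K) (hθ K)) (hZ K)
  have h2 : 1 / 2 * r K * ∑ j, u K j ^ 2 - 1 / 2 * r₀ K * ∑ j, u₀ K j ^ 2
      ≤ ∑ j, (r K * u K j - r₀ K * u₀ K j) * u K j - (r K - r₀ K) * ((∑ j, u K j ^ 2) / 2) := by
    rw [Finset.sum_div, Finset.mul_sum, Finset.mul_sum, Finset.mul_sum, ← Finset.sum_sub_distrib,
      ← Finset.sum_sub_distrib]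
    refine Finset.sum_le_sum fun j _ => ?_
    nlinarith [mul_nonneg (hr₀ K).le (sq_nonneg (u K j - u₀ K j))]
  have e0 : ∑ j, (r K * u K j - r₀ K * u₀ K j) / dt * u K j
      = (∑ j, (r K * u K j - r₀ K * u₀ K j) * u K j) / dt := by
    rw [Finset.sum_div]
    exact Finset.sum_congr rfl fun j _ => by ring
  rw [e0]
  have e1 : (P.energyDensity (r K) (θ K) (u K) - P.energyDensity (r₀ K) (θ₀ K) (u₀ K)) / dt
      - Z K * ((r K * P.entropy (r K) (θ K) - r₀ K * P.entropy (r₀ K) (θ₀ K)) / dt)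
      = ((P.energyDensity (r K) (θ K) (u K) - P.energyDensity (r₀ K) (θ₀ K) (u₀ K))
        - Z K * (r K * P.entropy (r K) (θ K) - r₀ K * P.entropy (r₀ K) (θ₀ K))) / dt := by ring
  have e2 : (∑ j, (r K * u K j - r₀ K * u₀ K j) * u K j) / dt
      + -1 * ((r K - r₀ K) / dt * ((∑ j, u K j ^ 2) / 2))
      + P.cv * ((r K * θ K - r₀ K * θ₀ K) / dt * 1)
      + -P.cv * ((r K * θ K - r₀ K * θ₀ K) / dt * (Z K / θ K))
      + -1 * ((r K - r₀ K) / dt * (Z K * (P.entropy (r K) (θ K) - P.cv - 1)))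
      = (∑ j, (r K * u K j - r₀ K * u₀ K j) * u K j - (r K - r₀ K) * ((∑ j, u K j ^ 2) / 2)
        + P.cv * (r K * θ K - r₀ K * θ₀ K)
        - (P.cv * r K * Z K - Z K * (P.cv * (r₀ K * θ₀ K) / θ K))
        - (r K - r₀ K) * (Z K * (P.entropy (r K) (θ K) - P.cv - 1))) / dt := by
    have := (hθ K).ne'
    field_simp
    ring
  rw [e1, e2]
  refine div_le_div_of_nonneg_right ?_ hdt.le
  have e3 : ∀ a b, P.entropy a b = P.cv * Real.log b - Real.log a := fun _ _ => rfl
  simp only [Model.energyDensity, e3]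
  linarith

/-- The discrete ballistic energy inequality with a nonnegative test function `Z`. -/
theorem StepEq.ballistic {P : Model n} {h dt : ℝ} {r₀ r θ₀ θ : Cell n N M → ℝ}
    {u₀ u : Cell n N M → Space n} {b : BdryData n N} {gI : Cell n N M → Space n}
    (S : StepEq P h dt r₀ r θ₀ θ u₀ u b gI) (hh : 0 < h) (hdt : 0 < dt)
    (hr₀ : ∀ K, 0 < r₀ K) (hr : ∀ K, 0 < r K) (hθ₀ : ∀ K, 0 < θ₀ K) (hθ : ∀ K, 0 < θ K)
    {Z : Cell n N M → ℝ} (hZ : ∀ K, 0 ≤ Z K) :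
    ballisticRate P h dt r₀ r θ₀ θ u₀ u Z
      + intFacesInt h (faceTerm P h r θ u Z)
      + 2 * intFacesExt h (fun s K => P.kappa / h * (θ K - b s K.1) * (1 - Z K / θ K))
      + intCells h (fun K => stressPower P h u K * (Z K / θ K))
      ≤ ∑ K, ∑ j, r K * u K j * gI K j := by
  have m1 := S.momentum u
  have m2 := S.mass (fun K => (∑ j, u K j ^ 2) / 2)
  have m3 := S.mass (fun K => Z K * (P.entropy (r K) (θ K) - P.cv - 1))
  have e1 := S.energy (fun _ => 1)
  have e2 := S.energy (fun K => Z K / θ K)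
  have hrate := ballisticRate_le_sum (P := P) (u₀ := u₀) (u := u) hh.le hdt hr₀ hr hθ₀ hθ hZ
  have hface := intFacesInt_mono hh.le (faceTerm_le (P := P) (h := h) (u := u) hr hθ hZ)
  simp only [intFacesInt_add, intFacesInt_const_mul] at hface
  -- The pressure cancels between the momentum equation and the energy equation tested with `1`; the
  -- pressure in the energy equation tested with `Z / θ` becomes a sum over the faces.
  have hdiv := sum_mul_div_eq hh.ne' (fun K => r K * Z K) u
  have z1 : intFacesInt h (fun i K K' =>
      flux h P.alpha (fun K => r K * θ K) u i K K' * ((1 : ℝ) - 1)) = 0 := by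
    have := intFacesInt_const_mul h 0 (fun i K K' => flux h P.alpha (fun K => r K * θ K) u i K K')
    simpa using this
  have z2 : intFacesInt h (fun (_ : Fin (n + 1)) K K' =>
      P.kappa / h * (θ K' - θ K) * ((1 : ℝ) - 1)) = 0 := by
    have := intFacesInt_const_mul h 0
      (fun (_ : Fin (n + 1)) (K K' : Cell n N M) => P.kappa / h * (θ K' - θ K))
    simpa using this
  rw [z1, z2] at e1
  have hext : intFacesExt h (fun s K => P.kappa / h * (θ K - b s K.1) * (1 - Z K / θ K))
      = intFacesExt h (fun s K => P.kappa / h * (θ K - b s K.1) * 1)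
        - intFacesExt h (fun s K => P.kappa / h * (θ K - b s K.1) * (Z K / θ K)) := by
    simp only [intFacesExt, ← Finset.sum_sub_distrib]
    refine Finset.sum_congr rfl fun K _ => ?_
    split_ifs <;> ring
  have hstress : intCells h (fun K => ∑ i, ∑ j,
      (stress P h u K i j - if i = j then r K * θ K else 0) * symGradH h u K i j)
      = intCells h (fun K => (stressPower P h u K - r K * θ K * ∑ i, gradH h u K i i) * 1) := by
    unfold intCells
    refine Finset.sum_congr rfl fun K _ => ?_
    beta_reduce
    rw [sum_stress_mul_symGradH, mul_one]
  have hpow : intCells h (fun K => (stressPower P h u K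
      - r K * θ K * ∑ i, gradH h u K i i) * (Z K / θ K))
      = intCells h (fun K => stressPower P h u K * (Z K / θ K))
        - ∑ K, h ^ (n + 1) * (r K * Z K * ∑ i, gradH h u K i i) := by
    unfold intCells
    rw [← Finset.sum_sub_distrib]
    refine Finset.sum_congr rfl fun K _ => ?_
    have := (hθ K).ne'
    field_simp
  rw [hpow, hdiv] at e2
  rw [hstress] at m1
  rw [hext]
  linarith

end Step

/-! ### Elementary estimates for the constitutive relations -/

theorem pos_of_mem_range {Λ x : ℝ} (hΛ : 1 ≤ Λ) (hx : x ∈ Set.Icc Λ⁻¹ Λ) : 0 < x :=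
  lt_of_lt_of_le (by positivity) hx.1

theorem inv_le_of_mem_range {Λ x : ℝ} (hΛ : 1 ≤ Λ) (hx : x ∈ Set.Icc Λ⁻¹ Λ) : x⁻¹ ≤ Λ :=
  inv_le_of_inv_le₀ (by positivity) hx.1

theorem abs_inv_sub_inv_le {Λ x y : ℝ} (hΛ : 1 ≤ Λ) (hx : x ∈ Set.Icc Λ⁻¹ Λ)
    (hy : y ∈ Set.Icc Λ⁻¹ Λ) : |x⁻¹ - y⁻¹| ≤ Λ ^ 2 * |x - y| := by
  have hx0 := pos_of_mem_range hΛ hx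
  have hy0 := pos_of_mem_range hΛ hy
  have e : x⁻¹ - y⁻¹ = x⁻¹ * y⁻¹ * (y - x) := by field_simp
  rw [e, abs_mul, abs_of_pos (by positivity), abs_sub_comm]
  refine mul_le_mul_of_nonneg_right ?_ (abs_nonneg _)
  rw [sq]
  exact mul_le_mul (inv_le_of_mem_range hΛ hx) (inv_le_of_mem_range hΛ hy) (by positivity)
    (by positivity)

theorem abs_log_le_of_mem_range {Λ x : ℝ} (hΛ : 1 ≤ Λ) (hx : x ∈ Set.Icc Λ⁻¹ Λ) :
    |Real.log x| ≤ Λ := by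
  have hx0 := pos_of_mem_range hΛ hx
  have h1 := Real.log_le_sub_one_of_pos hx0
  have h2 := Real.one_sub_inv_le_log_of_pos hx0
  have h3 := inv_le_of_mem_range hΛ hx
  rw [abs_le]
  constructor <;> linarith [hx.2]

theorem log_sub_log_le {Λ x y : ℝ} (hΛ : 1 ≤ Λ) (hx : x ∈ Set.Icc Λ⁻¹ Λ)
    (hy : y ∈ Set.Icc Λ⁻¹ Λ) : Real.log x - Real.log y ≤ Λ * |x - y| := by
  have hx0 := pos_of_mem_range hΛ hx
  have hy0 := pos_of_mem_range hΛ hy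
  have h1 := Real.log_le_sub_one_of_pos (div_pos hx0 hy0)
  rw [Real.log_div hx0.ne' hy0.ne'] at h1
  have e : x / y - 1 = y⁻¹ * (x - y) := by field_simp
  rw [e] at h1
  calc _ ≤ _ := h1
    _ ≤ y⁻¹ * |x - y| := mul_le_mul_of_nonneg_left (le_abs_self _) (by positivity)
    _ ≤ Λ * |x - y| := mul_le_mul_of_nonneg_right (inv_le_of_mem_range hΛ hy) (abs_nonneg _)

theorem abs_log_sub_log_le {Λ x y : ℝ} (hΛ : 1 ≤ Λ) (hx : x ∈ Set.Icc Λ⁻¹ Λ)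
    (hy : y ∈ Set.Icc Λ⁻¹ Λ) : |Real.log x - Real.log y| ≤ Λ * |x - y| := by
  rw [abs_le]
  have h1 := log_sub_log_le hΛ hx hy
  have h2 := log_sub_log_le hΛ hy hx
  rw [abs_sub_comm] at h2
  constructor <;> linarith

/-- The logarithm is strongly monotone on bounded intervals. -/
theorem sq_div_le_mul_log {Λ x y : ℝ} (hΛ : 1 ≤ Λ) (hx : x ∈ Set.Icc Λ⁻¹ Λ)
    (hy : y ∈ Set.Icc Λ⁻¹ Λ) : (x - y) ^ 2 / Λ ≤ (x - y) * (Real.log x - Real.log y) := by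
  have key : ∀ a b : ℝ, a ∈ Set.Icc Λ⁻¹ Λ → b ∈ Set.Icc Λ⁻¹ Λ → b ≤ a →
      (a - b) ^ 2 / Λ ≤ (a - b) * (Real.log a - Real.log b) := by
    intro a b ha hb hab
    have ha0 := pos_of_mem_range hΛ ha
    have hb0 := pos_of_mem_range hΛ hb
    have h1 := Real.one_sub_inv_le_log_of_pos (div_pos ha0 hb0)
    rw [Real.log_div ha0.ne' hb0.ne'] at h1
    have e : 1 - (a / b)⁻¹ = (a - b) / a := by field_simp
    rw [e] at h1
    have h2 : (a - b) / Λ ≤ (a - b) / a :=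
      div_le_div_of_nonneg_left (by linarith) ha0 ha.2
    calc (a - b) ^ 2 / Λ = (a - b) * ((a - b) / Λ) := by ring
      _ ≤ _ := mul_le_mul_of_nonneg_left (h2.trans h1) (by linarith)
  rcases le_total y x with h | h
  · exact key x y hx hy h
  · have := key y x hy hx h
    calc (x - y) ^ 2 / Λ = (y - x) ^ 2 / Λ := by ring
      _ ≤ _ := this
      _ = _ := by ring

section Entropy

variable {n : ℕ} (P : Model n)

theorem abs_entropy_le {Λ r θ : ℝ} (hΛ : 1 ≤ Λ) (hr : r ∈ Set.Icc Λ⁻¹ Λ)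
    (hθ : θ ∈ Set.Icc Λ⁻¹ Λ) : |P.entropy r θ| ≤ (P.cv + 1) * Λ := by
  have h1 := abs_log_le_of_mem_range hΛ hr
  have h2 := abs_log_le_of_mem_range hΛ hθ
  have hcv := P.cv_pos
  calc |P.entropy r θ| ≤ |P.cv * Real.log θ| + |Real.log r| := abs_sub _ _
    _ = P.cv * |Real.log θ| + |Real.log r| := by rw [abs_mul, abs_of_pos hcv]
    _ ≤ (P.cv + 1) * Λ := by nlinarith

theorem abs_entropy_sub_le {Λ r θ r' θ' : ℝ} (hΛ : 1 ≤ Λ) (hr : r ∈ Set.Icc Λ⁻¹ Λ)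
    (hθ : θ ∈ Set.Icc Λ⁻¹ Λ) (hr' : r' ∈ Set.Icc Λ⁻¹ Λ) (hθ' : θ' ∈ Set.Icc Λ⁻¹ Λ) :
    |P.entropy r θ - P.entropy r' θ'| ≤ (P.cv + 1) * Λ * (|r - r'| + |θ - θ'|) := by
  have h1 := abs_log_sub_log_le hΛ hr hr'
  have h2 := abs_log_sub_log_le hΛ hθ hθ'
  have hcv := P.cv_pos
  have e : P.entropy r θ - P.entropy r' θ'
      = P.cv * (Real.log θ - Real.log θ') - (Real.log r - Real.log r') := by
    simp only [Model.entropy]; ring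
  rw [e]
  calc _ ≤ |P.cv * (Real.log θ - Real.log θ')| + |Real.log r - Real.log r'| := abs_sub _ _
    _ = P.cv * |Real.log θ - Real.log θ'| + |Real.log r - Real.log r'| := by
        rw [abs_mul, abs_of_pos hcv]
    _ ≤ P.cv * (Λ * |θ - θ'|) + Λ * |r - r'| := by
        gcongr
    _ ≤ _ := by
        have := abs_nonneg (r - r')
        have := abs_nonneg (θ - θ')
        nlinarith [mul_nonneg hcv.le (mul_nonneg (zero_le_one.trans hΛ) (abs_nonneg (r - r'))),
          mul_nonneg (zero_le_one.trans hΛ) (abs_nonneg (θ - θ'))]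

theorem abs_mul_entropy_le {Λ r θ : ℝ} (hΛ : 1 ≤ Λ) (hr : r ∈ Set.Icc Λ⁻¹ Λ)
    (hθ : θ ∈ Set.Icc Λ⁻¹ Λ) : |r * P.entropy r θ| ≤ (P.cv + 1) * Λ ^ 2 := by
  have h1 := abs_entropy_le P hΛ hr hθ
  rw [abs_mul, abs_of_pos (pos_of_mem_range hΛ hr)]
  calc r * |P.entropy r θ| ≤ Λ * ((P.cv + 1) * Λ) :=
        mul_le_mul hr.2 h1 (abs_nonneg _) (by linarith)
    _ = _ := by ring

theorem abs_mul_entropy_sub_le {Λ r θ r' θ' : ℝ} (hΛ : 1 ≤ Λ) (hr : r ∈ Set.Icc Λ⁻¹ Λ)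
    (hθ : θ ∈ Set.Icc Λ⁻¹ Λ) (hr' : r' ∈ Set.Icc Λ⁻¹ Λ) (hθ' : θ' ∈ Set.Icc Λ⁻¹ Λ) :
    |r * P.entropy r θ - r' * P.entropy r' θ'|
      ≤ 2 * (P.cv + 1) * Λ ^ 2 * (|r - r'| + |θ - θ'|) := by
  have h1 := abs_entropy_sub_le P hΛ hr hθ hr' hθ'
  have h2 := abs_entropy_le P hΛ hr hθ
  have hcv := P.cv_pos
  have e : r * P.entropy r θ - r' * P.entropy r' θ'
      = (r - r') * P.entropy r θ + r' * (P.entropy r θ - P.entropy r' θ') := by ring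
  rw [e]
  calc _ ≤ |(r - r') * P.entropy r θ| + |r' * (P.entropy r θ - P.entropy r' θ')| :=
        abs_add_le _ _
    _ = |r - r'| * |P.entropy r θ| + r' * |P.entropy r θ - P.entropy r' θ'| := by
        rw [abs_mul, abs_mul, abs_of_pos (pos_of_mem_range hΛ hr')]
    _ ≤ |r - r'| * ((P.cv + 1) * Λ) + Λ * ((P.cv + 1) * Λ * (|r - r'| + |θ - θ'|)) := by
        refine add_le_add (mul_le_mul_of_nonneg_left h2 (abs_nonneg _))
          (mul_le_mul hr'.2 h1 (abs_nonneg _) (by linarith))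
    _ ≤ _ := by
        have h3 : |r - r'| * ((P.cv + 1) * Λ) ≤ (P.cv + 1) * Λ ^ 2 * (|r - r'| + |θ - θ'|) := by
          have h4 : (P.cv + 1) * Λ ≤ (P.cv + 1) * Λ ^ 2 :=
            mul_le_mul_of_nonneg_left (by nlinarith) (by linarith)
          rw [mul_comm]
          exact mul_le_mul h4 (by linarith [abs_nonneg (θ - θ')]) (abs_nonneg _) (by positivity)
        linarith

/-- The numerical diffusion of density and energy dissipates, up to a commutator with `Z`. -/
theorem diffusion_lower {Λ r θ r' θ' : ℝ} (hΛ : 1 ≤ Λ) (hr : r ∈ Set.Icc Λ⁻¹ Λ)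
    (hθ : θ ∈ Set.Icc Λ⁻¹ Λ) (hr' : r' ∈ Set.Icc Λ⁻¹ Λ) (hθ' : θ' ∈ Set.Icc Λ⁻¹ Λ)
    {Z Z' : ℝ} (hZ : 0 ≤ Z) (hZ' : 0 ≤ Z') :
    P.cv * (r' * θ' - r * θ) * (Z' / θ' - Z / θ)
      + (r' - r) * (Z' * (P.entropy r' θ' - P.cv - 1) - Z * (P.entropy r θ - P.cv - 1))
      ≤ -((Z + Z') / 2 * ((r' - r) ^ 2 / Λ))
        + 3 * (P.cv + 1) * Λ ^ 2 * |Z' - Z| * (|r' - r| + |θ' - θ|) := by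
  have hr0 := pos_of_mem_range hΛ hr
  have hθ0 := pos_of_mem_range hΛ hθ
  have hr0' := pos_of_mem_range hΛ hr'
  have hθ0' := pos_of_mem_range hΛ hθ'
  have hcv := P.cv_pos
  have h1 := sq_div_le_mul_log hΛ hr' hr
  -- The temperature part of the symmetrised relative entropy is nonnegative.
  have h2 : (r' * θ' - r * θ) * (θ'⁻¹ - θ⁻¹) + (r' - r) * (Real.log θ' - Real.log θ) ≤ 0 := by
    have a1 := Real.log_le_sub_one_of_pos (div_pos hθ0 hθ0')
    have a2 := Real.log_le_sub_one_of_pos (div_pos hθ0' hθ0)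
    rw [Real.log_div hθ0.ne' hθ0'.ne'] at a1
    rw [Real.log_div hθ0'.ne' hθ0.ne'] at a2
    have b1 := mul_le_mul_of_nonneg_left a1 hr0.le
    have b2 := mul_le_mul_of_nonneg_left a2 hr0'.le
    have e : (r' * θ' - r * θ) * (θ'⁻¹ - θ⁻¹)
        = -(r * (θ / θ' - 1)) - r' * (θ' / θ - 1) := by field_simp; ring
    rw [e]
    linarith
  have e : P.cv * (r' * θ' - r * θ) * (Z' / θ' - Z / θ)
      + (r' - r) * (Z' * (P.entropy r' θ' - P.cv - 1) - Z * (P.entropy r θ - P.cv - 1))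
      = (Z + Z') / 2 * (P.cv * ((r' * θ' - r * θ) * (θ'⁻¹ - θ⁻¹)
          + (r' - r) * (Real.log θ' - Real.log θ)) - (r' - r) * (Real.log r' - Real.log r))
        + (Z' - Z) * (P.cv * (r' * θ' - r * θ) * ((θ'⁻¹ + θ⁻¹) / 2)
          + (r' - r) * ((P.entropy r' θ' + P.entropy r θ) / 2 - P.cv - 1)) := by
    simp only [Model.entropy]
    ring
  rw [e]
  have h3 : (Z + Z') / 2 * (P.cv * ((r' * θ' - r * θ) * (θ'⁻¹ - θ⁻¹)
          + (r' - r) * (Real.log θ' - Real.log θ)) - (r' - r) * (Real.log r' - Real.log r))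
      ≤ -((Z + Z') / 2 * ((r' - r) ^ 2 / Λ)) := by
    rw [← mul_neg]
    refine mul_le_mul_of_nonneg_left ?_ (by linarith)
    nlinarith [mul_nonneg hcv.le (neg_nonneg.2 h2)]
  have h4 : |P.cv * (r' * θ' - r * θ) * ((θ'⁻¹ + θ⁻¹) / 2)
          + (r' - r) * ((P.entropy r' θ' + P.entropy r θ) / 2 - P.cv - 1)|
      ≤ 3 * (P.cv + 1) * Λ ^ 2 * (|r' - r| + |θ' - θ|) := by
    have c1 : |r' * θ' - r * θ| ≤ Λ * (|r' - r| + |θ' - θ|) := by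
      have : r' * θ' - r * θ = (r' - r) * θ' + r * (θ' - θ) := by ring
      rw [this]
      calc _ ≤ |(r' - r) * θ'| + |r * (θ' - θ)| := abs_add_le _ _
        _ = |r' - r| * θ' + r * |θ' - θ| := by
            rw [abs_mul, abs_mul, abs_of_pos hθ0', abs_of_pos hr0]
        _ ≤ |r' - r| * Λ + Λ * |θ' - θ| := by
            gcongr
            · exact hθ'.2
            · exact hr.2
        _ = _ := by ring
    have c2 : |(θ'⁻¹ + θ⁻¹) / 2| ≤ Λ := by
      rw [abs_of_pos (by positivity)]
      linarith [inv_le_of_mem_range hΛ hθ, inv_le_of_mem_range hΛ hθ']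
    have c3 : |(P.entropy r' θ' + P.entropy r θ) / 2 - P.cv - 1| ≤ 2 * (P.cv + 1) * Λ ^ 2 := by
      have d1 := abs_le.1 (abs_entropy_le P hΛ hr hθ)
      have d2 := abs_le.1 (abs_entropy_le P hΛ hr' hθ')
      have d3 : (P.cv + 1) * Λ ≤ (P.cv + 1) * Λ ^ 2 :=
        mul_le_mul_of_nonneg_left (by nlinarith) (by linarith)
      have d4 : (P.cv + 1) ≤ (P.cv + 1) * Λ ^ 2 :=
        le_mul_of_one_le_right (by linarith) (by nlinarith)
      rw [abs_le]
      constructor <;> linarith [d1.1, d1.2, d2.1, d2.2]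
    calc _ ≤ |P.cv * (r' * θ' - r * θ) * ((θ'⁻¹ + θ⁻¹) / 2)|
          + |(r' - r) * ((P.entropy r' θ' + P.entropy r θ) / 2 - P.cv - 1)| := abs_add_le _ _
      _ = P.cv * |r' * θ' - r * θ| * |(θ'⁻¹ + θ⁻¹) / 2|
          + |r' - r| * |(P.entropy r' θ' + P.entropy r θ) / 2 - P.cv - 1| := by
          rw [abs_mul, abs_mul, abs_mul, abs_of_pos hcv]
      _ ≤ P.cv * (Λ * (|r' - r| + |θ' - θ|)) * Λ
          + (|r' - r| + |θ' - θ|) * (2 * (P.cv + 1) * Λ ^ 2) := by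
          gcongr
          linarith [abs_nonneg (θ' - θ)]
      _ ≤ _ := by
          have : 0 ≤ Λ ^ 2 * (|r' - r| + |θ' - θ|) := by positivity
          nlinarith
  have h5 : (Z' - Z) * (P.cv * (r' * θ' - r * θ) * ((θ'⁻¹ + θ⁻¹) / 2)
          + (r' - r) * ((P.entropy r' θ' + P.entropy r θ) / 2 - P.cv - 1))
      ≤ |Z' - Z| * (3 * (P.cv + 1) * Λ ^ 2 * (|r' - r| + |θ' - θ|)) := by
    refine (le_abs_self _).trans ?_
    rw [abs_mul]
    exact mul_le_mul_of_nonneg_left h4 (abs_nonneg _)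
  linarith

/-- The conductive flux tested with `Z/ϑ` splits into entropy production and a term with the jump
of `Z`. -/
theorem heat_identity {θ θ' : ℝ} (hθ : 0 < θ) (hθ' : 0 < θ') (Z Z' : ℝ) :
    -((θ' - θ) * (Z' / θ' - Z / θ)) = (Z + Z') / 2 * (θ' - θ) ^ 2 / (θ * θ')
      - (θ' - θ) * (Z' - Z) * ((θ⁻¹ + θ'⁻¹) / 2) := by
  field_simp
  ring

end Entropy

/-! ### Estimates on a single face -/

section Faces

variable {n N M : ℕ}

/-- The admissible range of the discrete states. -/
structure InRange (Λ : ℝ) (r θ : Cell n N M → ℝ) (u : Cell n N M → Space n) : Prop where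
  rho : ∀ K, r K ∈ Set.Icc Λ⁻¹ Λ
  theta : ∀ K, θ K ∈ Set.Icc Λ⁻¹ Λ
  vel : ∀ K i, |u K i| ≤ Λ

/-- The squared jump of density and velocity across a face. -/
def jumpSq (r : Cell n N M → ℝ) (u : Cell n N M → Space n) (K K' : Cell n N M) : ℝ :=
  (r K' - r K) ^ 2 + ∑ j, (u K' j - u K j) ^ 2

theorem jumpSq_nonneg (r : Cell n N M → ℝ) (u : Cell n N M → Space n) (K K' : Cell n N M) :
    0 ≤ jumpSq r u K K' :=
  add_nonneg (sq_nonneg _) (Finset.sum_nonneg fun _ _ => sq_nonneg _)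

/-- Lower bound of `faceTerm`, in terms of difference quotients of `ϑ` and `Z`, which separates the
squared jumps from the terms containing a difference of `Z`. -/
theorem faceTerm_lower {P : Model n} {Λ h : ℝ} (hΛ : 1 ≤ Λ) (hh : 0 < h)
    {r θ Z : Cell n N M → ℝ} {u : Cell n N M → Space n} (hR : InRange Λ r θ u)
    (hZ : ∀ K, 0 ≤ Z K) (i : Fin (n + 1)) (K K' : Cell n N M) :
    h * (h ^ (P.alpha - 1) * ((∑ j, (u K' j - u K j) ^ 2) / Λ
          + (Z K + Z K') / 2 * ((r K' - r K) ^ 2 / Λ))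
        - h ^ P.alpha * (3 * (P.cv + 1) * Λ ^ 2 * |(Z K' - Z K) / h|
          * (|r K' - r K| + |θ K' - θ K|))
        + (u K i + u K' i) / 2 * (if 0 ≤ (u K i + u K' i) / 2 then r K * P.entropy (r K) (θ K)
          else r K' * P.entropy (r K') (θ K')) * ((Z K' - Z K) / h)
        + P.kappa * ((Z K + Z K') / 2 * ((θ K' - θ K) / h) ^ 2 / (θ K * θ K')
          - (θ K' - θ K) / h * ((Z K' - Z K) / h) * (((θ K)⁻¹ + (θ K')⁻¹) / 2)))
      ≤ faceTerm P h r θ u Z i K K' := by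
  have hθ0 := pos_of_mem_range hΛ (hR.theta K)
  have hθ0' := pos_of_mem_range hΛ (hR.theta K')
  have ha : 0 < h ^ P.alpha := Real.rpow_pos_of_pos hh _
  have hb : h ^ (P.alpha - 1) = h ^ P.alpha / h := by rw [Real.rpow_sub hh, Real.rpow_one]
  have h1 := mul_le_mul_of_nonneg_left
    (diffusion_lower P hΛ (hR.rho K) (hR.theta K) (hR.rho K') (hR.theta K') (hZ K) (hZ K')) ha.le
  have h2 : (∑ j, (u K' j - u K j) ^ 2) / Λ ≤ (r K + r K') / 2 * ∑ j, (u K' j - u K j) ^ 2 := by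
    rw [div_eq_inv_mul]
    exact mul_le_mul_of_nonneg_right (by linarith [(hR.rho K).1, (hR.rho K').1])
      (Finset.sum_nonneg fun _ _ => sq_nonneg _)
  have h3 := mul_le_mul_of_nonneg_left h2 ha.le
  have e1 : -(P.kappa / h * (θ K' - θ K) * (Z K' / θ K' - Z K / θ K))
      = h * (P.kappa * ((Z K + Z K') / 2 * ((θ K' - θ K) / h) ^ 2 / (θ K * θ K')
          - (θ K' - θ K) / h * ((Z K' - Z K) / h) * (((θ K)⁻¹ + (θ K')⁻¹) / 2))) := by
    have := heat_identity hθ0 hθ0' (Z K) (Z K')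
    calc _ = P.kappa / h * (-((θ K' - θ K) * (Z K' / θ K' - Z K / θ K))) := by ring
      _ = _ := by rw [this]; field_simp
  have e2 : h * (h ^ P.alpha * (3 * (P.cv + 1) * Λ ^ 2 * |(Z K' - Z K) / h|
          * (|r K' - r K| + |θ K' - θ K|)))
      = h ^ P.alpha * (3 * (P.cv + 1) * Λ ^ 2 * |Z K' - Z K| * (|r K' - r K| + |θ K' - θ K|)) := by
    rw [abs_div, abs_of_pos hh]; field_simp
  have e3 : ∀ w : ℝ, h * (w * ((Z K' - Z K) / h)) = w * (Z K' - Z K) := fun w => by field_simp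
  have e4 : ∀ w : ℝ, h * (h ^ P.alpha / h * w) = h ^ P.alpha * w := fun w => by field_simp
  rw [hb, mul_add, mul_add, mul_sub, e2, e3, e4, ← e1]
  unfold faceTerm
  linarith

/-- `2 x y ≤ a x² + y²/a`. -/
theorem two_mul_le_weighted {a x y : ℝ} (ha : 0 < a) : 2 * x * y ≤ a * x ^ 2 + y ^ 2 / a := by
  have : a * x ^ 2 + y ^ 2 / a - 2 * x * y = (a * x - y) ^ 2 / a := by field_simp; ring
  have h2 : 0 ≤ (a * x - y) ^ 2 / a := by positivity
  linarith

/-- Coercivity of the face terms for a test function bounded away from `0`. -/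
theorem exists_faceTerm_coercive (P : Model n) {Λ : ℝ} (hΛ : 1 ≤ Λ) :
    ∃ c > 0, ∃ C, 0 ≤ C ∧ ∀ {N M : ℕ} {h : ℝ}, 0 < h → h < 1 →
      ∀ {r θ Z : Cell n N M → ℝ} {u : Cell n N M → Space n}, InRange Λ r θ u →
      (∀ K, (2 * Λ)⁻¹ ≤ Z K) → ∀ (i : Fin (n + 1)) (K K' : Cell n N M),
      |Z K' - Z K| ≤ Λ * h →
      h * (c * (h ^ (P.alpha - 1) * jumpSq r u K K' + ((θ K' - θ K) / h) ^ 2) - C)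
        ≤ faceTerm P h r θ u Z i K K' := by
  have hΛ0 : 0 < Λ := by linarith
  have hκ := P.kappa_pos
  have hcv := P.cv_pos
  set m : ℝ := (2 * Λ)⁻¹ with hm
  have hm0 : 0 < m := by positivity
  set k : ℝ := 3 * (P.cv + 1) * Λ ^ 2 * Λ with hk
  have hk0 : 0 ≤ k := by positivity
  set l : ℝ := k + P.kappa * Λ ^ 2 with hl
  have hl0 : 0 ≤ l := by positivity
  set c1 : ℝ := m / Λ / 2 with hc1
  set c2 : ℝ := P.kappa * m / Λ ^ 2 / 2 with hc2
  have hc10 : 0 < c1 := by positivity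
  have hc20 : 0 < c2 := by positivity
  have hm1 : m ≤ 1 := by
    rw [hm]; exact inv_le_one_of_one_le₀ (by linarith)
  refine ⟨min c1 c2, lt_min hc10 hc20, k ^ 2 / c1 + l ^ 2 / c2 + Λ * ((P.cv + 1) * Λ ^ 2) * Λ,
    by positivity, ?_⟩
  intro N M h hh hh1 r θ Z u hR hZ i K K' hZZ
  have hZ0 : ∀ K, 0 ≤ Z K := fun K => hm0.le.trans (hZ K)
  refine le_trans (mul_le_mul_of_nonneg_left ?_ hh.le) (faceTerm_lower hΛ hh hR hZ0 i K K')
  have hdZ : |(Z K' - Z K) / h| ≤ Λ := by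
    rw [abs_div, abs_of_pos hh, div_le_iff₀ hh]; exact hZZ
  set dZ := (Z K' - Z K) / h with hdZdef
  set G := (θ K' - θ K) / h with hG
  have hθG : |θ K' - θ K| = h * |G| := by
    rw [hG, abs_div, abs_of_pos hh]; field_simp
  set a := h ^ P.alpha with ha
  set b := h ^ (P.alpha - 1) with hb
  have ha0 : 0 < a := Real.rpow_pos_of_pos hh _
  have hb0 : 0 < b := Real.rpow_pos_of_pos hh _
  have hab : a = b * h := by
    rw [ha, hb, ← Real.rpow_add_one hh.ne']; ring_nf
  have hah : a * h ≤ 1 := by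
    rw [ha, ← Real.rpow_add_one hh.ne']
    exact Real.rpow_le_one hh.le hh1.le (by linarith [P.alpha_gt])
  -- velocity and density jumps
  have t1 : min c1 c2 * (b * jumpSq r u K K') + c1 * (b * (r K' - r K) ^ 2)
      ≤ b * ((∑ j, (u K' j - u K j) ^ 2) / Λ + (Z K + Z K') / 2 * ((r K' - r K) ^ 2 / Λ)) := by
    have hu : 0 ≤ ∑ j, (u K' j - u K j) ^ 2 := Finset.sum_nonneg fun _ _ => sq_nonneg _
    have hmin : min c1 c2 ≤ c1 := min_le_left _ _
    have hc1' : c1 ≤ 1 / Λ := by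
      rw [hc1, div_div, div_le_div_iff₀ (by positivity) hΛ0]; nlinarith
    have e : b * (∑ j, (u K' j - u K j) ^ 2) * min c1 c2
        ≤ b * (∑ j, (u K' j - u K j) ^ 2) * (1 / Λ) :=
      mul_le_mul_of_nonneg_left (hmin.trans hc1') (by positivity)
    have e2 : m * ((r K' - r K) ^ 2 / Λ) ≤ (Z K + Z K') / 2 * ((r K' - r K) ^ 2 / Λ) :=
      mul_le_mul_of_nonneg_right (by linarith [hZ K, hZ K']) (by positivity)
    have e3 := mul_le_mul_of_nonneg_left e2 hb0.le
    have e4 : m * ((r K' - r K) ^ 2 / Λ) = 2 * (c1 * (r K' - r K) ^ 2) := by rw [hc1]; field_simp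
    have e5 : b * (r K' - r K) ^ 2 * min c1 c2 ≤ b * (r K' - r K) ^ 2 * c1 :=
      mul_le_mul_of_nonneg_left hmin (by positivity)
    rw [e4] at e3
    unfold jumpSq
    have e6 : (∑ j, (u K' j - u K j) ^ 2) / Λ = (∑ j, (u K' j - u K j) ^ 2) * (1 / Λ) := by ring
    rw [e6]
    linarith
  -- commutator of the numerical diffusion with `Z`
  have t2 : a * (3 * (P.cv + 1) * Λ ^ 2 * |dZ| * (|r K' - r K| + |θ K' - θ K|))
      ≤ c1 * (b * (r K' - r K) ^ 2) + k ^ 2 / c1 + k * |G| := by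
    have e1 : 3 * (P.cv + 1) * Λ ^ 2 * |dZ| ≤ k :=
      mul_le_mul_of_nonneg_left hdZ (by positivity)
    have e2 : a * (3 * (P.cv + 1) * Λ ^ 2 * |dZ| * (|r K' - r K| + |θ K' - θ K|))
        ≤ a * (k * (|r K' - r K| + |θ K' - θ K|)) := by gcongr
    have e3 : a * k * |r K' - r K| ≤ b * (c1 * (r K' - r K) ^ 2) + k ^ 2 / c1 := by
      have := two_mul_le_weighted (a := c1) (x := |r K' - r K|) (y := k * h) hc10
      rw [sq_abs] at this
      have h2 := mul_le_mul_of_nonneg_left this hb0.le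
      have h3 : b * ((k * h) ^ 2 / c1) = (a * h) * (k ^ 2 / c1) := by rw [hab]; ring
      have h4 : (a * h) * (k ^ 2 / c1) ≤ 1 * (k ^ 2 / c1) :=
        mul_le_mul_of_nonneg_right hah (by positivity)
      have h5 : 0 ≤ b * (|r K' - r K| * (k * h)) := by positivity
      rw [mul_add, h3] at h2
      have h6 : a * k * |r K' - r K| = b * (|r K' - r K| * (k * h)) := by rw [hab]; ring
      linarith
    have e4 : a * k * |θ K' - θ K| ≤ k * |G| := by
      rw [hθG]
      have : a * k * (h * |G|) = (a * h) * (k * |G|) := by ring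
      rw [this]
      exact mul_le_of_le_one_left (by positivity) hah
    linarith
  -- convection
  have t3 : -(Λ * ((P.cv + 1) * Λ ^ 2) * Λ) ≤
      (u K i + u K' i) / 2 * (if 0 ≤ (u K i + u K' i) / 2 then r K * P.entropy (r K) (θ K)
          else r K' * P.entropy (r K') (θ K')) * dZ := by
    have e1 : |(u K i + u K' i) / 2| ≤ Λ := by
      have d1 := abs_le.1 (hR.vel K i)
      have d2 := abs_le.1 (hR.vel K' i)
      rw [abs_le]; constructor <;> linarith [d1.1, d1.2, d2.1, d2.2]
    have e2 : |if 0 ≤ (u K i + u K' i) / 2 then r K * P.entropy (r K) (θ K)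
          else r K' * P.entropy (r K') (θ K')| ≤ (P.cv + 1) * Λ ^ 2 := by
      split_ifs
      · exact abs_mul_entropy_le P hΛ (hR.rho K) (hR.theta K)
      · exact abs_mul_entropy_le P hΛ (hR.rho K') (hR.theta K')
    refine (abs_le.1 ?_).1
    rw [abs_mul, abs_mul]
    gcongr
  -- heat conduction
  have t4 : 2 * c2 * G ^ 2 - P.kappa * Λ ^ 2 * |G| ≤
      P.kappa * ((Z K + Z K') / 2 * G ^ 2 / (θ K * θ K')
          - G * dZ * (((θ K)⁻¹ + (θ K')⁻¹) / 2)) := by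
    have hθ0 := pos_of_mem_range hΛ (hR.theta K)
    have hθ0' := pos_of_mem_range hΛ (hR.theta K')
    have e1 : m * G ^ 2 / Λ ^ 2 ≤ (Z K + Z K') / 2 * G ^ 2 / (θ K * θ K') := by
      refine div_le_div₀ (by have := hZ0 K; have := hZ0 K'; positivity) ?_ (by positivity) ?_
      · exact mul_le_mul_of_nonneg_right (by linarith [hZ K, hZ K']) (sq_nonneg _)
      · rw [sq]
        exact mul_le_mul (hR.theta K).2 (hR.theta K').2 hθ0'.le (by linarith)
    have e2 : G * dZ * (((θ K)⁻¹ + (θ K')⁻¹) / 2) ≤ |G| * Λ * Λ := by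
      refine (le_abs_self _).trans ?_
      rw [abs_mul, abs_mul]
      have : |((θ K)⁻¹ + (θ K')⁻¹) / 2| ≤ Λ := by
        rw [abs_of_pos (by positivity)]
        linarith [inv_le_of_mem_range hΛ (hR.theta K), inv_le_of_mem_range hΛ (hR.theta K')]
      gcongr
    have e3 : 2 * c2 * G ^ 2 = P.kappa * (m * G ^ 2 / Λ ^ 2) := by rw [hc2]; ring
    rw [e3]
    have := mul_le_mul_of_nonneg_left (sub_le_sub e1 e2) hκ.le
    linarith
  have t5 : l * |G| ≤ c2 * G ^ 2 + l ^ 2 / c2 := by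
    have := two_mul_le_weighted (a := c2) (x := |G|) (y := l) hc20
    rw [sq_abs] at this
    have : 0 ≤ |G| * l := by positivity
    linarith
  have t6 : min c1 c2 * G ^ 2 ≤ c2 * G ^ 2 :=
    mul_le_mul_of_nonneg_right (min_le_right _ _) (sq_nonneg _)
  have e7 : l * |G| = k * |G| + P.kappa * Λ ^ 2 * |G| := by rw [hl]; ring
  rw [mul_add (min c1 c2)]
  linarith

/-- The rate `h^((1-α)/2) + h^((1+α)/2)`. -/
def rate (α h : ℝ) : ℝ := h ^ ((1 - α) / 2) + h ^ ((1 + α) / 2)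

theorem rate_pos {α h : ℝ} (hh : 0 < h) : 0 < rate α h :=
  add_pos (Real.rpow_pos_of_pos hh _) (Real.rpow_pos_of_pos hh _)

theorem sqrt_le_rate {α h : ℝ} (hh : 0 < h) (hh1 : h < 1) : h ^ (1 / 2 : ℝ) ≤ rate α h := by
  rcases le_total 0 α with h0 | h0
  · have := Real.rpow_le_rpow_of_exponent_ge hh hh1.le
      (show (1 - α) / 2 ≤ 1 / 2 by linarith)
    exact this.trans (le_add_of_nonneg_right (Real.rpow_nonneg hh.le _))
  · have := Real.rpow_le_rpow_of_exponent_ge hh hh1.le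
      (show (1 + α) / 2 ≤ 1 / 2 by linarith)
    exact this.trans (le_add_of_nonneg_left (Real.rpow_nonneg hh.le _))

theorem le_rate {α h : ℝ} (hh : 0 < h) (hh1 : h < 1) : h ≤ rate α h := by
  refine le_trans ?_ (sqrt_le_rate hh hh1)
  have := Real.rpow_le_rpow_of_exponent_ge hh hh1.le (show (1 / 2 : ℝ) ≤ 1 by norm_num)
  rwa [Real.rpow_one] at this

/-- A jump is absorbed by its square with the weight `h^(α-1)` of the numerical diffusion. -/
theorem le_rate_mul {α h : ℝ} (hh : 0 < h) {x : ℝ} (hx : 0 ≤ x) :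
    x ≤ rate α h * (1 + h ^ (α - 1) * x ^ 2) := by
  have hs : 0 < h ^ ((1 - α) / 2) := Real.rpow_pos_of_pos hh _
  have e : h ^ (α - 1) = (h ^ ((1 - α) / 2))⁻¹ ^ 2 := by
    rw [← Real.rpow_neg hh.le, ← Real.rpow_natCast, ← Real.rpow_mul hh.le]
    congr 1; push_cast; ring
  have h1 : h ^ ((1 - α) / 2) * (1 + h ^ (α - 1) * x ^ 2)
      ≤ rate α h * (1 + h ^ (α - 1) * x ^ 2) := by
    refine mul_le_mul_of_nonneg_right (le_add_of_nonneg_right (Real.rpow_nonneg hh.le _)) ?_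
    have := Real.rpow_pos_of_pos hh (α - 1)
    positivity
  refine le_trans ?_ h1
  rw [e]
  set s := h ^ ((1 - α) / 2)
  have : s * (1 + s⁻¹ ^ 2 * x ^ 2) = s + x ^ 2 / s := by field_simp
  rw [this]
  have h2 := two_mul_le_weighted (a := s) (x := 1) (y := x) hs
  nlinarith

/-- A jump with the weight `h^α` of the numerical flux is absorbed likewise. -/
theorem rpow_mul_le_rate_mul {α h : ℝ} (hh : 0 < h) (x : ℝ) :
    h ^ α * x ≤ rate α h * (1 + h ^ (α - 1) * x ^ 2) := by
  have hs : 0 < h ^ ((1 + α) / 2) := Real.rpow_pos_of_pos hh _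
  have hb : 0 < h ^ (α - 1) := Real.rpow_pos_of_pos hh _
  have e : (h ^ α) ^ 2 = (h ^ ((1 + α) / 2)) ^ 2 * h ^ (α - 1) := by
    rw [← Real.rpow_natCast, ← Real.rpow_natCast, ← Real.rpow_mul hh.le, ← Real.rpow_mul hh.le,
      ← Real.rpow_add hh]
    congr 1; push_cast; ring
  have h1 : h ^ ((1 + α) / 2) * (1 + h ^ (α - 1) * x ^ 2)
      ≤ rate α h * (1 + h ^ (α - 1) * x ^ 2) :=
    mul_le_mul_of_nonneg_right (le_add_of_nonneg_left (Real.rpow_nonneg hh.le _)) (by positivity)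
  refine le_trans ?_ h1
  set s := h ^ ((1 + α) / 2)
  set b := h ^ (α - 1)
  have h2 : (h ^ α * x) ^ 2 ≤ (s * (1 + b * x ^ 2)) ^ 2 := by
    rw [mul_pow, e, mul_pow]
    have : b * x ^ 2 ≤ (1 + b * x ^ 2) ^ 2 := by nlinarith [mul_nonneg hb.le (sq_nonneg x)]
    calc s ^ 2 * b * x ^ 2 = s ^ 2 * (b * x ^ 2) := by ring
      _ ≤ _ := mul_le_mul_of_nonneg_left this (by positivity)
  exact (le_abs_self _).trans (abs_le_of_sq_le_sq h2 (by positivity))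

theorem rpow_mul_self_le_rate {α h : ℝ} (hα : -1 < α) (hh : 0 < h) (hh1 : h < 1) :
    h ^ α * h ≤ rate α h := by
  rw [← Real.rpow_add_one hh.ne']
  have := Real.rpow_le_rpow_of_exponent_ge hh hh1.le
    (show (1 + α) / 2 ≤ α + 1 by linarith)
  exact this.trans (le_add_of_nonneg_left (Real.rpow_nonneg hh.le _))

end Faces

section Faces

variable {n N M : ℕ}

set_option maxHeartbeats 1000000 in
/-- Consistency of an interior face term with the integrand of the ballistic energy on one of the
two adjacent cells `S`; `O` is the cell on the other side. The values `τ` and `γ` stand for `Θ` and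
`∂ᵢΘ` at a point near the face. -/
theorem exists_faceTerm_consistent (P : Model n) {Λ c₁ : ℝ} (hΛ : 1 ≤ Λ) (hc₁ : 0 ≤ c₁) :
    ∃ C, 0 ≤ C ∧ ∀ {N M : ℕ} {h : ℝ}, 0 < h → h < 1 →
      ∀ {r θ Z : Cell n N M → ℝ} {u : Cell n N M → Space n}, InRange Λ r θ u →
      (∀ K, 0 ≤ Z K) → ∀ (i : Fin (n + 1)) (K K' S O : Cell n N M),
      (S = K ∧ O = K' ∨ S = K' ∧ O = K) → ∀ (τ γ χ : ℝ), 0 ≤ τ → 0 ≤ χ →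
      χ * θ O ≤ θ S → |τ - (Z K + Z K') / 2| ≤ c₁ * h → |γ| ≤ c₁ →
      |Z K' - Z K| ≤ c₁ * h → |γ - (Z K' - Z K) / h| ≤ c₁ * h →
      h * (P.kappa * τ * χ / θ S ^ 2 * ((θ K' - θ K) / h) ^ 2
          + r S * P.entropy (r S) (θ S) * (u S i * γ)
          - P.kappa / θ S * ((θ K' - θ K) / h * γ))
        ≤ faceTerm P h r θ u Z i K K'
          + h * (C * rate P.alpha h * (1 + ((θ K' - θ K) / h) ^ 2
            + h ^ (P.alpha - 1) * jumpSq r u K K')) := by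
  have hΛ0 : 0 < Λ := by linarith
  have hκ := P.kappa_pos
  have hcv := P.cv_pos
  set e₀ : ℝ := (P.cv + 1) * Λ ^ 2 with he₀
  have he₀0 : 0 ≤ e₀ := by positivity
  set k : ℝ := 3 * (P.cv + 1) * Λ ^ 2 * c₁ with hk
  have hk0 : 0 ≤ k := by positivity
  refine ⟨2 * P.kappa * c₁ * Λ ^ 2 + P.kappa * c₁ * Λ + 2 * k + e₀ * Λ * c₁
    + c₁ * (4 * e₀ * Λ + e₀), by positivity, ?_⟩
  intro N M h hh hh1 r θ Z u hR hZ i K K' S O hS τ γ χ hτ hχ hχθ hτZ hγ hZZ hγZ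
  have hlow := faceTerm_lower (P := P) hΛ hh hR hZ i K K'
  refine le_trans ?_ (add_le_add_left hlow _)
  rw [← mul_add]
  refine mul_le_mul_of_nonneg_left ?_ hh.le
  have hθ0 := pos_of_mem_range hΛ (hR.theta K)
  have hθ0' := pos_of_mem_range hΛ (hR.theta K')
  have hθS := pos_of_mem_range hΛ (hR.theta S)
  have hθO := pos_of_mem_range hΛ (hR.theta O)
  have hdZ : |(Z K' - Z K) / h| ≤ c₁ := by
    rw [abs_div, abs_of_pos hh, div_le_iff₀ hh]; exact hZZ
  set dZ := (Z K' - Z K) / h with hdZdef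
  set G := (θ K' - θ K) / h with hG
  have hθG : |θ K' - θ K| = h * |G| := by
    rw [hG, abs_div, abs_of_pos hh]; field_simp
  set a := h ^ P.alpha with ha
  set b := h ^ (P.alpha - 1) with hb
  have ha0 : 0 < a := Real.rpow_pos_of_pos hh _
  have hb0 : 0 < b := Real.rpow_pos_of_pos hh _
  set R := rate P.alpha h with hRdef
  have hR0 : 0 < R := rate_pos hh
  have hhR : h ≤ R := le_rate hh hh1
  have hahR : a * h ≤ R := rpow_mul_self_le_rate P.alpha_gt hh hh1
  set W := 1 + G ^ 2 + b * jumpSq r u K K' with hW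
  have hJ := jumpSq_nonneg r u K K'
  have hbJ : 0 ≤ b * jumpSq r u K K' := mul_nonneg hb0.le hJ
  have hG2 := sq_nonneg G
  have hGW : |G| ≤ W := by
    have : 2 * |G| ≤ 1 + |G| ^ 2 := by nlinarith [sq_nonneg (|G| - 1)]
    rw [sq_abs] at this
    have := abs_nonneg G
    rw [hW]; linarith
  have hG2W : G ^ 2 ≤ W := by rw [hW]; linarith
  have h1W : 1 ≤ W := by rw [hW]; linarith
  have hrJ : (r K' - r K) ^ 2 ≤ jumpSq r u K K' :=
    le_add_of_nonneg_right (Finset.sum_nonneg fun _ _ => sq_nonneg _)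
  have huJ : (u K' i - u K i) ^ 2 ≤ jumpSq r u K K' :=
    (Finset.single_le_sum (f := fun j => (u K' j - u K j) ^ 2) (fun _ _ => sq_nonneg _)
      (Finset.mem_univ i)).trans (le_add_of_nonneg_left (sq_nonneg _))
  have hRW : ∀ x : ℝ, x ^ 2 ≤ jumpSq r u K K' → R * (1 + b * |x| ^ 2) ≤ R * W := by
    intro x hx
    rw [sq_abs]
    refine mul_le_mul_of_nonneg_left ?_ hR0.le
    have := mul_le_mul_of_nonneg_left hx hb0.le
    rw [hW]; linarith
  have jr : |r K' - r K| ≤ R * W := (le_rate_mul hh (abs_nonneg _)).trans (hRW _ hrJ)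
  have ju : |u K' i - u K i| ≤ R * W := (le_rate_mul hh (abs_nonneg _)).trans (hRW _ huJ)
  have jar : a * |r K' - r K| ≤ R * W :=
    (rpow_mul_le_rate_mul hh _).trans (hRW _ hrJ)
  have jhG : h * |G| ≤ R * W := mul_le_mul hhR hGW (abs_nonneg _) hR0.le
  have jθ : |θ K' - θ K| ≤ R * W := by rw [hθG]; exact jhG
  have jaθ : a * |θ K' - θ K| ≤ R * W := by
    rw [hθG, ← mul_assoc]; exact mul_le_mul hahR hGW (abs_nonneg _) hR0.le
  have jhG2 : h * G ^ 2 ≤ R * W := mul_le_mul hhR hG2W hG2 hR0.le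
  have jh : h ≤ R * W := hhR.trans (le_mul_of_one_le_right hR0.le h1W)
  have hSO : θ S * θ O = θ K * θ K' := by
    rcases hS with ⟨rfl, rfl⟩ | ⟨rfl, rfl⟩
    · rfl
    · exact mul_comm _ _
  -- temperature dissipation
  have t1 : P.kappa * τ * χ / θ S ^ 2 * G ^ 2 ≤
      P.kappa * ((Z K + Z K') / 2 * G ^ 2 / (θ K * θ K')) + P.kappa * c₁ * Λ ^ 2 * (R * W) := by
    have e1 : χ / θ S ^ 2 ≤ 1 / (θ K * θ K') := by
      rw [← hSO, div_le_div_iff₀ (by positivity) (by positivity)]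
      nlinarith
    have e2 : τ ≤ (Z K + Z K') / 2 + c₁ * h := by linarith [(abs_le.1 hτZ).2]
    have e3 : 1 / (θ K * θ K') ≤ Λ ^ 2 := by
      rw [one_div, mul_inv, sq]
      exact mul_le_mul (inv_le_of_mem_range hΛ (hR.theta K))
        (inv_le_of_mem_range hΛ (hR.theta K')) (by positivity) hΛ0.le
    calc P.kappa * τ * χ / θ S ^ 2 * G ^ 2 = P.kappa * G ^ 2 * τ * (χ / θ S ^ 2) := by ring
      _ ≤ P.kappa * G ^ 2 * τ * (1 / (θ K * θ K')) :=
          mul_le_mul_of_nonneg_left e1 (by positivity)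
      _ ≤ P.kappa * G ^ 2 * ((Z K + Z K') / 2 + c₁ * h) * (1 / (θ K * θ K')) := by
          gcongr
      _ = P.kappa * ((Z K + Z K') / 2 * G ^ 2 / (θ K * θ K'))
          + P.kappa * c₁ * (1 / (θ K * θ K')) * (h * G ^ 2) := by ring
      _ ≤ _ := by
          gcongr
  -- heat flux
  have t2 : -(P.kappa / θ S * (G * γ)) ≤
      -(P.kappa * (G * dZ * (((θ K)⁻¹ + (θ K')⁻¹) / 2)))
        + (P.kappa * c₁ * Λ + P.kappa * c₁ * Λ ^ 2) * (R * W) := by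
    have e1 : |(((θ K)⁻¹ + (θ K')⁻¹) / 2) - (θ S)⁻¹| ≤ Λ ^ 2 * (h * |G|) := by
      have d := abs_inv_sub_inv_le hΛ (hR.theta K') (hR.theta K)
      rw [hθG] at d
      have d0 : 0 ≤ |(θ K')⁻¹ - (θ K)⁻¹| := abs_nonneg _
      refine le_trans ?_ d
      rcases hS with ⟨rfl, rfl⟩ | ⟨rfl, rfl⟩
      · have : ((θ S)⁻¹ + (θ O)⁻¹) / 2 - (θ S)⁻¹ = ((θ O)⁻¹ - (θ S)⁻¹) / 2 := by ring
        rw [this, abs_div, abs_two]; linarith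
      · have : ((θ O)⁻¹ + (θ S)⁻¹) / 2 - (θ S)⁻¹ = -(((θ S)⁻¹ - (θ O)⁻¹) / 2) := by ring
        rw [this, abs_neg, abs_div, abs_two]; linarith
    have e2 : P.kappa * (G * dZ * (((θ K)⁻¹ + (θ K')⁻¹) / 2)) - P.kappa / θ S * (G * γ)
        = P.kappa * (G * (dZ * ((((θ K)⁻¹ + (θ K')⁻¹) / 2) - (θ S)⁻¹)
          - (γ - dZ) * (θ S)⁻¹)) := by
      ring
    have e3 : |dZ * ((((θ K)⁻¹ + (θ K')⁻¹) / 2) - (θ S)⁻¹) - (γ - dZ) * (θ S)⁻¹|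
        ≤ c₁ * (Λ ^ 2 * (h * |G|)) + c₁ * h * Λ := by
      refine (abs_sub _ _).trans ?_
      rw [abs_mul, abs_mul, abs_of_pos (inv_pos.2 hθS)]
      have := inv_le_of_mem_range hΛ (hR.theta S)
      gcongr
    have e4 : G * (dZ * ((((θ K)⁻¹ + (θ K')⁻¹) / 2) - (θ S)⁻¹) - (γ - dZ) * (θ S)⁻¹)
        ≤ |G| * (c₁ * (Λ ^ 2 * (h * |G|)) + c₁ * h * Λ) := by
      refine (le_abs_self _).trans ?_
      rw [abs_mul]
      exact mul_le_mul_of_nonneg_left e3 (abs_nonneg _)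
    have e5 : |G| * (c₁ * (Λ ^ 2 * (h * |G|)) + c₁ * h * Λ)
        = c₁ * Λ ^ 2 * (h * G ^ 2) + c₁ * Λ * (h * |G|) := by
      rw [← sq_abs G]; ring
    have e6 : c₁ * Λ ^ 2 * (h * G ^ 2) + c₁ * Λ * (h * |G|)
        ≤ c₁ * Λ ^ 2 * (R * W) + c₁ * Λ * (R * W) := by gcongr
    have e7 := mul_le_mul_of_nonneg_left (e4.trans (e5.le.trans e6)) hκ.le
    linarith
  -- commutator of the numerical diffusion with `Z`
  have t3 : a * (3 * (P.cv + 1) * Λ ^ 2 * |dZ| * (|r K' - r K| + |θ K' - θ K|))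
      ≤ 2 * k * (R * W) := by
    have e1 : 3 * (P.cv + 1) * Λ ^ 2 * |dZ| ≤ k :=
      mul_le_mul_of_nonneg_left hdZ (by positivity)
    calc _ ≤ a * (k * (|r K' - r K| + |θ K' - θ K|)) := by gcongr
      _ = k * (a * |r K' - r K| + a * |θ K' - θ K|) := by ring
      _ ≤ k * (R * W + R * W) := by gcongr
      _ = _ := by ring
  -- convection
  have t4 : r S * P.entropy (r S) (θ S) * (u S i * γ) ≤
      (u K i + u K' i) / 2 * (if 0 ≤ (u K i + u K' i) / 2 then r K * P.entropy (r K) (θ K)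
          else r K' * P.entropy (r K') (θ K')) * dZ
        + (e₀ * Λ * c₁ + c₁ * (4 * e₀ * Λ + e₀)) * (R * W) := by
    set ηup := (if 0 ≤ (u K i + u K' i) / 2 then r K * P.entropy (r K) (θ K)
          else r K' * P.entropy (r K') (θ K')) with hηup
    set w := (u K i + u K' i) / 2 with hw
    set ηS := r S * P.entropy (r S) (θ S) with hηS
    have d := abs_mul_entropy_sub_le P hΛ (hR.rho K') (hR.theta K') (hR.rho K) (hR.theta K)
    have hη : |ηS - ηup| ≤ 4 * e₀ * (R * W) := by
      have d1 : |r K' * P.entropy (r K') (θ K') - r K * P.entropy (r K) (θ K)|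
          ≤ 4 * e₀ * (R * W) := by
        refine d.trans ?_
        calc _ ≤ 2 * (P.cv + 1) * Λ ^ 2 * (R * W + R * W) := by gcongr
          _ = _ := by rw [he₀]; ring
      have d0 : 0 ≤ 4 * e₀ * (R * W) := by positivity
      rw [hηup, hηS]
      rcases hS with ⟨rfl, rfl⟩ | ⟨rfl, rfl⟩ <;> split_ifs
      · simpa using d0
      · rw [abs_sub_comm]; exact d1
      · exact d1
      · simpa using d0
    have hu : |u S i - w| ≤ R * W := by
      have d0 : 0 ≤ |u K' i - u K i| := abs_nonneg _
      refine le_trans ?_ ju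
      rw [hw]
      rcases hS with ⟨rfl, rfl⟩ | ⟨rfl, rfl⟩
      · have : u S i - (u S i + u O i) / 2 = -((u O i - u S i) / 2) := by ring
        rw [this, abs_neg, abs_div, abs_two]; linarith
      · have : u S i - (u O i + u S i) / 2 = (u S i - u O i) / 2 := by ring
        rw [this, abs_div, abs_two]; linarith
    have hηb : |ηup| ≤ e₀ := by
      rw [hηup]
      split_ifs
      · exact abs_mul_entropy_le P hΛ (hR.rho K) (hR.theta K)
      · exact abs_mul_entropy_le P hΛ (hR.rho K') (hR.theta K')
    have hηSb : |ηS| ≤ e₀ := abs_mul_entropy_le P hΛ (hR.rho S) (hR.theta S)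
    have e : ηS * (u S i * γ) - w * ηup * dZ
        = ηS * u S i * (γ - dZ) + dZ * ((ηS - ηup) * u S i + ηup * (u S i - w)) := by ring
    have e1 : |ηS * u S i * (γ - dZ)| ≤ e₀ * Λ * (c₁ * h) := by
      rw [abs_mul, abs_mul]
      have := hR.vel S i
      gcongr
    have e2 : |dZ * ((ηS - ηup) * u S i + ηup * (u S i - w))|
        ≤ c₁ * (4 * e₀ * (R * W) * Λ + e₀ * (R * W)) := by
      rw [abs_mul]
      refine mul_le_mul hdZ ?_ (abs_nonneg _) hc₁
      refine (abs_add_le _ _).trans ?_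
      rw [abs_mul, abs_mul]
      have := hR.vel S i
      gcongr
    have e3 := (le_abs_self _).trans (abs_add_le (ηS * u S i * (γ - dZ))
      (dZ * ((ηS - ηup) * u S i + ηup * (u S i - w))))
    have e4 : e₀ * Λ * (c₁ * h) ≤ e₀ * Λ * (c₁ * (R * W)) := by gcongr
    linarith
  have t5 : 0 ≤ b * ((∑ j, (u K' j - u K j) ^ 2) / Λ
      + (Z K + Z K') / 2 * ((r K' - r K) ^ 2 / Λ)) := by
    have := hZ K
    have := hZ K'
    have : 0 ≤ ∑ j, (u K' j - u K j) ^ 2 := Finset.sum_nonneg fun _ _ => sq_nonneg _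
    positivity
  rw [mul_assoc _ R W]
  linarith

/-- Coercivity of an exterior face term, with the boundary temperature `b` and the test function
`max z m`, where `z` is close to `b`. -/
theorem exists_extTerm_coercive (P : Model n) {Λ : ℝ} (hΛ : 1 ≤ Λ) :
    ∃ c > 0, ∃ C, 0 ≤ C ∧ ∀ {h θ b z : ℝ}, 0 < h → θ ∈ Set.Icc Λ⁻¹ Λ → 0 ≤ b →
      |b - z| ≤ Λ * h →
      h / 2 * (c * (2 * (b - θ) / h) ^ 2 - C)
        ≤ 2 * (P.kappa / h * (θ - b) * (1 - max z (2 * Λ)⁻¹ / θ)) := by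
  have hΛ0 : 0 < Λ := by linarith
  have hκ := P.kappa_pos
  refine ⟨P.kappa / (4 * Λ), by positivity, 4 * P.kappa * Λ * Λ ^ 2, by positivity, ?_⟩
  intro h θ b z hh hθ hb hbz
  have hθ0 := pos_of_mem_range hΛ hθ
  set m := (2 * Λ)⁻¹ with hm
  have hmθ : 2 * m ≤ θ := by
    have : 2 * m = Λ⁻¹ := by rw [hm]; field_simp
    rw [this]; exact hθ.1
  have hm0 : 0 < m := by positivity
  -- The truncation at `m ≤ θ / 2` only matters if `b < m`, and then `θ - m` is at least half of
  -- `θ - b`.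
  have h1 : (θ - b) ^ 2 / 2 ≤ (θ - b) * (θ - max b m) := by
    rcases le_total m b with hmb | hmb
    · rw [max_eq_left hmb]; nlinarith [sq_nonneg (θ - b)]
    · rw [max_eq_right hmb]; nlinarith
  have h2 : |max b m - max z m| ≤ Λ * h := (abs_max_sub_max_le_abs _ _ _).trans hbz
  have h3 : (θ - b) ^ 2 / 4 - (Λ * h) ^ 2 ≤ (θ - b) * (θ - max z m) := by
    have e : (θ - b) * (θ - max z m)
        = (θ - b) * (θ - max b m) + (θ - b) * (max b m - max z m) := by ring
    have h4 : -(|θ - b| * (Λ * h)) ≤ (θ - b) * (max b m - max z m) := by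
      refine (abs_le.1 ?_).1
      rw [abs_mul]
      exact mul_le_mul_of_nonneg_left h2 (abs_nonneg _)
    have h5 : |θ - b| * (Λ * h) ≤ (θ - b) ^ 2 / 4 + (Λ * h) ^ 2 := by
      rw [← sq_abs (θ - b)]
      nlinarith [sq_nonneg (|θ - b| / 2 - Λ * h)]
    rw [e]; linarith
  have e1 : 2 * (P.kappa / h * (θ - b) * (1 - max z m / θ))
      = 2 * P.kappa / (h * θ) * ((θ - b) * (θ - max z m)) := by field_simp
  rw [e1]
  have h6 := mul_le_mul_of_nonneg_left h3 (show 0 ≤ 2 * P.kappa / (h * θ) by positivity)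
  refine le_trans ?_ h6
  have e2 : h / 2 * (P.kappa / (4 * Λ) * (2 * (b - θ) / h) ^ 2 - 4 * P.kappa * Λ * Λ ^ 2)
      = 2 * P.kappa / h * (Λ⁻¹ * ((θ - b) ^ 2 / 4)) - 2 * P.kappa / h * (Λ * (Λ * h) ^ 2) := by
    field_simp; ring
  have e3 : 2 * P.kappa / (h * θ) * ((θ - b) ^ 2 / 4 - (Λ * h) ^ 2)
      = 2 * P.kappa / h * (θ⁻¹ * ((θ - b) ^ 2 / 4)) - 2 * P.kappa / h * (θ⁻¹ * (Λ * h) ^ 2) := by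
    field_simp
  rw [e2, e3]
  have h7 : Λ⁻¹ ≤ θ⁻¹ := inv_anti₀ hθ0 hθ.2
  have h8 := inv_le_of_mem_range hΛ hθ
  gcongr

/-- Consistency of an exterior face term with the integrand on the adjacent half cell, whose
volume is small. The sign `s` is that of the outer normal. -/
theorem exists_extTerm_consistent (P : Model n) {Λ c₁ : ℝ} (hΛ : 1 ≤ Λ) (hc₁ : 0 ≤ c₁) :
    ∃ C, 0 ≤ C ∧ ∀ {h r θ v b Z τ γ χ s : ℝ}, 0 < h → h < 1 → r ∈ Set.Icc Λ⁻¹ Λ →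
      θ ∈ Set.Icc Λ⁻¹ Λ → |v| ≤ Λ → 0 ≤ b → |τ - b| ≤ c₁ * h → |b - Z| ≤ c₁ * h → |γ| ≤ c₁ →
      0 ≤ χ → χ ≤ 1 → χ * b ≤ θ → |s| = 1 →
      h / 2 * (P.kappa * τ * χ / θ ^ 2 * (s * (2 * (b - θ) / h)) ^ 2
          + r * P.entropy r θ * (v * γ) - P.kappa / θ * (s * (2 * (b - θ) / h) * γ))
        ≤ 2 * (P.kappa / h * (θ - b) * (1 - Z / θ))
          + h / 2 * (C * (h ^ (1 / 2 : ℝ) * (2 * (b - θ) / h) ^ 2 + (h ^ (1 / 2 : ℝ))⁻¹)) := by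
  have hΛ0 : 0 < Λ := by linarith
  have hκ := P.kappa_pos
  have hcv := P.cv_pos
  refine ⟨P.kappa * c₁ * Λ ^ 2 + 3 * (P.kappa * Λ * c₁) + (P.cv + 1) * Λ ^ 2 * (Λ * c₁),
    by positivity, ?_⟩
  intro h r θ v b Z τ γ χ s hh hh1 hr hθ hv hb hτb hbZ hγ hχ hχ1 hχb hs
  have hθ0 := pos_of_mem_range hΛ hθ
  have hs2 : s ^ 2 = 1 := by rw [← sq_abs, hs, one_pow]
  set G := 2 * (b - θ) / h with hG
  have e1 : 2 * (P.kappa / h * (θ - b) * (1 - Z / θ))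
      = h / 2 * (P.kappa * θ⁻¹ * G ^ 2 - 2 * P.kappa * θ⁻¹ * (G * ((b - Z) / h))) := by
    rw [hG]; field_simp; ring
  rw [e1, ← mul_add]
  refine mul_le_mul_of_nonneg_left ?_ (by positivity)
  set q := h ^ (1 / 2 : ℝ) with hq
  have hq0 : 0 < q := Real.rpow_pos_of_pos hh _
  have hq1 : q ≤ 1 := Real.rpow_le_one hh.le hh1.le (by norm_num)
  have hhq : h ≤ q := by
    have := Real.rpow_le_rpow_of_exponent_ge hh hh1.le (show (1 / 2 : ℝ) ≤ 1 by norm_num)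
    rwa [Real.rpow_one] at this
  have hqinv : 1 ≤ q⁻¹ := (one_le_inv₀ hq0).2 hq1
  set W := q * G ^ 2 + q⁻¹ with hW
  have hqG : 0 ≤ q * G ^ 2 := by positivity
  have hGW : |G| ≤ W := by
    have := two_mul_le_weighted (a := q) (x := |G|) (y := 1) hq0
    rw [sq_abs, one_pow, one_div] at this
    have := abs_nonneg G
    rw [hW]; linarith
  have h1W : 1 ≤ W := by rw [hW]; linarith
  have hhGW : h * G ^ 2 ≤ W := by
    have : h * G ^ 2 ≤ q * G ^ 2 := mul_le_mul_of_nonneg_right hhq (sq_nonneg _)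
    rw [hW]; linarith
  have hθi := inv_le_of_mem_range hΛ hθ
  have t1 : P.kappa * τ * χ / θ ^ 2 * (s * G) ^ 2
      ≤ P.kappa * θ⁻¹ * G ^ 2 + P.kappa * c₁ * Λ ^ 2 * W := by
    rw [mul_pow, hs2, one_mul]
    have d1 : τ * χ ≤ θ + c₁ * h := by
      have : τ ≤ b + c₁ * h := by linarith [(abs_le.1 hτb).2]
      have h2 := mul_le_mul_of_nonneg_right this hχ
      have h3 : c₁ * h * χ ≤ c₁ * h := mul_le_of_le_one_right (by positivity) hχ1
      linarith
    have d2 : P.kappa * τ * χ / θ ^ 2 * G ^ 2 = P.kappa * (θ⁻¹) ^ 2 * G ^ 2 * (τ * χ) := by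
      field_simp
    rw [d2]
    calc _ ≤ P.kappa * (θ⁻¹) ^ 2 * G ^ 2 * (θ + c₁ * h) :=
          mul_le_mul_of_nonneg_left d1 (by positivity)
      _ = P.kappa * θ⁻¹ * G ^ 2 + P.kappa * c₁ * (θ⁻¹) ^ 2 * (h * G ^ 2) := by field_simp
      _ ≤ _ := by gcongr
  have t2 : r * P.entropy r θ * (v * γ) ≤ (P.cv + 1) * Λ ^ 2 * (Λ * c₁) * W := by
    have d1 : r * P.entropy r θ * (v * γ) ≤ (P.cv + 1) * Λ ^ 2 * (Λ * c₁) := by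
      refine (le_abs_self _).trans ?_
      rw [abs_mul, abs_mul v]
      have := abs_mul_entropy_le P hΛ hr hθ
      gcongr
    exact d1.trans (le_mul_of_one_le_right (by positivity) h1W)
  have t3 : -(P.kappa / θ * (s * G * γ)) ≤ P.kappa * Λ * c₁ * W := by
    refine (neg_le_abs _).trans ?_
    have : |P.kappa / θ * (s * G * γ)| = P.kappa * θ⁻¹ * |γ| * |G| := by
      rw [abs_mul, abs_mul, abs_mul, hs, abs_of_pos (div_pos hκ hθ0)]; ring
    rw [this]
    gcongr
  have t4 : 2 * P.kappa * θ⁻¹ * (G * ((b - Z) / h)) ≤ 2 * (P.kappa * Λ * c₁) * W := by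
    have d1 : |(b - Z) / h| ≤ c₁ := by
      rw [abs_div, abs_of_pos hh, div_le_iff₀ hh]; exact hbZ
    refine (le_abs_self _).trans ?_
    have : |2 * P.kappa * θ⁻¹ * (G * ((b - Z) / h))|
        = 2 * (P.kappa * θ⁻¹ * |(b - Z) / h|) * |G| := by
      rw [abs_mul, abs_mul G, abs_of_pos (by positivity)]; ring
    rw [this]
    gcongr
  linarith

end Faces

/-! ### The mesh as a partition of the domain -/

section MeshGeometry

variable {n : ℕ} {P : Model n} {T : ℝ} {D : Discretization P T}

theorem corner_castSucc (K : Cell n D.N D.M) (j : Fin n) :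
    D.corner K j.castSucc = -P.L + ((K.1 j).val : ℝ) * D.h := by
  simp [Discretization.corner]

theorem corner_last (K : Cell n D.N D.M) :
    D.corner K (Fin.last n) = -P.H + (K.2.val : ℝ) * D.h := by
  simp [Discretization.corner]

theorem box_eq_pi (K : Cell n D.N D.M) :
    D.box K = Set.univ.pi fun i => Set.Ico (D.corner K i) (D.corner K i + D.h) := by
  ext x; simp [Discretization.box, Set.mem_pi]

theorem halfUp_eq_pi (i : Fin (n + 1)) (K : Cell n D.N D.M) :
    D.halfUp i K = Set.univ.pi fun j =>
      Set.Ico (D.corner K j + if j = i then D.h / 2 else 0) (D.corner K j + D.h) := by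
  have hh := D.h_pos
  ext x
  simp only [Discretization.halfUp, Discretization.box, Set.mem_ofPred_eq, Set.mem_pi, Set.mem_univ,
    true_implies, Set.mem_Ico]
  constructor
  · rintro ⟨h1, h2⟩ j
    refine ⟨?_, (h1 j).2⟩
    split_ifs with h
    · rw [h]; exact h2
    · simpa using (h1 j).1
  · intro h1
    refine ⟨fun j => ⟨?_, (h1 j).2⟩, by simpa using (h1 i).1⟩
    have := (h1 j).1
    split_ifs at this <;> linarith

theorem halfDown_eq_pi (i : Fin (n + 1)) (K : Cell n D.N D.M) :
    D.halfDown i K = Set.univ.pi fun j =>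
      Set.Ico (D.corner K j) (D.corner K j + if j = i then D.h / 2 else D.h) := by
  have hh := D.h_pos
  ext x
  simp only [Discretization.halfDown, Discretization.box, Set.mem_ofPred_eq, Set.mem_pi,
    Set.mem_univ, true_implies, Set.mem_Ico]
  constructor
  · rintro ⟨h1, h2⟩ j
    refine ⟨(h1 j).1, ?_⟩
    split_ifs with h
    · rw [h]; exact h2
    · exact (h1 j).2
  · intro h1
    refine ⟨fun j => ⟨(h1 j).1, ?_⟩, by simpa using (h1 i).2⟩
    have := (h1 j).2
    split_ifs at this <;> linarith

theorem measurableSet_box (K : Cell n D.N D.M) : MeasurableSet (D.box K) := by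
  rw [box_eq_pi]; exact MeasurableSet.univ_pi fun _ => measurableSet_Ico

theorem measurableSet_halfUp (i : Fin (n + 1)) (K : Cell n D.N D.M) :
    MeasurableSet (D.halfUp i K) := by
  rw [halfUp_eq_pi]; exact MeasurableSet.univ_pi fun _ => measurableSet_Ico

theorem measurableSet_halfDown (i : Fin (n + 1)) (K : Cell n D.N D.M) :
    MeasurableSet (D.halfDown i K) := by
  rw [halfDown_eq_pi]; exact MeasurableSet.univ_pi fun _ => measurableSet_Ico

theorem volume_real_pi_Ico {m : ℕ} {a b : Fin m → ℝ} (hab : ∀ i, a i ≤ b i) :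
    volume.real (Set.univ.pi fun i => Set.Ico (a i) (b i)) = ∏ i, (b i - a i) := by
  rw [measureReal_def, Real.volume_pi_Ico_toReal (fun i => hab i)]

theorem volume_box (K : Cell n D.N D.M) : volume.real (D.box K) = D.h ^ (n + 1) := by
  rw [box_eq_pi, volume_real_pi_Ico fun i => by linarith [D.h_pos]]
  simp

theorem prod_ite_half (i : Fin (n + 1)) (h : ℝ) :
    ∏ j, (if j = i then h / 2 else h) = h ^ (n + 1) / 2 := by
  have : ∀ j, (if j = i then h / 2 else h) = h * (if j = i then 1 / 2 else 1) := fun j => by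
    split_ifs <;> ring
  simp only [this, Finset.prod_mul_distrib, Finset.prod_const, Finset.card_univ, Fintype.card_fin,
    Finset.prod_ite_eq', Finset.mem_univ, if_true]
  ring

theorem volume_halfUp (i : Fin (n + 1)) (K : Cell n D.N D.M) :
    volume.real (D.halfUp i K) = D.h ^ (n + 1) / 2 := by
  have hh := D.h_pos
  rw [halfUp_eq_pi, volume_real_pi_Ico fun j => by split_ifs <;> linarith, ← prod_ite_half i]
  refine Finset.prod_congr rfl fun j _ => ?_
  split_ifs <;> ring

theorem volume_halfDown (i : Fin (n + 1)) (K : Cell n D.N D.M) :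
    volume.real (D.halfDown i K) = D.h ^ (n + 1) / 2 := by
  have hh := D.h_pos
  rw [halfDown_eq_pi, volume_real_pi_Ico fun j => by split_ifs <;> linarith, ← prod_ite_half i]
  refine Finset.prod_congr rfl fun j _ => ?_
  split_ifs <;> ring

theorem halfUp_subset (i : Fin (n + 1)) (K : Cell n D.N D.M) : D.halfUp i K ⊆ D.box K :=
  fun _ hx => hx.1

theorem halfDown_subset (i : Fin (n + 1)) (K : Cell n D.N D.M) : D.halfDown i K ⊆ D.box K :=
  fun _ hx => hx.1

theorem halfUp_union_halfDown (i : Fin (n + 1)) (K : Cell n D.N D.M) :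
    D.halfUp i K ∪ D.halfDown i K = D.box K := by
  ext x
  constructor
  · rintro (h | h) <;> exact h.1
  · intro h
    rcases le_or_gt (D.corner K i + D.h / 2) (x i) with h1 | h1
    · exact Or.inl ⟨h, h1⟩
    · exact Or.inr ⟨h, h1⟩

theorem disjoint_halfUp_halfDown (i : Fin (n + 1)) (K : Cell n D.N D.M) :
    Disjoint (D.halfUp i K) (D.halfDown i K) :=
  Set.disjoint_left.2 fun _ h1 h2 => not_lt.2 h1.2 h2.2

theorem setIntegral_box_eq_halves {f : Space n → ℝ} (i : Fin (n + 1)) (K : Cell n D.N D.M)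
    (hf : IntegrableOn f (D.box K)) :
    ∫ x in D.box K, f x = (∫ x in D.halfUp i K, f x) + ∫ x in D.halfDown i K, f x := by
  rw [← halfUp_union_halfDown i K, setIntegral_union (disjoint_halfUp_halfDown i K)
    (measurableSet_halfDown i K) (hf.mono_set (halfUp_subset i K))
    (hf.mono_set (halfDown_subset i K))]

theorem nat_eq_of_grid {h c y : ℝ} (hh : 0 < h) {k k' : ℕ} (h1 : c + k * h ≤ y)
    (h2 : y < c + k * h + h) (h1' : c + k' * h ≤ y) (h2' : y < c + k' * h + h) : k = k' := by
  have a1 : (k : ℝ) * h < (k' + 1) * h := by linarith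
  have a2 : (k' : ℝ) * h < (k + 1) * h := by linarith
  have b1 : (k : ℝ) < k' + 1 := lt_of_mul_lt_mul_right a1 hh.le
  have b2 : (k' : ℝ) < k + 1 := lt_of_mul_lt_mul_right a2 hh.le
  have c1 : k < k' + 1 := by exact_mod_cast b1
  have c2 : k' < k + 1 := by exact_mod_cast b2
  omega

theorem exists_grid {h c y : ℝ} (hh : 0 < h) {N : ℕ} (h1 : c ≤ y) (h2 : y < c + N * h) :
    ∃ k : Fin N, c + (k.val : ℝ) * h ≤ y ∧ y < c + (k.val : ℝ) * h + h := by
  have h3 : 0 ≤ (y - c) / h := div_nonneg (by linarith) hh.le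
  have h4 := Nat.floor_le h3
  have h5 := Nat.lt_floor_add_one ((y - c) / h)
  rw [le_div_iff₀ hh] at h4
  rw [div_lt_iff₀ hh] at h5
  have h6 : ((⌊(y - c) / h⌋₊ : ℕ) : ℝ) * h < N * h := by linarith
  have h7 : ⌊(y - c) / h⌋₊ < N := by exact_mod_cast lt_of_mul_lt_mul_right h6 hh.le
  exact ⟨⟨_, h7⟩, by simp only; linarith, by simp only; linarith⟩

theorem cell_eq_of_mem_box {K K' : Cell n D.N D.M} {x : Space n} (h : x ∈ D.box K)
    (h' : x ∈ D.box K') : K = K' := by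
  refine Prod.ext (funext fun j => Fin.ext ?_) (Fin.ext ?_)
  · have h1 := h j.castSucc
    have h2 := h' j.castSucc
    rw [corner_castSucc] at h1 h2
    exact nat_eq_of_grid D.h_pos h1.1 h1.2 h2.1 h2.2
  · have h1 := h (Fin.last n)
    have h2 := h' (Fin.last n)
    rw [corner_last] at h1 h2
    exact nat_eq_of_grid D.h_pos h1.1 h1.2 h2.1 h2.2

theorem pairwise_disjoint_box : Pairwise (Function.onFun Disjoint D.box) := fun _ _ hne =>
  Set.disjoint_left.2 fun _ h h' => hne (cell_eq_of_mem_box h h')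

theorem omega_eq_Icc : P.Omega = Set.Icc (Fin.snoc (α := fun _ => ℝ) (fun _ : Fin n => -P.L) (-P.H))
    (Fin.snoc (α := fun _ => ℝ) (fun _ : Fin n => P.L) P.H) := by
  ext x
  simp only [Model.Omega, Set.mem_ofPred_eq, Set.mem_Icc, Pi.le_def, Fin.forall_fin_succ',
    Fin.snoc_castSucc, Fin.snoc_last]
  exact ⟨fun h => ⟨⟨fun i => (h.1 i).1, h.2.1⟩, ⟨fun i => (h.1 i).2, h.2.2⟩⟩,
    fun h => ⟨fun i => ⟨h.1.1 i, h.2.1 i⟩, ⟨h.1.2, h.2.2⟩⟩⟩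

/-- The half-open cells tile the domain up to its faces of largest coordinates. -/
theorem iUnion_box_eq : ⋃ K, D.box K = Set.univ.pi fun i => Set.Ico
    (Fin.snoc (α := fun _ => ℝ) (fun _ : Fin n => -P.L) (-P.H) i)
    (Fin.snoc (α := fun _ => ℝ) (fun _ : Fin n => P.L) P.H i) := by
  have hh := D.h_pos
  ext x
  simp only [Set.mem_iUnion, Set.mem_pi, Set.mem_univ, true_implies, Fin.forall_fin_succ',
    Fin.snoc_castSucc, Fin.snoc_last, Set.mem_Ico]
  constructor
  · rintro ⟨K, hK⟩
    have key : ∀ {N : ℕ} (k : Fin N), (k.val : ℝ) * D.h + D.h ≤ N * D.h ∧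
        0 ≤ (k.val : ℝ) * D.h := by
      intro N k
      have h1 : ((k.val + 1 : ℕ) : ℝ) ≤ N := by exact_mod_cast k.isLt
      push_cast at h1
      exact ⟨by nlinarith, by positivity⟩
    constructor
    · intro j
      have h1 := hK j.castSucc
      rw [corner_castSucc] at h1
      have h2 := key (K.1 j)
      rw [D.N_mul_h] at h2
      exact ⟨by linarith, by linarith⟩
    · have h1 := hK (Fin.last n)
      rw [corner_last] at h1
      have h2 := key K.2
      rw [D.M_mul_h] at h2
      exact ⟨by linarith, by linarith⟩
  · rintro ⟨h1, h2⟩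
    have a1 : ∀ j : Fin n, ∃ k : Fin D.N, -P.L + (k.val : ℝ) * D.h ≤ x j.castSucc ∧
        x j.castSucc < -P.L + (k.val : ℝ) * D.h + D.h := fun j =>
      exists_grid hh (h1 j).1 (by rw [D.N_mul_h]; linarith [(h1 j).2])
    obtain ⟨m, hm⟩ : ∃ k : Fin D.M, -P.H + (k.val : ℝ) * D.h ≤ x (Fin.last n) ∧
        x (Fin.last n) < -P.H + (k.val : ℝ) * D.h + D.h :=
      exists_grid hh h2.1 (by rw [D.M_mul_h]; linarith [h2.2])
    choose k hk using a1
    refine ⟨(k, m), fun i => ?_⟩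
    refine Fin.lastCases ?_ (fun j => ?_) i
    · rw [corner_last]; exact hm
    · rw [corner_castSucc]; exact hk j

theorem iUnion_box_ae_eq : (⋃ K, D.box K : Set (Space n)) =ᵐ[volume] P.Omega := by
  rw [iUnion_box_eq, omega_eq_Icc, volume_pi]
  exact Measure.univ_pi_Ico_ae_eq_Icc

theorem box_subset_omega (K : Cell n D.N D.M) : D.box K ⊆ P.Omega := by
  refine (Set.subset_iUnion _ K).trans ?_
  rw [iUnion_box_eq, omega_eq_Icc, ← Set.pi_univ_Icc]
  exact Set.pi_mono fun i _ => Set.Ico_subset_Icc_self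

theorem integral_omega_eq_sum {f : Space n → ℝ} (hf : ∀ K, IntegrableOn f (D.box K)) :
    ∫ x in P.Omega, f x = ∑ K, ∫ x in D.box K, f x := by
  rw [← setIntegral_congr_set (iUnion_box_ae_eq (D := D)),
    integral_iUnion_fintype measurableSet_box pairwise_disjoint_box hf]

theorem pw_eq {v : Cell n D.N D.M → ℝ} {K : Cell n D.N D.M} {x : Space n} (hx : x ∈ D.box K) :
    D.pw v x = v K := by
  unfold Discretization.pw
  rw [Finset.sum_eq_single K]
  · simp [hx]
  · intro K' _ hne
    exact Set.indicator_of_notMem (fun h => hne (cell_eq_of_mem_box h hx)) _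
  · simp

theorem pw_of_notMem {v : Cell n D.N D.M → ℝ} {x : Space n} (hx : ∀ K, x ∉ D.box K) :
    D.pw v x = 0 :=
  Finset.sum_eq_zero fun K _ => Set.indicator_of_notMem (hx K) _

theorem measurable_pw (v : Cell n D.N D.M → ℝ) : Measurable (D.pw v) :=
  Finset.measurable_fun_sum _ fun K _ => measurable_const.indicator (measurableSet_box K)

theorem gradE_eq_of_halfUp {b : BdryData n D.N} {v : Cell n D.N D.M → ℝ} {i : Fin (n + 1)}
    {K : Cell n D.N D.M} {x : Space n} (hx : x ∈ D.halfUp i K) :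
    D.gradE b v i x = dfaceUp D.h b v i K := by
  unfold Discretization.gradE
  rw [Finset.sum_eq_single K]
  · rw [Set.indicator_of_mem hx, Set.indicator_of_notMem, add_zero]
    exact Set.disjoint_left.1 (disjoint_halfUp_halfDown i K) hx
  · intro K' _ hne
    rw [Set.indicator_of_notMem (fun h => hne (cell_eq_of_mem_box h.1 hx.1)),
      Set.indicator_of_notMem (fun h => hne (cell_eq_of_mem_box h.1 hx.1)), add_zero]
  · simp

theorem gradE_eq_of_halfDown {b : BdryData n D.N} {v : Cell n D.N D.M → ℝ} {i : Fin (n + 1)}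
    {K : Cell n D.N D.M} {x : Space n} (hx : x ∈ D.halfDown i K) :
    D.gradE b v i x = dfaceDown D.h b v i K := by
  unfold Discretization.gradE
  rw [Finset.sum_eq_single K]
  · rw [Set.indicator_of_mem hx, Set.indicator_of_notMem, zero_add]
    exact Set.disjoint_right.1 (disjoint_halfUp_halfDown i K) hx
  · intro K' _ hne
    rw [Set.indicator_of_notMem (fun h => hne (cell_eq_of_mem_box h.1 hx.1)),
      Set.indicator_of_notMem (fun h => hne (cell_eq_of_mem_box h.1 hx.1)), add_zero]
  · simp

theorem volume_box_lt_top (K : Cell n D.N D.M) : volume (D.box K) < ⊤ := by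
  rw [box_eq_pi, Real.volume_pi_Ico]
  exact ENNReal.prod_lt_top fun _ _ => ENNReal.ofReal_lt_top

theorem card_cells_mul : ((Fintype.card (Cell n D.N D.M) : ℕ) : ℝ) * D.h ^ (n + 1)
    = (2 * P.L) ^ n * (2 * P.H) := by
  rw [← D.N_mul_h, ← D.M_mul_h]
  simp
  ring

theorem N_pos (D : Discretization P T) : 0 < D.N := by
  rcases Nat.eq_zero_or_pos D.N with h | h
  · have := D.N_mul_h
    rw [h] at this
    have := P.L_pos
    simp at *
    linarith
  · exact h

theorem M_pos (D : Discretization P T) : 0 < D.M := by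
  rcases Nat.eq_zero_or_pos D.M with h | h
  · have := D.M_mul_h
    rw [h] at this
    have := P.H_pos
    simp at *
    linarith
  · exact h

/-- Crossing a face shifts the cell by `h`, up to one period. -/
theorem corner_of_up {i : Fin (n + 1)} {K K' : Cell n D.N D.M} (hK : up i K = some K') :
    D.corner K' = D.corner K + Pi.single i D.h ∨ ∃ j : Fin n, i = j.castSucc ∧
      D.corner K' + Pi.single i (2 * P.L) = D.corner K + Pi.single i D.h := by
  revert hK
  refine Fin.lastCases ?_ (fun j => ?_) i
  · intro hK
    left
    simp only [up, Fin.lastCases_last] at hK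
    split_ifs at hK with h1
    simp only [Option.some.injEq] at hK
    subst hK
    funext l
    refine Fin.lastCases ?_ (fun l => ?_) l
    · simp only [corner_last, Pi.add_apply, Pi.single_eq_same]
      push_cast; ring
    · simp [corner_castSucc, Fin.castSucc_ne_last]
  · intro hK
    rw [up_castSucc] at hK
    simp only [Option.some.injEq] at hK
    subst hK
    obtain ⟨m, hm⟩ := Nat.exists_eq_succ_of_ne_zero (N_pos D).ne'
    have hNh := D.N_mul_h
    obtain ⟨a, k⟩ := K
    have hrot : ((finRotate D.N (a j)).val : ℝ) = (a j).val + 1 ∨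
        ((finRotate D.N (a j)).val : ℝ) + D.N = (a j).val + 1 := by
      have : ∀ (N : ℕ) (x : Fin N), 0 < N → ((finRotate N x).val : ℝ) = x.val + 1 ∨
          ((finRotate N x).val : ℝ) + N = x.val + 1 := by
        intro N x hN
        obtain ⟨m, rfl⟩ := Nat.exists_eq_succ_of_ne_zero hN.ne'
        rw [coe_finRotate]
        split_ifs with h
        · right; rw [h]; simp
        · left; push_cast; ring
      exact this _ _ (N_pos D)
    rcases hrot with h1 | h1
    · left
      funext l
      refine Fin.lastCases ?_ (fun l => ?_) l
      · simp [corner_last, (Fin.castSucc_ne_last j).symm]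
      · simp only [corner_castSucc, Pi.add_apply]
        by_cases hl : l = j
        · subst hl; simp only [Function.update_self, Pi.single_eq_same]; rw [h1]; ring
        · simp [hl]
    · right
      refine ⟨j, rfl, ?_⟩
      funext l
      refine Fin.lastCases ?_ (fun l => ?_) l
      · simp [corner_last, (Fin.castSucc_ne_last j).symm]
      · simp only [corner_castSucc, Pi.add_apply]
        by_cases hl : l = j
        · subst hl
          simp only [Function.update_self, Pi.single_eq_same]
          rw [← hNh]
          have : ((finRotate D.N (a l)).val + (D.N : ℝ)) * D.h = ((a l).val + 1) * D.h := by rw [h1]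
          linarith
        · simp [hl]

theorem up_last_eq_none_iff (K : Cell n D.N D.M) :
    up (Fin.last n) K = none ↔ K.2.val + 1 = D.M := by
  have := K.2.isLt
  simp only [up, Fin.lastCases_last, dite_eq_right_iff, reduceCtorEq, imp_false]
  omega

theorem down_last_eq_none_iff (K : Cell n D.N D.M) : down (Fin.last n) K = none ↔ K.2.val = 0 := by
  simp only [down, Fin.lastCases_last]
  split_ifs with h
  · simp; omega
  · simp; omega

/-- The layer of cells with a given vertical index has volume `O(h)`. -/
theorem sum_layer (k : Fin D.M) : (∑ K : Cell n D.N D.M, if K.2 = k then D.h ^ (n + 1) else 0)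
    = (2 * P.L) ^ n * D.h := by
  rw [Fintype.sum_prod_type]
  simp only [Finset.sum_ite_eq', Finset.mem_univ, if_true, Finset.sum_const, Finset.card_univ,
    Fintype.card_pi, Fintype.card_fin, Finset.prod_const, nsmul_eq_mul]
  rw [← D.N_mul_h]
  push_cast
  ring

end MeshGeometry

/-! ### Mollification of weakly differentiable functions -/

section Bumps

/-- A sequence of bump functions shrinking to `0`. -/
def bumpSeq (E : Type*) [NormedAddCommGroup E] (k : ℕ) : ContDiffBump (0 : E) where
  rIn := 1 / ((k : ℝ) + 1)
  rOut := 2 / ((k : ℝ) + 1)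
  rIn_pos := by positivity
  rIn_lt_rOut := by gcongr; norm_num

theorem tendsto_bumpSeq {E : Type*} [NormedAddCommGroup E] :
    Tendsto (fun k => (bumpSeq E k).rOut) atTop (𝓝 0) := by
  have h : Tendsto (fun k : ℕ => 2 * (1 / ((k : ℝ) + 1))) atTop (𝓝 (2 * 0)) :=
    tendsto_one_div_add_atTop_nhds_zero_nat.const_mul 2
  rw [mul_zero] at h
  refine h.congr fun k => ?_
  show _ = 2 / ((k : ℝ) + 1)
  ring

theorem convex_setOf_closedBall_subset {E : Type*} [NormedAddCommGroup E] [NormedSpace ℝ E]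
    {U : Set E} (hU : Convex ℝ U) (ε : ℝ) :
    Convex ℝ {x : E | Metric.closedBall x ε ⊆ U} := by
  intro x hx y hy a b ha hb hab z hz
  rw [Metric.mem_closedBall, dist_eq_norm] at hz
  set w := z - (a • x + b • y) with hw
  have h1 : x + w ∈ U := hx (by simpa [Metric.mem_closedBall, dist_eq_norm] using hz)
  have h2 : y + w ∈ U := hy (by simpa [Metric.mem_closedBall, dist_eq_norm] using hz)
  have h3 := hU h1 h2 ha hb hab
  have h4 : a • (x + w) + b • (y + w) = z := by
    rw [smul_add, smul_add, add_add_add_comm, ← add_smul, hab, one_smul, hw]; abel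
  rwa [h4] at h3

theorem eventually_closedBall_bumpSeq_subset {E : Type*} [NormedAddCommGroup E]
    {U : Set E} (hU : IsOpen U) {x : E} (hx : x ∈ U) :
    ∀ᶠ k in atTop, Metric.closedBall x (bumpSeq E k).rOut ⊆ U := by
  obtain ⟨ε, hε, h⟩ := Metric.isOpen_iff.1 hU x hx
  filter_upwards [(tendsto_order.1 (tendsto_bumpSeq (E := E))).2 ε hε] with k hk
  exact (Metric.closedBall_subset_ball hk).trans h

end Bumps

section Mollify

variable {E : Type*} [NormedAddCommGroup E] [NormedSpace ℝ E] [MeasureSpace E] [BorelSpace E]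
  [FiniteDimensional ℝ E] [(volume : Measure E).IsAddHaarMeasure]

/-- The mollification of `f`, extended by `0` outside `U`, by the normalised bump function `φ`. -/
def mollify (φ : ContDiffBump (0 : E)) (U : Set E) (f : E → ℝ) : E → ℝ :=
  MeasureTheory.convolution (φ.normed volume) (U.indicator f) (ContinuousLinearMap.lsmul ℝ ℝ)
    volume

theorem mollify_eq_integral (φ : ContDiffBump (0 : E)) {U : Set E} (hU : MeasurableSet U)
    (f : E → ℝ) (x : E) :
    mollify φ U f x = ∫ t in U, f t * φ.normed volume (x - t) := by
  rw [mollify, convolution_eq_swap, ← integral_indicator hU]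
  refine integral_congr_ae (Eventually.of_forall fun t => ?_)
  by_cases h : t ∈ U <;> simp [h, mul_comm]

theorem mollify_congr (φ : ContDiffBump (0 : E)) {U : Set E} (hU : MeasurableSet U)
    {f g : E → ℝ} (h : f =ᵐ[volume.restrict U] g) : mollify φ U f = mollify φ U g := by
  funext x
  rw [mollify_eq_integral φ hU, mollify_eq_integral φ hU]
  exact integral_congr_ae (h.mono fun t ht => by simp only [ht])

theorem mollify_eq_conv_right (φ : ContDiffBump (0 : E)) (U : Set E) (f : E → ℝ) :
    mollify φ U f = MeasureTheory.convolution (U.indicator f) (φ.normed volume)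
      (ContinuousLinearMap.lsmul ℝ ℝ) volume := by
  funext x
  rw [mollify, convolution_eq_swap, convolution_def]
  refine integral_congr_ae (Eventually.of_forall fun t => ?_)
  simp [mul_comm]

/-- Mollification commutes with weak derivatives away from the boundary. -/
theorem hasFDerivAt_mollify (φ : ContDiffBump (0 : E)) {U : Set E} (hU : MeasurableSet U)
    {f : E → ℝ} (hf : LocallyIntegrable (U.indicator f)) {x : E}
    (hx : Metric.closedBall x φ.rOut ⊆ U) :
    ∃ A : E →L[ℝ] ℝ, HasFDerivAt (mollify φ U f) A x ∧
      ∀ v g, HasWeakDeriv U v f g → A v = mollify φ U g x := by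
  have h1 := φ.hasCompactSupport_normed.hasFDerivAt_convolution_right
    (ContinuousLinearMap.lsmul ℝ ℝ) hf (φ.contDiff_normed (μ := volume)) x
  refine ⟨_, by rw [mollify_eq_conv_right]; exact h1, fun v g hg => ?_⟩
  rw [convolution_precompR_apply _ hf (φ.hasCompactSupport_normed.fderiv ℝ)
    ((φ.contDiff_normed (n := 1)).continuous_fderiv (by simp))]
  set ψ : E → ℝ := fun t => φ.normed volume (x - t) with hψ
  have hψd : ContDiff ℝ ∞ ψ := φ.contDiff_normed.comp (contDiff_const.sub contDiff_id)
  have hsupp : Function.support ψ ⊆ Metric.closedBall x φ.rOut := by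
    intro t ht
    have h2 : x - t ∈ Function.support (φ.normed volume) := ht
    rw [φ.support_normed_eq, mem_ball_zero_iff, ← dist_eq_norm] at h2
    rw [Metric.mem_closedBall, dist_comm]
    exact h2.le
  have htsupp : tsupport ψ ⊆ Metric.closedBall x φ.rOut :=
    closure_minimal hsupp Metric.isClosed_closedBall
  have hcs : HasCompactSupport ψ :=
    HasCompactSupport.of_support_subset_isCompact (isCompact_closedBall x φ.rOut) hsupp
  -- The reflected and translated kernel is admissible as a test function because its support lies
  -- in `U`.
  have h3 := hg.2.2 ψ hψd hcs (htsupp.trans hx)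
  have h4 : ∀ t, fderiv ℝ ψ t v = -(fderiv ℝ (φ.normed volume) (x - t) v) := by
    intro t
    have h5 : HasFDerivAt (φ.normed (volume : Measure E)) (fderiv ℝ (φ.normed volume) (x - t))
        (x - t) :=
      ((φ.contDiff_normed (n := 1)).differentiable (by simp) _).hasFDerivAt
    have h6 := h5.comp t ((hasFDerivAt_const x t).sub (hasFDerivAt_id t))
    have h7 : fderiv ℝ ψ t = _ := h6.fderiv
    rw [h7]
    simp
  simp only [h4, mul_neg, integral_neg, neg_inj] at h3
  rw [mollify_eq_integral φ hU, ← h3, convolution_def, ← integral_indicator hU]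
  refine integral_congr_ae (Eventually.of_forall fun t => ?_)
  by_cases h : t ∈ U <;> simp [h]

theorem abs_mollify_le (φ : ContDiffBump (0 : E)) {U : Set E} (hU : MeasurableSet U)
    {g : E → ℝ} {M : ℝ} (hM : 0 ≤ M) (hg : ∀ᵐ x ∂volume.restrict U, |g x| ≤ M) (x : E) :
    |mollify φ U g x| ≤ M := by
  have hint : Integrable (fun t => φ.normed (volume : Measure E) (x - t)) :=
    φ.integrable_normed.comp_sub_left x
  rw [mollify_eq_integral φ hU]
  calc |∫ t in U, g t * φ.normed volume (x - t)|
      ≤ ∫ t in U, M * φ.normed volume (x - t) := by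
        rw [← Real.norm_eq_abs]
        refine norm_integral_le_of_norm_le (hint.const_mul M).integrableOn (hg.mono fun t ht => ?_)
        rw [Real.norm_eq_abs, abs_mul,
          abs_of_nonneg (φ.nonneg_normed (μ := (volume : Measure E)) (x - t))]
        exact mul_le_mul_of_nonneg_right ht (φ.nonneg_normed (μ := (volume : Measure E)) (x - t))
    _ ≤ ∫ t, M * φ.normed volume (x - t) :=
        setIntegral_le_integral (hint.const_mul M)
          (Eventually.of_forall fun t => mul_nonneg hM
            (φ.nonneg_normed (μ := (volume : Measure E)) (x - t)))
    _ = M := by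
        rw [integral_const_mul, integral_sub_left_eq_self (fun t => φ.normed volume t) volume x,
          φ.integral_normed, mul_one]

/-- A mollified Lipschitz function is uniformly close to the function itself. -/
theorem abs_mollify_sub_le (φ : ContDiffBump (0 : E)) {U : Set E} (hU : MeasurableSet U)
    {f G : E → ℝ} (hfG : f =ᵐ[volume.restrict U] G) {N : ℝ} (hN : 0 ≤ N) (hGc : Continuous G)
    (hG : ∀ x y, |G x - G y| ≤ N * dist x y) {x : E} (hx : Metric.closedBall x φ.rOut ⊆ U) :
    |mollify φ U f x - G x| ≤ N * φ.rOut := by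
  rw [mollify_congr φ hU hfG]
  have hxU : x ∈ U := hx (Metric.mem_closedBall_self φ.rOut_pos.le)
  have := φ.dist_normed_convolution_le (μ := volume) (g := U.indicator G) (x₀ := x)
    (ε := N * φ.rOut) (hGc.aestronglyMeasurable.indicator hU) (fun y hy => by
      have hyU : y ∈ U := hx (Metric.ball_subset_closedBall hy)
      rw [Set.indicator_of_mem hyU, Set.indicator_of_mem hxU, Real.dist_eq]
      exact (hG y x).trans (mul_le_mul_of_nonneg_left (Metric.mem_ball.1 hy).le hN))
  rwa [Set.indicator_of_mem hxU, Real.dist_eq] at this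

/-- If the mollified functions have bounded gradients, then `f` has a Lipschitz representative. -/
theorem exists_lipschitz_of_mollify {U : Set E} (hU : IsOpen U) (hUc : Convex ℝ U) {f : E → ℝ}
    (hf : LocallyIntegrable (U.indicator f)) (M : NNReal)
    (hM : ∀ (φ : ContDiffBump (0 : E)) (x : E), Metric.closedBall x φ.rOut ⊆ U →
      ∃ A : E →L[ℝ] ℝ, HasFDerivAt (mollify φ U f) A x ∧ ‖A‖ ≤ M) :
    ∃ G : E → ℝ, LipschitzWith M G ∧ f =ᵐ[volume.restrict U] G := by
  have hae := ContDiffBump.ae_convolution_tendsto_right_of_locallyIntegrable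
    (φ := bumpSeq E) (l := atTop) (K := 2) (μ := volume) tendsto_bumpSeq
    (Eventually.of_forall fun k => by
      show 2 / ((k : ℝ) + 1) ≤ 2 * (1 / ((k : ℝ) + 1)); rw [mul_one_div]) hf
  set S : Set E := {x | Tendsto (fun k => mollify (bumpSeq E k) U f x) atTop
    (𝓝 (U.indicator f x))} with hS
  have hlip : LipschitzOnWith M f (S ∩ U) := by
    refine LipschitzOnWith.of_dist_le_mul fun x hx y hy => ?_
    have h1 : Tendsto (fun k => dist (mollify (bumpSeq E k) U f x) (mollify (bumpSeq E k) U f y))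
        atTop (𝓝 (dist (U.indicator f x) (U.indicator f y))) := hx.1.dist hy.1
    rw [Set.indicator_of_mem hx.2, Set.indicator_of_mem hy.2] at h1
    refine le_of_tendsto h1 ?_
    filter_upwards [eventually_closedBall_bumpSeq_subset hU hx.2,
      eventually_closedBall_bumpSeq_subset hU hy.2] with k hkx hky
    choose! A hA using hM (bumpSeq E k)
    have := (convex_setOf_closedBall_subset hUc
      (bumpSeq E k).rOut).norm_image_sub_le_of_norm_hasFDerivWithin_le
      (f := mollify (bumpSeq E k) U f) (f' := A) (C := M)
      (fun z hz => (hA z hz).1.hasFDerivWithinAt) (fun z hz => (hA z hz).2) hky hkx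
    rw [dist_eq_norm, dist_eq_norm]
    exact this
  obtain ⟨G, hG, hGf⟩ := hlip.extend_real
  refine ⟨G, hG, ?_⟩
  rw [EventuallyEq, ae_restrict_iff' hU.measurableSet]
  filter_upwards [hae] with x hx hxU
  exact hGf ⟨hx, hxU⟩

end Mollify

/-! ### Functions of class `W^{2,∞}` on the space-time slab -/

section SobolevInf

variable {n : ℕ}

theorem hasWeakDeriv_weakDeriv {E : Type*} [NormedAddCommGroup E] [NormedSpace ℝ E]
    [MeasureSpace E] {U : Set E} {v : E} {f : E → ℝ} (h : ∃ g, HasWeakDeriv U v f g) :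
    HasWeakDeriv U v f (weakDeriv U v f) := by
  unfold weakDeriv
  rw [dif_pos h]
  exact h.choose_spec

theorem isOpen_stSlab (H T : ℝ) : IsOpen (stSlab n H T) := by
  have h1 : IsOpen {z : SpaceTime n | z.1 ∈ Set.Ioo 0 T} := isOpen_Ioo.preimage continuous_fst
  have h2 : IsOpen {z : SpaceTime n | z.2 (Fin.last n) ∈ Set.Ioo (-H) H} :=
    isOpen_Ioo.preimage ((continuous_apply _).comp continuous_snd)
  exact h1.inter h2

theorem convex_stSlab (H T : ℝ) : Convex ℝ (stSlab n H T) := by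
  intro x hx y hy a b ha hb hab
  exact ⟨convex_Ioo 0 T hx.1 hy.1 ha hb hab, convex_Ioo (-H) H hx.2 hy.2 ha hb hab⟩

theorem stSlab_subset_closed (H T : ℝ) : stSlab n H T ⊆ stSlabClosed n H T := fun _ hz =>
  ⟨Set.Ioo_subset_Icc_self hz.1, Set.Ioo_subset_Icc_self hz.2⟩

/-- Contraction of the closed slab into the open one, towards its centre. -/
theorem contract_mem_stSlab {H T : ℝ} (hH : 0 < H) (hT : 0 < T) {z : SpaceTime n}
    (hz : z ∈ stSlabClosed n H T) {δ : ℝ} (hδ : δ ∈ Set.Ioc (0 : ℝ) 1) :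
    z + δ • (((T / 2, 0) : SpaceTime n) - z) ∈ stSlab n H T := by
  obtain ⟨⟨h1, h2⟩, h3, h4⟩ := hz
  obtain ⟨hδ0, hδ1⟩ := hδ
  refine ⟨⟨?_, ?_⟩, ?_, ?_⟩
  all_goals simp only [Prod.fst_add, Prod.snd_add, Prod.smul_fst, Prod.smul_snd, Prod.fst_sub,
    Prod.snd_sub, Pi.add_apply, Pi.smul_apply, Pi.sub_apply, Pi.zero_apply, smul_eq_mul]
  · nlinarith [mul_nonneg (sub_nonneg.2 hδ1) h1, mul_pos hδ0 hT]
  · nlinarith [mul_nonneg (sub_nonneg.2 hδ1) (sub_nonneg.2 h2), mul_pos hδ0 hT]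
  · nlinarith [mul_nonneg (sub_nonneg.2 hδ1) (sub_nonneg.2 h3), mul_pos hδ0 hH]
  · nlinarith [mul_nonneg (sub_nonneg.2 hδ1) (sub_nonneg.2 h4), mul_pos hδ0 hH]

theorem stSlabClosed_subset_closure {H T : ℝ} (hH : 0 < H) (hT : 0 < T) :
    stSlabClosed n H T ⊆ closure (stSlab n H T) := by
  intro z hz
  have h1 : Tendsto (fun δ : ℝ => z + δ • (((T / 2, 0) : SpaceTime n) - z)) (𝓝[>] 0) (𝓝 z) := by
    have : Continuous (fun δ : ℝ => z + δ • (((T / 2, 0) : SpaceTime n) - z)) := by fun_prop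
    have h2 := (this.tendsto 0).mono_left (nhdsWithin_le_nhds (s := Set.Ioi (0 : ℝ)))
    simpa using h2
  refine mem_closure_of_tendsto h1 ?_
  filter_upwards [Ioc_mem_nhdsGT (show (0 : ℝ) < 1 by norm_num)] with δ hδ
  exact contract_mem_stSlab hH hT hz hδ

theorem abs_le_normLInf {H T : ℝ} {f : SpaceTime n → ℝ}
    (hf : MemLp f ⊤ (volume.restrict (stSlab n H T))) :
    ∀ᵐ z ∂volume.restrict (stSlab n H T), |f z| ≤ normLInf H T f := by
  have h := ae_le_eLpNormEssSup (f := f) (μ := volume.restrict (stSlab n H T))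
  filter_upwards [h] with z hz
  rw [← eLpNorm_exponent_top] at hz
  have := ENNReal.toReal_mono hf.eLpNorm_ne_top hz
  rwa [toReal_enorm, Real.norm_eq_abs] at this

theorem normLInf_nonneg (H T : ℝ) (f : SpaceTime n → ℝ) : 0 ≤ normLInf H T f :=
  ENNReal.toReal_nonneg

theorem locallyIntegrable_indicator_of_memLp {E : Type*} [NormedAddCommGroup E]
    [MeasureSpace E] [BorelSpace E] [IsLocallyFiniteMeasure (volume : Measure E)] {U : Set E}
    (hU : MeasurableSet U) {p : ENNReal} (hp : 1 ≤ p)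
    {f : E → ℝ} (hf : MemLp f p (volume.restrict U)) : LocallyIntegrable (U.indicator f) :=
  ((memLp_indicator_iff_restrict hU).2 hf).locallyIntegrable hp

theorem eq_sum_stDir (w : SpaceTime n) :
    w = w.1 • stDir none + ∑ i, w.2 i • stDir (some i) := by
  have h1 : ∑ i, w.2 i • (stDir (some i) : SpaceTime n) = (0, w.2) := by
    refine Prod.ext ?_ ?_
    · rw [Prod.fst_sum]; simp [stDir]
    · rw [Prod.snd_sum]
      simp only [stDir, Prod.smul_snd]
      funext j
      simp [Finset.sum_apply, Pi.single_apply]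
  rw [h1]
  refine Prod.ext ?_ ?_ <;> simp [stDir]

theorem norm_stDir_le (a : Option (Fin (n + 1))) : ‖(stDir a : SpaceTime n)‖ ≤ 1 := by
  cases a with
  | none => simp [stDir, Prod.norm_def]
  | some i => simp [stDir, Prod.norm_def, Pi.norm_single]

instance : (volume : Measure (SpaceTime n)).IsAddHaarMeasure :=
  inferInstanceAs ((volume : Measure ℝ).prod (volume : Measure (Space n))).IsAddHaarMeasure

/-- A function with bounded weak derivatives has a Lipschitz representative. -/
theorem exists_lipschitz_rep {H T : ℝ} {f : SpaceTime n → ℝ}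
    (hf : MemLp f ⊤ (volume.restrict (stSlab n H T)))
    (hd : ∀ a, ∃ g, HasWeakDeriv (stSlab n H T) (stDir a) f g)
    (hdb : ∀ a, MemLp (stPartial H T a f) ⊤ (volume.restrict (stSlab n H T))) {N : ℝ}
    (hN : ∑ a, normLInf H T (stPartial H T a f) ≤ N) :
    ∃ G : SpaceTime n → ℝ, (∀ z z', |G z - G z'| ≤ N * dist z z') ∧
      f =ᵐ[volume.restrict (stSlab n H T)] G := by
  have hU := isOpen_stSlab (n := n) H T
  have hN0 : 0 ≤ N := (Finset.sum_nonneg fun a _ => normLInf_nonneg H T _).trans hN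
  obtain ⟨G, hG, hfG⟩ := exists_lipschitz_of_mollify hU (convex_stSlab H T)
    (locallyIntegrable_indicator_of_memLp hU.measurableSet le_top hf) ⟨N, hN0⟩ (by
    intro φ x hx
    obtain ⟨A, hA, hAv⟩ := hasFDerivAt_mollify φ hU.measurableSet
      (locallyIntegrable_indicator_of_memLp hU.measurableSet le_top hf) hx
    refine ⟨A, hA, A.opNorm_le_bound hN0 fun w => ?_⟩
    have hAa : ∀ a, |A (stDir a)| ≤ normLInf H T (stPartial H T a f) := fun a => by
      rw [hAv (stDir a) _ (hasWeakDeriv_weakDeriv (hd a))]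
      exact abs_mollify_le φ hU.measurableSet (normLInf_nonneg H T _)
        (abs_le_normLInf (hdb a)) x
    have h1 : |w.1| ≤ ‖w‖ := norm_fst_le w
    have h2 : ∀ i, |w.2 i| ≤ ‖w‖ := fun i => (norm_le_pi_norm w.2 i).trans (norm_snd_le w)
    conv_lhs => rw [eq_sum_stDir w]
    rw [map_add, map_sum, Real.norm_eq_abs]
    simp only [map_smul, smul_eq_mul]
    calc |w.1 * A (stDir none) + ∑ i, w.2 i * A (stDir (some i))|
        ≤ |w.1 * A (stDir none)| + ∑ i, |w.2 i * A (stDir (some i))| :=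
          (abs_add_le _ _).trans (add_le_add le_rfl (Finset.abs_sum_le_sum_abs _ _))
      _ ≤ ‖w‖ * normLInf H T (stPartial H T none f)
          + ∑ i, ‖w‖ * normLInf H T (stPartial H T (some i) f) := by
          refine add_le_add ?_ (Finset.sum_le_sum fun i _ => ?_)
          · rw [abs_mul]; exact mul_le_mul h1 (hAa _) (abs_nonneg _) (norm_nonneg _)
          · rw [abs_mul]; exact mul_le_mul (h2 i) (hAa _) (abs_nonneg _) (norm_nonneg _)
      _ = ‖w‖ * ∑ a, normLInf H T (stPartial H T a f) := by
          rw [Fintype.sum_option, mul_add, Finset.mul_sum]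
      _ ≤ ‖w‖ * N := mul_le_mul_of_nonneg_left hN (norm_nonneg _)
      _ = N * ‖w‖ := mul_comm _ _)
  exact ⟨G, fun z z' => hG.dist_le_mul z z', hfG⟩

/-- A function of class `W^{2,∞}` together with its classical counterparts: a globally Lipschitz
extension `fe` of it, and Lipschitz representatives `G` of its first weak derivatives, with all
constants bounded by `N`. -/
structure RegularRep (L H T N : ℝ) (f fe : SpaceTime n → ℝ)
    (G : Option (Fin (n + 1)) → SpaceTime n → ℝ) : Prop where
  nonneg : 0 ≤ N
  eq : ∀ z ∈ stSlabClosed n H T, fe z = f z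
  bound : ∀ z ∈ stSlabClosed n H T, |fe z| ≤ N
  lip : ∀ z z', |fe z - fe z'| ≤ N * dist z z'
  boundG : ∀ a, ∀ z ∈ stSlabClosed n H T, |G a z| ≤ N
  lipG : ∀ a z z', |G a z - G a z'| ≤ N * dist z z'
  partial_eq : ∀ a, stPartial H T a f =ᵐ[volume.restrict (stSlab n H T)] G a
  taylor : ∀ a (s : ℝ) (z : SpaceTime n), z ∈ stSlabClosed n H T →
    z + s • stDir a ∈ stSlabClosed n H T → |fe (z + s • stDir a) - fe z - s * G a z| ≤ N * s ^ 2
  periodic : ∀ z ∈ stSlabClosed n H T, ∀ i : Fin n,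
    fe (z.1, z.2 + Pi.single i.castSucc (2 * L)) = fe z

theorem continuous_of_lip {N : ℝ} {f : SpaceTime n → ℝ} (hN : 0 ≤ N)
    (h : ∀ z z', |f z - f z'| ≤ N * dist z z') : Continuous f :=
  (LipschitzWith.of_dist_le_mul (K := ⟨N, hN⟩) fun z z' => h z z').continuous

theorem abs_le_on_closed {H T M : ℝ} (hH : 0 < H) (hT : 0 < T) {f : SpaceTime n → ℝ}
    (hf : Continuous f) (h : ∀ᵐ z ∂volume.restrict (stSlab n H T), |f z| ≤ M) :
    ∀ z ∈ stSlabClosed n H T, |f z| ≤ M := by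
  have h1 : (fun z => max |f z| M) =ᵐ[volume.restrict (stSlab n H T)] fun _ => M := by
    filter_upwards [h] with z hz
    exact max_eq_right hz
  have h2 := Measure.eqOn_open_of_ae_eq h1 (isOpen_stSlab H T)
    (hf.abs.max continuous_const).continuousOn continuousOn_const
  have h3 : stSlab n H T ⊆ {z | |f z| ≤ M} := fun z hz => by
    have := h2 hz
    simp only [max_eq_right_iff] at this
    exact this
  have h4 : IsClosed {z | |f z| ≤ M} := isClosed_le hf.abs continuous_const
  exact fun z hz => closure_minimal h3 h4 (stSlabClosed_subset_closure hH hT hz)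

/-- First order Taylor expansion along the direction of a weak derivative which has a Lipschitz
representative: it holds for the mollified functions, hence in the limit. -/
theorem taylor_on_open {H T N : ℝ} (hN : 0 ≤ N) {f fe g G : SpaceTime n → ℝ}
    {v : SpaceTime n} (hv : ‖v‖ ≤ 1) (hf : LocallyIntegrable ((stSlab n H T).indicator f))
    (hfe : f =ᵐ[volume.restrict (stSlab n H T)] fe) (hlip : ∀ z z', |fe z - fe z'| ≤ N * dist z z')
    (hg : HasWeakDeriv (stSlab n H T) v f g) (hgG : g =ᵐ[volume.restrict (stSlab n H T)] G)
    (hlipG : ∀ z z', |G z - G z'| ≤ N * dist z z') {z : SpaceTime n} {s : ℝ}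
    (hz : z ∈ stSlab n H T) (hzs : z + s • v ∈ stSlab n H T) :
    |fe (z + s • v) - fe z - s * G z| ≤ N * s ^ 2 := by
  have hU := isOpen_stSlab (n := n) H T
  set F : ℕ → SpaceTime n → ℝ := fun k => mollify (bumpSeq _ k) (stSlab n H T) f with hF
  set ε : ℕ → ℝ := fun k => (bumpSeq (SpaceTime n) k).rOut with hε
  have hε0 : ∀ k, 0 ≤ ε k := fun k => (bumpSeq (SpaceTime n) k).rOut_pos.le
  have hεt : Tendsto ε atTop (𝓝 0) := tendsto_bumpSeq
  -- The mean value inequality on the segment for the mollified function minus the linear map.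
  have key : ∀ᶠ k in atTop, |fe (z + s • v) - fe z - s * G z|
      ≤ (N * ε k + N * |s|) * |s| + 2 * (N * ε k) := by
    filter_upwards [eventually_closedBall_bumpSeq_subset hU hz,
      eventually_closedBall_bumpSeq_subset hU hzs] with k hk1 hk2
    have hball : ∀ θ ∈ Set.Icc (0 : ℝ) 1,
        Metric.closedBall (z + θ • (s • v)) (bumpSeq (SpaceTime n) k).rOut ⊆ stSlab n H T :=
      fun θ hθ => (convex_setOf_closedBall_subset (convex_stSlab H T)
        (bumpSeq (SpaceTime n) k).rOut).add_smul_mem hk1 hk2 hθ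
    have hder : ∀ θ ∈ Set.Icc (0 : ℝ) 1, HasDerivWithinAt
        (fun θ : ℝ => F k (z + θ • (s • v)) - θ * (s * G z))
        (s * (mollify (bumpSeq _ k) (stSlab n H T) g (z + θ • (s • v)) - G z))
        (Set.Icc 0 1) θ := by
      intro θ hθ
      obtain ⟨A, hA, hAv⟩ := hasFDerivAt_mollify (bumpSeq _ k) hU.measurableSet hf (hball θ hθ)
      have h1 : HasDerivAt (fun θ : ℝ => z + θ • (s • v)) (s • v) θ := by
        simpa using ((hasDerivAt_id θ).smul_const (s • v)).const_add z
      have h2 := hA.comp_hasDerivAt θ h1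
      have h3 : A (s • v) = s * mollify (bumpSeq _ k) (stSlab n H T) g (z + θ • (s • v)) := by
        rw [map_smul, hAv v g hg, smul_eq_mul]
      rw [h3] at h2
      have h4 := h2.sub ((hasDerivAt_id θ).mul_const (s * G z))
      rw [one_mul, ← mul_sub] at h4
      exact h4.hasDerivWithinAt
    have hbd : ∀ θ ∈ Set.Icc (0 : ℝ) 1,
        ‖s * (mollify (bumpSeq _ k) (stSlab n H T) g (z + θ • (s • v)) - G z)‖
          ≤ (N * ε k + N * |s|) * |s| := by
      intro θ hθ
      rw [norm_mul, Real.norm_eq_abs, Real.norm_eq_abs, mul_comm]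
      refine mul_le_mul_of_nonneg_right ?_ (abs_nonneg s)
      have e1 := abs_mollify_sub_le (bumpSeq _ k) hU.measurableSet hgG hN
        (continuous_of_lip hN hlipG) hlipG (hball θ hθ)
      have e2 := hlipG (z + θ • (s • v)) z
      have e3 : dist (z + θ • (s • v)) z ≤ |s| := by
        rw [dist_eq_norm, add_sub_cancel_left, norm_smul, norm_smul, Real.norm_eq_abs,
          Real.norm_eq_abs, abs_of_nonneg hθ.1]
        calc θ * (|s| * ‖v‖) ≤ 1 * (|s| * 1) := by
              gcongr
              exact hθ.2
          _ = |s| := by ring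
      have e4 := abs_sub_le (mollify (bumpSeq _ k) (stSlab n H T) g (z + θ • (s • v)))
        (G (z + θ • (s • v))) (G z)
      have e5 := e2.trans (mul_le_mul_of_nonneg_left e3 hN)
      linarith
    have hmv := (convex_Icc (0 : ℝ) 1).norm_image_sub_le_of_norm_hasDerivWithin_le hder hbd
      (Set.left_mem_Icc.2 zero_le_one) (Set.right_mem_Icc.2 zero_le_one)
    rw [sub_zero, norm_one, mul_one, Real.norm_eq_abs] at hmv
    simp only [one_smul, zero_smul, add_zero, one_mul, zero_mul, sub_zero] at hmv
    have e1 := abs_mollify_sub_le (bumpSeq _ k) hU.measurableSet hfe hN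
      (continuous_of_lip hN hlip) hlip hk1
    have e2 := abs_mollify_sub_le (bumpSeq _ k) hU.measurableSet hfe hN
      (continuous_of_lip hN hlip) hlip hk2
    have e3 : fe (z + s • v) - fe z - s * G z = (F k (z + s • v) - s * G z - F k z)
        - (F k (z + s • v) - fe (z + s • v)) + (F k z - fe z) := by ring
    rw [e3]
    calc _ ≤ |(F k (z + s • v) - s * G z - F k z) - (F k (z + s • v) - fe (z + s • v))|
          + |F k z - fe z| := abs_add_le _ _
      _ ≤ |F k (z + s • v) - s * G z - F k z| + |F k (z + s • v) - fe (z + s • v)|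
          + |F k z - fe z| := add_le_add (abs_sub _ _) le_rfl
      _ ≤ _ := by linarith
  have hlim : Tendsto (fun k => (N * ε k + N * |s|) * |s| + 2 * (N * ε k)) atTop
      (𝓝 ((N * 0 + N * |s|) * |s| + 2 * (N * 0))) :=
    (((hεt.const_mul N).add_const _).mul_const _).add ((hεt.const_mul N).const_mul 2)
  have := ge_of_tendsto hlim key
  calc _ ≤ _ := this
    _ = N * |s| ^ 2 := by ring
    _ = N * s ^ 2 := by rw [sq_abs]

/-- Functions in `W^{2,∞}` are `C^{1,1}`, with constants bounded by their norm. -/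
theorem MemW2Inf.exists_regularRep {L H T : ℝ} (hH : 0 < H) (hT : 0 < T) {f : SpaceTime n → ℝ}
    (hf : MemW2Inf L H T f) : ∃ fe G, RegularRep L H T (normW2Inf H T f) f fe G := by
  set N := normW2Inf H T f with hNdef
  have hn0 : ∀ g : SpaceTime n → ℝ, 0 ≤ normLInf H T g := normLInf_nonneg H T
  have s1 : 0 ≤ ∑ a, normLInf H T (stPartial H T a f) := Finset.sum_nonneg fun a _ => hn0 _
  have s2 : 0 ≤ ∑ a, ∑ b, normLInf H T (stPartial H T b (stPartial H T a f)) :=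
    Finset.sum_nonneg fun a _ => Finset.sum_nonneg fun b _ => hn0 _
  have hNe : N = normLInf H T f + (∑ a, normLInf H T (stPartial H T a f)) +
    ∑ a, ∑ b, normLInf H T (stPartial H T b (stPartial H T a f)) := rfl
  have hN0 : 0 ≤ N := hNe ▸ add_nonneg (add_nonneg (hn0 f) s1) s2
  have hN1 : normLInf H T f ≤ N :=
    hNe ▸ (le_add_of_nonneg_right s1).trans (le_add_of_nonneg_right s2)
  have hN2 : ∑ a, normLInf H T (stPartial H T a f) ≤ N :=
    hNe ▸ (le_add_of_nonneg_left (hn0 f)).trans (le_add_of_nonneg_right s2)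
  have hN3 : ∀ a, normLInf H T (stPartial H T a f) ≤ N := fun a =>
    (Finset.single_le_sum (f := fun a => normLInf H T (stPartial H T a f)) (fun a _ => hn0 _)
      (Finset.mem_univ a)).trans hN2
  have hN4 : ∀ a, ∑ b, normLInf H T (stPartial H T b (stPartial H T a f)) ≤ N := fun a =>
    (Finset.single_le_sum
      (f := fun a => ∑ b, normLInf H T (stPartial H T b (stPartial H T a f)))
      (fun a _ => Finset.sum_nonneg fun b _ => hn0 _) (Finset.mem_univ a)).trans
      (hNe ▸ le_add_of_nonneg_left (add_nonneg (hn0 f) s1))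
  obtain ⟨fe, hfe, hffe⟩ := exists_lipschitz_rep hf.memLp hf.exists_deriv hf.deriv_memLp hN2
  have hG' : ∀ a, ∃ G : SpaceTime n → ℝ, (∀ z z', |G z - G z'| ≤ N * dist z z') ∧
      stPartial H T a f =ᵐ[volume.restrict (stSlab n H T)] G := fun a =>
    exists_lipschitz_rep (hf.deriv_memLp a) (hf.exists_deriv2 a) (hf.deriv2_memLp a) (hN4 a)
  choose G hGlip hGeq using hG'
  have hfec := continuous_of_lip hN0 hfe
  have heqo : Set.EqOn f fe (stSlab n H T) := Measure.eqOn_open_of_ae_eq hffe (isOpen_stSlab H T)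
    (hf.cont.mono (stSlab_subset_closed H T)) hfec.continuousOn
  have heqc : ∀ z ∈ stSlabClosed n H T, fe z = f z := fun z hz =>
    (heqo.of_subset_closure hf.cont hfec.continuousOn (stSlab_subset_closed H T)
      (stSlabClosed_subset_closure hH hT) hz).symm
  have hloc := locallyIntegrable_indicator_of_memLp (isOpen_stSlab (n := n) H T).measurableSet
    le_top hf.memLp
  refine ⟨fe, G, hN0, heqc, ?_, hfe, ?_, hGlip, hGeq, ?_, ?_⟩
  · refine abs_le_on_closed hH hT hfec ?_
    filter_upwards [abs_le_normLInf hf.memLp, hffe] with z h1 h2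
    rw [← h2]; exact h1.trans hN1
  · intro a
    refine abs_le_on_closed hH hT (continuous_of_lip hN0 (hGlip a)) ?_
    filter_upwards [abs_le_normLInf (hf.deriv_memLp a), hGeq a] with z h1 h2
    rw [← h2]; exact h1.trans (hN3 a)
  · intro a s z hz hzs
    -- Contract both points into the open slab and pass to the limit.
    set c : SpaceTime n := (T / 2, 0) with hc
    have hop : ∀ δ ∈ Set.Ioc (0 : ℝ) 1,
        |fe (z + δ • (c - z) + ((1 - δ) * s) • stDir a) - fe (z + δ • (c - z))
          - ((1 - δ) * s) * G a (z + δ • (c - z))| ≤ N * ((1 - δ) * s) ^ 2 := by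
      intro δ hδ
      refine taylor_on_open hN0 (norm_stDir_le a) hloc hffe hfe
        (hasWeakDeriv_weakDeriv (hf.exists_deriv a)) (hGeq a) (hGlip a)
        (contract_mem_stSlab hH hT hz hδ) ?_
      have := contract_mem_stSlab hH hT hzs hδ
      have e : z + s • stDir a + δ • (((T / 2, 0) : SpaceTime n) - (z + s • stDir a))
          = z + δ • (c - z) + ((1 - δ) * s) • stDir a := by
        rw [hc]; module
      rwa [e] at this
    have hGc := continuous_of_lip hN0 (hGlip a)
    have hcl : Continuous fun δ : ℝ => |fe (z + δ • (c - z) + ((1 - δ) * s) • stDir a)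
        - fe (z + δ • (c - z)) - ((1 - δ) * s) * G a (z + δ • (c - z))| := by fun_prop
    have hcr : Continuous fun δ : ℝ => N * ((1 - δ) * s) ^ 2 := by fun_prop
    have hl := (hcl.tendsto 0).mono_left (nhdsWithin_le_nhds (s := Set.Ioi (0 : ℝ)))
    have hr := (hcr.tendsto 0).mono_left (nhdsWithin_le_nhds (s := Set.Ioi (0 : ℝ)))
    have := le_of_tendsto_of_tendsto hl hr (by
      filter_upwards [Ioc_mem_nhdsGT (show (0 : ℝ) < 1 by norm_num)] with δ hδ using hop δ hδ)
    simpa using this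
  · intro z hz i
    have hz' : ((z.1, z.2 + Pi.single i.castSucc (2 * L)) : SpaceTime n) ∈ stSlabClosed n H T := by
      refine ⟨hz.1, ?_⟩
      simpa [Pi.single_apply, (Fin.castSucc_ne_last i).symm] using hz.2
    rw [heqc _ hz', heqc z hz, hf.periodic z hz i]

end SobolevInf

/-! ### Functions of class `W^{1,2}` in time -/

section SobolevTime

variable {T : ℝ} {ψ : ℝ → ℝ}

theorem MemW12.intervalIntegrable (hT : 0 < T) (hψ : MemW12 T ψ) :
    IntervalIntegrable (weakDeriv (Set.Ioo 0 T) 1 ψ) volume 0 T := by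
  rw [intervalIntegrable_iff_integrableOn_Ioo_of_le hT.le]
  exact hψ.deriv_memLp.integrable (by norm_num)

/-- A function of class `W^{1,2}` is the primitive of its weak derivative. -/
theorem MemW12.eq_integral (hT : 0 < T) (hψ : MemW12 T ψ) :
    ∀ t ∈ Set.Icc 0 T, ψ t = ψ 0 + ∫ τ in (0 : ℝ)..t, weakDeriv (Set.Ioo 0 T) 1 ψ τ := by
  set g := weakDeriv (Set.Ioo 0 T) 1 ψ with hg
  have hgi : IntervalIntegrable g volume 0 T := hψ.intervalIntegrable hT
  set Φ : ℝ → ℝ := fun t => ∫ τ in (0 : ℝ)..t, g τ with hΦ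
  have hΦac : AbsolutelyContinuousOnInterval Φ 0 T :=
    hgi.absolutelyContinuousOnInterval_intervalIntegral (by simp)
  have hΦc : ContinuousOn Φ (Set.Icc 0 T) := by
    have := hΦac.continuousOn
    rwa [Set.uIcc_of_le hT.le] at this
  set f : ℝ → ℝ := fun t => ψ t - Φ t with hf
  have hfc : ContinuousOn f (Set.Icc 0 T) := hψ.cont.sub hΦc
  have hint : ∀ q : ℝ → ℝ, ContinuousOn q (Set.Icc 0 T) → IntegrableOn q (Set.Ioo 0 T) :=
    fun q hq => (hq.integrableOn_Icc).mono_set Set.Ioo_subset_Icc_self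
  have hw := hasWeakDeriv_weakDeriv hψ.exists_deriv
  -- The difference to the primitive of `g` has weak derivative `0`, hence is Lipschitz continuous
  -- with constant `0`.
  have hweak : HasWeakDeriv (Set.Ioo 0 T) 1 f 0 := by
    refine ⟨(hint f hfc).locallyIntegrableOn, (integrableOn_zero).locallyIntegrableOn, ?_⟩
    intro φ hφ hφc hφs
    have h1 := hw.2.2 φ hφ hφc hφs
    have hφd : Continuous fun x => fderiv ℝ φ x (1 : ℝ) :=
      (hφ.continuous_fderiv (by simp)).clm_apply continuous_const
    have hφac : AbsolutelyContinuousOnInterval φ 0 T :=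
      (hφ.of_le (by simp)).contDiffOn.absolutelyContinuousOnInterval
    have h2 := hΦac.integral_mul_deriv_eq_deriv_mul hφac
    have h0 : φ 0 = 0 := by
      by_contra hne
      exact absurd (hφs (subset_tsupport φ hne)).1 (lt_irrefl 0)
    have hT0 : φ T = 0 := by
      by_contra hne
      exact absurd (hφs (subset_tsupport φ hne)).2 (lt_irrefl T)
    rw [h0, hT0, mul_zero, mul_zero, sub_zero, zero_sub, intervalIntegral.integral_of_le hT.le,
      intervalIntegral.integral_of_le hT.le, integral_Ioc_eq_integral_Ioo,
      integral_Ioc_eq_integral_Ioo] at h2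
    have h3 : ∫ x in Set.Ioo 0 T, deriv Φ x * φ x = ∫ x in Set.Ioo 0 T, g x * φ x := by
      refine setIntegral_congr_ae measurableSet_Ioo ?_
      filter_upwards [hgi.ae_hasDerivAt_integral] with x hx hxI
      have hxu : x ∈ Set.uIcc 0 T := by
        rw [Set.uIcc_of_le hT.le]; exact Set.Ioo_subset_Icc_self hxI
      rw [(hx hxu 0 (by simp)).deriv]
    have h4 : ∀ x, deriv φ x = fderiv ℝ φ x 1 := fun x => fderiv_apply_one_eq_deriv.symm
    simp only [h4] at h2
    rw [h3] at h2
    have h5 : ∫ x in Set.Ioo 0 T, f x * fderiv ℝ φ x 1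
        = (∫ x in Set.Ioo 0 T, ψ x * fderiv ℝ φ x 1)
          - ∫ x in Set.Ioo 0 T, Φ x * fderiv ℝ φ x 1 := by
      rw [← integral_sub]
      · refine integral_congr_ae (Eventually.of_forall fun x => ?_)
        simp only [hf]; ring
      · exact hint _ (hψ.cont.mul hφd.continuousOn)
      · exact hint _ (hΦc.mul hφd.continuousOn)
    rw [h5, h1, h2]
    simp [hg]
  obtain ⟨G, hG, hfG⟩ := exists_lipschitz_of_mollify (E := ℝ) isOpen_Ioo (convex_Ioo 0 T)
    (f := f) ((hint f hfc).integrable_indicator measurableSet_Ioo).locallyIntegrable 0 (by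
    intro φ x hx
    obtain ⟨A, hA, hAv⟩ := hasFDerivAt_mollify φ measurableSet_Ioo
      ((hint f hfc).integrable_indicator measurableSet_Ioo).locallyIntegrable hx
    refine ⟨A, hA, A.opNorm_le_bound le_rfl fun w => ?_⟩
    have h1 := hAv 1 0 hweak
    rw [mollify_eq_integral φ measurableSet_Ioo] at h1
    have h2 : A w = w * A 1 := by
      rw [← smul_eq_mul, ← map_smul, smul_eq_mul, mul_one]
    rw [h2, h1]
    simp)
  have hconst : ∀ x, G x = G 0 := fun x => by
    have := hG.dist_le_mul x 0
    simpa using this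
  have heq : Set.EqOn f (fun _ => G 0) (Set.Ioo 0 T) :=
    Measure.eqOn_open_of_ae_eq (hfG.trans (Eventually.of_forall hconst)) isOpen_Ioo
      (hfc.mono Set.Ioo_subset_Icc_self) continuousOn_const
  have heqc : Set.EqOn f (fun _ => G 0) (Set.Icc 0 T) :=
    heq.of_subset_closure hfc continuousOn_const Set.Ioo_subset_Icc_self
      (by rw [closure_Ioo hT.ne])
  intro t ht
  have e1 := heqc ht
  have e2 := heqc (Set.left_mem_Icc.2 hT.le)
  simp only [hf, hΦ, intervalIntegral.integral_same, sub_zero] at e1 e2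
  linarith

end SobolevTime

/-! ### Cell and face averages of regular functions -/

section Averages

theorem abs_avg_sub_le {X : Type*} [MeasureSpace X] {s : Set X} {V δ c : ℝ}
    (hV : 0 < V) (hsV : volume.real s = V) {f : X → ℝ} (hf : IntegrableOn f s)
    (h : ∀ x ∈ s, |f x - c| ≤ δ) : |V⁻¹ * (∫ x in s, f x) - c| ≤ δ := by
  have hfin : volume s ≠ ⊤ := by
    intro htop
    rw [measureReal_def, htop, ENNReal.toReal_top] at hsV
    exact hV.ne hsV
  have h1 : ∫ x in s, (f x - c) = (∫ x in s, f x) - V * c := by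
    rw [integral_sub hf (integrableOn_const hfin), setIntegral_const, hsV, smul_eq_mul]
  have h2 : |∫ x in s, (f x - c)| ≤ δ * V := by
    rw [← hsV, ← Real.norm_eq_abs]
    exact norm_setIntegral_le_of_norm_le_const (f := fun x => f x - c) hfin.lt_top
      fun x hx => by rw [Real.norm_eq_abs]; exact h x hx
  have h3 : V⁻¹ * (∫ x in s, f x) - c = V⁻¹ * ∫ x in s, (f x - c) := by
    rw [h1]; field_simp
  rw [h3, abs_mul, abs_of_pos (inv_pos.2 hV)]
  calc V⁻¹ * |∫ x in s, (f x - c)| ≤ V⁻¹ * (δ * V) :=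
        mul_le_mul_of_nonneg_left h2 (inv_pos.2 hV).le
    _ = δ := by field_simp

variable {n : ℕ} {P : Model n} {T : ℝ} {D : Discretization P T}

theorem mem_closed_of_mem_box {t : ℝ} (ht : t ∈ Set.Icc 0 T) {K : Cell n D.N D.M} {x : Space n}
    (hx : x ∈ D.box K) : (t, x) ∈ stSlabClosed n P.H T :=
  ⟨ht, (box_subset_omega K hx).2⟩

theorem dist_le_of_mem_box {K : Cell n D.N D.M} {x y : Space n} (hx : x ∈ D.box K)
    (hy : y ∈ D.box K) : dist x y ≤ D.h := by
  refine (dist_pi_le_iff D.h_pos.le).2 fun i => ?_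
  rw [Real.dist_eq, abs_le]
  constructor <;> linarith [(hx i).1, (hx i).2, (hy i).1, (hy i).2]

theorem integrableOn_box_of_continuous {f : Space n → ℝ} (hf : Continuous f)
    (K : Cell n D.N D.M) : IntegrableOn f (D.box K) := by
  have h : D.box K ⊆ Set.Icc (D.corner K) (fun i => D.corner K i + D.h) := fun x hx =>
    ⟨fun i => (hx i).1, fun i => (hx i).2.le⟩
  exact (hf.continuousOn.integrableOn_compact isCompact_Icc).mono_set h

theorem mem_box_add_iff {K K' : Cell n D.N D.M} {q : Space n}
    (hq : D.corner K' = D.corner K + q) (x : Space n) : x + q ∈ D.box K' ↔ x ∈ D.box K := by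
  simp only [Discretization.box, Set.mem_ofPred_eq, hq, Pi.add_apply]
  refine forall_congr' fun i => ?_
  constructor <;> rintro ⟨h1, h2⟩ <;> constructor <;> linarith

theorem integral_box_add {K K' : Cell n D.N D.M} {q : Space n}
    (hq : D.corner K' = D.corner K + q) (f : Space n → ℝ) :
    ∫ x in D.box K, f (x + q) = ∫ x in D.box K', f x := by
  have h1 : (fun x => x + q) ⁻¹' D.box K' = D.box K := by
    ext x; exact mem_box_add_iff hq x
  rw [← h1]
  exact (measurePreserving_add_right volume q).setIntegral_preimage_emb
    (measurableEmbedding_addRight q) f _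

/-- The shift across an interior face, up to a period `p` which a function on the periodic slab
does not see. -/
theorem exists_shift_of_up {L N : ℝ} {f fe : SpaceTime n → ℝ}
    {G : Option (Fin (n + 1)) → SpaceTime n → ℝ} (hLP : L = P.L)
    (hf : RegularRep L P.H T N f fe G) {i : Fin (n + 1)} {K K' : Cell n D.N D.M}
    (hK : up i K = some K') : ∃ q p : Space n, D.corner K' = D.corner K + q ∧
      Pi.single i D.h = q + p ∧
      ∀ (t : ℝ) (x : Space n), (t, x) ∈ stSlabClosed n P.H T →
        (t, x + p) ∈ stSlabClosed n P.H T ∧ (t, x - p) ∈ stSlabClosed n P.H T ∧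
        fe (t, x + p) = fe (t, x) ∧ fe (t, x - p) = fe (t, x) := by
  rcases corner_of_up hK with h | ⟨j, rfl, h⟩
  · exact ⟨Pi.single i D.h, 0, h, by simp, fun t x hx => by simp [hx]⟩
  · refine ⟨Pi.single j.castSucc D.h - Pi.single j.castSucc (2 * P.L),
      Pi.single j.castSucc (2 * P.L), ?_, by simp, fun t x hx => ?_⟩
    · rw [← add_sub_assoc, ← h]; simp
    · have h1 : (t, x + Pi.single j.castSucc (2 * P.L)) ∈ stSlabClosed n P.H T := by
        refine ⟨hx.1, ?_⟩
        simpa [Pi.single_apply, (Fin.castSucc_ne_last j).symm] using hx.2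
      have h2 : (t, x - Pi.single j.castSucc (2 * P.L)) ∈ stSlabClosed n P.H T := by
        refine ⟨hx.1, ?_⟩
        simpa [Pi.single_apply, (Fin.castSucc_ne_last j).symm] using hx.2
      refine ⟨h1, h2, ?_, ?_⟩
      · have := hf.periodic _ hx j
        rwa [hLP] at this
      · have := hf.periodic _ h2 j
        rw [hLP] at this
        simp only [sub_add_cancel] at this
        exact this.symm

variable {N : ℝ} {f fe : SpaceTime n → ℝ} {G : Option (Fin (n + 1)) → SpaceTime n → ℝ}

theorem RegularRep.continuous (hf : RegularRep P.L P.H T N f fe G) : Continuous fe :=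
  continuous_of_lip hf.nonneg hf.lip

theorem RegularRep.continuousG (hf : RegularRep P.L P.H T N f fe G)
    (a : Option (Fin (n + 1))) : Continuous (G a) :=
  continuous_of_lip hf.nonneg (hf.lipG a)

theorem dist_prod_le {t t' δ : ℝ} {x x' : Space n} (hδ : dist x x' ≤ δ) :
    dist ((t, x) : SpaceTime n) (t', x') ≤ δ + |t - t'| := by
  rw [Prod.dist_eq, Real.dist_eq]
  have := abs_nonneg (t - t')
  have : 0 ≤ dist x x' := dist_nonneg
  exact max_le (by linarith) (by linarith)

theorem RegularRep.abs_cellAvg_sub_le (hf : RegularRep P.L P.H T N f fe G) (t t' : ℝ)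
    {K : Cell n D.N D.M} {x : Space n} (hx : x ∈ D.box K) :
    |D.cellAvg (fun x => fe (t, x)) K - fe (t', x)| ≤ N * (D.h + |t - t'|) := by
  refine abs_avg_sub_le (pow_pos D.h_pos _) (volume_box K)
    (integrableOn_box_of_continuous (hf.continuous.comp (by fun_prop)) K) fun y hy => ?_
  exact (hf.lip _ _).trans (mul_le_mul_of_nonneg_left
    (dist_prod_le (dist_le_of_mem_box hy hx)) hf.nonneg)

theorem RegularRep.abs_cellAvg_le (hf : RegularRep P.L P.H T N f fe G) {t : ℝ}
    (ht : t ∈ Set.Icc 0 T) (K : Cell n D.N D.M) : |D.cellAvg (fun x => fe (t, x)) K| ≤ N := by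
  have := abs_avg_sub_le (c := 0) (δ := N) (pow_pos D.h_pos _) (volume_box K)
    (integrableOn_box_of_continuous (f := fun x => fe (t, x)) (hf.continuous.comp (by fun_prop)) K)
    fun y hy => by rw [sub_zero]; exact hf.bound _ (mem_closed_of_mem_box ht hy)
  rwa [sub_zero] at this

theorem cellAvg_nonneg {t : ℝ}
    (ht : t ∈ Set.Icc 0 T) (h0 : ∀ z ∈ stSlabClosed n P.H T, 0 ≤ fe z) (K : Cell n D.N D.M) :
    0 ≤ D.cellAvg (fun x => fe (t, x)) K :=
  mul_nonneg (inv_nonneg.2 (pow_nonneg D.h_pos.le _))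
    (setIntegral_nonneg (measurableSet_box K) fun _ hx => h0 _ (mem_closed_of_mem_box ht hx))

theorem RegularRep.abs_cellAvg_sub_cellAvg_le (hf : RegularRep P.L P.H T N f fe G) (t t' : ℝ)
    (K : Cell n D.N D.M) :
    |D.cellAvg (fun x => fe (t, x)) K - D.cellAvg (fun x => fe (t', x)) K| ≤ N * |t - t'| := by
  have hV : 0 < D.h ^ (n + 1) := pow_pos D.h_pos _
  have hi : ∀ s, IntegrableOn (fun x => fe (s, x)) (D.box K) := fun s =>
    integrableOn_box_of_continuous (hf.continuous.comp (by fun_prop)) K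
  have := abs_avg_sub_le (c := 0) (δ := N * |t - t'|) hV (volume_box K)
    ((hi t).sub (hi t')) fun y hy => by
      rw [sub_zero]
      refine (hf.lip _ _).trans (mul_le_mul_of_nonneg_left ?_ hf.nonneg)
      have := dist_prod_le (t := t) (t' := t') (dist_self y).le
      linarith
  rw [sub_zero] at this
  simp only [Pi.sub_apply] at this
  rw [integral_sub (hi t) (hi t'), mul_sub] at this
  exact this

/-- Cell averages in adjacent cells are averages of translates over the same cell; across the
periodic boundary the translate is taken modulo the period. -/
theorem RegularRep.cellAvg_up (hf : RegularRep P.L P.H T N f fe G) {t : ℝ}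
    (ht : t ∈ Set.Icc 0 T) {i : Fin (n + 1)} {K K' : Cell n D.N D.M} (hK : up i K = some K') :
    (∀ x ∈ D.box K, (t, x + Pi.single i D.h) ∈ stSlabClosed n P.H T) ∧
    (∀ x ∈ D.box K', (t, x - Pi.single i D.h) ∈ stSlabClosed n P.H T) ∧
    D.cellAvg (fun x => fe (t, x)) K' = D.cellAvg (fun x => fe (t, x + Pi.single i D.h)) K ∧
    D.cellAvg (fun x => fe (t, x)) K = D.cellAvg (fun x => fe (t, x - Pi.single i D.h)) K' := by
  obtain ⟨q, p, hq, hqp, hp⟩ := exists_shift_of_up rfl hf hK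
  have hm1 : ∀ x ∈ D.box K, (t, x + q) ∈ stSlabClosed n P.H T := fun x hx =>
    mem_closed_of_mem_box ht ((mem_box_add_iff hq x).2 hx)
  have hm2 : ∀ x ∈ D.box K', (t, x - q) ∈ stSlabClosed n P.H T := fun x hx =>
    mem_closed_of_mem_box ht ((mem_box_add_iff hq (x - q)).1 (by rwa [sub_add_cancel]))
  have e1 : ∀ x : Space n, x + Pi.single i D.h = x + q + p := fun x => by rw [hqp, add_assoc]
  have e2 : ∀ x : Space n, x - Pi.single i D.h = x - q - p := fun x => by rw [hqp, sub_sub]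
  refine ⟨fun x hx => ?_, fun x hx => ?_, ?_, ?_⟩
  · rw [e1]; exact (hp t _ (hm1 x hx)).1
  · rw [e2]; exact (hp t _ (hm2 x hx)).2.1
  · unfold Discretization.cellAvg
    congr 1
    rw [← integral_box_add hq]
    refine setIntegral_congr_fun (measurableSet_box K) fun x hx => ?_
    simp only [e1]
    exact (hp t _ (hm1 x hx)).2.2.1.symm
  · unfold Discretization.cellAvg
    congr 1
    rw [← integral_box_add hq]
    refine setIntegral_congr_fun (measurableSet_box K) fun x hx => ?_
    simp only [e2, add_sub_cancel_right]
    exact (hp t _ (mem_closed_of_mem_box ht hx)).2.2.2.symm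

theorem RegularRep.abs_cellAvg_jump_le (hf : RegularRep P.L P.H T N f fe G) {t : ℝ}
    (ht : t ∈ Set.Icc 0 T) {i : Fin (n + 1)} {K K' : Cell n D.N D.M} (hK : up i K = some K') :
    |D.cellAvg (fun x => fe (t, x)) K' - D.cellAvg (fun x => fe (t, x)) K| ≤ N * D.h := by
  have hV : 0 < D.h ^ (n + 1) := pow_pos D.h_pos _
  have hh := D.h_pos
  rw [(hf.cellAvg_up ht hK).2.2.1]
  have hi1 : IntegrableOn (fun x => fe (t, x + Pi.single i D.h)) (D.box K) :=
    integrableOn_box_of_continuous (hf.continuous.comp (by fun_prop)) K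
  have hi2 : IntegrableOn (fun x => fe (t, x)) (D.box K) :=
    integrableOn_box_of_continuous (hf.continuous.comp (by fun_prop)) K
  have := abs_avg_sub_le (c := 0) (δ := N * D.h) hV (volume_box K)
    (hi1.sub hi2) fun y hy => by
      rw [sub_zero]
      refine (hf.lip _ _).trans (mul_le_mul_of_nonneg_left ?_ hf.nonneg)
      rw [dist_eq_norm, Prod.mk_sub_mk, sub_self, add_sub_cancel_left, Prod.norm_def,
        Pi.norm_single, norm_zero, Real.norm_eq_abs, abs_of_pos hh]
      exact max_le hh.le le_rfl
  rw [sub_zero] at this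
  simp only [Pi.sub_apply] at this
  rw [integral_sub hi1 hi2, mul_sub] at this
  exact this

theorem prod_add_smul_stDir (t s : ℝ) (x : Space n) (i : Fin (n + 1)) :
    ((t, x) : SpaceTime n) + s • stDir (some i) = (t, x + Pi.single i s) := by
  simp only [stDir, Prod.smul_mk, smul_zero, Prod.mk_add_mk, add_zero]
  congr 2
  funext j
  simp [Pi.single_apply]

/-- The difference quotient of the cell averages across a face approximates the derivative at any
point of the two cells. -/
theorem RegularRep.abs_cellAvg_quotient_le (hf : RegularRep P.L P.H T N f fe G) {t t' : ℝ}
    (ht : t ∈ Set.Icc 0 T) {i : Fin (n + 1)} {K K' S : Cell n D.N D.M}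
    (hK : up i K = some K') (hS : S = K ∨ S = K') {x : Space n} (hx : x ∈ D.box S) :
    |G (some i) (t', x)
      - (D.cellAvg (fun x => fe (t, x)) K' - D.cellAvg (fun x => fe (t, x)) K) / D.h|
      ≤ N * (2 * D.h + |t - t'|) := by
  have hV : 0 < D.h ^ (n + 1) := pow_pos D.h_pos _
  have hh := D.h_pos
  obtain ⟨hm1, hm2, ha1, ha2⟩ := hf.cellAvg_up ht hK
  have hi0 : ∀ C : Cell n D.N D.M, IntegrableOn (fun x => fe (t, x)) (D.box C) := fun C =>
    integrableOn_box_of_continuous (hf.continuous.comp (by fun_prop)) C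
  have hi1 : IntegrableOn (fun x => fe (t, x + Pi.single i D.h)) (D.box K) :=
    integrableOn_box_of_continuous (hf.continuous.comp (by fun_prop)) K
  have hi2 : IntegrableOn (fun x => fe (t, x - Pi.single i D.h)) (D.box K') :=
    integrableOn_box_of_continuous (hf.continuous.comp (by fun_prop)) K'
  have hG : ∀ y ∈ D.box S, |G (some i) (t, y) - G (some i) (t', x)| ≤ N * (D.h + |t - t'|) :=
    fun y hy => (hf.lipG _ _ _).trans (mul_le_mul_of_nonneg_left
      (dist_prod_le (dist_le_of_mem_box hy hx)) hf.nonneg)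
  have hquot : ∀ w y : ℝ, |w - D.h * y| ≤ N * D.h ^ 2 → |w / D.h - y| ≤ N * D.h := by
    intro w y hw
    have e : w / D.h - y = (w - D.h * y) / D.h := by field_simp
    rw [e, abs_div, abs_of_pos hh, div_le_iff₀ hh]
    calc _ ≤ _ := hw
      _ = _ := by ring
  rw [abs_sub_comm]
  -- Both averages are taken over the cell which contains `x`, by a forward or backward translation.
  rcases hS with rfl | rfl
  · have := abs_avg_sub_le (c := G (some i) (t', x)) (δ := N * (2 * D.h + |t - t'|))
      hV (volume_box S) ((hi1.sub (hi0 S)).div_const D.h) fun y hy => by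
        have h1 := hf.taylor (some i) D.h (t, y) (mem_closed_of_mem_box ht hy)
          (by rw [prod_add_smul_stDir]; exact hm1 y hy)
        rw [prod_add_smul_stDir] at h1
        have h2 := hquot _ _ h1
        have h3 := hG y hy
        have h4 := abs_sub_le ((fe (t, y + Pi.single i D.h) - fe (t, y)) / D.h)
          (G (some i) (t, y)) (G (some i) (t', x))
        simp only [Pi.sub_apply]
        linarith
    simp only [Pi.sub_apply] at this
    rw [integral_div, integral_sub hi1 (hi0 S), ← mul_div_assoc, mul_sub] at this
    rw [ha1]
    exact this
  · have := abs_avg_sub_le (c := G (some i) (t', x)) (δ := N * (2 * D.h + |t - t'|))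
      hV (volume_box S) (((hi0 S).sub hi2).div_const D.h) fun y hy => by
        have e0 : y - Pi.single i D.h = y + Pi.single i (-D.h) := by
          rw [Pi.single_neg, sub_eq_add_neg]
        have h1 := hf.taylor (some i) (-D.h) (t, y) (mem_closed_of_mem_box ht hy)
          (by rw [prod_add_smul_stDir, ← e0]; exact hm2 y hy)
        rw [prod_add_smul_stDir, ← e0] at h1
        have h2 := hquot (fe (t, y) - fe (t, y - Pi.single i D.h)) (G (some i) (t, y)) (by
          rw [abs_sub_comm]
          calc _ = |fe (t, y - Pi.single i D.h) - fe (t, y) - -D.h * G (some i) (t, y)| := by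
                congr 1; ring
            _ ≤ _ := h1
            _ = _ := by ring)
        have h3 := hG y hy
        have h4 := abs_sub_le ((fe (t, y) - fe (t, y - Pi.single i D.h)) / D.h)
          (G (some i) (t, y)) (G (some i) (t', x))
        simp only [Pi.sub_apply]
        linarith
    simp only [Pi.sub_apply] at this
    rw [integral_div, integral_sub (hi0 S) hi2, ← mul_div_assoc, mul_sub] at this
    rw [ha2]
    exact this

/-- The horizontal cube below a column of cells, over which `bdryAvg` averages. -/
def faceCube (D : Discretization P T) (a : Fin n → Fin D.N) : Set (Fin n → ℝ) :=
  {y | ∀ i, -P.L + ((a i).val : ℝ) * D.h ≤ y i ∧ y i < -P.L + ((a i).val : ℝ) * D.h + D.h}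

theorem faceCube_eq_pi (a : Fin n → Fin D.N) : faceCube D a = Set.univ.pi fun i =>
    Set.Ico (-P.L + ((a i).val : ℝ) * D.h) (-P.L + ((a i).val : ℝ) * D.h + D.h) := by
  ext y; simp [faceCube, Set.mem_pi]

theorem measurableSet_faceCube (a : Fin n → Fin D.N) : MeasurableSet (faceCube D a) := by
  rw [faceCube_eq_pi]; exact MeasurableSet.univ_pi fun _ => measurableSet_Ico

theorem volume_faceCube (a : Fin n → Fin D.N) : volume.real (faceCube D a) = D.h ^ n := by
  rw [faceCube_eq_pi, volume_real_pi_Ico fun i => by linarith [D.h_pos]]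
  simp

theorem bdryAvg_eq (θB : SpaceTime n → ℝ) (t : ℝ) (s : Bool) (a : Fin n → Fin D.N) :
    D.bdryAvg θB t s a = (D.h ^ n)⁻¹ * ∫ y in faceCube D a,
      θB (t, Fin.snoc (α := fun _ => ℝ) y (if s then P.H else -P.H)) := rfl

theorem snoc_mem_closed {t : ℝ} (ht : t ∈ Set.Icc 0 T) (s : Bool) (y : Fin n → ℝ) :
    (t, (Fin.snoc (α := fun _ => ℝ) y (if s then P.H else -P.H) : Space n))
      ∈ stSlabClosed n P.H T := by
  refine ⟨ht, ?_⟩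
  have := P.H_pos
  simp only [Fin.snoc_last]
  split_ifs <;> constructor <;> linarith

theorem bdryAvg_congr {θB Θ : SpaceTime n → ℝ} {t : ℝ}
    (h : ∀ x : Space n, |x (Fin.last n)| = P.H → Θ (t, x) = θB (t, x)) :
    D.bdryAvg θB t = D.bdryAvg Θ t := by
  funext s a
  rw [bdryAvg_eq, bdryAvg_eq]
  congr 1
  refine setIntegral_congr_fun (measurableSet_faceCube a) fun y _ => ?_
  refine (h _ ?_).symm
  have := P.H_pos
  simp only [Fin.snoc_last]
  split_ifs
  · exact abs_of_pos this
  · rw [abs_neg, abs_of_pos this]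

theorem continuous_snoc (c : ℝ) :
    Continuous fun y : Fin n → ℝ => (Fin.snoc (α := fun _ => ℝ) y c : Space n) := by
  refine continuous_pi fun i => ?_
  refine Fin.lastCases ?_ (fun j => ?_) i
  · simp only [Fin.snoc_last]; exact continuous_const
  · simp only [Fin.snoc_castSucc]; exact continuous_apply j

theorem integrableOn_faceCube {f : (Fin n → ℝ) → ℝ} (hf : Continuous f) (a : Fin n → Fin D.N) :
    IntegrableOn f (faceCube D a) := by
  have h : faceCube D a ⊆ Set.Icc (fun i => -P.L + ((a i).val : ℝ) * D.h)
      (fun i => -P.L + ((a i).val : ℝ) * D.h + D.h) := fun x hx =>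
    ⟨fun i => (hx i).1, fun i => (hx i).2.le⟩
  exact (hf.continuousOn.integrableOn_compact isCompact_Icc).mono_set h

theorem RegularRep.bdryAvg_eq (hf : RegularRep P.L P.H T N f fe G) {t : ℝ}
    (ht : t ∈ Set.Icc 0 T) (s : Bool) (a : Fin n → Fin D.N) :
    D.bdryAvg f t s a = D.bdryAvg fe t s a := by
  rw [BallisticFV.bdryAvg_eq, BallisticFV.bdryAvg_eq]
  congr 1
  exact setIntegral_congr_fun (measurableSet_faceCube a) fun y _ =>
    (hf.eq _ (snoc_mem_closed ht s y)).symm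

theorem bdryAvg_nonneg {t : ℝ} (ht : t ∈ Set.Icc 0 T)
    (h0 : ∀ z ∈ stSlabClosed n P.H T, 0 ≤ fe z) (s : Bool) (a : Fin n → Fin D.N) :
    0 ≤ D.bdryAvg fe t s a := by
  rw [BallisticFV.bdryAvg_eq]
  exact mul_nonneg (inv_nonneg.2 (pow_nonneg D.h_pos.le _))
    (setIntegral_nonneg (measurableSet_faceCube a) fun y _ => h0 _ (snoc_mem_closed ht s y))

theorem RegularRep.bdryAvg_le (hf : RegularRep P.L P.H T N f fe G) {t : ℝ}
    (ht : t ∈ Set.Icc 0 T) (s : Bool) (a : Fin n → Fin D.N) : D.bdryAvg fe t s a ≤ N := by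
  rw [BallisticFV.bdryAvg_eq]
  have := abs_avg_sub_le (c := 0) (δ := N) (pow_pos D.h_pos n)
    (volume_faceCube a) (integrableOn_faceCube (f := fun y => fe (t, Fin.snoc (α := fun _ => ℝ) y
      (if s then P.H else -P.H))) (hf.continuous.comp
      (continuous_const.prodMk (continuous_snoc _))) a)
    fun y _ => by rw [sub_zero]; exact hf.bound _ (snoc_mem_closed ht s y)
  rw [sub_zero] at this
  exact (le_abs_self _).trans this

/-- The face average on the exterior face of a boundary cell is close to the values in the cell. -/
theorem RegularRep.abs_bdryAvg_sub_le (hf : RegularRep P.L P.H T N f fe G) (t t' : ℝ) (s : Bool)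
    {K : Cell n D.N D.M}
    (hK : if s then up (Fin.last n) K = none else down (Fin.last n) K = none)
    {x : Space n} (hx : x ∈ D.box K) :
    |D.bdryAvg fe t s K.1 - fe (t', x)| ≤ N * (D.h + |t - t'|) := by
  rw [BallisticFV.bdryAvg_eq]
  refine abs_avg_sub_le (pow_pos D.h_pos n) (volume_faceCube K.1)
    (integrableOn_faceCube (hf.continuous.comp (continuous_const.prodMk (continuous_snoc _))) K.1)
    fun y hy => ?_
  refine (hf.lip _ _).trans (mul_le_mul_of_nonneg_left (dist_prod_le ?_) hf.nonneg)
  refine (dist_pi_le_iff D.h_pos.le).2 fun i => ?_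
  refine Fin.lastCases ?_ (fun j => ?_) i
  · have h1 := hx (Fin.last n)
    rw [corner_last] at h1
    have h2 := D.M_mul_h
    rw [Fin.snoc_last, Real.dist_eq, abs_le]
    cases s with
    | true =>
      simp only [if_true] at hK ⊢
      rw [up_last_eq_none_iff] at hK
      have h3 : ((K.2.val : ℝ) + 1) * D.h = D.M * D.h := by
        have h4 : (K.2.val : ℝ) + 1 = D.M := by exact_mod_cast hK
        rw [h4]
      constructor <;> linarith
    | false =>
      simp only [Bool.false_eq_true, if_false] at hK ⊢
      rw [down_last_eq_none_iff] at hK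
      rw [hK] at h1
      push_cast at h1
      constructor <;> linarith
  · have h1 := hx j.castSucc
    rw [corner_castSucc] at h1
    have h2 := hy j
    rw [Fin.snoc_castSucc, Real.dist_eq, abs_le]
    constructor <;> linarith [h1.1, h1.2, h2.1, h2.2]

end Averages

/-! ### The discrete dissipation -/

section Dissipation

variable {n N M : ℕ}

/-- The contribution of the upper face of `K` in direction `i` to the volume integral over the
half of `K` adjacent to it; `E` lives on interior and `B` on exterior faces. -/
def faceUp (h : ℝ) (E : Fin (n + 1) → Cell n N M → Cell n N M → ℝ) (B : Bool → Cell n N M → ℝ)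
    (i : Fin (n + 1)) (K : Cell n N M) : ℝ :=
  match up i K with
  | some K' => E i K K' / h
  | none => 4 * B true K / h

/-- As `faceUp`, for the lower face. -/
def faceDown (h : ℝ) (E : Fin (n + 1) → Cell n N M → Cell n N M → ℝ) (B : Bool → Cell n N M → ℝ)
    (i : Fin (n + 1)) (K : Cell n N M) : ℝ :=
  match down i K with
  | some K' => E i K' K / h
  | none => 4 * B false K / h

theorem up_eq_none_iff_of_ne {i : Fin (n + 1)} (hi : i ≠ Fin.last n) (K : Cell n N M) :
    up i K ≠ none ∧ down i K ≠ none := by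
  revert hi
  refine Fin.lastCases ?_ (fun j => ?_) i
  · exact fun h => absurd rfl h
  · intro _; rw [up_castSucc, down_castSucc]; simp

/-- A sum over the faces as a sum over half cells, each with half the volume of a cell. An exterior
face carries the factor `2` of the scheme and belongs to a single half cell, whence the factor `4`
in `faceUp`. -/
theorem faces_eq {h : ℝ} (hh : h ≠ 0) (E : Fin (n + 1) → Cell n N M → Cell n N M → ℝ)
    (B : Bool → Cell n N M → ℝ) :
    intFacesInt h E + 2 * intFacesExt h B
      = ∑ K, ∑ i, h ^ (n + 1) / 2 * (faceUp h E B i K + faceDown h E B i K) := by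
  have hext : 2 * intFacesExt h B = ∑ K : Cell n N M, ∑ i,
      ((if up i K = none then 2 * h ^ n * B true K else 0)
        + (if down i K = none then 2 * h ^ n * B false K else 0)) := by
    rw [intFacesExt, Finset.mul_sum]
    refine Finset.sum_congr rfl fun K _ => ?_
    rw [Finset.sum_eq_single (Fin.last n)]
    · split_ifs <;> ring
    · intro i _ hi
      have := up_eq_none_iff_of_ne hi K
      rw [if_neg this.1, if_neg this.2, add_zero]
    · simp
  rw [intFacesInt_eq_half, hext, ← Finset.sum_add_distrib]
  refine Finset.sum_congr rfl fun K _ => ?_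
  rw [← Finset.sum_add_distrib]
  refine Finset.sum_congr rfl fun i _ => ?_
  have h1 : 1 / 2 * sumUp i (fun K K' => h ^ n * E i K K') K
      + (if up i K = none then 2 * h ^ n * B true K else 0)
      = h ^ (n + 1) / 2 * faceUp h E B i K := by
    rcases hK : up i K with _ | K'
    · rw [sumUp_none hK]; simp only [faceUp, hK, if_true]; field_simp; ring
    · rw [sumUp_some hK]; simp only [faceUp, hK, reduceCtorEq, if_false]; field_simp; ring
  have h2 : 1 / 2 * sumDown i (fun K K' => h ^ n * E i K K') K
      + (if down i K = none then 2 * h ^ n * B false K else 0)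
      = h ^ (n + 1) / 2 * faceDown h E B i K := by
    rcases hK : down i K with _ | K'
    · rw [sumDown_none hK]; simp only [faceDown, hK, if_true]; field_simp; ring
    · rw [sumDown_some hK]; simp only [faceDown, hK, reduceCtorEq, if_false]; field_simp; ring
  rw [mul_add, mul_add, ← h1, ← h2]
  ring

/-- The weighted squared jumps of all fields on the upper face of `K` in direction `i`. -/
def dissUp (P : Model n) (h : ℝ) (b : BdryData n N) (r θ : Cell n N M → ℝ)
    (u : Cell n N M → Space n) (i : Fin (n + 1)) (K : Cell n N M) : ℝ :=
  sumUp i (fun K K' => h ^ (P.alpha - 1) * jumpSq r u K K') K + dfaceUp h b θ i K ^ 2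

/-- As `dissUp`, for the lower face. -/
def dissDown (P : Model n) (h : ℝ) (b : BdryData n N) (r θ : Cell n N M → ℝ)
    (u : Cell n N M → Space n) (i : Fin (n + 1)) (K : Cell n N M) : ℝ :=
  sumDown i (fun K K' => h ^ (P.alpha - 1) * jumpSq r u K K') K + dfaceDown h b θ i K ^ 2

/-- The dissipation of one time step: numerical diffusion, heat conduction and viscosity. -/
def dissipation (P : Model n) (h : ℝ) (b : BdryData n N) (r θ : Cell n N M → ℝ)
    (u : Cell n N M → Space n) : ℝ :=
  (∑ K, ∑ i, h ^ (n + 1) / 2 * (dissUp P h b r θ u i K + dissDown P h b r θ u i K))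
    + intCells h (stressPower P h u)

theorem dfaceUp_sq_le {P : Model n} {h : ℝ} (hh : 0 < h) (b : BdryData n N)
    (r θ : Cell n N M → ℝ) (u : Cell n N M → Space n) (i : Fin (n + 1)) (K : Cell n N M) :
    dfaceUp h b θ i K ^ 2 ≤ dissUp P h b r θ u i K := by
  have : 0 ≤ sumUp i (fun K K' => h ^ (P.alpha - 1) * jumpSq r u K K') K := by
    rcases hK : up i K with _ | K'
    · rw [sumUp_none hK]
    · rw [sumUp_some hK]; exact mul_nonneg (Real.rpow_nonneg hh.le _) (jumpSq_nonneg _ _ _ _)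
  unfold dissUp
  linarith

theorem dfaceDown_sq_le {P : Model n} {h : ℝ} (hh : 0 < h) (b : BdryData n N)
    (r θ : Cell n N M → ℝ) (u : Cell n N M → Space n) (i : Fin (n + 1)) (K : Cell n N M) :
    dfaceDown h b θ i K ^ 2 ≤ dissDown P h b r θ u i K := by
  have : 0 ≤ sumDown i (fun K K' => h ^ (P.alpha - 1) * jumpSq r u K K') K := by
    rcases hK : down i K with _ | K'
    · rw [sumDown_none hK]
    · rw [sumDown_some hK]; exact mul_nonneg (Real.rpow_nonneg hh.le _) (jumpSq_nonneg _ _ _ _)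
  unfold dissDown
  linarith

theorem intCells_nonneg {h : ℝ} (hh : 0 ≤ h) {f : Cell n N M → ℝ} (hf : ∀ K, 0 ≤ f K) :
    0 ≤ intCells h f :=
  Finset.sum_nonneg fun K _ => mul_nonneg (pow_nonneg hh _) (hf K)

theorem dissUp_nonneg {P : Model n} {h : ℝ} (hh : 0 < h) (b : BdryData n N)
    (r θ : Cell n N M → ℝ) (u : Cell n N M → Space n) (i : Fin (n + 1)) (K : Cell n N M) :
    0 ≤ dissUp P h b r θ u i K := (sq_nonneg _).trans (dfaceUp_sq_le hh b r θ u i K)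

theorem dissDown_nonneg {P : Model n} {h : ℝ} (hh : 0 < h) (b : BdryData n N)
    (r θ : Cell n N M → ℝ) (u : Cell n N M → Space n) (i : Fin (n + 1)) (K : Cell n N M) :
    0 ≤ dissDown P h b r θ u i K := (sq_nonneg _).trans (dfaceDown_sq_le hh b r θ u i K)

theorem dissipation_faces_le {P : Model n} {h : ℝ} (hh : 0 < h) (b : BdryData n N)
    (r θ : Cell n N M → ℝ) (u : Cell n N M → Space n) :
    ∑ K, ∑ i, h ^ (n + 1) / 2 * (dissUp P h b r θ u i K + dissDown P h b r θ u i K)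
      ≤ dissipation P h b r θ u :=
  le_add_of_nonneg_right (intCells_nonneg hh.le fun K => stressPower_nonneg P h u K)

theorem dissipation_stress_le {P : Model n} {h : ℝ} (hh : 0 < h) (b : BdryData n N)
    (r θ : Cell n N M → ℝ) (u : Cell n N M → Space n) :
    intCells h (stressPower P h u) ≤ dissipation P h b r θ u :=
  le_add_of_nonneg_left (Finset.sum_nonneg fun K _ => Finset.sum_nonneg fun i _ =>
    mul_nonneg (by positivity) (add_nonneg (dissUp_nonneg hh ..) (dissDown_nonneg hh ..)))

theorem dissipation_nonneg {P : Model n} {h : ℝ} (hh : 0 < h) (b : BdryData n N)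
    (r θ : Cell n N M → ℝ) (u : Cell n N M → Space n) : 0 ≤ dissipation P h b r θ u :=
  (intCells_nonneg hh.le fun K => stressPower_nonneg P h u K).trans
    (dissipation_stress_le hh b r θ u)

/-- With a test function bounded away from zero which nearly matches the boundary temperature,
the ballistic energy inequality of one time step controls the dissipation. -/
theorem exists_dissipation_le (P : Model n) {Λ V B : ℝ} (hΛ : 1 ≤ Λ) (hV : 0 ≤ V) (hB : 0 ≤ B) :
    ∃ c > 0, ∃ C, 0 ≤ C ∧ ∀ {N M : ℕ} {h dt : ℝ}, 0 < h → h < 1 → 0 < dt →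
      ((Fintype.card (Cell n N M) : ℕ) : ℝ) * h ^ (n + 1) = V →
      ∀ {r₀ r θ₀ θ z : Cell n N M → ℝ} {u₀ u : Cell n N M → Space n} {b : BdryData n N}
        {gI : Cell n N M → Space n}, StepEq P h dt r₀ r θ₀ θ u₀ u b gI →
      InRange Λ r₀ θ₀ u₀ → InRange Λ r θ u → (∀ K j, |gI K j| ≤ B * h ^ (n + 1)) →
      (∀ s a, 0 ≤ b s a) → (∀ i K K', up i K = some K' → |z K' - z K| ≤ Λ * h) →
      (∀ K, up (Fin.last n) K = none → |b true K.1 - z K| ≤ Λ * h) →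
      (∀ K, down (Fin.last n) K = none → |b false K.1 - z K| ≤ Λ * h) →
      c * dissipation P h b r θ u
        ≤ C - ballisticRate P h dt r₀ r θ₀ θ u₀ u (fun K => max (z K) (2 * Λ)⁻¹) := by
  have hΛ0 : 0 < Λ := by linarith
  obtain ⟨c₁, hc₁, C₁, hC₁, H₁⟩ := exists_faceTerm_coercive P hΛ
  obtain ⟨c₂, hc₂, C₂, hC₂, H₂⟩ := exists_extTerm_coercive P hΛ
  set c := min (min c₁ c₂) ((2 * Λ)⁻¹ * Λ⁻¹) with hc
  have hc0 : 0 < c := lt_min (lt_min hc₁ hc₂) (by positivity)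
  have hcc₁ : c ≤ c₁ := (min_le_left _ _).trans (min_le_left _ _)
  have hcc₂ : c ≤ c₂ := (min_le_left _ _).trans (min_le_right _ _)
  refine ⟨c, hc0, (n + 1) * V * (C₁ + C₂) + V * ((n + 1) * (Λ * Λ * B)), by positivity, ?_⟩
  intro N M h dt hh hh1 hdt hcard r₀ r θ₀ θ z u₀ u b gI S hR₀ hR hgI hb hz hbu hbd
  set Z : Cell n N M → ℝ := fun K => max (z K) (2 * Λ)⁻¹ with hZ
  have hZm : ∀ K, (2 * Λ)⁻¹ ≤ Z K := fun K => le_max_right _ _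
  have hZ0 : ∀ K, 0 ≤ Z K := fun K => le_trans (by positivity) (hZm K)
  have hθ0 : ∀ K, 0 < θ K := fun K => pos_of_mem_range hΛ (hR.theta K)
  have hbal := S.ballistic hh hdt (fun K => pos_of_mem_range hΛ (hR₀.rho K))
    (fun K => pos_of_mem_range hΛ (hR.rho K)) (fun K => pos_of_mem_range hΛ (hR₀.theta K)) hθ0 hZ0
  set E := faceTerm P h r θ u Z with hE
  set Bx : Bool → Cell n N M → ℝ :=
    fun s K => P.kappa / h * (θ K - b s K.1) * (1 - Z K / θ K) with hBx
  have hfaces := faces_eq hh.ne' E Bx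
  have hint : ∀ i K K', up i K = some K' → h * (c * (h ^ (P.alpha - 1) * jumpSq r u K K'
      + ((θ K' - θ K) / h) ^ 2) - (C₁ + C₂)) ≤ E i K K' := by
    intro i K K' hK
    refine le_trans (mul_le_mul_of_nonneg_left ?_ hh.le) (H₁ hh hh1 hR hZm i K K'
      ((abs_max_sub_max_le_abs _ _ _).trans (hz i K K' hK)))
    have : 0 ≤ h ^ (P.alpha - 1) * jumpSq r u K K' + ((θ K' - θ K) / h) ^ 2 :=
      add_nonneg (mul_nonneg (Real.rpow_nonneg hh.le _) (jumpSq_nonneg _ _ _ _)) (sq_nonneg _)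
    nlinarith
  have hext : ∀ s K, |b s K.1 - z K| ≤ Λ * h →
      c * (2 * (b s K.1 - θ K) / h) ^ 2 - (C₁ + C₂) ≤ 4 * Bx s K / h := by
    intro s K hK
    have h1 := H₂ hh (hR.theta K) (hb s K.1) hK
    rw [le_div_iff₀ hh]
    have h2 : c * (2 * (b s K.1 - θ K) / h) ^ 2 ≤ c₂ * (2 * (b s K.1 - θ K) / h) ^ 2 :=
      mul_le_mul_of_nonneg_right hcc₂ (sq_nonneg _)
    simp only [hBx, hZ]
    nlinarith
  have hup : ∀ i K, c * dissUp P h b r θ u i K - (C₁ + C₂) ≤ faceUp h E Bx i K := by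
    intro i K
    rcases hK : up i K with _ | K'
    · obtain rfl : i = Fin.last n := by
        by_contra hi
        exact (up_eq_none_iff_of_ne hi K).1 hK
      have := hext true K (hbu K hK)
      simp only [dissUp, sumUp_none hK, faceUp, dfaceUp, hK, zero_add]
      convert this using 4
      ring
    · simp only [dissUp, sumUp_some hK, faceUp, dfaceUp, hK]
      rw [le_div_iff₀ hh, mul_comm]
      exact hint i K K' hK
  have hdown : ∀ i K, c * dissDown P h b r θ u i K - (C₁ + C₂) ≤ faceDown h E Bx i K := by
    intro i K
    rcases hK : down i K with _ | K'
    · obtain rfl : i = Fin.last n := by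
        by_contra hi
        exact (up_eq_none_iff_of_ne hi K).2 hK
      have := hext false K (hbd K hK)
      simp only [dissDown, sumDown_none hK, faceDown, dfaceDown, hK, zero_add]
      convert this using 3
      rw [← neg_sq]
      congr 1
      ring
    · simp only [dissDown, sumDown_some hK, faceDown, dfaceDown, hK]
      rw [le_div_iff₀ hh, mul_comm]
      exact hint i K' K ((up_eq_some_iff i K' K).2 hK)
  have hsum : c * (∑ K, ∑ i, h ^ (n + 1) / 2 * (dissUp P h b r θ u i K + dissDown P h b r θ u i K))
      - (n + 1) * V * (C₁ + C₂) ≤ intFacesInt h E + 2 * intFacesExt h Bx := by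
    have e : (n + 1) * V * (C₁ + C₂)
        = ∑ _K : Cell n N M, ∑ _i : Fin (n + 1), h ^ (n + 1) / 2 * (2 * (C₁ + C₂)) := by
      simp only [Finset.sum_const, Finset.card_univ, Fintype.card_fin, nsmul_eq_mul, ← hcard]
      push_cast
      ring
    rw [hfaces, e, Finset.mul_sum, ← Finset.sum_sub_distrib]
    refine Finset.sum_le_sum fun K _ => ?_
    rw [Finset.mul_sum, ← Finset.sum_sub_distrib]
    refine Finset.sum_le_sum fun i _ => ?_
    have h3 := mul_le_mul_of_nonneg_left (add_le_add (hup i K) (hdown i K))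
      (show 0 ≤ h ^ (n + 1) / 2 by positivity)
    linarith
  have hstress : c * intCells h (stressPower P h u)
      ≤ intCells h (fun K => stressPower P h u K * (Z K / θ K)) := by
    rw [← intCells_const_mul]
    refine intCells_mono hh.le fun K => ?_
    rw [mul_comm]
    refine mul_le_mul_of_nonneg_left ((min_le_right _ _).trans ?_) (stressPower_nonneg P h u K)
    rw [div_eq_mul_inv]
    exact mul_le_mul (hZm K) (inv_anti₀ (hθ0 K) (hR.theta K).2) (by positivity) (hZ0 K)
  have hg : ∑ K, ∑ j, r K * u K j * gI K j ≤ V * ((n + 1) * (Λ * Λ * B)) := by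
    have e : V * ((n + 1) * (Λ * Λ * B))
        = ∑ _K : Cell n N M, ∑ _i : Fin (n + 1), Λ * Λ * (B * h ^ (n + 1)) := by
      simp only [Finset.sum_const, Finset.card_univ, Fintype.card_fin, nsmul_eq_mul, ← hcard]
      push_cast
      ring
    rw [e]
    refine Finset.sum_le_sum fun K _ => Finset.sum_le_sum fun j _ => ?_
    refine (le_abs_self _).trans ?_
    rw [abs_mul, abs_mul]
    have hr0 := pos_of_mem_range hΛ (hR.rho K)
    exact mul_le_mul (mul_le_mul (by rw [abs_of_pos hr0]; exact (hR.rho K).2) (hR.vel K j)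
      (abs_nonneg _) hΛ0.le) (hgI K j) (abs_nonneg _) (by positivity)
  have hdiss : c * dissipation P h b r θ u
      = c * (∑ K, ∑ i, h ^ (n + 1) / 2 * (dissUp P h b r θ u i K + dissDown P h b r θ u i K))
      + c * intCells h (stressPower P h u) := by rw [dissipation]; ring
  rw [hdiss]
  linarith

/-- Summation by parts in time. -/
theorem abs_sum_mul_sub_le {m : ℕ} {Z η : ℕ → ℝ} {A B δ : ℝ} (hB : 0 ≤ B)
    (hη : ∀ k ≤ m, |η k| ≤ A) (hZ : ∀ k ≤ m, |Z k| ≤ B) (hδ : ∀ k < m, |Z (k + 1) - Z k| ≤ δ) :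
    |∑ k ∈ Finset.range m, Z (k + 1) * (η (k + 1) - η k)| ≤ 2 * A * B + m * δ * A := by
  have h1 : ∑ k ∈ Finset.range m, Z (k + 1) * (η (k + 1) - η k)
      = Z m * η m - Z 0 * η 0 - ∑ k ∈ Finset.range m, (Z (k + 1) - Z k) * η k := by
    have : ∑ k ∈ Finset.range m, (Z (k + 1) * η (k + 1) - Z k * η k) = Z m * η m - Z 0 * η 0 :=
      Finset.sum_range_sub (fun k => Z k * η k) m
    rw [← this, ← Finset.sum_sub_distrib]
    exact Finset.sum_congr rfl fun k _ => by ring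
  have h2 : |∑ k ∈ Finset.range m, (Z (k + 1) - Z k) * η k| ≤ m * (δ * A) := by
    refine (Finset.abs_sum_le_sum_abs _ _).trans ?_
    have : ∀ k ∈ Finset.range m, |(Z (k + 1) - Z k) * η k| ≤ δ * A := fun k hk => by
      rw [abs_mul]
      have hk' := Finset.mem_range.1 hk
      exact mul_le_mul (hδ k hk') (hη k hk'.le) (abs_nonneg _)
        ((abs_nonneg _).trans (hδ k hk'))
    refine (Finset.sum_le_sum this).trans ?_
    simp
  have h3 : ∀ k ≤ m, |Z k * η k| ≤ B * A := fun k hk => by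
    rw [abs_mul]
    exact mul_le_mul (hZ k hk) (hη k hk) (abs_nonneg _) hB
  have h4 := h3 m le_rfl
  have h5 := h3 0 (Nat.zero_le _)
  rw [h1]
  have h6 := abs_sub (Z m * η m - Z 0 * η 0) (∑ k ∈ Finset.range m, (Z (k + 1) - Z k) * η k)
  have h7 := abs_sub (Z m * η m) (Z 0 * η 0)
  linarith

theorem energyDensity_le {P : Model n} {Λ : ℝ} (hΛ : 1 ≤ Λ) {r θ : Cell n N M → ℝ}
    {u : Cell n N M → Space n} (hR : InRange Λ r θ u) (K : Cell n N M) :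
    |P.energyDensity (r K) (θ K) (u K)| ≤ (n + 1) * Λ ^ 3 + P.cv * Λ ^ 2 := by
  have hΛ0 : 0 < Λ := by linarith
  have hr0 := pos_of_mem_range hΛ (hR.rho K)
  have hθ0 := pos_of_mem_range hΛ (hR.theta K)
  have hs : ∑ j, u K j ^ 2 ≤ (n + 1) * Λ ^ 2 := by
    have : ∀ j ∈ Finset.univ, u K j ^ 2 ≤ Λ ^ 2 := fun j _ => by
      rw [← sq_abs]; exact pow_le_pow_left₀ (abs_nonneg _) (hR.vel K j) 2
    refine (Finset.sum_le_sum this).trans ?_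
    simp
  have hs0 : 0 ≤ ∑ j, u K j ^ 2 := Finset.sum_nonneg fun j _ => sq_nonneg _
  have hcv := P.cv_pos
  rw [Model.energyDensity, abs_of_nonneg (by positivity)]
  have h1 : r K * ∑ j, u K j ^ 2 ≤ Λ * ((n + 1) * Λ ^ 2) :=
    mul_le_mul (hR.rho K).2 hs hs0 hΛ0.le
  have h2 : r K * θ K ≤ Λ * Λ := mul_le_mul (hR.rho K).2 (hR.theta K).2 hθ0.le hΛ0.le
  have h3 : 0 ≤ r K * ∑ j, u K j ^ 2 := by positivity
  have h4 := mul_le_mul_of_nonneg_left h2 hcv.le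
  nlinarith

/-- The a priori bound of the dissipation over all time steps. -/
theorem exists_sum_dissipation_le (P : Model n) {Λ V B : ℝ} (hΛ : 1 ≤ Λ) (hV : 0 ≤ V)
    (hB : 0 ≤ B) :
    ∃ C, 0 ≤ C ∧ ∀ {N M : ℕ} {h dt : ℝ} {m : ℕ}, 0 < h → h < 1 → 0 < dt → m * dt ≤ Λ →
      ((Fintype.card (Cell n N M) : ℕ) : ℝ) * h ^ (n + 1) = V →
      ∀ {r θ z : ℕ → Cell n N M → ℝ} {u : ℕ → Cell n N M → Space n} {b : ℕ → BdryData n N}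
        {gI : Cell n N M → Space n},
      (∀ k < m, StepEq P h dt (r k) (r (k + 1)) (θ k) (θ (k + 1)) (u k) (u (k + 1)) (b (k + 1))
        gI) →
      (∀ k ≤ m, InRange Λ (r k) (θ k) (u k)) → (∀ K j, |gI K j| ≤ B * h ^ (n + 1)) →
      (∀ k ≤ m, ∀ s a, 0 ≤ b k s a) → (∀ k ≤ m, ∀ K, |z k K| ≤ Λ) →
      (∀ k < m, ∀ K, |z (k + 1) K - z k K| ≤ Λ * dt) →
      (∀ k ≤ m, ∀ i K K', up i K = some K' → |z k K' - z k K| ≤ Λ * h) →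
      (∀ k ≤ m, ∀ K, up (Fin.last n) K = none → |b k true K.1 - z k K| ≤ Λ * h) →
      (∀ k ≤ m, ∀ K, down (Fin.last n) K = none → |b k false K.1 - z k K| ≤ Λ * h) →
      ∑ k ∈ Finset.range m, dt * dissipation P h (b (k + 1)) (r (k + 1)) (θ (k + 1)) (u (k + 1))
        ≤ C := by
  have hΛ0 : 0 < Λ := by linarith
  have hcv := P.cv_pos
  obtain ⟨c, hc, C, hC, H⟩ := exists_dissipation_le P hΛ hV hB
  set A := (P.cv + 1) * Λ ^ 2 with hA
  have hA0 : 0 ≤ A := by positivity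
  set e₀ := (n + 1) * Λ ^ 3 + P.cv * Λ ^ 2 with he₀
  have he₀0 : 0 ≤ e₀ := by positivity
  refine ⟨(Λ * C + V * (2 * e₀ + (2 * A * Λ + Λ * Λ * A))) / c, by positivity, ?_⟩
  intro N M h dt m hh hh1 hdt hm hcard r θ z u b gI S hR hgI hb hzb hzt hzx hbu hbd
  rw [le_div_iff₀ hc]
  set Z : ℕ → Cell n N M → ℝ := fun k K => max (z k K) (2 * Λ)⁻¹ with hZ
  have hinv : (2 * Λ)⁻¹ ≤ Λ := by
    have : (2 * Λ)⁻¹ ≤ 1 := inv_le_one_of_one_le₀ (by linarith)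
    linarith
  have hZb : ∀ k ≤ m, ∀ K, |Z k K| ≤ Λ := fun k hk K => by
    have h1 := hzb k hk K
    have h2 : 0 < (2 * Λ)⁻¹ := by positivity
    rw [abs_of_nonneg (h2.le.trans (le_max_right _ _))]
    exact max_le ((le_abs_self _).trans h1) hinv
  have hZt : ∀ k < m, ∀ K, |Z (k + 1) K - Z k K| ≤ Λ * dt := fun k hk K =>
    (abs_max_sub_max_le_abs _ _ _).trans (hzt k hk K)
  have hstep : ∀ k ∈ Finset.range m,
      c * (dt * dissipation P h (b (k + 1)) (r (k + 1)) (θ (k + 1)) (u (k + 1)))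
      ≤ dt * C - dt * ballisticRate P h dt (r k) (r (k + 1)) (θ k) (θ (k + 1)) (u k) (u (k + 1))
          (Z (k + 1)) := by
    intro k hk
    have hk1 : k + 1 ≤ m := Finset.mem_range.1 hk
    have h1 := H hh hh1 hdt hcard (S k hk1) (hR k (by omega)) (hR (k + 1) hk1) hgI
      (hb (k + 1) hk1) (hzx (k + 1) hk1) (hbu (k + 1) hk1) (hbd (k + 1) hk1)
    have := mul_le_mul_of_nonneg_left h1 hdt.le
    linarith
  have hrate : ∀ k, dt * ballisticRate P h dt (r k) (r (k + 1)) (θ k) (θ (k + 1)) (u k) (u (k + 1))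
      (Z (k + 1)) = ∑ K, h ^ (n + 1) * ((P.energyDensity (r (k + 1) K) (θ (k + 1) K) (u (k + 1) K)
        - P.energyDensity (r k K) (θ k K) (u k K))
        - Z (k + 1) K * (r (k + 1) K * P.entropy (r (k + 1) K) (θ (k + 1) K)
          - r k K * P.entropy (r k K) (θ k K))) := by
    intro k
    rw [ballisticRate, intCells, Finset.mul_sum]
    refine Finset.sum_congr rfl fun K _ => ?_
    field_simp
  have hlow : -(V * (2 * e₀ + (2 * A * Λ + Λ * Λ * A))) ≤ ∑ k ∈ Finset.range m,
      dt * ballisticRate P h dt (r k) (r (k + 1)) (θ k) (θ (k + 1)) (u k) (u (k + 1))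
        (Z (k + 1)) := by
    simp only [hrate]
    rw [Finset.sum_comm]
    have e : -(V * (2 * e₀ + (2 * A * Λ + Λ * Λ * A)))
        = ∑ _K : Cell n N M, h ^ (n + 1) * -(2 * e₀ + (2 * A * Λ + Λ * Λ * A)) := by
      simp only [Finset.sum_const, Finset.card_univ, nsmul_eq_mul, ← hcard]
      ring
    rw [e]
    refine Finset.sum_le_sum fun K _ => ?_
    rw [← Finset.mul_sum]
    refine mul_le_mul_of_nonneg_left ?_ (by positivity)
    rw [Finset.sum_sub_distrib,
      Finset.sum_range_sub (fun k => P.energyDensity (r k K) (θ k K) (u k K)) m]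
    have h1 := abs_sum_mul_sub_le (m := m) (Z := fun k => Z k K)
      (η := fun k => r k K * P.entropy (r k K) (θ k K)) hΛ0.le
      (fun k hk => abs_mul_entropy_le P hΛ ((hR k hk).rho K) ((hR k hk).theta K))
      (fun k hk => hZb k hk K) (fun k hk => hZt k hk K)
    have h2 : (m : ℝ) * (Λ * dt) * A ≤ Λ * Λ * A := by
      have := mul_le_mul_of_nonneg_left hm (mul_nonneg hΛ0.le hA0)
      linarith
    have h3 := abs_le.1 (energyDensity_le (P := P) hΛ (hR m le_rfl) K)
    have h4 := abs_le.1 (energyDensity_le (P := P) hΛ (hR 0 (Nat.zero_le _)) K)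
    have h5 := (abs_le.1 h1).2
    linarith [h3.1, h3.2, h4.1, h4.2]
  have hfin := Finset.sum_le_sum hstep
  rw [Finset.sum_sub_distrib, ← Finset.mul_sum] at hfin
  simp only [Finset.sum_const, Finset.card_range, nsmul_eq_mul] at hfin
  have h6 : (m : ℝ) * (dt * C) ≤ Λ * C := by
    have := mul_le_mul_of_nonneg_right hm hC
    linarith
  rw [mul_comm]
  linarith

end Dissipation

/-! ### Consistency of one time step -/

section Consistency

/-- The density of conductive entropy production, entropy transport and heat flux in one
direction: `g` is the discrete temperature gradient, `τ` and `γ` are the test function and its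
derivative. -/
def Model.sideDensity {n : ℕ} (P : Model n) (r θ v χ g τ γ : ℝ) : ℝ :=
  P.kappa * τ * χ / θ ^ 2 * g ^ 2 + r * P.entropy r θ * (v * γ) - P.kappa / θ * (g * γ)

theorem abs_sideDensity_le {n : ℕ} (P : Model n) {Λ c r θ v χ g τ γ : ℝ} (hΛ : 1 ≤ Λ)
    (hr : r ∈ Set.Icc Λ⁻¹ Λ) (hθ : θ ∈ Set.Icc Λ⁻¹ Λ) (hv : |v| ≤ Λ) (hχ : 0 ≤ χ) (hχ1 : χ ≤ 1)
    (hτ : |τ| ≤ c) (hγ : |γ| ≤ c) :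
    |P.sideDensity r θ v χ g τ γ|
      ≤ (2 * P.kappa * Λ ^ 2 * c + (P.cv + 1) * Λ ^ 3 * c) * (1 + g ^ 2) := by
  have hκ := P.kappa_pos
  have hcv := P.cv_pos
  have hθ0 := pos_of_mem_range hΛ hθ
  have hc0 : 0 ≤ c := (abs_nonneg _).trans hτ
  have hΛ0 : 0 < Λ := by linarith
  have hΛ2 : Λ ≤ Λ ^ 2 := by nlinarith
  have hinv := inv_le_of_mem_range hΛ hθ
  have h1 : |P.kappa * τ * χ / θ ^ 2 * g ^ 2| ≤ P.kappa * Λ ^ 2 * c * g ^ 2 := by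
    have e : P.kappa * τ * χ / θ ^ 2 * g ^ 2 = P.kappa * (τ * (χ * (θ⁻¹ ^ 2 * g ^ 2))) := by
      field_simp
    rw [e, abs_mul, abs_of_pos hκ, abs_mul, abs_of_nonneg (show 0 ≤ χ * (θ⁻¹ ^ 2 * g ^ 2) by
      positivity)]
    have h2 : χ * (θ⁻¹ ^ 2 * g ^ 2) ≤ 1 * (Λ ^ 2 * g ^ 2) := by
      refine mul_le_mul hχ1 (mul_le_mul_of_nonneg_right ?_ (sq_nonneg _)) (by positivity)
        zero_le_one
      exact pow_le_pow_left₀ (inv_pos.2 hθ0).le hinv 2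
    calc P.kappa * (|τ| * (χ * (θ⁻¹ ^ 2 * g ^ 2))) ≤ P.kappa * (c * (1 * (Λ ^ 2 * g ^ 2))) :=
          mul_le_mul_of_nonneg_left (mul_le_mul hτ h2 (by positivity) hc0) hκ.le
      _ = _ := by ring
  have h2 : |r * P.entropy r θ * (v * γ)| ≤ (P.cv + 1) * Λ ^ 3 * c := by
    rw [abs_mul, abs_mul v]
    calc _ ≤ (P.cv + 1) * Λ ^ 2 * (Λ * c) := mul_le_mul (abs_mul_entropy_le P hΛ hr hθ)
          (mul_le_mul hv hγ (abs_nonneg _) hΛ0.le) (by positivity) (by positivity)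
      _ = _ := by ring
  have h3 : |P.kappa / θ * (g * γ)| ≤ P.kappa * Λ ^ 2 * c * (1 + g ^ 2) := by
    rw [div_eq_mul_inv, abs_mul, abs_mul g, abs_of_pos (mul_pos hκ (inv_pos.2 hθ0))]
    have hg : |g| ≤ 1 + g ^ 2 := by
      rw [← sq_abs]; nlinarith [sq_nonneg (|g| - 1), abs_nonneg g]
    calc _ ≤ P.kappa * Λ ^ 2 * ((1 + g ^ 2) * c) := mul_le_mul
          (mul_le_mul_of_nonneg_left (hinv.trans hΛ2) hκ.le)
          (mul_le_mul hg hγ (abs_nonneg _) (by positivity)) (by positivity) (by positivity)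
      _ = _ := by ring
  have h4 : (P.cv + 1) * Λ ^ 3 * c ≤ (P.cv + 1) * Λ ^ 3 * c * (1 + g ^ 2) :=
    le_mul_of_one_le_right (by positivity) (by nlinarith [sq_nonneg g])
  have h5 : P.kappa * Λ ^ 2 * c * g ^ 2 ≤ P.kappa * Λ ^ 2 * c * (1 + g ^ 2) :=
    mul_le_mul_of_nonneg_left (by linarith) (by positivity)
  unfold Model.sideDensity
  have h6 := abs_sub (P.kappa * τ * χ / θ ^ 2 * g ^ 2 + r * P.entropy r θ * (v * γ))
    (P.kappa / θ * (g * γ))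
  have h7 := abs_add_le (P.kappa * τ * χ / θ ^ 2 * g ^ 2) (r * P.entropy r θ * (v * γ))
  linarith

theorem setIntegral_le_mul {X : Type*} [MeasureSpace X] {s : Set X} (hs : MeasurableSet s)
    (hfin : volume s < ⊤) {f : X → ℝ} {a V : ℝ} (hV : volume.real s = V) (hf : IntegrableOn f s)
    (h : ∀ x ∈ s, f x ≤ a) : ∫ x in s, f x ≤ V * a := by
  have := setIntegral_mono_on hf (integrableOn_const hfin.ne (C := a)) hs h
  rwa [setIntegral_const, smul_eq_mul, hV] at this

variable {n : ℕ} {P : Model n} {T : ℝ} {D : Discretization P T}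

theorem integrableOn_halfUp {f : Space n → ℝ} (hf : Continuous f) (i : Fin (n + 1))
    (K : Cell n D.N D.M) : IntegrableOn f (D.halfUp i K) :=
  (integrableOn_box_of_continuous hf K).mono_set (halfUp_subset i K)

theorem integrableOn_halfDown {f : Space n → ℝ} (hf : Continuous f) (i : Fin (n + 1))
    (K : Cell n D.N D.M) : IntegrableOn f (D.halfDown i K) :=
  (integrableOn_box_of_continuous hf K).mono_set (halfDown_subset i K)

theorem integrableOn_box_gradE {φ : ℝ → Space n → ℝ} (hφ : ∀ g, Continuous (φ g))
    (b : BdryData n D.N) (v : Cell n D.N D.M → ℝ) (i : Fin (n + 1)) (K : Cell n D.N D.M) :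
    IntegrableOn (fun x => φ (D.gradE b v i x) x) (D.box K) := by
  rw [← halfUp_union_halfDown i K]
  refine IntegrableOn.union ?_ ?_
  · exact (integrableOn_halfUp (hφ (dfaceUp D.h b v i K)) i K).congr_fun
      (fun x hx => by simp only [gradE_eq_of_halfUp hx]) (measurableSet_halfUp i K)
  · exact (integrableOn_halfDown (hφ (dfaceDown D.h b v i K)) i K).congr_fun
      (fun x hx => by simp only [gradE_eq_of_halfDown hx]) (measurableSet_halfDown i K)

theorem integral_box_gradE {φ : ℝ → Space n → ℝ} (hφ : ∀ g, Continuous (φ g))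
    (b : BdryData n D.N) (v : Cell n D.N D.M → ℝ) (i : Fin (n + 1)) (K : Cell n D.N D.M) :
    ∫ x in D.box K, φ (D.gradE b v i x) x
      = (∫ x in D.halfUp i K, φ (dfaceUp D.h b v i K) x)
        + ∫ x in D.halfDown i K, φ (dfaceDown D.h b v i K) x := by
  rw [setIntegral_box_eq_halves i K (integrableOn_box_gradE hφ b v i K)]
  congr 1
  · exact setIntegral_congr_fun (measurableSet_halfUp i K)
      fun x hx => by simp only [gradE_eq_of_halfUp hx]
  · exact setIntegral_congr_fun (measurableSet_halfDown i K)
      fun x hx => by simp only [gradE_eq_of_halfDown hx]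

/-- The integral over `Ω` of entropy production, entropy transport and heat flux, tested with `Θ`
and with an approximation `G` of its gradient, and split into integrals over half cells. -/
def stepIntegral (D : Discretization P T) (b : BdryData n D.N) (r θ : Cell n D.N D.M → ℝ)
    (u : Cell n D.N D.M → Space n) (χ : Cell n D.N D.M → ℝ) (Θ : Space n → ℝ)
    (G : Fin (n + 1) → Space n → ℝ) : ℝ :=
  ∑ K, ((∑ i, ((∫ x in D.halfUp i K, P.sideDensity (r K) (θ K) (u K i) (χ K)
        (dfaceUp D.h b θ i K) (Θ x) (G i x))
      + ∫ x in D.halfDown i K, P.sideDensity (r K) (θ K) (u K i) (χ K)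
        (dfaceDown D.h b θ i K) (Θ x) (G i x)))
    + ∫ x in D.box K, Θ x / θ K * stressPower P D.h u K)

/-- The spatial integrals of the consistency error at a fixed time; the time derivative `Gt` of the
test function is split off. -/
theorem integral_add_integral_eq_stepIntegral (b : BdryData n D.N) (r θ : Cell n D.N D.M → ℝ)
    (u : Cell n D.N D.M → Space n) (χ : Cell n D.N D.M → ℝ) {χf Θ Gt : Space n → ℝ}
    {G : Fin (n + 1) → Space n → ℝ} (hχ : ∀ K, ∀ x ∈ D.box K, χf x = χ K) (hΘ : Continuous Θ)
    (hGt : Continuous Gt) (hG : ∀ i, Continuous (G i)) :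
    (∫ x in P.Omega, (P.kappa * Θ x * χf x / D.pw θ x ^ 2 * ∑ i, D.gradE b θ i x ^ 2
        + Θ x / D.pw θ x * D.pw (stressPower P D.h u) x))
      + ∫ x in P.Omega, (D.pw r x * P.entropy (D.pw r x) (D.pw θ x)
          * (Gt x + ∑ i, D.pw (fun K => u K i) x * G i x)
        - P.kappa / D.pw θ x * ∑ i, D.gradE b θ i x * G i x)
      = (∑ K, r K * P.entropy (r K) (θ K) * ∫ x in D.box K, Gt x)
        + stepIntegral D b r θ u χ Θ G := by
  set φ : Cell n D.N D.M → Fin (n + 1) → ℝ → Space n → ℝ := fun K i g x =>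
    P.kappa * Θ x * χ K / θ K ^ 2 * g ^ 2 with hφ
  set φ' : Cell n D.N D.M → Fin (n + 1) → ℝ → Space n → ℝ := fun K i g x =>
    r K * P.entropy (r K) (θ K) * (u K i * G i x) - P.kappa / θ K * (g * G i x) with hφ'
  have hφc : ∀ K i g, Continuous (φ K i g) := fun K i g => by
    simp only [hφ]; fun_prop
  have hφc' : ∀ K i g, Continuous (φ' K i g) := fun K i g => by
    have := hG i
    simp only [hφ']; fun_prop
  set A : Space n → ℝ := fun x => P.kappa * Θ x * χf x / D.pw θ x ^ 2 * ∑ i, D.gradE b θ i x ^ 2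
        + Θ x / D.pw θ x * D.pw (stressPower P D.h u) x with hA
  set B : Space n → ℝ := fun x => D.pw r x * P.entropy (D.pw r x) (D.pw θ x)
          * (Gt x + ∑ i, D.pw (fun K => u K i) x * G i x)
        - P.kappa / D.pw θ x * ∑ i, D.gradE b θ i x * G i x with hB
  have hAK : ∀ K, Set.EqOn (fun x => (∑ i, φ K i (D.gradE b θ i x) x)
      + Θ x / θ K * stressPower P D.h u K) A (D.box K) := fun K x hx => by
    simp only [hA, hφ, hχ K x hx, pw_eq hx, Finset.mul_sum]
  have hBK : ∀ K, Set.EqOn (fun x => (∑ i, φ' K i (D.gradE b θ i x) x)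
      + r K * P.entropy (r K) (θ K) * Gt x) B (D.box K) := fun K x hx => by
    simp only [hB, hφ', pw_eq hx, Finset.mul_sum, Finset.sum_sub_distrib, mul_add]
    ring
  have hi1 : ∀ K, IntegrableOn (fun x => ∑ i, φ K i (D.gradE b θ i x) x) (D.box K) := fun K =>
    integrable_finsetSum _ fun i _ => integrableOn_box_gradE (hφc K i) b θ i K
  have hi1' : ∀ K, IntegrableOn (fun x => ∑ i, φ' K i (D.gradE b θ i x) x) (D.box K) := fun K =>
    integrable_finsetSum _ fun i _ => integrableOn_box_gradE (hφc' K i) b θ i K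
  have hi2 : ∀ K, IntegrableOn (fun x => Θ x / θ K * stressPower P D.h u K) (D.box K) := fun K =>
    integrableOn_box_of_continuous (by fun_prop) K
  have hi2' : ∀ K, IntegrableOn (fun x => r K * P.entropy (r K) (θ K) * Gt x) (D.box K) := fun K =>
    integrableOn_box_of_continuous (by fun_prop) K
  have hiA : ∀ K, IntegrableOn A (D.box K) := fun K =>
    ((hi1 K).add (hi2 K)).congr_fun (hAK K) (measurableSet_box K)
  have hiB : ∀ K, IntegrableOn B (D.box K) := fun K =>
    ((hi1' K).add (hi2' K)).congr_fun (hBK K) (measurableSet_box K)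
  rw [integral_omega_eq_sum hiA, integral_omega_eq_sum hiB, stepIntegral, ← Finset.sum_add_distrib,
    ← Finset.sum_add_distrib]
  refine Finset.sum_congr rfl fun K _ => ?_
  rw [← setIntegral_congr_fun (measurableSet_box K) (hAK K),
    ← setIntegral_congr_fun (measurableSet_box K) (hBK K), integral_add (hi1 K) (hi2 K),
    integral_add (hi1' K) (hi2' K), integral_const_mul,
    integral_finsetSum _ fun i _ => integrableOn_box_gradE (hφc K i) b θ i K,
    integral_finsetSum _ fun i _ => integrableOn_box_gradE (hφc' K i) b θ i K]
  have hside : ∀ i, (∫ x in D.box K, φ K i (D.gradE b θ i x) x)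
      + (∫ x in D.box K, φ' K i (D.gradE b θ i x) x)
      = (∫ x in D.halfUp i K, P.sideDensity (r K) (θ K) (u K i) (χ K)
        (dfaceUp D.h b θ i K) (Θ x) (G i x))
      + ∫ x in D.halfDown i K, P.sideDensity (r K) (θ K) (u K i) (χ K)
        (dfaceDown D.h b θ i K) (Θ x) (G i x) := by
    intro i
    rw [← integral_add (integrableOn_box_gradE (hφc K i) b θ i K)
      (integrableOn_box_gradE (hφc' K i) b θ i K)]
    rw [integral_box_gradE (φ := fun g x => φ K i g x + φ' K i g x)
      (fun g => (hφc K i g).add (hφc' K i g)) b θ i K]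
    simp only [hφ, hφ', Model.sideDensity, add_sub_assoc]
  have hs := Finset.sum_congr (rfl : (Finset.univ : Finset (Fin (n + 1))) = Finset.univ)
    fun i _ => hside i
  rw [← hs, Finset.sum_add_distrib]
  ring

theorem continuous_sideDensity (r θ v χ g : ℝ) {Θ γ : Space n → ℝ} (hΘ : Continuous Θ)
    (hγ : Continuous γ) : Continuous fun x => P.sideDensity r θ v χ g (Θ x) (γ x) := by
  unfold Model.sideDensity
  fun_prop

theorem volume_halfUp_lt_top (i : Fin (n + 1)) (K : Cell n D.N D.M) : volume (D.halfUp i K) < ⊤ :=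
  (measure_mono (halfUp_subset i K)).trans_lt (volume_box_lt_top K)

theorem volume_halfDown_lt_top (i : Fin (n + 1)) (K : Cell n D.N D.M) :
    volume (D.halfDown i K) < ⊤ :=
  (measure_mono (halfDown_subset i K)).trans_lt (volume_box_lt_top K)

theorem stepIntegral_le {b : BdryData n D.N} {r θ : Cell n D.N D.M → ℝ}
    {u : Cell n D.N D.M → Space n} {χ : Cell n D.N D.M → ℝ} {Θ : Space n → ℝ}
    {G : Fin (n + 1) → Space n → ℝ} (hΘ : Continuous Θ) (hG : ∀ i, Continuous (G i))
    {aU aD : Fin (n + 1) → Cell n D.N D.M → ℝ} {aS : Cell n D.N D.M → ℝ}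
    (hU : ∀ i K, ∀ x ∈ D.halfUp i K, P.sideDensity (r K) (θ K) (u K i) (χ K)
      (dfaceUp D.h b θ i K) (Θ x) (G i x) ≤ aU i K)
    (hD : ∀ i K, ∀ x ∈ D.halfDown i K, P.sideDensity (r K) (θ K) (u K i) (χ K)
      (dfaceDown D.h b θ i K) (Θ x) (G i x) ≤ aD i K)
    (hS : ∀ K, ∀ x ∈ D.box K, Θ x / θ K * stressPower P D.h u K ≤ aS K) :
    stepIntegral D b r θ u χ Θ G
      ≤ (∑ K, ∑ i, D.h ^ (n + 1) / 2 * (aU i K + aD i K)) + intCells D.h aS := by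
  rw [stepIntegral, intCells, ← Finset.sum_add_distrib]
  refine Finset.sum_le_sum fun K _ => add_le_add (Finset.sum_le_sum fun i _ => ?_) ?_
  · rw [mul_add]
    exact add_le_add
      (setIntegral_le_mul (measurableSet_halfUp i K) (volume_halfUp_lt_top i K) (volume_halfUp i K)
        (integrableOn_halfUp (continuous_sideDensity _ _ _ _ _ hΘ (hG i)) i K) (hU i K))
      (setIntegral_le_mul (measurableSet_halfDown i K) (volume_halfDown_lt_top i K)
        (volume_halfDown i K)
        (integrableOn_halfDown (continuous_sideDensity _ _ _ _ _ hΘ (hG i)) i K) (hD i K))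
  · exact setIntegral_le_mul (measurableSet_box K) (volume_box_lt_top K) (volume_box K)
      (integrableOn_box_of_continuous (by fun_prop) K) (hS K)

theorem sideDensity_neg (r θ v χ g τ γ : ℝ) :
    P.sideDensity r θ v χ g (-τ) (-γ) = -P.sideDensity r θ v χ g τ γ := by
  unfold Model.sideDensity; ring

theorem sum_cells_directions : ∑ _K : Cell n D.N D.M, ∑ _i : Fin (n + 1), D.h ^ (n + 1)
    = (n + 1) * ((2 * P.L) ^ n * (2 * P.H)) := by
  simp only [Finset.sum_const, Finset.card_univ, Fintype.card_fin, nsmul_eq_mul,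
    ← card_cells_mul (D := D)]
  push_cast
  ring

theorem stepIntegral_neg (b : BdryData n D.N) (r θ : Cell n D.N D.M → ℝ)
    (u : Cell n D.N D.M → Space n) (χ : Cell n D.N D.M → ℝ) (Θ : Space n → ℝ)
    (G : Fin (n + 1) → Space n → ℝ) :
    stepIntegral D b r θ u χ (fun x => -Θ x) (fun i x => -G i x)
      = -stepIntegral D b r θ u χ Θ G := by
  unfold stepIntegral
  simp only [sideDensity_neg, integral_neg, neg_div, neg_mul]
  rw [← Finset.sum_neg_distrib]
  refine Finset.sum_congr rfl fun K _ => ?_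
  rw [neg_add, ← Finset.sum_neg_distrib]
  congr 1
  exact Finset.sum_congr rfl fun i _ => by ring

/-- The integrals over one time slice are controlled by the dissipation. -/
theorem exists_abs_stepIntegral_le (P : Model n) {Λ c : ℝ} (hΛ : 1 ≤ Λ) (hc : 0 ≤ c) :
    ∃ C, 0 ≤ C ∧ ∀ {T : ℝ} {D : Discretization P T} {b : BdryData n D.N}
      {r θ : Cell n D.N D.M → ℝ} {u : Cell n D.N D.M → Space n} {χ : Cell n D.N D.M → ℝ}
      {Θ : Space n → ℝ} {G : Fin (n + 1) → Space n → ℝ}, InRange Λ r θ u →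
      (∀ K, 0 ≤ χ K ∧ χ K ≤ 1) → Continuous Θ → (∀ i, Continuous (G i)) →
      (∀ K, ∀ x ∈ D.box K, |Θ x| ≤ c) → (∀ i K, ∀ x ∈ D.box K, |G i x| ≤ c) →
      |stepIntegral D b r θ u χ Θ G| ≤ C * (1 + dissipation P D.h b r θ u) := by
  have hκ := P.kappa_pos
  have hcv := P.cv_pos
  have hL := P.L_pos
  have hH := P.H_pos
  have hΛ0 : 0 < Λ := by linarith
  set C₁ := 2 * P.kappa * Λ ^ 2 * c + (P.cv + 1) * Λ ^ 3 * c with hC₁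
  have hC₁0 : 0 ≤ C₁ := by positivity
  set V := (2 * P.L) ^ n * (2 * P.H) with hV
  have hV0 : 0 ≤ V := by positivity
  refine ⟨C₁ * ((n + 1) * V) + C₁ + c * Λ, by positivity, ?_⟩
  intro T D b r θ u χ Θ G hR hχ hΘ hG hΘb hGb
  have hh := D.h_pos
  have key : ∀ {Θ : Space n → ℝ} {G : Fin (n + 1) → Space n → ℝ}, Continuous Θ →
      (∀ i, Continuous (G i)) → (∀ K, ∀ x ∈ D.box K, |Θ x| ≤ c) →
      (∀ i K, ∀ x ∈ D.box K, |G i x| ≤ c) → stepIntegral D b r θ u χ Θ G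
        ≤ (C₁ * ((n + 1) * V) + C₁ + c * Λ) * (1 + dissipation P D.h b r θ u) := by
    intro Θ G hΘ hG hΘb hGb
    have h1 := stepIntegral_le (b := b) (r := r) (θ := θ) (u := u) (χ := χ) hΘ hG
      (aU := fun i K => C₁ * (1 + dissUp P D.h b r θ u i K))
      (aD := fun i K => C₁ * (1 + dissDown P D.h b r θ u i K))
      (aS := fun K => c * Λ * stressPower P D.h u K)
      (fun i K x hx => (le_abs_self _).trans ((abs_sideDensity_le P hΛ (hR.rho K) (hR.theta K)
        (hR.vel K i) (hχ K).1 (hχ K).2 (hΘb K x hx.1) (hGb i K x hx.1)).trans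
        (mul_le_mul_of_nonneg_left (by linarith [dfaceUp_sq_le hh b r θ u i K (P := P)]) hC₁0)))
      (fun i K x hx => (le_abs_self _).trans ((abs_sideDensity_le P hΛ (hR.rho K) (hR.theta K)
        (hR.vel K i) (hχ K).1 (hχ K).2 (hΘb K x hx.1) (hGb i K x hx.1)).trans
        (mul_le_mul_of_nonneg_left (by linarith [dfaceDown_sq_le hh b r θ u i K (P := P)]) hC₁0)))
      (fun K x hx => mul_le_mul_of_nonneg_right (by
        have hθ0 := pos_of_mem_range hΛ (hR.theta K)
        rw [div_eq_mul_inv]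
        exact mul_le_mul ((le_abs_self _).trans (hΘb K x hx))
          (inv_le_of_mem_range hΛ (hR.theta K)) (inv_pos.2 hθ0).le hc)
        (stressPower_nonneg P D.h u K))
    rw [intCells_const_mul] at h1
    have h2 : ∑ K, ∑ i, D.h ^ (n + 1) / 2 * (C₁ * (1 + dissUp P D.h b r θ u i K)
        + C₁ * (1 + dissDown P D.h b r θ u i K))
        = C₁ * ((n + 1) * V) + C₁ * ∑ K, ∑ i, D.h ^ (n + 1) / 2 *
          (dissUp P D.h b r θ u i K + dissDown P D.h b r θ u i K) := by
      rw [hV, ← sum_cells_directions (D := D)]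
      simp only [Finset.mul_sum, ← Finset.sum_add_distrib]
      exact Finset.sum_congr rfl fun K _ => Finset.sum_congr rfl fun i _ => by ring
    have h3 := dissipation_faces_le hh b r θ u (P := P)
    have h4 := dissipation_stress_le hh b r θ u (P := P)
    have h5 := dissipation_nonneg hh b r θ u (P := P)
    have h6 := mul_le_mul_of_nonneg_left h3 hC₁0
    have h7 := mul_le_mul_of_nonneg_left h4 (mul_nonneg hc hΛ0.le)
    have h8 : 0 ≤ C₁ * ((n + 1) * V) * dissipation P D.h b r θ u := by positivity
    have h9 : 0 ≤ c * Λ := by positivity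
    rw [h2] at h1
    linarith
  rw [abs_le]
  refine ⟨?_, key hΘ hG hΘb hGb⟩
  have h := key (Θ := fun x => -Θ x) (G := fun i x => -G i x) hΘ.neg (fun i => (hG i).neg)
    (fun K x hx => by rw [abs_neg]; exact hΘb K x hx)
    (fun i K x hx => by rw [abs_neg]; exact hGb i K x hx)
  rw [stepIntegral_neg] at h
  linarith

theorem sum_up_none : (∑ K : Cell n D.N D.M, ∑ i, if up i K = none then D.h ^ (n + 1) else 0)
    = (2 * P.L) ^ n * D.h := by
  have hM := M_pos D
  rw [← sum_layer (D := D) ⟨D.M - 1, by omega⟩]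
  refine Finset.sum_congr rfl fun K _ => ?_
  rw [Finset.sum_eq_single (Fin.last n)]
  · have : K.2.val + 1 = D.M ↔ K.2 = ⟨D.M - 1, by omega⟩ := by
      rw [Fin.ext_iff]; simp only; omega
    simp only [up_last_eq_none_iff, this]
  · intro i _ hi
    rw [if_neg (up_eq_none_iff_of_ne hi K).1]
  · simp

theorem sum_down_none : (∑ K : Cell n D.N D.M, ∑ i, if down i K = none then D.h ^ (n + 1) else 0)
    = (2 * P.L) ^ n * D.h := by
  have hM := M_pos D
  rw [← sum_layer (D := D) ⟨0, hM⟩]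
  refine Finset.sum_congr rfl fun K _ => ?_
  rw [Finset.sum_eq_single (Fin.last n)]
  · have : K.2.val = 0 ↔ K.2 = ⟨0, hM⟩ := by rw [Fin.ext_iff]
    simp only [down_last_eq_none_iff, this]
  · intro i _ hi
    rw [if_neg (up_eq_none_iff_of_ne hi K).2]
  · simp

/-- Closeness of the discrete test function `Z` and the boundary values `b` to a regular function
`Θ` with gradient `G`. -/
structure IsApprox (D : Discretization P T) (c : ℝ) (b : BdryData n D.N) (Z : Cell n D.N D.M → ℝ)
    (Θ : Space n → ℝ) (G : Fin (n + 1) → Space n → ℝ) : Prop where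
  contΘ : Continuous Θ
  contG : ∀ i, Continuous (G i)
  nonneg : ∀ K, ∀ x ∈ D.box K, 0 ≤ Θ x
  boundΘ : ∀ K, ∀ x ∈ D.box K, |Θ x| ≤ c
  boundG : ∀ i K, ∀ x ∈ D.box K, |G i x| ≤ c
  val : ∀ K, ∀ x ∈ D.box K, |Θ x - Z K| ≤ c * D.h
  jump : ∀ i K K', up i K = some K' → |Z K' - Z K| ≤ c * D.h
  grad : ∀ i K K', up i K = some K' → ∀ S, S = K ∨ S = K' → ∀ x ∈ D.box S,
    |G i x - (Z K' - Z K) / D.h| ≤ c * D.h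
  bdryUp : ∀ K, up (Fin.last n) K = none →
    |b true K.1 - Z K| ≤ c * D.h ∧ ∀ x ∈ D.box K, |Θ x - b true K.1| ≤ c * D.h
  bdryDown : ∀ K, down (Fin.last n) K = none →
    |b false K.1 - Z K| ≤ c * D.h ∧ ∀ x ∈ D.box K, |Θ x - b false K.1| ≤ c * D.h

/-- The cut-off `χ` makes the product with the temperature on the other side of any face of a cell
at most the temperature in the cell. -/
structure IsCutoff (b : BdryData n D.N) (θ χ : Cell n D.N D.M → ℝ) : Prop where
  nonneg : ∀ K, 0 ≤ χ K
  le_one : ∀ K, χ K ≤ 1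
  up_some : ∀ i K K', up i K = some K' → χ K * θ K' ≤ θ K
  down_some : ∀ i K K', down i K = some K' → χ K * θ K' ≤ θ K
  up_none : ∀ K, up (Fin.last n) K = none → χ K * b true K.1 ≤ θ K
  down_none : ∀ K, down (Fin.last n) K = none → χ K * b false K.1 ≤ θ K

/-- Consistency in space: the integral over a time slice is bounded by the sum of the face terms of
the discrete ballistic energy inequality, up to the consistency rate times the dissipation. The two
are compared on each half cell. -/
theorem exists_stepIntegral_le (P : Model n) {Λ c : ℝ} (hΛ : 1 ≤ Λ) (hc : 0 ≤ c) :
    ∃ C, 0 ≤ C ∧ ∀ {T : ℝ} {D : Discretization P T} {b : BdryData n D.N}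
      {r θ Z : Cell n D.N D.M → ℝ} {u : Cell n D.N D.M → Space n} {χ : Cell n D.N D.M → ℝ}
      {Θ : Space n → ℝ} {G : Fin (n + 1) → Space n → ℝ}, InRange Λ r θ u →
      IsCutoff b θ χ → (∀ s a, 0 ≤ b s a) → (∀ K, 0 ≤ Z K) → IsApprox D c b Z Θ G →
      stepIntegral D b r θ u χ Θ G ≤ intFacesInt D.h (faceTerm P D.h r θ u Z)
        + 2 * intFacesExt D.h (fun s K => P.kappa / D.h * (θ K - b s K.1) * (1 - Z K / θ K))
        + intCells D.h (fun K => stressPower P D.h u K * (Z K / θ K))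
        + C * rate P.alpha D.h * (1 + dissipation P D.h b r θ u) := by
  have hL := P.L_pos
  have hH := P.H_pos
  have hΛ0 : 0 < Λ := by linarith
  have h2c : 0 ≤ 2 * c := by linarith
  obtain ⟨C₁, hC₁, H₁⟩ := exists_faceTerm_consistent P hΛ h2c
  obtain ⟨C₂, hC₂, H₂⟩ := exists_extTerm_consistent P hΛ h2c
  set V := (2 * P.L) ^ n * (2 * P.H) with hV
  have hV0 : 0 ≤ V := by positivity
  set W := (2 * P.L) ^ n with hW
  have hW0 : 0 ≤ W := by positivity
  refine ⟨(C₁ + C₂) * ((n + 1) * V + 1) + C₂ * W + c * Λ, by positivity, ?_⟩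
  intro T D b r θ Z u χ Θ G hR hχ hb hZ hA
  have hh := D.h_pos
  have hh1 := D.h_lt_one
  have hrate := rate_pos (α := P.alpha) hh
  set ρ := rate P.alpha D.h with hρ
  set q := D.h ^ (1 / 2 : ℝ) with hq
  have hq0 : 0 < q := Real.rpow_pos_of_pos hh _
  have hqρ : q ≤ ρ := sqrt_le_rate hh hh1
  have hqq : D.h * q⁻¹ = q := by
    have : q * q = D.h := by
      rw [hq, ← Real.rpow_add hh]; norm_num
    field_simp
    nlinarith
  set E := faceTerm P D.h r θ u Z with hE
  set Bx : Bool → Cell n D.N D.M → ℝ :=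
    fun s K => P.kappa / D.h * (θ K - b s K.1) * (1 - Z K / θ K) with hBx
  set C := C₁ + C₂ with hCdef
  have hC0 : 0 ≤ C := by positivity
  have hτ : ∀ i K K', up i K = some K' → ∀ S, (S = K ∨ S = K') → ∀ x ∈ D.box S,
      |Θ x - (Z K + Z K') / 2| ≤ 2 * c * D.h := by
    intro i K K' hK S hS x hx
    have h1 := abs_le.1 (hA.val S x hx)
    have h2 := abs_le.1 (hA.jump i K K' hK)
    rw [abs_le]
    rcases hS with rfl | rfl <;> constructor <;> linarith [h1.1, h1.2, h2.1, h2.2]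
  have hch : c * D.h ≤ 2 * c * D.h := by nlinarith
  have hint : ∀ i K K', up i K = some K' → ∀ S O, (S = K ∧ O = K' ∨ S = K' ∧ O = K) →
      χ S * θ O ≤ θ S → ∀ x ∈ D.box S,
      P.sideDensity (r S) (θ S) (u S i) (χ S) ((θ K' - θ K) / D.h) (Θ x) (G i x)
      ≤ E i K K' / D.h + C * ρ * (1 + (D.h ^ (P.alpha - 1) * jumpSq r u K K'
        + ((θ K' - θ K) / D.h) ^ 2)) := by
    intro i K K' hK S O hSO hχS x hx
    have hS : S = K ∨ S = K' := hSO.imp And.left And.left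
    have h1 := H₁ hh hh1 hR hZ i K K' S O hSO (Θ x) (G i x) (χ S) (hA.nonneg S x hx)
      (hχ.nonneg S) hχS (hτ i K K' hK S hS x hx) ((hA.boundG i S x hx).trans (by linarith))
      ((hA.jump i K K' hK).trans hch) ((hA.grad i K K' hK S hS x hx).trans hch)
    have h0 : 0 ≤ D.h ^ (P.alpha - 1) * jumpSq r u K K' :=
      mul_nonneg (Real.rpow_nonneg hh.le _) (jumpSq_nonneg _ _ _ _)
    have h2 : D.h * (C₁ * ρ * (1 + ((θ K' - θ K) / D.h) ^ 2
        + D.h ^ (P.alpha - 1) * jumpSq r u K K'))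
        ≤ D.h * (C * ρ * (1 + (D.h ^ (P.alpha - 1) * jumpSq r u K K'
        + ((θ K' - θ K) / D.h) ^ 2))) := by
      refine mul_le_mul_of_nonneg_left ?_ hh.le
      have : C₁ * ρ ≤ C * ρ := mul_le_mul_of_nonneg_right (by linarith) hrate.le
      calc _ = C₁ * ρ * (1 + (D.h ^ (P.alpha - 1) * jumpSq r u K K'
        + ((θ K' - θ K) / D.h) ^ 2)) := by ring
        _ ≤ _ := mul_le_mul_of_nonneg_right this (by positivity)
    have h3 : E i K K' / D.h * D.h = E i K K' := by field_simp
    refine le_of_mul_le_mul_left ?_ hh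
    rw [mul_add, mul_comm D.h (E i K K' / D.h), h3]
    unfold Model.sideDensity
    linarith
  -- The error at an exterior face is only `O(q⁻¹)` with `q = √h`, and not small; it is compensated
  -- by the small volume of a boundary layer of cells.
  have hext : ∀ s K (σ g : ℝ), |σ| = 1 → σ * (2 * (b s K.1 - θ K) / D.h) = g →
      χ K * b s K.1 ≤ θ K → |b s K.1 - Z K| ≤ c * D.h → ∀ x ∈ D.box K, |Θ x - b s K.1| ≤ c * D.h →
      P.sideDensity (r K) (θ K) (u K (Fin.last n)) (χ K) g (Θ x) (G (Fin.last n) x)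
      ≤ 4 * Bx s K / D.h + (C * ρ * (1 + g ^ 2) + C₂ * q⁻¹) := by
    intro s K σ g hσ hg hχb hbZ x hx hΘb
    have h1 := H₂ (s := σ) hh hh1 (hR.rho K) (hR.theta K) (hR.vel K (Fin.last n)) (hb s K.1)
      (hΘb.trans hch) (hbZ.trans hch) ((hA.boundG (Fin.last n) K x hx).trans (by linarith))
      (hχ.nonneg K) (hχ.le_one K) hχb hσ
    have hg2 : (2 * (b s K.1 - θ K) / D.h) ^ 2 = g ^ 2 := by
      rw [← hg, mul_pow, ← sq_abs σ, hσ]; ring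
    rw [hg, hg2] at h1
    have h2 : C₂ * (q * g ^ 2) ≤ C * ρ * (1 + g ^ 2) := by
      have a1 : C₂ * q ≤ C * ρ := mul_le_mul (by linarith) hqρ hq0.le hC0
      have a2 := mul_le_mul a1 (show g ^ 2 ≤ 1 + g ^ 2 by linarith) (sq_nonneg g) (by positivity)
      linarith
    refine le_of_mul_le_mul_left ?_ (show 0 < D.h / 2 by linarith)
    have h3 : D.h / 2 * (4 * Bx s K / D.h) = 2 * Bx s K := by field_simp; ring
    rw [mul_add, h3]
    have h4 := mul_le_mul_of_nonneg_left h2 (show 0 ≤ D.h / 2 by linarith)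
    unfold Model.sideDensity
    simp only [hBx]
    linarith
  have hU : ∀ i K, ∀ x ∈ D.halfUp i K, P.sideDensity (r K) (θ K) (u K i) (χ K)
      (dfaceUp D.h b θ i K) (Θ x) (G i x) ≤ faceUp D.h E Bx i K
        + (C * ρ * (1 + dissUp P D.h b r θ u i K) + C₂ * q⁻¹ * if up i K = none then 1 else 0) := by
    intro i K x hx
    rcases hK : up i K with _ | K'
    · obtain rfl : i = Fin.last n := by
        by_contra hi
        exact (up_eq_none_iff_of_ne hi K).1 hK
      have := hext true K 1 (2 * (b true K.1 - θ K) / D.h) (by simp) (by ring) (hχ.up_none K hK)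
        (hA.bdryUp K hK).1 x hx.1 ((hA.bdryUp K hK).2 x hx.1)
      have e : (2 * b true K.1 - θ K - θ K) / D.h = 2 * (b true K.1 - θ K) / D.h := by ring
      simpa only [dissUp, sumUp_none hK, faceUp, dfaceUp, hK, zero_add, e, if_true, mul_one]
        using this
    · have := hint i K K' hK K K' (Or.inl ⟨rfl, rfl⟩) (hχ.up_some i K K' hK) x hx.1
      simpa only [dissUp, sumUp_some hK, faceUp, dfaceUp, hK, reduceCtorEq, if_false, mul_zero,
        add_zero] using this
  have hD : ∀ i K, ∀ x ∈ D.halfDown i K, P.sideDensity (r K) (θ K) (u K i) (χ K)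
      (dfaceDown D.h b θ i K) (Θ x) (G i x) ≤ faceDown D.h E Bx i K
        + (C * ρ * (1 + dissDown P D.h b r θ u i K)
          + C₂ * q⁻¹ * if down i K = none then 1 else 0) := by
    intro i K x hx
    rcases hK : down i K with _ | K'
    · obtain rfl : i = Fin.last n := by
        by_contra hi
        exact (up_eq_none_iff_of_ne hi K).2 hK
      have := hext false K (-1) (-1 * (2 * (b false K.1 - θ K) / D.h)) (by simp) (by ring)
        (hχ.down_none K hK) (hA.bdryDown K hK).1 x hx.1 ((hA.bdryDown K hK).2 x hx.1)
      have e : (θ K - (2 * b false K.1 - θ K)) / D.h = -1 * (2 * (b false K.1 - θ K) / D.h) := by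
        ring
      simpa only [dissDown, sumDown_none hK, faceDown, dfaceDown, hK, zero_add, e, if_true,
        mul_one] using this
    · have hK' := (up_eq_some_iff i K' K).2 hK
      have := hint i K' K hK' K K' (Or.inr ⟨rfl, rfl⟩) (hχ.down_some i K K' hK) x hx.1
      simpa only [dissDown, sumDown_some hK, faceDown, dfaceDown, hK, reduceCtorEq, if_false,
        mul_zero, add_zero] using this
  have hS : ∀ K, ∀ x ∈ D.box K, Θ x / θ K * stressPower P D.h u K
      ≤ stressPower P D.h u K * (Z K / θ K) + c * Λ * ρ * stressPower P D.h u K := by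
    intro K x hx
    have hθ0 := pos_of_mem_range hΛ (hR.theta K)
    have h1 : Θ x / θ K ≤ Z K / θ K + c * Λ * ρ := by
      have h2 : Θ x ≤ Z K + c * D.h := by linarith [(abs_le.1 (hA.val K x hx)).2]
      have h3 : c * D.h / θ K ≤ c * Λ * ρ := by
        rw [div_eq_mul_inv]
        calc c * D.h * (θ K)⁻¹ ≤ c * ρ * Λ := mul_le_mul
              (mul_le_mul_of_nonneg_left (le_rate hh hh1) hc)
              (inv_le_of_mem_range hΛ (hR.theta K)) (inv_pos.2 hθ0).le (by positivity)
          _ = _ := by ring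
      calc Θ x / θ K ≤ (Z K + c * D.h) / θ K := div_le_div_of_nonneg_right h2 hθ0.le
        _ = Z K / θ K + c * D.h / θ K := by ring
        _ ≤ _ := by linarith
    have := mul_le_mul_of_nonneg_right h1 (stressPower_nonneg P D.h u K)
    linarith
  have htot := stepIntegral_le hA.contΘ hA.contG hU hD hS
  rw [intCells_add, intCells_const_mul] at htot
  have hsum : ∑ K, ∑ i, D.h ^ (n + 1) / 2 * (faceUp D.h E Bx i K
        + (C * ρ * (1 + dissUp P D.h b r θ u i K) + C₂ * q⁻¹ * if up i K = none then 1 else 0)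
        + (faceDown D.h E Bx i K + (C * ρ * (1 + dissDown P D.h b r θ u i K)
          + C₂ * q⁻¹ * if down i K = none then 1 else 0)))
      = (∑ K, ∑ i, D.h ^ (n + 1) / 2 * (faceUp D.h E Bx i K + faceDown D.h E Bx i K))
        + C * ρ * ((∑ _K : Cell n D.N D.M, ∑ _i : Fin (n + 1), D.h ^ (n + 1))
          + ∑ K, ∑ i, D.h ^ (n + 1) / 2 * (dissUp P D.h b r θ u i K + dissDown P D.h b r θ u i K))
        + C₂ * q⁻¹ / 2 * ((∑ K : Cell n D.N D.M, ∑ i, if up i K = none then D.h ^ (n + 1) else 0)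
          + ∑ K : Cell n D.N D.M, ∑ i, if down i K = none then D.h ^ (n + 1) else 0) := by
    simp only [Finset.mul_sum, ← Finset.sum_add_distrib]
    refine Finset.sum_congr rfl fun K _ => Finset.sum_congr rfl fun i _ => ?_
    split_ifs <;> ring
  rw [hsum, sum_cells_directions, ← hW, ← hV, sum_up_none, sum_down_none,
    ← faces_eq hh.ne' E Bx] at htot
  -- Each of the two layers of boundary cells has volume `W h`.
  have hlay : C₂ * q⁻¹ / 2 * (W * D.h + W * D.h) = C₂ * W * q := by
    calc _ = C₂ * W * (D.h * q⁻¹) := by ring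
      _ = _ := by rw [hqq]
  rw [hlay] at htot
  set Y := dissipation P D.h b r θ u with hY
  have hY0 : 0 ≤ Y := dissipation_nonneg hh b r θ u
  have e1 : C * ρ * ∑ K, ∑ i, D.h ^ (n + 1) / 2 *
      (dissUp P D.h b r θ u i K + dissDown P D.h b r θ u i K) ≤ C * ρ * Y :=
    mul_le_mul_of_nonneg_left (dissipation_faces_le hh b r θ u) (by positivity)
  have e2 : c * Λ * ρ * intCells D.h (stressPower P D.h u) ≤ c * Λ * ρ * Y :=
    mul_le_mul_of_nonneg_left (dissipation_stress_le hh b r θ u) (by positivity)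
  have e3 : C₂ * W * q ≤ C₂ * W * ρ := mul_le_mul_of_nonneg_left hqρ (by positivity)
  have e4 : 0 ≤ C * ((n + 1) * V) * ρ * Y := by positivity
  have e5 : 0 ≤ C₂ * W * ρ * Y := by positivity
  have e6 : 0 ≤ C * ρ := by positivity
  have e7 : 0 ≤ c * Λ * ρ := by positivity
  have e8 : (C * ((n + 1) * V + 1) + C₂ * W + c * Λ) * ρ * (1 + Y)
      = C * ρ * ((n + 1) * V) + C * ρ + C₂ * W * ρ + c * Λ * ρ + C * ((n + 1) * V) * ρ * Y
        + C * ρ * Y + C₂ * W * ρ * Y + c * Λ * ρ * Y := by ring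
  rw [e8]
  linarith

end Consistency

/-! ### Integration in time -/

section Time

/-- Integration by parts for an absolutely continuous and a Lipschitz continuous function. -/
theorem integral_parts {T a b L : ℝ} {ψ g w w' : ℝ → ℝ} (ha : 0 ≤ a) (hab : a ≤ b) (hb : b ≤ T)
    (hL : 0 ≤ L) (hg : IntervalIntegrable g volume 0 T)
    (hψ : ∀ t ∈ Set.Icc 0 T, ψ t = ψ 0 + ∫ τ in (0 : ℝ)..t, g τ)
    (hw : ∀ s ∈ Set.Icc a b, ∀ t ∈ Set.Icc a b, |w s - w t| ≤ L * |s - t|)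
    (hw' : ∀ t ∈ Set.Ioo a b, HasDerivAt w (w' t) t) :
    ∫ t in a..b, (g t * w t + ψ t * w' t) = ψ b * w b - ψ a * w a := by
  have h0T : (0 : ℝ) ≤ T := ha.trans (hab.trans hb)
  set Φ : ℝ → ℝ := fun t => ψ 0 + ∫ τ in (0 : ℝ)..t, g τ with hΦ
  have hsub : Set.uIcc a b ⊆ Set.uIcc 0 T := by
    rw [Set.uIcc_of_le hab, Set.uIcc_of_le h0T]
    exact Set.Icc_subset_Icc ha hb
  have hΦψ : ∀ t ∈ Set.Icc a b, Φ t = ψ t := fun t ht =>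
    (hψ t ⟨ha.trans ht.1, ht.2.trans hb⟩).symm
  have hΦac : AbsolutelyContinuousOnInterval Φ a b := by
    have h1 : AbsolutelyContinuousOnInterval (fun _ : ℝ => ψ 0) 0 T :=
      ((LipschitzWith.const (ψ 0)).lipschitzOnWith
        (s := Set.uIcc 0 T)).absolutelyContinuousOnInterval
    exact (h1.add (hg.absolutelyContinuousOnInterval_intervalIntegral (by simp))).mono hsub
  have hwac : AbsolutelyContinuousOnInterval w a b := by
    have : LipschitzOnWith ⟨L, hL⟩ w (Set.uIcc a b) := by
      rw [Set.uIcc_of_le hab]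
      exact LipschitzOnWith.of_dist_le_mul fun s hs t ht => hw s hs t ht
    exact this.absolutelyContinuousOnInterval
  rw [← hΦψ a ⟨le_rfl, hab⟩, ← hΦψ b ⟨hab, le_rfl⟩, ← hΦac.integral_deriv_mul_eq_sub hwac]
  refine intervalIntegral.integral_congr_ae ?_
  filter_upwards [hg.ae_hasDerivAt_integral, Measure.ae_ne volume b] with t ht htb hmem
  rw [Set.uIoc_of_le hab] at hmem
  have h1 := ht (hsub (by rw [Set.uIcc_of_le hab]; exact ⟨hmem.1.le, hmem.2⟩)) 0 (by simp)
  have h2 : HasDerivAt Φ (g t) t := h1.const_add _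
  rw [h2.deriv, (hw' t ⟨hmem.1, lt_of_le_of_ne hmem.2 htb⟩).deriv,
    hΦψ t ⟨hmem.1.le, hmem.2⟩]

/-- The Hölder estimate for functions of class `W^{1,2}`. -/
theorem MemW12.abs_sub_le {T : ℝ} (hT : 0 < T) {ψ : ℝ → ℝ} (hψ : MemW12 T ψ) {s t : ℝ}
    (hs : 0 ≤ s) (hst : s ≤ t) (ht : t ≤ T) :
    |ψ t - ψ s| ≤ Real.sqrt (t - s) * normW12 T ψ := by
  set g := weakDeriv (Set.Ioo 0 T) 1 ψ with hg
  have hgi := hψ.intervalIntegrable hT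
  have hsubs : Set.uIcc s t ⊆ Set.uIcc 0 T := by
    rw [Set.uIcc_of_le hst, Set.uIcc_of_le hT.le]
    exact Set.Icc_subset_Icc hs ht
  have hgst : IntervalIntegrable g volume s t := hgi.mono_set hsubs
  have hg2T : IntegrableOn (fun τ => g τ ^ 2) (Set.Ioo 0 T) := hψ.deriv_memLp.integrable_sq
  have hg2 : IntervalIntegrable (fun τ => g τ ^ 2) volume s t := by
    refine IntervalIntegrable.mono_set (a := 0) (b := T) ?_ hsubs
    rwa [intervalIntegrable_iff_integrableOn_Ioo_of_le hT.le]
  have h1 : ψ t - ψ s = ∫ τ in s..t, g τ := by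
    rw [hψ.eq_integral hT t ⟨hs.trans hst, ht⟩, hψ.eq_integral hT s ⟨hs, hst.trans ht⟩,
      add_sub_add_left_eq_sub, intervalIntegral.integral_interval_sub_left]
    · refine hgi.mono_set ?_
      rw [Set.uIcc_of_le (hs.trans hst), Set.uIcc_of_le hT.le]
      exact Set.Icc_subset_Icc le_rfl ht
    · refine hgi.mono_set ?_
      rw [Set.uIcc_of_le hs, Set.uIcc_of_le hT.le]
      exact Set.Icc_subset_Icc le_rfl (hst.trans ht)
  set A := ∫ τ in s..t, g τ ^ 2 with hA
  set I := ∫ τ in s..t, g τ with hI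
  have hAW : A ≤ normW12 T ψ ^ 2 := by
    have h2 : A ≤ ∫ τ in Set.Ioo 0 T, g τ ^ 2 := by
      rw [hA, intervalIntegral.integral_of_le hst, integral_Ioc_eq_integral_Ioo]
      exact setIntegral_mono_set hg2T (ae_of_all _ fun _ => sq_nonneg _)
        (Set.Ioo_subset_Ioo hs ht).eventuallyLE
    have h3 : 0 ≤ ∫ τ in Set.Ioo 0 T, ψ τ ^ 2 := integral_nonneg fun _ => sq_nonneg _
    have h4 : 0 ≤ ∫ τ in Set.Ioo 0 T, g τ ^ 2 := integral_nonneg fun _ => sq_nonneg _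
    rw [normW12, Real.sq_sqrt (add_nonneg h3 h4)]
    linarith
  have hW0 : 0 ≤ normW12 T ψ := Real.sqrt_nonneg _
  have hCS : I ^ 2 ≤ (t - s) * A := by
    rcases hst.eq_or_lt with rfl | hlt
    · simp [hI]
    -- Cauchy-Schwarz: the square of `g - l` has nonnegative integral for every constant `l`.
    have h5 : ∀ l : ℝ, 0 ≤ A - 2 * l * I + l ^ 2 * (t - s) := by
      intro l
      have h6 : ∫ τ in s..t, (g τ - l) ^ 2 = A - 2 * l * I + l ^ 2 * (t - s) := by
        have e : ∀ τ, (g τ - l) ^ 2 = g τ ^ 2 - 2 * l * g τ + l ^ 2 := fun τ => by ring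
        simp only [e]
        rw [intervalIntegral.integral_add (hg2.sub (hgst.const_mul _)) (by simp),
          intervalIntegral.integral_sub hg2 (hgst.const_mul _),
          intervalIntegral.integral_const_mul, intervalIntegral.integral_const, smul_eq_mul]
        ring
      rw [← h6]
      exact intervalIntegral.integral_nonneg hst fun τ _ => sq_nonneg _
    have h7 := h5 (I / (t - s))
    have h8 : 0 < t - s := by linarith
    have h9 : A - 2 * (I / (t - s)) * I + (I / (t - s)) ^ 2 * (t - s)
        = (A * (t - s) - I ^ 2) / (t - s) := by field_simp; ring
    rw [h9] at h7
    have h10 : 0 ≤ A * (t - s) - I ^ 2 := by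
      by_contra hneg
      exact absurd h7 (not_le.2 (div_neg_of_neg_of_pos (not_le.1 hneg) h8))
    linarith
  rw [h1]
  refine abs_le_of_sq_le_sq ?_ (mul_nonneg (Real.sqrt_nonneg _) hW0)
  rw [mul_pow, Real.sq_sqrt (by linarith)]
  exact hCS.trans (mul_le_mul_of_nonneg_left hAW (by linarith))

variable {n : ℕ} {P : Model n} {T : ℝ} {D : Discretization P T}

theorem idx_eq {k : ℕ} {t : ℝ} (ht : t ∈ Set.Ioc (k * D.dt) ((k + 1 : ℕ) * D.dt)) :
    D.idx t = k + 1 := by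
  have hdt := D.dt_pos
  unfold Discretization.idx
  rw [Nat.ceil_eq_iff (Nat.succ_ne_zero k), Nat.succ_sub_one, lt_div_iff₀ hdt, div_le_iff₀ hdt]
  exact ht

theorem step_le_T {k : ℕ} (hk : k ≤ D.NT) : (k : ℝ) * D.dt ≤ T := by
  exact (mul_le_mul_of_nonneg_right (by exact_mod_cast hk) D.dt_pos.le).trans_eq D.NT_mul_dt

theorem step_mem {k : ℕ} (hk : k ≤ D.NT) : (k : ℝ) * D.dt ∈ Set.Icc 0 T :=
  ⟨mul_nonneg (Nat.cast_nonneg k) D.dt_pos.le, step_le_T hk⟩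

theorem step_le_succ (D : Discretization P T) (k : ℕ) : (k : ℝ) * D.dt ≤ (k + 1 : ℕ) * D.dt :=
  mul_le_mul_of_nonneg_right (by exact_mod_cast Nat.le_succ k) D.dt_pos.le

theorem step_subset {k : ℕ} (hk : k < D.NT) :
    Set.Icc ((k : ℝ) * D.dt) ((k + 1 : ℕ) * D.dt) ⊆ Set.Icc 0 T :=
  Set.Icc_subset_Icc (step_mem hk.le).1 (step_mem hk).2

/-- Integrals over `(0,T)` of functions which depend on time also through the index of the time
step, as sums over the time steps. -/
theorem integral_idx {φ Fn : ℝ → ℝ} {f : ℕ → ℝ → ℝ} (hφ : IntervalIntegrable φ volume 0 T)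
    (hf : ∀ k ≤ D.NT, ContinuousOn (f k) (Set.Icc 0 T))
    (hF : ∀ᵐ t, t ∈ Set.Ioo 0 T → Fn t = f (D.idx t) t) :
    ∫ t in (0 : ℝ)..T, φ t * Fn t
      = ∑ k ∈ Finset.range D.NT, ∫ t in ((k : ℝ) * D.dt)..((k + 1 : ℕ) * D.dt),
          φ t * f (k + 1) t := by
  have hT : (0 : ℝ) ≤ T := by
    exact (mul_nonneg (Nat.cast_nonneg _) D.dt_pos.le).trans_eq D.NT_mul_dt
  have hcongr : ∀ k < D.NT, ∀ᵐ t, t ∈ Set.uIoc ((k : ℝ) * D.dt) ((k + 1 : ℕ) * D.dt) →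
      φ t * f (k + 1) t = φ t * Fn t := by
    intro k hk
    filter_upwards [hF, Measure.ae_ne volume T] with t ht htT hmem
    rw [Set.uIoc_of_le (step_le_succ D k)] at hmem
    have h0 := (step_subset hk ⟨hmem.1.le, hmem.2⟩)
    have h1 : 0 < t := (step_mem (T := T) (D := D) hk.le).1.trans_lt hmem.1
    rw [ht ⟨h1, lt_of_le_of_ne h0.2 htT⟩, idx_eq hmem]
  have hint : ∀ k < D.NT, IntervalIntegrable (fun t => φ t * f (k + 1) t) volume
      ((k : ℝ) * D.dt) ((k + 1 : ℕ) * D.dt) := by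
    intro k hk
    have hs : Set.uIcc ((k : ℝ) * D.dt) ((k + 1 : ℕ) * D.dt) ⊆ Set.Icc 0 T := by
      rw [Set.uIcc_of_le (step_le_succ D k)]; exact step_subset hk
    exact (hφ.mono_set (by rwa [Set.uIcc_of_le hT])).mul_continuousOn ((hf (k + 1) hk).mono hs)
  have h2 := intervalIntegral.sum_integral_adjacent_intervals (μ := volume)
    (f := fun t => φ t * Fn t) (a := fun k : ℕ => (k : ℝ) * D.dt) (n := D.NT)
    (fun k hk => (hint k hk).congr_ae ((ae_restrict_iff' measurableSet_uIoc).2 (hcongr k hk)))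
  simp only [Nat.cast_zero, zero_mul, D.NT_mul_dt] at h2
  rw [← h2]
  exact Finset.sum_congr rfl fun k hk =>
    (intervalIntegral.integral_congr_ae (hcongr k (Finset.mem_range.1 hk))).symm

theorem continuousOn_setIntegral {s : Set (Space n)} (hs : MeasurableSet s) {K : Cell n D.N D.M}
    (hsK : s ⊆ D.box K) {Φ : SpaceTime n → ℝ} (hΦ : Continuous Φ) :
    ContinuousOn (fun t => ∫ x in s, Φ (t, x)) (Set.Icc 0 T) := by
  have hsub : s ⊆ Set.Icc (D.corner K) (fun i => D.corner K i + D.h) := fun x hx =>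
    ⟨fun i => (hsK hx i).1, fun i => (hsK hx i).2.le⟩
  obtain ⟨C, hC⟩ := (isCompact_Icc (a := (0 : ℝ)) (b := T)).prod (isCompact_Icc
    (a := D.corner K) (b := fun i => D.corner K i + D.h)) |>.exists_bound_of_continuousOn
    hΦ.continuousOn
  have hfin : volume s < ⊤ := (measure_mono hsK).trans_lt (volume_box_lt_top K)
  refine continuousOn_of_dominated (bound := fun _ => C) (fun t _ => ?_) (fun t ht => ?_) ?_ ?_
  · exact (hΦ.comp (by fun_prop : Continuous fun x : Space n => (t, x))).aestronglyMeasurable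
  · rw [ae_restrict_iff' hs]
    exact ae_of_all _ fun x hx => hC (t, x) ⟨ht, hsub hx⟩
  · exact integrableOn_const hfin.ne
  · exact ae_of_all _ fun x =>
      (hΦ.comp (by fun_prop : Continuous fun t : ℝ => (t, x))).continuousOn

theorem continuousOn_stepIntegral (b : BdryData n D.N) (r θ : Cell n D.N D.M → ℝ)
    (u : Cell n D.N D.M → Space n) (χ : Cell n D.N D.M → ℝ) {Θ : SpaceTime n → ℝ}
    {G : Fin (n + 1) → SpaceTime n → ℝ} (hΘ : Continuous Θ) (hG : ∀ i, Continuous (G i)) :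
    ContinuousOn (fun t => stepIntegral D b r θ u χ (fun x => Θ (t, x)) (fun i x => G i (t, x)))
      (Set.Icc 0 T) := by
  unfold stepIntegral
  refine continuousOn_finsetSum _ fun K _ => (continuousOn_finsetSum _ fun i _ => ?_).add ?_
  · have hc : ∀ g, Continuous fun z => P.sideDensity (r K) (θ K) (u K i) (χ K) g (Θ z) (G i z) :=
      fun g => by
        have := hG i
        unfold Model.sideDensity
        fun_prop
    exact (continuousOn_setIntegral (measurableSet_halfUp i K) (halfUp_subset i K) (hc _)).add
      (continuousOn_setIntegral (measurableSet_halfDown i K) (halfDown_subset i K) (hc _))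
  · exact continuousOn_setIntegral (Φ := fun z => Θ z / θ K * stressPower P D.h u K)
      (measurableSet_box K) subset_rfl (by fun_prop)

/-- `stepIntegral` is additive in the pair of the test function and its gradient. -/
theorem stepIntegral_add_zero (b : BdryData n D.N) (r θ : Cell n D.N D.M → ℝ)
    (u : Cell n D.N D.M → Space n) (χ : Cell n D.N D.M → ℝ) {Θ : Space n → ℝ}
    {G : Fin (n + 1) → Space n → ℝ} (hΘ : Continuous Θ) (hG : ∀ i, Continuous (G i)) :
    stepIntegral D b r θ u χ Θ (fun _ _ => 0) + stepIntegral D b r θ u χ (fun _ => 0) G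
      = stepIntegral D b r θ u χ Θ G := by
  have hs : ∀ r θ v χ g τ γ, P.sideDensity r θ v χ g τ γ
      = P.sideDensity r θ v χ g τ 0 + P.sideDensity r θ v χ g 0 γ := fun r θ v χ g τ γ => by
    simp only [Model.sideDensity]; ring
  unfold stepIntegral
  rw [← Finset.sum_add_distrib]
  refine Finset.sum_congr rfl fun K _ => ?_
  simp only [zero_div, zero_mul, integral_zero, add_zero]
  rw [add_right_comm, ← Finset.sum_add_distrib]
  congr 1
  refine Finset.sum_congr rfl fun i _ => ?_
  have e1 := integral_add
    (integrableOn_halfUp (D := D) (continuous_sideDensity (P := P) (r K) (θ K) (u K i) (χ K)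
      (dfaceUp D.h b θ i K) hΘ (continuous_const (y := (0 : ℝ)))) i K)
    (integrableOn_halfUp (continuous_sideDensity (P := P) (r K) (θ K) (u K i) (χ K)
      (dfaceUp D.h b θ i K) (continuous_const (y := (0 : ℝ))) (hG i)) i K)
  have e2 := integral_add
    (integrableOn_halfDown (D := D) (continuous_sideDensity (P := P) (r K) (θ K) (u K i) (χ K)
      (dfaceDown D.h b θ i K) hΘ (continuous_const (y := (0 : ℝ)))) i K)
    (integrableOn_halfDown (continuous_sideDensity (P := P) (r K) (θ K) (u K i) (χ K)
      (dfaceDown D.h b θ i K) (continuous_const (y := (0 : ℝ))) (hG i)) i K)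
  simp only [← hs] at e1 e2
  rw [e1, e2]
  ring

variable {N : ℝ} {f fe : SpaceTime n → ℝ} {G : Option (Fin (n + 1)) → SpaceTime n → ℝ}

theorem RegularRep.hasDerivAt_integral_box (hf : RegularRep P.L P.H T N f fe G)
    (K : Cell n D.N D.M) {t : ℝ} (ht : t ∈ Set.Ioo 0 T) :
    HasDerivAt (fun t => ∫ x in D.box K, fe (t, x)) (∫ x in D.box K, G none (t, x)) t := by
  have hi : ∀ s, IntegrableOn (fun x => fe (s, x)) (D.box K) := fun s =>
    integrableOn_box_of_continuous (hf.continuous.comp (by fun_prop)) K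
  have hiG : IntegrableOn (fun x => G none (t, x)) (D.box K) :=
    integrableOn_box_of_continuous ((hf.continuousG none).comp (by fun_prop)) K
  have hfin := volume_box_lt_top K
  have hbound : ∀ᶠ s in 𝓝 t, ‖(∫ x in D.box K, fe (s, x)) - (∫ x in D.box K, fe (t, x))
      - (s - t) • ∫ x in D.box K, G none (t, x)‖ ≤ N * D.h ^ (n + 1) * ‖(s - t) ^ 2‖ := by
    filter_upwards [Ioo_mem_nhds ht.1 ht.2] with s hs
    have e : (∫ x in D.box K, fe (s, x)) - (∫ x in D.box K, fe (t, x))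
        - (s - t) • ∫ x in D.box K, G none (t, x)
        = ∫ x in D.box K, (fe (s, x) - fe (t, x) - (s - t) * G none (t, x)) := by
      rw [integral_sub (f := fun x => fe (s, x) - fe (t, x)) ((hi s).sub (hi t))
        (hiG.const_mul _), integral_sub (hi s) (hi t), integral_const_mul, smul_eq_mul]
    rw [e, norm_pow, Real.norm_eq_abs (s - t), sq_abs]
    calc _ ≤ N * (s - t) ^ 2 * volume.real (D.box K) := by
          refine norm_setIntegral_le_of_norm_le_const hfin fun x hx => ?_
          have hz : ((t, x) : SpaceTime n) + (s - t) • stDir none = (s, x) := by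
            simp [stDir]
          have := hf.taylor none (s - t) (t, x)
            (mem_closed_of_mem_box ⟨ht.1.le, ht.2.le⟩ hx)
            (by rw [hz]; exact mem_closed_of_mem_box ⟨hs.1.le, hs.2.le⟩ hx)
          rw [hz] at this
          exact this
      _ = _ := by rw [volume_box]; ring
  rw [hasDerivAt_iff_isLittleO]
  refine (Asymptotics.IsBigO.of_bound _ hbound).trans_isLittleO ?_
  have h1 : Tendsto (fun s : ℝ => s - t) (𝓝 t) (𝓝 0) := by
    have : Continuous fun s : ℝ => s - t := by fun_prop
    simpa using this.tendsto t
  exact (Asymptotics.isLittleO_pow_id one_lt_two).comp_tendsto h1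

theorem RegularRep.abs_integral_box_sub_le (hf : RegularRep P.L P.H T N f fe G)
    (K : Cell n D.N D.M) (s t : ℝ) :
    |(∫ x in D.box K, fe (s, x)) - ∫ x in D.box K, fe (t, x)|
      ≤ D.h ^ (n + 1) * (N * |s - t|) := by
  have h := hf.abs_cellAvg_sub_cellAvg_le s t K
  have hV : 0 < D.h ^ (n + 1) := pow_pos D.h_pos _
  have e : (∫ x in D.box K, fe (s, x)) - ∫ x in D.box K, fe (t, x) = D.h ^ (n + 1) *
      (D.cellAvg (fun x => fe (s, x)) K - D.cellAvg (fun x => fe (t, x)) K) := by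
    unfold Discretization.cellAvg
    field_simp
  rw [e, abs_mul, abs_of_pos hV]
  exact mul_le_mul_of_nonneg_left h hV.le

/-- The total ballistic energy of given discrete fields, as a function of time through the test
function. -/
def energyAt (D : Discretization P T) (r θ : Cell n D.N D.M → ℝ) (u : Cell n D.N D.M → Space n)
    (Θ : SpaceTime n → ℝ) (t : ℝ) : ℝ :=
  ∑ K, (D.h ^ (n + 1) * P.energyDensity (r K) (θ K) (u K)
    - r K * P.entropy (r K) (θ K) * ∫ x in D.box K, Θ (t, x))

/-- The entropy tested with a function of space and time. -/
def entropyAt (D : Discretization P T) (r θ : Cell n D.N D.M → ℝ) (Θ : SpaceTime n → ℝ)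
    (t : ℝ) : ℝ :=
  ∑ K, r K * P.entropy (r K) (θ K) * ∫ x in D.box K, Θ (t, x)

theorem RegularRep.hasDerivAt_energyAt (hf : RegularRep P.L P.H T N f fe G)
    (r θ : Cell n D.N D.M → ℝ) (u : Cell n D.N D.M → Space n) {t : ℝ} (ht : t ∈ Set.Ioo 0 T) :
    HasDerivAt (energyAt D r θ u fe) (-entropyAt D r θ (G none) t) t := by
  unfold energyAt entropyAt
  rw [← Finset.sum_neg_distrib]
  refine HasDerivAt.fun_sum fun K _ => ?_
  exact ((hf.hasDerivAt_integral_box K ht).const_mul _).const_sub _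

theorem RegularRep.exists_abs_energyAt_sub_le (hf : RegularRep P.L P.H T N f fe G)
    (r θ : Cell n D.N D.M → ℝ) (u : Cell n D.N D.M → Space n) :
    ∃ L, 0 ≤ L ∧ ∀ s t, |energyAt D r θ u fe s - energyAt D r θ u fe t| ≤ L * |s - t| := by
  refine ⟨∑ K, |r K * P.entropy (r K) (θ K)| * (D.h ^ (n + 1) * N),
    Finset.sum_nonneg fun K _ => mul_nonneg (abs_nonneg _)
      (mul_nonneg (pow_nonneg D.h_pos.le _) hf.nonneg), fun s t => ?_⟩
  unfold energyAt
  rw [← Finset.sum_sub_distrib, Finset.sum_mul]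
  refine (Finset.abs_sum_le_sum_abs _ _).trans (Finset.sum_le_sum fun K _ => ?_)
  rw [sub_sub_sub_cancel_left, ← mul_sub, abs_mul, mul_assoc]
  refine mul_le_mul_of_nonneg_left ?_ (abs_nonneg _)
  have := hf.abs_integral_box_sub_le K t s
  rw [abs_sub_comm t s] at this
  linarith

theorem RegularRep.ballisticEnergy_eq (hf : RegularRep P.L P.H T N f fe G) (F : Fields D) (k : ℕ)
    {t : ℝ} (ht : t ∈ Set.Icc 0 T) :
    F.ballisticEnergy f k t = energyAt D (F.rho k) (F.theta k) (F.u k) fe t := by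
  have hK : ∀ K, Set.EqOn (fun x => P.energyDensity (F.rho k K) (F.theta k K) (F.u k K)
      - F.rho k K * P.entropy (F.rho k K) (F.theta k K) * fe (t, x))
      (fun x => 1 / 2 * D.pw (F.rho k) x * ∑ i, D.pw (fun K => F.u k K i) x ^ 2
      + P.cv * D.pw (F.rho k) x * D.pw (F.theta k) x
      - D.pw (F.rho k) x * P.entropy (D.pw (F.rho k) x) (D.pw (F.theta k) x) * f (t, x))
      (D.box K) := fun K x hx => by
    simp only [pw_eq hx, Model.energyDensity, hf.eq _ (mem_closed_of_mem_box ht hx)]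
  have hc : Continuous fun x : Space n => fe (t, x) := hf.continuous.comp (by fun_prop)
  have hi : ∀ K, IntegrableOn (fun x => P.energyDensity (F.rho k K) (F.theta k K) (F.u k K)
      - F.rho k K * P.entropy (F.rho k K) (F.theta k K) * fe (t, x)) (D.box K) := fun K =>
    integrableOn_box_of_continuous (continuous_const.sub (continuous_const.mul hc)) K
  rw [Fields.ballisticEnergy, integral_omega_eq_sum fun K =>
    (hi K).congr_fun (hK K) (measurableSet_box K), energyAt]
  refine Finset.sum_congr rfl fun K _ => ?_
  rw [← setIntegral_congr_fun (measurableSet_box K) (hK K),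
    integral_sub (integrableOn_box_of_continuous continuous_const K)
      ((integrableOn_box_of_continuous hc K).const_mul _), integral_const_mul, setIntegral_const,
    volume_box, smul_eq_mul]

/-- Integration by parts in time over all steps: the errors of the time discretization cancel
exactly, because the test function enters the discrete inequality through its value at the
beginning of the step. -/
theorem RegularRep.sum_integral_parts (hf : RegularRep P.L P.H T N f fe G) (F : Fields D)
    {ψ g : ℝ → ℝ} (hg : IntervalIntegrable g volume 0 T)
    (hψ : ∀ t ∈ Set.Icc 0 T, ψ t = ψ 0 + ∫ τ in (0 : ℝ)..t, g τ) (hψT : ψ T = 0) :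
    ψ 0 * energyAt D (F.rho 0) (F.theta 0) (F.u 0) fe 0
      + ∑ k ∈ Finset.range D.NT, ∫ t in ((k : ℝ) * D.dt)..((k + 1 : ℕ) * D.dt),
        (g t * energyAt D (F.rho (k + 1)) (F.theta (k + 1)) (F.u (k + 1)) fe t
          + ψ t * -entropyAt D (F.rho (k + 1)) (F.theta (k + 1)) (G none) t)
      = -∑ k ∈ Finset.range D.NT, D.dt * (ψ (k * D.dt) * ballisticRate P D.h D.dt
          (F.rho k) (F.rho (k + 1)) (F.theta k) (F.theta (k + 1)) (F.u k) (F.u (k + 1))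
          (D.cellAvg fun x => fe (k * D.dt, x))) := by
  set E : ℕ → ℝ → ℝ := fun k => energyAt D (F.rho k) (F.theta k) (F.u k) fe with hE
  have h1 : ∀ k ∈ Finset.range D.NT, ∫ t in ((k : ℝ) * D.dt)..((k + 1 : ℕ) * D.dt),
        (g t * E (k + 1) t + ψ t * -entropyAt D (F.rho (k + 1)) (F.theta (k + 1)) (G none) t)
      = (ψ ((k + 1 : ℕ) * D.dt) * E (k + 1) ((k + 1 : ℕ) * D.dt)
        - ψ (k * D.dt) * E k (k * D.dt))
        - ψ (k * D.dt) * (E (k + 1) (k * D.dt) - E k (k * D.dt)) := by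
    intro k hk
    have hk' := Finset.mem_range.1 hk
    obtain ⟨L, hL, hLip⟩ := hf.exists_abs_energyAt_sub_le (F.rho (k + 1)) (F.theta (k + 1))
      (F.u (k + 1)) (D := D)
    have hsub := step_subset (T := T) (D := D) hk'
    rw [integral_parts (step_mem hk'.le).1 (step_le_succ D k) (step_mem hk').2 hL hg hψ
      (fun s _ t _ => hLip s t) fun t ht => hf.hasDerivAt_energyAt _ _ _
        ⟨(step_mem hk'.le).1.trans_lt ht.1, ht.2.trans_le (step_mem hk').2⟩]
    ring
  -- Only the fields change between the two energies; the test function is evaluated at the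
  -- beginning of the step in both.
  have h2 : ∀ k, E (k + 1) (k * D.dt) - E k (k * D.dt) = D.dt * ballisticRate P D.h D.dt
          (F.rho k) (F.rho (k + 1)) (F.theta k) (F.theta (k + 1)) (F.u k) (F.u (k + 1))
          (D.cellAvg fun x => fe (k * D.dt, x)) := by
    intro k
    have hdt := D.dt_pos.ne'
    have hV : D.h ^ (n + 1) ≠ 0 := (pow_pos D.h_pos _).ne'
    simp only [hE, energyAt, ballisticRate, intCells]
    rw [← Finset.sum_sub_distrib, Finset.mul_sum]
    refine Finset.sum_congr rfl fun K _ => ?_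
    unfold Discretization.cellAvg
    field_simp
    ring
  -- The boundary terms telescope, and `ψ T = 0` removes the last one.
  rw [Finset.sum_congr rfl h1, Finset.sum_sub_distrib,
    Finset.sum_range_sub (fun k : ℕ => ψ (k * D.dt) * E k (k * D.dt)) D.NT]
  simp only [h2, D.NT_mul_dt, hψT, Nat.cast_zero, zero_mul, zero_sub]
  have h3 : ∀ k : ℕ, ψ (k * D.dt) * (D.dt * ballisticRate P D.h D.dt
          (F.rho k) (F.rho (k + 1)) (F.theta k) (F.theta (k + 1)) (F.u k) (F.u (k + 1))
          (D.cellAvg fun x => fe (k * D.dt, x))) = D.dt * (ψ (k * D.dt) * ballisticRate P D.h D.dt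
          (F.rho k) (F.rho (k + 1)) (F.theta k) (F.theta (k + 1)) (F.u k) (F.u (k + 1))
          (D.cellAvg fun x => fe (k * D.dt, x))) := fun k => by ring
  simp only [h3]
  ring

end Time

/-! ### The cut-off -/

section Cutoff

variable {n N M : ℕ}

/-- The cell values of the function `χ_h`: one minus a multiple of the temperature jumps across
the faces of the cell, truncated from below. -/
def cutoff (Λ h : ℝ) (b : BdryData n N) (θ : Cell n N M → ℝ) (K : Cell n N M) : ℝ :=
  max (Λ ^ 2)⁻¹ (1 - Λ * (h * ∑ i, (|dfaceUp h b θ i K| + |dfaceDown h b θ i K|)))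

theorem cutoff_ge (Λ h : ℝ) (b : BdryData n N) (θ : Cell n N M → ℝ) (K : Cell n N M) :
    (Λ ^ 2)⁻¹ ≤ cutoff Λ h b θ K := le_max_left _ _

theorem cutoff_le_one {Λ h : ℝ} (hΛ : 1 ≤ Λ) (hh : 0 < h) (b : BdryData n N)
    (θ : Cell n N M → ℝ) (K : Cell n N M) : cutoff Λ h b θ K ≤ 1 := by
  refine max_le (inv_le_one_of_one_le₀ (one_le_pow₀ hΛ)) ?_
  have : 0 ≤ Λ * (h * ∑ i, (|dfaceUp h b θ i K| + |dfaceDown h b θ i K|)) := by positivity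
  linarith

/-- The truncation at `Λ⁻²` is harmless because the ratio of two temperatures in `[Λ⁻¹, Λ]` is at
least `Λ⁻²`. -/
theorem max_mul_le {Λ θ y δ : ℝ} (hΛ : 1 ≤ Λ) (hθ : Λ⁻¹ ≤ θ) (hy : 0 ≤ y) (hyΛ : y ≤ Λ)
    (hδ : |y - θ| ≤ δ) : max (Λ ^ 2)⁻¹ (1 - Λ * δ) * y ≤ θ := by
  have hΛ0 : 0 < Λ := by linarith
  rcases le_total (1 - Λ * δ) (Λ ^ 2)⁻¹ with h | h
  · rw [max_eq_left h]
    calc (Λ ^ 2)⁻¹ * y ≤ (Λ ^ 2)⁻¹ * Λ := mul_le_mul_of_nonneg_left hyΛ (by positivity)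
      _ = Λ⁻¹ := by field_simp
      _ ≤ θ := hθ
  · rw [max_eq_right h]
    have hδ0 : 0 ≤ δ := (abs_nonneg _).trans hδ
    rcases le_total y Λ⁻¹ with h1 | h1
    · have : 0 ≤ Λ * δ * y := by positivity
      linarith
    · have h2 : 1 ≤ Λ * y := by
        have := mul_le_mul_of_nonneg_left h1 hΛ0.le
        rwa [mul_inv_cancel₀ hΛ0.ne'] at this
      have h3 := (abs_le.1 hδ).2
      nlinarith

theorem le_sum_abs_dface {h : ℝ} (b : BdryData n N) (θ : Cell n N M → ℝ) (i : Fin (n + 1))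
    (K : Cell n N M) :
    |dfaceUp h b θ i K| + |dfaceDown h b θ i K|
      ≤ ∑ i, (|dfaceUp h b θ i K| + |dfaceDown h b θ i K|) :=
  Finset.single_le_sum (f := fun i => |dfaceUp h b θ i K| + |dfaceDown h b θ i K|)
    (fun _ _ => by positivity) (Finset.mem_univ i)

theorem isCutoff_cutoff {P : Model n} {T : ℝ} {D : Discretization P T} {Λ : ℝ} (hΛ : 1 ≤ Λ)
    {b : BdryData n D.N} {θ : Cell n D.N D.M → ℝ} (hθ : ∀ K, θ K ∈ Set.Icc Λ⁻¹ Λ)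
    (hb : ∀ s a, 0 ≤ b s a) (hbΛ : ∀ s a, b s a ≤ Λ) : IsCutoff b θ (cutoff Λ D.h b θ) := by
  have hh := D.h_pos
  have hθ0 : ∀ K, 0 ≤ θ K := fun K => (pos_of_mem_range hΛ (hθ K)).le
  have hsum : ∀ i K, ∀ y, (y ≤ |dfaceUp D.h b θ i K| ∨ y ≤ |dfaceDown D.h b θ i K|) →
      D.h * y ≤ D.h * ∑ i, (|dfaceUp D.h b θ i K| + |dfaceDown D.h b θ i K|) := by
    intro i K y hy
    refine mul_le_mul_of_nonneg_left (le_trans ?_ (le_sum_abs_dface b θ i K)) hh.le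
    have h1 := abs_nonneg (dfaceUp D.h b θ i K)
    have h2 := abs_nonneg (dfaceDown D.h b θ i K)
    rcases hy with hy | hy <;> linarith
  have hdiv : ∀ x : ℝ, D.h * |x / D.h| = |x| := fun x => by
    rw [abs_div, abs_of_pos hh]; field_simp
  have htwo : ∀ x : ℝ, |x| ≤ |2 * x| := fun x => by
    rw [abs_mul, abs_two]; linarith [abs_nonneg x]
  refine ⟨fun K => le_trans (by positivity) (cutoff_ge Λ D.h b θ K),
    fun K => cutoff_le_one hΛ hh b θ K, ?_, ?_, ?_, ?_⟩
  · intro i K K' hK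
    refine max_mul_le hΛ (hθ K).1 (hθ0 K') (hθ K').2 ?_
    have h1 := hsum i K _ (Or.inl le_rfl)
    have e : dfaceUp D.h b θ i K = (θ K' - θ K) / D.h := by simp only [dfaceUp, hK]
    rw [e, hdiv] at h1
    exact h1
  · intro i K K' hK
    refine max_mul_le hΛ (hθ K).1 (hθ0 K') (hθ K').2 ?_
    have h1 := hsum i K _ (Or.inr le_rfl)
    have e : dfaceDown D.h b θ i K = (θ K - θ K') / D.h := by simp only [dfaceDown, hK]
    rw [e, hdiv, abs_sub_comm] at h1
    exact h1
  · intro K hK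
    refine max_mul_le hΛ (hθ K).1 (hb true K.1) (hbΛ true K.1) ?_
    have h1 := hsum (Fin.last n) K _ (Or.inl le_rfl)
    have e : dfaceUp D.h b θ (Fin.last n) K = (2 * (b true K.1 - θ K)) / D.h := by
      simp only [dfaceUp, hK]; ring
    rw [e, hdiv] at h1
    exact (htwo _).trans h1
  · intro K hK
    refine max_mul_le hΛ (hθ K).1 (hb false K.1) (hbΛ false K.1) ?_
    have h1 := hsum (Fin.last n) K _ (Or.inr le_rfl)
    have e : dfaceDown D.h b θ (Fin.last n) K = -(2 * (b false K.1 - θ K)) / D.h := by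
      simp only [dfaceDown, hK]; ring
    rw [e, hdiv, abs_neg] at h1
    exact (htwo _).trans h1

/-- The cut-off differs from `1` by `O(h)` times a quantity controlled by the dissipation. -/
theorem one_sub_cutoff_le {P : Model n} {Λ h : ℝ} (hΛ : 1 ≤ Λ) (hh : 0 < h) (b : BdryData n N)
    (r θ : Cell n N M → ℝ) (u : Cell n N M → Space n) (K : Cell n N M) :
    1 - cutoff Λ h b θ K ≤ Λ * h * ∑ i : Fin (n + 1),
      (1 + (dissUp P h b r θ u i K + dissDown P h b r θ u i K) / 2) := by
  have hΛ0 : 0 < Λ := by linarith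
  have h1 : 1 - Λ * (h * ∑ i, (|dfaceUp h b θ i K| + |dfaceDown h b θ i K|))
      ≤ cutoff Λ h b θ K := le_max_right _ _
  have hx : ∀ x : ℝ, |x| ≤ (1 + x ^ 2) / 2 := fun x => by
    rw [← sq_abs]; nlinarith [sq_nonneg (|x| - 1)]
  have h2 : ∑ i, (|dfaceUp h b θ i K| + |dfaceDown h b θ i K|) ≤ ∑ i : Fin (n + 1),
      (1 + (dissUp P h b r θ u i K + dissDown P h b r θ u i K) / 2) := by
    refine Finset.sum_le_sum fun i _ => ?_
    have a1 := hx (dfaceUp h b θ i K)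
    have a2 := hx (dfaceDown h b θ i K)
    have a3 := dfaceUp_sq_le hh b r θ u i K (P := P)
    have a4 := dfaceDown_sq_le hh b r θ u i K (P := P)
    linarith
  have h3 := mul_le_mul_of_nonneg_left h2 (show 0 ≤ Λ * h by positivity)
  linarith

theorem sum_one_sub_cutoff_le {P : Model n} {T : ℝ} {D : Discretization P T} {Λ : ℝ}
    (hΛ : 1 ≤ Λ) (b : BdryData n D.N) (r θ : Cell n D.N D.M → ℝ)
    (u : Cell n D.N D.M → Space n) :
    ∑ K, D.h ^ (n + 1) * (1 - cutoff Λ D.h b θ K)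
      ≤ Λ * D.h * ((n + 1) * ((2 * P.L) ^ n * (2 * P.H)) + dissipation P D.h b r θ u) := by
  have hh := D.h_pos
  have hΛ0 : 0 < Λ := by linarith
  have h1 : ∑ K, D.h ^ (n + 1) * (1 - cutoff Λ D.h b θ K) ≤ ∑ K, D.h ^ (n + 1) * (Λ * D.h *
      ∑ i : Fin (n + 1), (1 + (dissUp P D.h b r θ u i K + dissDown P D.h b r θ u i K) / 2)) :=
    Finset.sum_le_sum fun K _ => mul_le_mul_of_nonneg_left (one_sub_cutoff_le hΛ hh b r θ u K)
      (by positivity)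
  refine h1.trans ?_
  have h2 : ∑ K, D.h ^ (n + 1) * (Λ * D.h *
      ∑ i : Fin (n + 1), (1 + (dissUp P D.h b r θ u i K + dissDown P D.h b r θ u i K) / 2))
      = Λ * D.h * ((∑ _K : Cell n D.N D.M, ∑ _i : Fin (n + 1), D.h ^ (n + 1))
        + ∑ K, ∑ i, D.h ^ (n + 1) / 2 *
          (dissUp P D.h b r θ u i K + dissDown P D.h b r θ u i K)) := by
    simp only [Finset.mul_sum, ← Finset.sum_add_distrib]
    exact Finset.sum_congr rfl fun K _ => Finset.sum_congr rfl fun i _ => by ring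
  rw [h2, sum_cells_directions]
  have := dissipation_faces_le hh b r θ u (P := P)
  exact mul_le_mul_of_nonneg_left (by linarith) (by positivity)

end Cutoff

/-! ### The numerical solution -/

section Solution

variable {n : ℕ} {P : Model n} {T : ℝ} {D : Discretization P T}

/-- The integrals of the gravitational force over the cells. -/
def gravity (D : Discretization P T) (K : Cell n D.N D.M) : Space n :=
  fun j => ∫ x in D.box K, P.g x j

theorem integrableOn_gravity (K : Cell n D.N D.M) (j : Fin (n + 1)) :
    IntegrableOn (fun x => P.g x j) (D.box K) := by
  obtain ⟨B, hB⟩ := P.g_bdd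
  refine Measure.integrableOn_of_bounded (M := B) (volume_box_lt_top K).ne
    (((measurable_pi_apply j).comp P.g_meas).aestronglyMeasurable) ?_
  exact ae_of_all _ fun x => hB x j

theorem exists_gravity_bound (P : Model n) : ∃ B, 0 ≤ B ∧ ∀ {T : ℝ} (D : Discretization P T)
    (K : Cell n D.N D.M) (j : Fin (n + 1)), |gravity D K j| ≤ B * D.h ^ (n + 1) := by
  obtain ⟨B, hB⟩ := P.g_bdd
  refine ⟨B, (abs_nonneg _).trans (hB 0 0), fun D K j => ?_⟩
  rw [← volume_box K, ← Real.norm_eq_abs]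
  exact norm_setIntegral_le_of_norm_le_const (volume_box_lt_top K) fun x _ => hB x j

theorem integral_gravity (r : Cell n D.N D.M → ℝ) (u : Cell n D.N D.M → Space n) :
    ∫ x in P.Omega, D.pw r x * ∑ i, P.g x i * D.pw (fun K => u K i) x
      = ∑ K, ∑ j, r K * u K j * gravity D K j := by
  have hK : ∀ K, Set.EqOn (fun x => ∑ j, r K * u K j * P.g x j)
      (fun x => D.pw r x * ∑ i, P.g x i * D.pw (fun K => u K i) x) (D.box K) := fun K x hx => by
    simp only [pw_eq hx, Finset.mul_sum]
    exact Finset.sum_congr rfl fun j _ => by ring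
  have hi : ∀ K, IntegrableOn (fun x => ∑ j, r K * u K j * P.g x j) (D.box K) := fun K =>
    integrable_finsetSum _ fun j _ => (integrableOn_gravity K j).const_mul _
  rw [integral_omega_eq_sum fun K => (hi K).congr_fun (hK K) (measurableSet_box K)]
  refine Finset.sum_congr rfl fun K _ => ?_
  rw [← setIntegral_congr_fun (measurableSet_box K) (hK K),
    integral_finsetSum _ fun j _ => (integrableOn_gravity K j).const_mul _]
  exact Finset.sum_congr rfl fun j _ => integral_const_mul _ _

theorem Fields.IsSolution.stepEq {F : Fields D} {θB : SpaceTime n → ℝ} {ρ₀ : Space n → ℝ}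
    {u₀ : Space n → Space n} {θ₀ : Space n → ℝ} (hF : F.IsSolution θB ρ₀ u₀ θ₀) {k : ℕ}
    (hk : k < D.NT) :
    StepEq P D.h D.dt (F.rho k) (F.rho (k + 1)) (F.theta k) (F.theta (k + 1)) (F.u k)
      (F.u (k + 1)) (D.bdryAvg θB ((k + 1 : ℕ) * D.dt)) (gravity D) :=
  ⟨hF.mass (k + 1) (by omega) hk, hF.momentum (k + 1) (by omega) hk,
    hF.energy (k + 1) (by omega) hk⟩

theorem nonneg_on_closed {H : ℝ} (hH : 0 < H) (hT : 0 < T) {f fe : SpaceTime n → ℝ}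
    (hfe : Continuous fe) (heq : ∀ z ∈ stSlabClosed n H T, fe z = f z)
    (h : ∀ t ∈ Set.Ioo 0 T, ∀ x : Space n, |x (Fin.last n)| ≤ H → 0 < f (t, x)) :
    ∀ z ∈ stSlabClosed n H T, 0 ≤ fe z := by
  have h1 : stSlab n H T ⊆ {z | 0 ≤ fe z} := fun z hz => by
    have hzc : z ∈ stSlabClosed n H T :=
      ⟨⟨hz.1.1.le, hz.1.2.le⟩, ⟨hz.2.1.le, hz.2.2.le⟩⟩
    have := h z.1 hz.1 z.2 (abs_le.2 ⟨hz.2.1.le, hz.2.2.le⟩)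
    rw [Set.mem_ofPred_eq, heq z hzc]
    exact this.le
  exact fun z hz => closure_minimal h1 (isClosed_le continuous_const hfe)
    (stSlabClosed_subset_closure hH hT hz)

variable {N : ℝ} {f fe : SpaceTime n → ℝ} {G : Option (Fin (n + 1)) → SpaceTime n → ℝ}

theorem RegularRep.abs_bdryAvg_sub_cellAvg_le (hf : RegularRep P.L P.H T N f fe G) (t t' : ℝ)
    (s : Bool) {K : Cell n D.N D.M}
    (hK : if s then up (Fin.last n) K = none else down (Fin.last n) K = none) :
    |D.bdryAvg fe t s K.1 - D.cellAvg (fun x => fe (t', x)) K| ≤ N * (D.h + |t - t'|) := by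
  rw [abs_sub_comm]
  refine abs_avg_sub_le (pow_pos D.h_pos _) (volume_box K)
    (integrableOn_box_of_continuous (hf.continuous.comp (by fun_prop)) K) fun x hx => ?_
  rw [abs_sub_comm]
  exact hf.abs_bdryAvg_sub_le t t' s hK hx

/-- The bounds on the data and on the numerical solution, in terms of `Λ`. -/
structure Controlled (Λ : ℝ) (θB : SpaceTime n → ℝ) (F : Fields D) : Prop where
  T_pos : 0 < T
  T_le : T ≤ Λ
  dt_le : D.dt ≤ Λ * D.h
  memW2Inf : MemW2Inf P.L P.H T θB
  norm_le : normW2Inf P.H T θB ≤ Λ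
  pos : ∀ t ∈ Set.Ioo 0 T, ∀ x : Space n, |x (Fin.last n)| ≤ P.H → 0 < θB (t, x)
  inRange : ∀ k ≤ D.NT, InRange Λ (F.rho k) (F.theta k) (F.u k)
  stepEq : ∀ k < D.NT, StepEq P D.h D.dt (F.rho k) (F.rho (k + 1)) (F.theta k)
    (F.theta (k + 1)) (F.u k) (F.u (k + 1)) (D.bdryAvg θB ((k + 1 : ℕ) * D.dt)) (gravity D)

theorem Controlled.bdryAvg_mem {Λ : ℝ} {θB : SpaceTime n → ℝ} {F : Fields D}
    (h : Controlled Λ θB F) {t : ℝ} (ht : t ∈ Set.Icc 0 T) (s : Bool) (a : Fin n → Fin D.N) :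
    0 ≤ D.bdryAvg θB t s a ∧ D.bdryAvg θB t s a ≤ Λ := by
  obtain ⟨fe, G, hf⟩ := h.memW2Inf.exists_regularRep P.H_pos h.T_pos
  rw [hf.bdryAvg_eq ht]
  exact ⟨bdryAvg_nonneg ht (nonneg_on_closed P.H_pos h.T_pos hf.continuous hf.eq h.pos) s a,
    (hf.bdryAvg_le ht s a).trans h.norm_le⟩

/-- The dissipation of the fields at step `k`. -/
def Fields.diss (F : Fields D) (θB : SpaceTime n → ℝ) (k : ℕ) : ℝ :=
  dissipation P D.h (D.bdryAvg θB (k * D.dt)) (F.rho k) (F.theta k) (F.u k)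

theorem Controlled.exists_sum_diss_le (P : Model n) {Λ : ℝ} (hΛ : 1 ≤ Λ) :
    ∃ C, 0 ≤ C ∧ ∀ {T : ℝ} {D : Discretization P T} {θB : SpaceTime n → ℝ} {F : Fields D},
      Controlled Λ θB F → ∑ k ∈ Finset.range D.NT, D.dt * F.diss θB (k + 1) ≤ C := by
  have hL := P.L_pos
  have hH := P.H_pos
  obtain ⟨B, hB, hgB⟩ := exists_gravity_bound P
  obtain ⟨C, hC, H⟩ := exists_sum_dissipation_le P hΛ
    (show 0 ≤ (2 * P.L) ^ n * (2 * P.H) by positivity) hB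
  refine ⟨C, hC, fun {T D θB F} h => ?_⟩
  obtain ⟨fe, G, hf⟩ := h.memW2Inf.exists_regularRep P.H_pos h.T_pos
  have hN := h.norm_le
  have hh := D.h_pos
  have hdt := D.dt_pos
  refine H (z := fun k => D.cellAvg fun x => fe (k * D.dt, x))
    (b := fun k => D.bdryAvg θB (k * D.dt)) hh D.h_lt_one hdt
    (D.NT_mul_dt.trans_le h.T_le) card_cells_mul h.stepEq h.inRange
    (fun K j => hgB D K j) (fun k hk s a => (h.bdryAvg_mem (step_mem hk) s a).1)
    (fun k hk K => (hf.abs_cellAvg_le (step_mem hk) K).trans hN) (fun k hk K => ?_)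
    (fun k hk i K K' hK => (hf.abs_cellAvg_jump_le (step_mem hk) hK).trans
      (mul_le_mul_of_nonneg_right hN hh.le)) (fun k hk K hK => ?_) (fun k hk K hK => ?_)
  · refine (hf.abs_cellAvg_sub_cellAvg_le _ _ K).trans ?_
    have e : ((k + 1 : ℕ) : ℝ) * D.dt - k * D.dt = D.dt := by push_cast; ring
    rw [e, abs_of_pos hdt]
    exact mul_le_mul_of_nonneg_right hN hdt.le
  · have := hf.abs_bdryAvg_sub_cellAvg_le (D := D) (k * D.dt) (k * D.dt) true (K := K) (by simpa)
    rw [sub_self, abs_zero, add_zero, ← hf.bdryAvg_eq (step_mem hk)] at this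
    exact this.trans (mul_le_mul_of_nonneg_right hN hh.le)
  · have := hf.abs_bdryAvg_sub_cellAvg_le (D := D) (k * D.dt) (k * D.dt) false (K := K) (by simpa)
    rw [sub_self, abs_zero, add_zero, ← hf.bdryAvg_eq (step_mem hk)] at this
    exact this.trans (mul_le_mul_of_nonneg_right hN hh.le)

/-- The cut-off at step `k`. -/
def Fields.chi (F : Fields D) (Λ : ℝ) (θB : SpaceTime n → ℝ) (k : ℕ) : Cell n D.N D.M → ℝ :=
  cutoff Λ D.h (D.bdryAvg θB (k * D.dt)) (F.theta k)

/-- `stepIntegral` for the fields at step `k`. -/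
def Fields.production (F : Fields D) (Λ : ℝ) (θB Θ : SpaceTime n → ℝ)
    (G : Fin (n + 1) → SpaceTime n → ℝ) (k : ℕ) (t : ℝ) : ℝ :=
  stepIntegral D (D.bdryAvg θB (k * D.dt)) (F.rho k) (F.theta k) (F.u k) (F.chi Λ θB k)
    (fun x => Θ (t, x)) (fun i x => G i (t, x))

/-- The power of the gravitational force at step `k`. -/
def Fields.power (F : Fields D) (k : ℕ) : ℝ :=
  ∑ K, ∑ j, F.rho k K * F.u k K j * gravity D K j

theorem Controlled.abs_power_le {Λ B : ℝ} (hΛ : 1 ≤ Λ) {θB : SpaceTime n → ℝ} {F : Fields D}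
    (h : Controlled Λ θB F) (hB : ∀ K j, |gravity D K j| ≤ B * D.h ^ (n + 1)) {k : ℕ}
    (hk : k ≤ D.NT) :
    |F.power k| ≤ Λ ^ 2 * B * ((n + 1) * ((2 * P.L) ^ n * (2 * P.H))) := by
  have hΛ0 : 0 < Λ := by linarith
  have hR := h.inRange k hk
  rw [← sum_cells_directions (D := D), Finset.mul_sum, Fields.power]
  refine (Finset.abs_sum_le_sum_abs _ _).trans (Finset.sum_le_sum fun K _ => ?_)
  rw [Finset.mul_sum]
  refine (Finset.abs_sum_le_sum_abs _ _).trans (Finset.sum_le_sum fun j _ => ?_)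
  rw [abs_mul, abs_mul, mul_assoc (Λ ^ 2), pow_two]
  have hr0 := pos_of_mem_range hΛ (hR.rho K)
  exact mul_le_mul (mul_le_mul (by rw [abs_of_pos hr0]; exact (hR.rho K).2) (hR.vel K j)
    (abs_nonneg _) hΛ0.le) (hB K j) (abs_nonneg _) (by positivity)

/-- The cell averages of the test function at the beginning of a time step approximate it during
the whole step. The boundary temperature is that at the end of the step, hence the time step
enters. -/
theorem RegularRep.isApprox {Λ : ℝ} (hΛ : 1 ≤ Λ) (hf : RegularRep P.L P.H T N f fe G)
    (h0 : ∀ z ∈ stSlabClosed n P.H T, 0 ≤ fe z) {θB : SpaceTime n → ℝ}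
    (hbd : ∀ t ∈ Set.Icc 0 T, ∀ x : Space n, |x (Fin.last n)| = P.H → f (t, x) = θB (t, x))
    (hdt : D.dt ≤ Λ * D.h) {k : ℕ} (hk : k < D.NT) {t : ℝ}
    (ht : t ∈ Set.Icc ((k : ℝ) * D.dt) ((k + 1 : ℕ) * D.dt)) :
    IsApprox D (N * (3 + Λ)) (D.bdryAvg θB ((k + 1 : ℕ) * D.dt))
      (D.cellAvg fun x => fe (k * D.dt, x)) (fun x => fe (t, x))
      (fun i x => G (some i) (t, x)) := by
  have hh := D.h_pos
  have hN := hf.nonneg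
  have htT := step_subset hk ht
  have hk0 : (k : ℝ) * D.dt ∈ Set.Icc 0 T := step_mem hk.le
  have hk1 : ((k + 1 : ℕ) : ℝ) * D.dt ∈ Set.Icc 0 T := step_mem (D := D) hk
  have hb : D.bdryAvg θB ((k + 1 : ℕ) * D.dt) = D.bdryAvg fe ((k + 1 : ℕ) * D.dt) := by
    rw [bdryAvg_congr (hbd _ hk1)]
    funext s a
    exact hf.bdryAvg_eq hk1 s a
  have e : ((k + 1 : ℕ) : ℝ) * D.dt = k * D.dt + D.dt := by push_cast; ring
  have d1 : |(k : ℝ) * D.dt - t| ≤ Λ * D.h := by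
    rw [abs_sub_comm, abs_of_nonneg (by linarith [ht.1])]; linarith [ht.2]
  have d2 : |((k + 1 : ℕ) : ℝ) * D.dt - t| ≤ Λ * D.h := by
    rw [abs_of_nonneg (by linarith [ht.2])]; linarith [ht.1]
  have d3 : |((k + 1 : ℕ) : ℝ) * D.dt - k * D.dt| ≤ Λ * D.h := by
    rw [e, add_sub_cancel_left, abs_of_pos D.dt_pos]; exact hdt
  have hmul : ∀ a y : ℝ, a ≤ 3 → y ≤ Λ * D.h → N * (a * D.h + y) ≤ N * (3 + Λ) * D.h := by
    intro a y ha hy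
    rw [mul_assoc]
    exact mul_le_mul_of_nonneg_left (by nlinarith) hN
  have hNc : N ≤ N * (3 + Λ) := le_mul_of_one_le_right hN (by linarith)
  refine ⟨hf.continuous.comp (by fun_prop), fun i => (hf.continuousG _).comp (by fun_prop),
    fun K x hx => h0 _ (mem_closed_of_mem_box htT hx),
    fun K x hx => (hf.bound _ (mem_closed_of_mem_box htT hx)).trans hNc,
    fun i K x hx => (hf.boundG _ _ (mem_closed_of_mem_box htT hx)).trans hNc,
    fun K x hx => ?_, fun i K K' hK => ?_, fun i K K' hK S hS x hx => ?_, fun K hK => ⟨?_, ?_⟩,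
    fun K hK => ⟨?_, ?_⟩⟩
  · rw [abs_sub_comm]
    have h1 := hmul 1 _ (by norm_num) d1
    rw [one_mul] at h1
    exact (hf.abs_cellAvg_sub_le (D := D) _ t hx).trans h1
  · refine (hf.abs_cellAvg_jump_le hk0 hK).trans ?_
    exact mul_le_mul_of_nonneg_right hNc hh.le
  · exact (hf.abs_cellAvg_quotient_le hk0 hK hS hx).trans (hmul 2 _ (by norm_num) d1)
  · have h1 := hmul 1 _ (by norm_num) d3
    rw [one_mul] at h1
    rw [hb]
    exact (hf.abs_bdryAvg_sub_cellAvg_le _ _ true (by simpa)).trans h1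
  · intro x hx
    have h1 := hmul 1 _ (by norm_num) d2
    rw [one_mul] at h1
    rw [hb, abs_sub_comm]
    exact (hf.abs_bdryAvg_sub_le _ t true (by simpa) hx).trans h1
  · have h1 := hmul 1 _ (by norm_num) d3
    rw [one_mul] at h1
    rw [hb]
    exact (hf.abs_bdryAvg_sub_cellAvg_le _ _ false (by simpa)).trans h1
  · intro x hx
    have h1 := hmul 1 _ (by norm_num) d2
    rw [one_mul] at h1
    rw [hb, abs_sub_comm]
    exact (hf.abs_bdryAvg_sub_le _ t false (by simpa) hx).trans h1

/-- The consistency of one time step: the discrete ballistic energy inequality with the cell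
averages of the test function is combined with `exists_stepIntegral_le`. -/
theorem Controlled.exists_step_le (P : Model n) {Λ N : ℝ} (hΛ : 1 ≤ Λ) (hN : 0 ≤ N) :
    ∃ C, 0 ≤ C ∧ ∀ {T : ℝ} {D : Discretization P T} {θB : SpaceTime n → ℝ} {F : Fields D}
      {f fe : SpaceTime n → ℝ} {G : Option (Fin (n + 1)) → SpaceTime n → ℝ},
      Controlled Λ θB F → RegularRep P.L P.H T N f fe G →
      (∀ z ∈ stSlabClosed n P.H T, 0 ≤ fe z) →
      (∀ t ∈ Set.Icc 0 T, ∀ x : Space n, |x (Fin.last n)| = P.H → f (t, x) = θB (t, x)) →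
      ∀ k < D.NT, ∀ t ∈ Set.Icc ((k : ℝ) * D.dt) ((k + 1 : ℕ) * D.dt),
      ballisticRate P D.h D.dt (F.rho k) (F.rho (k + 1)) (F.theta k) (F.theta (k + 1)) (F.u k)
          (F.u (k + 1)) (D.cellAvg fun x => fe (k * D.dt, x))
        ≤ F.power (k + 1) - F.production Λ θB fe (fun i => G (some i)) (k + 1) t
          + C * rate P.alpha D.h * (1 + F.diss θB (k + 1)) ∧
      |F.power (k + 1) - F.production Λ θB fe (fun i => G (some i)) (k + 1) t|
        ≤ C * (1 + F.diss θB (k + 1)) := by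
  have hL := P.L_pos
  have hH := P.H_pos
  have hc : 0 ≤ N * (3 + Λ) := by positivity
  obtain ⟨B, hB, hgB⟩ := exists_gravity_bound P
  obtain ⟨C₁, hC₁, H₁⟩ := exists_stepIntegral_le P hΛ hc
  obtain ⟨C₂, hC₂, H₂⟩ := exists_abs_stepIntegral_le P hΛ hc
  set C₃ := Λ ^ 2 * B * ((n + 1) * ((2 * P.L) ^ n * (2 * P.H))) with hC₃
  have hC₃0 : 0 ≤ C₃ := by positivity
  refine ⟨C₁ + C₂ + C₃, by positivity, ?_⟩
  intro T D θB F f fe G h hf h0 hbd k hk t ht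
  have hh := D.h_pos
  have hk1 : ((k + 1 : ℕ) : ℝ) * D.dt ∈ Set.Icc 0 T := step_mem (D := D) hk
  have hA := hf.isApprox hΛ h0 hbd h.dt_le hk ht
  have hR := h.inRange (k + 1) hk
  have hR₀ := h.inRange k hk.le
  have hb := fun s a => (h.bdryAvg_mem hk1 s a).1
  have hχ : IsCutoff (D.bdryAvg θB ((k + 1 : ℕ) * D.dt)) (F.theta (k + 1)) (F.chi Λ θB (k + 1)) :=
    isCutoff_cutoff hΛ hR.theta hb fun s a => (h.bdryAvg_mem hk1 s a).2
  have hZ : ∀ K, 0 ≤ D.cellAvg (fun x => fe (k * D.dt, x)) K := fun K =>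
    cellAvg_nonneg (step_mem hk.le) h0 K
  have hY0 : 0 ≤ F.diss θB (k + 1) := dissipation_nonneg hh _ _ _ _
  have hrate := rate_pos (α := P.alpha) hh
  have hbal := (h.stepEq k hk).ballistic hh D.dt_pos (fun K => pos_of_mem_range hΛ (hR₀.rho K))
    (fun K => pos_of_mem_range hΛ (hR.rho K)) (fun K => pos_of_mem_range hΛ (hR₀.theta K))
    (fun K => pos_of_mem_range hΛ (hR.theta K)) hZ
  have hle := H₁ hR hχ hb hZ hA
  have habs := H₂ hR (fun K => ⟨hχ.nonneg K, hχ.le_one K⟩) hA.contΘ hA.contG hA.boundΘ hA.boundG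
    (b := D.bdryAvg θB ((k + 1 : ℕ) * D.dt))
  have hpow := h.abs_power_le hΛ (hgB D) (k := k + 1) hk
  constructor
  · have h1 : C₁ * rate P.alpha D.h * (1 + F.diss θB (k + 1))
        ≤ (C₁ + C₂ + C₃) * rate P.alpha D.h * (1 + F.diss θB (k + 1)) :=
      mul_le_mul_of_nonneg_right (mul_le_mul_of_nonneg_right (by linarith) hrate.le)
        (by linarith)
    unfold Fields.power Fields.production
    unfold Fields.diss at h1 ⊢
    linarith
  · have h1 : 0 ≤ C₁ * (1 + F.diss θB (k + 1)) := by positivity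
    have h2 : C₃ ≤ C₃ * (1 + F.diss θB (k + 1)) := le_mul_of_one_le_right hC₃0 (by linarith)
    have h3 := abs_sub (F.power (k + 1))
      (F.production Λ θB fe (fun i => G (some i)) (k + 1) t)
    have h4 : |F.production Λ θB fe (fun i => G (some i)) (k + 1) t|
      ≤ C₂ * (1 + F.diss θB (k + 1)) := habs
    have h5 : |F.power (k + 1)| ≤ C₃ := hpow
    linarith

end Solution

/-! ### The function `χ_h` -/

section Chi

variable {n : ℕ} {P : Model n} {T : ℝ} {D : Discretization P T}

/-- The function `χ_h`, extended by `1` outside the mesh. -/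
def Fields.chiFun (F : Fields D) (Λ : ℝ) (θB : SpaceTime n → ℝ) (z : SpaceTime n) : ℝ :=
  1 + D.pw (fun K => F.chi Λ θB (D.idx z.1) K - 1) z.2

theorem Fields.chiFun_eq (F : Fields D) (Λ : ℝ) (θB : SpaceTime n → ℝ) (t : ℝ)
    {K : Cell n D.N D.M} {x : Space n} (hx : x ∈ D.box K) :
    F.chiFun Λ θB (t, x) = F.chi Λ θB (D.idx t) K := by
  simp only [Fields.chiFun, pw_eq hx]; ring

theorem Fields.measurable_chiFun (F : Fields D) (Λ : ℝ) (θB : SpaceTime n → ℝ) :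
    Measurable (F.chiFun Λ θB) := by
  have h1 : Measurable fun p : ℕ × Space n => D.pw (fun K => F.chi Λ θB p.1 K - 1) p.2 :=
    measurable_from_prod_countable_right fun k => measurable_pw (fun K => F.chi Λ θB k K - 1)
  have h3 : Measurable fun t : ℝ => D.idx t :=
    Nat.measurable_ceil.comp (measurable_id.div_const D.dt)
  have h2 : Measurable fun z : SpaceTime n => (D.idx z.1, z.2) :=
    (h3.comp measurable_fst).prodMk measurable_snd
  have h4 : Measurable fun z : SpaceTime n =>
      D.pw (fun K => F.chi Λ θB (D.idx z.1) K - 1) z.2 := fun _ hs => h2 (h1 hs)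
  exact h4.const_add 1

theorem Fields.chiFun_mem (F : Fields D) {Λ : ℝ} (hΛ : 1 ≤ Λ) (θB : SpaceTime n → ℝ)
    (z : SpaceTime n) : (Λ ^ 2)⁻¹ ≤ F.chiFun Λ θB z ∧ F.chiFun Λ θB z ≤ 1 := by
  by_cases h : ∃ K, z.2 ∈ D.box K
  · obtain ⟨K, hK⟩ := h
    rw [show z = (z.1, z.2) from rfl, F.chiFun_eq Λ θB z.1 hK]
    exact ⟨cutoff_ge _ _ _ _ _, cutoff_le_one hΛ D.h_pos _ _ _⟩
  · push Not at h
    rw [Fields.chiFun, pw_of_notMem h, add_zero]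
    exact ⟨inv_le_one_of_one_le₀ (one_le_pow₀ hΛ), le_rfl⟩

theorem Fields.integral_chiFun (F : Fields D) {Λ : ℝ} (hΛ : 1 ≤ Λ) (θB : SpaceTime n → ℝ)
    (t : ℝ) : ∫ x in P.Omega, |F.chiFun Λ θB (t, x) - 1|
      = ∑ K, D.h ^ (n + 1) * (1 - F.chi Λ θB (D.idx t) K) := by
  have hK : ∀ K, Set.EqOn (fun _ => 1 - F.chi Λ θB (D.idx t) K)
      (fun x => |F.chiFun Λ θB (t, x) - 1|) (D.box K) := fun K x hx => by
    have h1 : F.chi Λ θB (D.idx t) K ≤ 1 := cutoff_le_one hΛ D.h_pos _ _ _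
    simp only [F.chiFun_eq Λ θB t hx]
    rw [abs_sub_comm, abs_of_nonneg (by linarith)]
  have hi : ∀ K, IntegrableOn (fun _ => 1 - F.chi Λ θB (D.idx t) K) (D.box K) := fun K =>
    integrableOn_box_of_continuous continuous_const K
  rw [integral_omega_eq_sum fun K => (hi K).congr_fun (hK K) (measurableSet_box K)]
  refine Finset.sum_congr rfl fun K _ => ?_
  rw [← setIntegral_congr_fun (measurableSet_box K) (hK K), setIntegral_const, volume_box,
    smul_eq_mul]

theorem measurableSet_omega (P : Model n) : MeasurableSet P.Omega := by
  rw [omega_eq_Icc]; exact measurableSet_Icc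

theorem volume_omega_lt_top (P : Model n) : volume P.Omega < ⊤ := by
  rw [omega_eq_Icc]; exact isCompact_Icc.measure_lt_top

/-- The `L¹` distance of `χ_h` from `1` is of order `h`, by the a priori bound of the
dissipation. -/
theorem Controlled.exists_integral_chiFun_le (P : Model n) {Λ : ℝ} (hΛ : 1 ≤ Λ) :
    ∃ C, 0 ≤ C ∧ ∀ {T : ℝ} {D : Discretization P T} {θB : SpaceTime n → ℝ} {F : Fields D},
      Controlled Λ θB F →
      ∫ z in Set.Ioo 0 T ×ˢ P.Omega, |F.chiFun Λ θB z - 1| ≤ C * D.h := by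
  have hL := P.L_pos
  have hH := P.H_pos
  obtain ⟨C, hC, H⟩ := Controlled.exists_sum_diss_le P hΛ
  set A := (n + 1) * ((2 * P.L) ^ n * (2 * P.H)) with hA
  have hA0 : 0 ≤ A := by positivity
  refine ⟨Λ * (Λ * A + C), by positivity, fun {T D θB F} h => ?_⟩
  have hint : IntegrableOn (fun z => |F.chiFun Λ θB z - 1|) (Set.Ioo 0 T ×ˢ P.Omega)
      (volume.prod volume) := by
    refine Measure.integrableOn_of_bounded (M := 1) ?_
      (((F.measurable_chiFun Λ θB).sub_const 1).abs.aestronglyMeasurable) ?_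
    · rw [Measure.prod_prod]
      exact ENNReal.mul_ne_top (by simp) (volume_omega_lt_top P).ne
    · refine ae_of_all _ fun z => ?_
      have h1 := F.chiFun_mem hΛ θB z
      have h2 : 0 ≤ (Λ ^ 2)⁻¹ := by positivity
      rw [Real.norm_eq_abs, abs_abs, abs_sub_comm, abs_of_nonneg (by linarith)]
      linarith
  rw [Measure.volume_eq_prod, setIntegral_prod _ hint, ← integral_Ioc_eq_integral_Ioo,
    ← intervalIntegral.integral_of_le h.T_pos.le]
  have h1 := integral_idx (D := D) (φ := fun _ => 1)
    (Fn := fun t => ∫ x in P.Omega, |F.chiFun Λ θB (t, x) - 1|)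
    (f := fun k _ => ∑ K, D.h ^ (n + 1) * (1 - F.chi Λ θB k K)) (by simp)
    (fun k _ => continuousOn_const) (ae_of_all _ fun t _ => F.integral_chiFun hΛ θB t)
  simp only [one_mul] at h1
  rw [h1]
  have h2 : ∀ k ∈ Finset.range D.NT, ∫ _t in ((k : ℝ) * D.dt)..((k + 1 : ℕ) * D.dt),
      ∑ K, D.h ^ (n + 1) * (1 - F.chi Λ θB (k + 1) K)
      ≤ Λ * D.h * (D.dt * A + D.dt * F.diss θB (k + 1)) := by
    intro k _
    have e : ((k + 1 : ℕ) : ℝ) * D.dt - k * D.dt = D.dt := by push_cast; ring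
    rw [intervalIntegral.integral_const, e, smul_eq_mul]
    have h3 := sum_one_sub_cutoff_le (D := D) hΛ (D.bdryAvg θB ((k + 1 : ℕ) * D.dt))
      (F.rho (k + 1)) (F.theta (k + 1)) (F.u (k + 1))
    have := mul_le_mul_of_nonneg_left h3 D.dt_pos.le
    unfold Fields.chi Fields.diss
    linarith
  refine (Finset.sum_le_sum h2).trans ?_
  rw [← Finset.mul_sum, Finset.sum_add_distrib]
  simp only [Finset.sum_const, Finset.card_range, nsmul_eq_mul]
  have h4 : (D.NT : ℝ) * (D.dt * A) ≤ Λ * A := by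
    rw [← mul_assoc, D.NT_mul_dt]
    exact mul_le_mul_of_nonneg_right h.T_le hA0
  have h5 := H h
  have h6 : 0 ≤ Λ * D.h := mul_nonneg (by linarith) D.h_pos.le
  have h7 := mul_le_mul_of_nonneg_left (add_le_add h4 h5) h6
  linarith

end Chi

/-! ### The consistency error -/

section Error

variable {n : ℕ} {P : Model n} {T : ℝ} {D : Discretization P T}
  {N : ℝ} {f fe : SpaceTime n → ℝ} {G : Option (Fin (n + 1)) → SpaceTime n → ℝ}

theorem RegularRep.ae_partial_eq (hf : RegularRep P.L P.H T N f fe G) :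
    ∀ᵐ t, t ∈ Set.Ioo 0 T → ∀ᵐ x ∂volume.restrict P.Omega, ∀ a,
      stPartial P.H T a f (t, x) = G a (t, x) := by
  have h1 : ∀ᵐ z ∂volume.restrict (stSlab n P.H T), ∀ a, stPartial P.H T a f z = G a z :=
    ae_all_iff.2 hf.partial_eq
  rw [ae_restrict_iff' (isOpen_stSlab P.H T).measurableSet, Measure.volume_eq_prod] at h1
  filter_upwards [Measure.ae_ae_of_ae_prod h1] with t ht htT
  rw [ae_restrict_iff' (measurableSet_omega P)]
  filter_upwards [ht, Measure.ae_eval_ne (μ := fun _ : Fin (n + 1) => (volume : Measure ℝ))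
    (Fin.last n) (-P.H), Measure.ae_eval_ne (μ := fun _ : Fin (n + 1) => (volume : Measure ℝ))
    (Fin.last n) P.H] with x hx h2 h3 hΩ
  exact hx ⟨htT, lt_of_le_of_ne hΩ.2.1 (Ne.symm h2), lt_of_le_of_ne hΩ.2.2 h3⟩

theorem RegularRep.integral_production_eq (hf : RegularRep P.L P.H T N f fe G) (F : Fields D)
    (Λ : ℝ) (θB : SpaceTime n → ℝ) {t : ℝ} (ht : t ∈ Set.Ioo 0 T) :
    ∫ x in P.Omega,
      (P.kappa * f (t, x) * F.chiFun Λ θB (t, x) / D.pw (F.theta (D.idx t)) x ^ 2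
          * ∑ i, F.gradTheta θB i t x ^ 2
        + f (t, x) / D.pw (F.theta (D.idx t)) x
          * D.pw (stressPower P D.h (F.u (D.idx t))) x)
      = F.production Λ θB fe (fun _ _ => 0) (D.idx t) t := by
  have h1 := integral_add_integral_eq_stepIntegral (D := D) (D.bdryAvg θB (D.idx t * D.dt))
    (F.rho (D.idx t)) (F.theta (D.idx t)) (F.u (D.idx t)) (F.chi Λ θB (D.idx t))
    (χf := fun x => F.chiFun Λ θB (t, x)) (Θ := fun x => fe (t, x)) (Gt := fun _ => 0)
    (G := fun _ _ => 0) (fun K x hx => F.chiFun_eq Λ θB t hx) (hf.continuous.comp (by fun_prop))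
    continuous_const (fun _ => continuous_const)
  simp only [mul_zero, Finset.sum_const_zero, add_zero, sub_zero, integral_zero, zero_add] at h1
  rw [Fields.production, ← h1]
  refine setIntegral_congr_fun (measurableSet_omega P) fun x hx => ?_
  have e : f (t, x) = fe (t, x) := (hf.eq (t, x) ⟨⟨ht.1.le, ht.2.le⟩, hx.2⟩).symm
  simp only [e, Fields.gradTheta]

/-- The weak derivatives agree with their Lipschitz representatives on almost every time slice. -/
theorem RegularRep.ae_integral_transport_eq (hf : RegularRep P.L P.H T N f fe G) (F : Fields D)
    (Λ : ℝ) (θB : SpaceTime n → ℝ) : ∀ᵐ t, t ∈ Set.Ioo 0 T →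
    ∫ x in P.Omega,
      (D.pw (F.rho (D.idx t)) x
          * P.entropy (D.pw (F.rho (D.idx t)) x) (D.pw (F.theta (D.idx t)) x)
          * (stPartial P.H T none f (t, x)
            + ∑ i, D.pw (fun K => F.u (D.idx t) K i) x * stPartial P.H T (some i) f (t, x))
        - P.kappa / D.pw (F.theta (D.idx t)) x
          * ∑ i, F.gradTheta θB i t x * stPartial P.H T (some i) f (t, x))
      = entropyAt D (F.rho (D.idx t)) (F.theta (D.idx t)) (G none) t
        + F.production Λ θB (fun _ => 0) (fun i => G (some i)) (D.idx t) t := by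
  filter_upwards [hf.ae_partial_eq] with t ht htT
  have h1 := integral_add_integral_eq_stepIntegral (D := D) (D.bdryAvg θB (D.idx t * D.dt))
    (F.rho (D.idx t)) (F.theta (D.idx t)) (F.u (D.idx t)) (F.chi Λ θB (D.idx t))
    (χf := fun x => F.chiFun Λ θB (t, x)) (Θ := fun _ => 0) (Gt := fun x => G none (t, x))
    (G := fun i x => G (some i) (t, x)) (fun K x hx => F.chiFun_eq Λ θB t hx)
    continuous_const ((hf.continuousG _).comp (by fun_prop))
    (fun i => (hf.continuousG _).comp (by fun_prop))
  simp only [mul_zero, zero_mul, zero_div, add_zero, integral_zero, zero_add] at h1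
  rw [Fields.production, entropyAt, ← h1]
  refine integral_congr_ae ?_
  filter_upwards [ht htT] with x hx
  simp only [hx, Fields.gradTheta]

theorem continuousOn_entropyAt (r θ : Cell n D.N D.M → ℝ) {Θ : SpaceTime n → ℝ}
    (hΘ : Continuous Θ) : ContinuousOn (entropyAt D r θ Θ) (Set.Icc 0 T) :=
  continuousOn_finsetSum _ fun K _ => continuousOn_const.mul
    (continuousOn_setIntegral (measurableSet_box K) subset_rfl hΘ)

theorem continuousOn_energyAt (r θ : Cell n D.N D.M → ℝ) (u : Cell n D.N D.M → Space n)
    {Θ : SpaceTime n → ℝ} (hΘ : Continuous Θ) :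
    ContinuousOn (energyAt D r θ u Θ) (Set.Icc 0 T) :=
  continuousOn_finsetSum _ fun K _ => continuousOn_const.sub (continuousOn_const.mul
    (continuousOn_setIntegral (measurableSet_box K) subset_rfl hΘ))

/-- The consistency error is a sum over the time steps of the defect between the integrated
production terms and the discrete ballistic energy rate. -/
theorem RegularRep.errorBE_eq (hT : 0 < T) (hf : RegularRep P.L P.H T N f fe G) (F : Fields D)
    (Λ : ℝ) (θB : SpaceTime n → ℝ) {ψ : ℝ → ℝ} (hψ : MemW12 T ψ) (hψT : ψ T = 0) :
    F.errorBE θB (F.chiFun Λ θB) f ψ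
      = ∑ k ∈ Finset.range D.NT, ((∫ t in ((k : ℝ) * D.dt)..((k + 1 : ℕ) * D.dt),
          ψ t * (F.power (k + 1) - F.production Λ θB fe (fun i => G (some i)) (k + 1) t))
        - D.dt * (ψ (k * D.dt) * ballisticRate P D.h D.dt
          (F.rho k) (F.rho (k + 1)) (F.theta k) (F.theta (k + 1)) (F.u k) (F.u (k + 1))
          (D.cellAvg fun x => fe (k * D.dt, x)))) := by
  set g := weakDeriv (Set.Ioo 0 T) 1 ψ with hg
  have hgi : IntervalIntegrable g volume 0 T := hψ.intervalIntegrable hT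
  have hψc : ContinuousOn ψ (Set.uIcc 0 T) := by rw [Set.uIcc_of_le hT.le]; exact hψ.cont
  have hψi : IntervalIntegrable ψ volume 0 T := hψc.intervalIntegrable
  have hGc := hf.continuousG
  have hc0 : Continuous fun _ : SpaceTime n => (0 : ℝ) := continuous_const
  have c1 : ∀ k, ContinuousOn (F.production Λ θB fe (fun _ _ => 0) k) (Set.Icc 0 T) := fun k =>
    continuousOn_stepIntegral (Θ := fe) (G := fun _ _ => 0) _ _ _ _ _ hf.continuous fun _ => hc0
  have c2 : ∀ k, ContinuousOn (F.production Λ θB (fun _ => 0) (fun i => G (some i)) k)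
      (Set.Icc 0 T) := fun k =>
    continuousOn_stepIntegral (Θ := fun _ => 0) (G := fun i => G (some i)) _ _ _ _ _ hc0
      fun i => hGc (some i)
  have c3 : ∀ k, ContinuousOn (entropyAt D (F.rho k) (F.theta k) (G none)) (Set.Icc 0 T) :=
    fun k => continuousOn_entropyAt _ _ (hGc none)
  have c4 : ∀ k, ContinuousOn (energyAt D (F.rho k) (F.theta k) (F.u k) fe) (Set.Icc 0 T) :=
    fun k => continuousOn_energyAt _ _ _ hf.continuous
  have hsplit : ∀ k t, F.production Λ θB fe (fun _ _ => 0) k t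
      + F.production Λ θB (fun _ => 0) (fun i => G (some i)) k t
      = F.production Λ θB fe (fun i => G (some i)) k t := fun k t =>
    stepIntegral_add_zero _ _ _ _ _ (hf.continuous.comp (by fun_prop))
      fun i => (hGc (some i)).comp (by fun_prop)
  have i1 := integral_idx (D := D) (φ := ψ) (f := fun k _ => F.power k) hψi
    (fun k _ => continuousOn_const) (ae_of_all _ fun t _ =>
      integral_gravity (F.rho (D.idx t)) (F.u (D.idx t)))
  have i2 := integral_idx (D := D) (φ := g) (Fn := fun t => F.ballisticEnergy f (D.idx t) t)
    (f := fun k => energyAt D (F.rho k) (F.theta k) (F.u k) fe) hgi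
    (fun k _ => c4 k) (ae_of_all _ fun t ht => hf.ballisticEnergy_eq F _ ⟨ht.1.le, ht.2.le⟩)
  have i3 := integral_idx (D := D) (φ := ψ)
    (f := F.production Λ θB fe (fun _ _ => 0)) hψi
    (fun k _ => c1 k) (ae_of_all _ fun t ht => hf.integral_production_eq F Λ θB ht)
  have i4 := integral_idx (D := D) (φ := ψ)
    (f := fun k t => entropyAt D (F.rho k) (F.theta k) (G none) t
      + F.production Λ θB (fun _ => 0) (fun i => G (some i)) k t) hψi
    (fun k _ => (c3 k).add (c2 k)) (hf.ae_integral_transport_eq F Λ θB)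
  have hparts := hf.sum_integral_parts F hgi (hψ.eq_integral hT) hψT
  rw [Finset.sum_sub_distrib, sub_eq_add_neg (Finset.sum _ _), ← hparts, Fields.errorBE, i1, i2,
    i3, i4, hf.ballisticEnergy_eq F 0 ⟨le_rfl, hT.le⟩]
  have hstep : ∀ k ∈ Finset.range D.NT,
      (∫ t in ((k : ℝ) * D.dt)..((k + 1 : ℕ) * D.dt), ψ t * F.power (k + 1))
      + (∫ t in ((k : ℝ) * D.dt)..((k + 1 : ℕ) * D.dt),
        g t * energyAt D (F.rho (k + 1)) (F.theta (k + 1)) (F.u (k + 1)) fe t)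
      - (∫ t in ((k : ℝ) * D.dt)..((k + 1 : ℕ) * D.dt),
        ψ t * F.production Λ θB fe (fun _ _ => 0) (k + 1) t)
      - (∫ t in ((k : ℝ) * D.dt)..((k + 1 : ℕ) * D.dt),
        ψ t * (entropyAt D (F.rho (k + 1)) (F.theta (k + 1)) (G none) t
        + F.production Λ θB (fun _ => 0) (fun i => G (some i)) (k + 1) t))
      = (∫ t in ((k : ℝ) * D.dt)..((k + 1 : ℕ) * D.dt),
          ψ t * (F.power (k + 1) - F.production Λ θB fe (fun i => G (some i)) (k + 1) t))
        + ∫ t in ((k : ℝ) * D.dt)..((k + 1 : ℕ) * D.dt),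
          (g t * energyAt D (F.rho (k + 1)) (F.theta (k + 1)) (F.u (k + 1)) fe t
          + ψ t * -entropyAt D (F.rho (k + 1)) (F.theta (k + 1)) (G none) t) := by
    intro k hk
    have hs : Set.uIcc ((k : ℝ) * D.dt) ((k + 1 : ℕ) * D.dt) ⊆ Set.Icc 0 T := by
      rw [Set.uIcc_of_le (step_le_succ D k)]; exact step_subset (Finset.mem_range.1 hk)
    have hs' : Set.uIcc ((k : ℝ) * D.dt) ((k + 1 : ℕ) * D.dt) ⊆ Set.uIcc 0 T := by
      rwa [Set.uIcc_of_le hT.le]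
    have hψk := hψi.mono_set hs'
    have hgk := hgi.mono_set hs'
    have j1 : IntervalIntegrable (fun t => ψ t * F.power (k + 1)) volume
      ((k : ℝ) * D.dt) ((k + 1 : ℕ) * D.dt) := hψk.mul_const _
    have j2 := hgk.mul_continuousOn ((c4 (k + 1)).mono hs)
    have j3 := hψk.mul_continuousOn ((c1 (k + 1)).mono hs)
    have j4 := hψk.mul_continuousOn ((c3 (k + 1)).mono hs)
    have j5 := hψk.mul_continuousOn ((c2 (k + 1)).mono hs)
    have e1 : ∀ t, ψ t * (entropyAt D (F.rho (k + 1)) (F.theta (k + 1)) (G none) t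
        + F.production Λ θB (fun _ => 0) (fun i => G (some i)) (k + 1) t)
        = ψ t * entropyAt D (F.rho (k + 1)) (F.theta (k + 1)) (G none) t
        + ψ t * F.production Λ θB (fun _ => 0) (fun i => G (some i)) (k + 1) t :=
      fun t => mul_add _ _ _
    have e2 : ∀ t, ψ t * (F.power (k + 1)
        - F.production Λ θB fe (fun i => G (some i)) (k + 1) t)
        = ψ t * F.power (k + 1) - (ψ t * F.production Λ θB fe (fun _ _ => 0) (k + 1) t
          + ψ t * F.production Λ θB (fun _ => 0) (fun i => G (some i)) (k + 1) t) := fun t => by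
      rw [← hsplit]; ring
    have e3 : ∀ t, g t * energyAt D (F.rho (k + 1)) (F.theta (k + 1)) (F.u (k + 1)) fe t
          + ψ t * -entropyAt D (F.rho (k + 1)) (F.theta (k + 1)) (G none) t
        = g t * energyAt D (F.rho (k + 1)) (F.theta (k + 1)) (F.u (k + 1)) fe t
          - ψ t * entropyAt D (F.rho (k + 1)) (F.theta (k + 1)) (G none) t := fun t => by ring
    simp only [e1, e2, e3]
    rw [intervalIntegral.integral_add j4 j5, intervalIntegral.integral_sub j1 (j3.add j5),
      intervalIntegral.integral_add j3 j5, intervalIntegral.integral_sub j2 j4]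
    ring
  have hsum := Finset.sum_congr (rfl : Finset.range D.NT = _) hstep
  simp only [Finset.sum_add_distrib, Finset.sum_sub_distrib] at hsum
  linarith

theorem rate_ge_sqrt {α Λ h dt : ℝ} (hΛ : 1 ≤ Λ) (hh : 0 < h) (hh1 : h < 1)
    (hdt : dt ≤ Λ * h) : Real.sqrt dt ≤ Λ * rate α h := by
  have h1 : Real.sqrt h ≤ rate α h := by
    rw [Real.sqrt_eq_rpow]; exact sqrt_le_rate hh hh1
  have h2 : Real.sqrt Λ ≤ Λ := by
    rw [Real.sqrt_le_left (by linarith)]; nlinarith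
  calc Real.sqrt dt ≤ Real.sqrt (Λ * h) := Real.sqrt_le_sqrt hdt
    _ = Real.sqrt Λ * Real.sqrt h := Real.sqrt_mul (by linarith) _
    _ ≤ Λ * rate α h := mul_le_mul h2 h1 (Real.sqrt_nonneg _) (by linarith)

/-- Sum of the consistency estimates over the time steps. The oscillation of `ψ` within a step is at
most `√Δt` times its norm, and `√Δt` is bounded by a multiple of the rate; `ψ` itself is bounded by
its norm because `ψ(T) = 0`. -/
theorem Controlled.exists_errorBE_ge (P : Model n) {Λ N : ℝ} (hΛ : 1 ≤ Λ) (hN : 0 ≤ N) :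
    ∃ C, ∀ {T : ℝ} {D : Discretization P T} {θB Θ : SpaceTime n → ℝ} {F : Fields D},
      Controlled Λ θB F → MemW2Inf P.L P.H T Θ → normW2Inf P.H T Θ = N →
      (∀ t ∈ Set.Ioo 0 T, ∀ x : Space n, |x (Fin.last n)| ≤ P.H → 0 < Θ (t, x)) →
      (∀ t ∈ Set.Icc 0 T, ∀ x : Space n, |x (Fin.last n)| = P.H → Θ (t, x) = θB (t, x)) →
      ∀ {ψ : ℝ → ℝ}, MemW12 T ψ → (∀ t ∈ Set.Icc 0 T, 0 ≤ ψ t) → ψ T = 0 →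
      -(C * normW12 T ψ * rate P.alpha D.h) ≤ F.errorBE θB (F.chiFun Λ θB) Θ ψ := by
  have hΛ0 : 0 < Λ := by linarith
  obtain ⟨C₁, hC₁, H₁⟩ := Controlled.exists_step_le P hΛ hN
  obtain ⟨C₂, hC₂, H₂⟩ := Controlled.exists_sum_diss_le P hΛ
  refine ⟨2 * Λ * C₁ * (Λ + C₂), ?_⟩
  intro T D θB Θ F h hΘ hΘN hpos hbd ψ hψ hψ0 hψT
  obtain ⟨fe, G, hf⟩ := hΘ.exists_regularRep P.H_pos h.T_pos
  rw [hΘN] at hf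
  have hT := h.T_pos
  have h0 := nonneg_on_closed P.H_pos hT hf.continuous hf.eq hpos
  rw [hf.errorBE_eq hT F Λ θB hψ hψT]
  have hh := D.h_pos
  have hdt := D.dt_pos
  set W := normW12 T ψ with hW
  have hW0 : 0 ≤ W := Real.sqrt_nonneg _
  set ρ := rate P.alpha D.h with hρ
  have hρ0 : 0 < ρ := rate_pos hh
  set Q : ℕ → ℝ → ℝ := fun k t =>
    F.power k - F.production Λ θB fe (fun i => G (some i)) k t with hQ
  set X : ℕ → ℝ := fun k => ballisticRate P D.h D.dt
    (F.rho k) (F.rho (k + 1)) (F.theta k) (F.theta (k + 1)) (F.u k) (F.u (k + 1))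
    (D.cellAvg fun x => fe (k * D.dt, x)) with hX
  have hQc : ∀ k, ContinuousOn (Q k) (Set.Icc 0 T) := fun k =>
    continuousOn_const.sub (continuousOn_stepIntegral (Θ := fe) (G := fun i => G (some i))
      _ _ _ _ _ hf.continuous fun i => hf.continuousG (some i))
  have hψW : ∀ t ∈ Set.Icc 0 T, ψ t ≤ Λ * W := by
    intro t ht
    have h1 := hψ.abs_sub_le hT ht.1 ht.2 le_rfl
    rw [hψT, zero_sub, abs_neg] at h1
    have h2 : Real.sqrt (T - t) ≤ Λ := by
      rw [Real.sqrt_le_left hΛ0.le]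
      nlinarith [ht.1, h.T_le]
    exact (le_abs_self _).trans (h1.trans (mul_le_mul_of_nonneg_right h2 hW0))
  have hstep : ∀ k ∈ Finset.range D.NT,
      -(2 * Λ * C₁ * W * ρ * (D.dt + D.dt * F.diss θB (k + 1)))
      ≤ (∫ t in ((k : ℝ) * D.dt)..((k + 1 : ℕ) * D.dt), ψ t * Q (k + 1) t)
        - D.dt * (ψ (k * D.dt) * X k) := by
    intro k hk
    have hk' := Finset.mem_range.1 hk
    have hle := step_le_succ D k
    have hsub := step_subset (T := T) hk'
    have hkT : (k : ℝ) * D.dt ∈ Set.Icc 0 T := step_mem hk'.le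
    have e : ((k + 1 : ℕ) : ℝ) * D.dt - k * D.dt = D.dt := by push_cast; ring
    have hY0 : 0 ≤ F.diss θB (k + 1) := dissipation_nonneg hh _ _ _ _
    have hpt : ∀ t ∈ Set.Icc ((k : ℝ) * D.dt) ((k + 1 : ℕ) * D.dt),
        ψ (k * D.dt) * X k - 2 * Λ * C₁ * W * ρ * (1 + F.diss θB (k + 1))
        ≤ ψ t * Q (k + 1) t := by
      intro t ht
      obtain ⟨h1, h2⟩ := H₁ h hf h0 hbd k hk' t ht
      have h3 := mul_le_mul_of_nonneg_left h1 (hψ0 _ hkT)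
      have h4 : ψ (k * D.dt) * (C₁ * ρ * (1 + F.diss θB (k + 1)))
          ≤ Λ * W * (C₁ * ρ * (1 + F.diss θB (k + 1))) :=
        mul_le_mul_of_nonneg_right (hψW _ hkT) (by positivity)
      have h5 : |ψ t - ψ (k * D.dt)| ≤ Λ * ρ * W := by
        refine (hψ.abs_sub_le hT hkT.1 ht.1 (hsub ht).2).trans
          (mul_le_mul_of_nonneg_right ?_ hW0)
        refine rate_ge_sqrt hΛ hh D.h_lt_one (le_trans ?_ h.dt_le)
        linarith [ht.2]
      have h6 : |(ψ t - ψ (k * D.dt)) * Q (k + 1) t|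
          ≤ Λ * ρ * W * (C₁ * (1 + F.diss θB (k + 1))) := by
        rw [abs_mul]
        exact mul_le_mul h5 h2 (abs_nonneg _) (by positivity)
      have h7 := (abs_le.1 h6).1
      have h8 : ψ t * Q (k + 1) t
          = ψ (k * D.dt) * Q (k + 1) t + (ψ t - ψ (k * D.dt)) * Q (k + 1) t := by ring
      rw [h8]
      simp only [hX, hQ] at h3 h7 ⊢
      linarith
    have hs : Set.uIcc ((k : ℝ) * D.dt) ((k + 1 : ℕ) * D.dt) ⊆ Set.Icc 0 T := by
      rw [Set.uIcc_of_le hle]; exact hsub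
    have hi : IntervalIntegrable (fun t => ψ t * Q (k + 1) t) volume
        ((k : ℝ) * D.dt) ((k + 1 : ℕ) * D.dt) :=
      ((hψ.cont.mono hs).mul ((hQc (k + 1)).mono hs)).intervalIntegrable
    have hmono := intervalIntegral.integral_mono_on hle (by simp) hi hpt
    rw [intervalIntegral.integral_const, e, smul_eq_mul] at hmono
    linarith
  refine le_trans ?_ (Finset.sum_le_sum hstep)
  rw [Finset.sum_neg_distrib, ← Finset.mul_sum, Finset.sum_add_distrib]
  simp only [Finset.sum_const, Finset.card_range, nsmul_eq_mul, D.NT_mul_dt]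
  have h9 := add_le_add h.T_le (H₂ h)
  have h10 := mul_le_mul_of_nonneg_left h9 (show 0 ≤ 2 * Λ * C₁ * W * ρ by positivity)
  linarith

/-- All the bounds hold with the constant `Λ` of the theorem; `Λ ≥ 1` because it is at least
`1/ρlo + ρhi ≥ 1/ρlo + ρlo`. -/
theorem Controlled.of_isSolution (hT : 0 < T) {θB : SpaceTime n → ℝ}
    (hθB : MemW2Inf P.L P.H T θB)
    (hpos : ∀ t ∈ Set.Ioo 0 T, ∀ x : Space n, |x (Fin.last n)| ≤ P.H → 0 < θB (t, x))
    {ρlo ρhi θlo θhi uhi Clo Chi : ℝ} (hρlo : 0 < ρlo) (hθlo : 0 < θlo) (hClo : 0 < Clo)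
    (hdt : D.dt ≤ Chi * D.h) {ρ₀ : Space n → ℝ} {u₀ : Space n → Space n} {θ₀ : Space n → ℝ}
    {F : Fields D} (hF : F.IsSolution θB ρ₀ u₀ θ₀) (hB : F.Bounded ρlo ρhi θlo θhi uhi) :
    1 ≤ Lam P.H T θB ρlo ρhi θlo θhi uhi Clo Chi ∧
      Controlled (Lam P.H T θB ρlo ρhi θlo θhi uhi Clo Chi) θB F := by
  have hh := D.h_pos
  set K₀ : Cell n D.N D.M := (fun _ => ⟨0, N_pos D⟩, ⟨0, M_pos D⟩)
  obtain ⟨⟨hρ1, hρ2⟩, ⟨hθ1, hθ2⟩, hu⟩ := hB 0 (Nat.zero_le _) K₀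
  have hρhi : ρlo ≤ ρhi := hρ1.trans hρ2
  have hθhi : θlo ≤ θhi := hθ1.trans hθ2
  have huhi : 0 ≤ uhi := (Real.sqrt_nonneg _).trans hu
  have hChi : 0 < Chi := pos_of_mul_pos_left (D.dt_pos.trans_le hdt) hh.le
  have hnorm : 0 ≤ normW2Inf P.H T θB := by
    obtain ⟨fe, G, hf⟩ := hθB.exists_regularRep P.H_pos hT
    exact hf.nonneg
  have i1 : 0 < 1 / ρlo := by positivity
  have i2 : 0 < 1 / θlo := by positivity
  have i3 : 0 < 1 / Clo := by positivity
  set Λ := Lam P.H T θB ρlo ρhi θlo θhi uhi Clo Chi with hΛdef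
  have hΛ : Λ = T + normW2Inf P.H T θB + 1 / ρlo + ρhi + 1 / θlo + θhi + uhi + 1 / Clo + Chi := rfl
  have h1 : 1 ≤ 1 / ρlo + ρlo := by
    have : 1 / ρlo + ρlo - 1 = ((ρlo - 1) ^ 2 + ρlo) / ρlo := by field_simp; ring
    have : 0 ≤ ((ρlo - 1) ^ 2 + ρlo) / ρlo := by positivity
    linarith
  have hΛ1 : 1 ≤ Λ := by linarith
  have hΛ0 : 0 < Λ := by linarith
  have hinv : ∀ lo, 0 < lo → 1 / lo ≤ Λ → Λ⁻¹ ≤ lo := fun lo hlo hle => by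
    rw [inv_le_comm₀ hΛ0 hlo, ← one_div]; exact hle
  refine ⟨hΛ1, hT, by linarith, hdt.trans (mul_le_mul_of_nonneg_right (by linarith) hh.le), hθB,
    by linarith, hpos, fun k hk => ⟨fun K => ?_, fun K => ?_, fun K i => ?_⟩,
    fun k hk => hF.stepEq hk⟩
  · have := (hB k hk K).1
    exact ⟨(hinv ρlo hρlo (by linarith)).trans this.1, by linarith [this.2]⟩
  · have := (hB k hk K).2.1
    exact ⟨(hinv θlo hθlo (by linarith)).trans this.1, by linarith [this.2]⟩
  · refine (Real.abs_le_sqrt ?_).trans ((hB k hk K).2.2.trans (by linarith))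
    exact Finset.single_le_sum (f := fun i => F.u k K i ^ 2) (fun _ _ => sq_nonneg _)
      (Finset.mem_univ i)

end Error

end BallisticFV

end

theorem lemma2p5 (n : ℕ) (hn : n = 1 ∨ n = 2) (P : BallisticFV.Model n) :
    ∃ (C : ℝ → ℝ → ℝ) (χlo χhi : ℝ → ℝ) (ε : ℝ → ℝ → ℝ),
      (∀ Λ, 0 < χlo Λ) ∧ (∀ Λ, Tendsto (ε Λ) (𝓝[>] 0) (𝓝 0)) ∧
      ∀ (T : ℝ) (_ : 0 < T)
        (θB : BallisticFV.SpaceTime n → ℝ) (_ : BallisticFV.MemW2Inf P.L P.H T θB)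
        (_ : ∀ t ∈ Set.Ioo 0 T, ∀ x : BallisticFV.Space n, |x (Fin.last n)| ≤ P.H → 0 < θB (t, x))
        (ρlo ρhi θlo θhi uhi Clo Chi : ℝ) (_ : 0 < ρlo) (_ : 0 < θlo) (_ : 0 < Clo)
        (D : BallisticFV.Discretization P T) (_ : Clo * D.h ≤ D.dt) (_ : D.dt ≤ Chi * D.h)
        (ρ₀ : BallisticFV.Space n → ℝ) (u₀ : BallisticFV.Space n → BallisticFV.Space n)
        (θ₀ : BallisticFV.Space n → ℝ) (_ : IntegrableOn ρ₀ P.Omega)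
        (_ : IntegrableOn u₀ P.Omega) (_ : IntegrableOn θ₀ P.Omega)
        (F : BallisticFV.Fields D) (_ : F.IsSolution θB ρ₀ u₀ θ₀)
        (_ : F.Bounded ρlo ρhi θlo θhi uhi),
        ∃ χ : BallisticFV.SpaceTime n → ℝ, Measurable χ ∧
          (∀ z, χlo (BallisticFV.Lam P.H T θB ρlo ρhi θlo θhi uhi Clo Chi) ≤ χ z ∧
            χ z ≤ χhi (BallisticFV.Lam P.H T θB ρlo ρhi θlo θhi uhi Clo Chi)) ∧
          (∫ z in Set.Ioo 0 T ×ˢ P.Omega, |χ z - 1|) ≤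
            ε (BallisticFV.Lam P.H T θB ρlo ρhi θlo θhi uhi Clo Chi) D.h ∧
          ∀ (Θ : BallisticFV.SpaceTime n → ℝ) (_ : BallisticFV.MemW2Inf P.L P.H T Θ)
            (_ : ∀ t ∈ Set.Ioo 0 T, ∀ x : BallisticFV.Space n,
              |x (Fin.last n)| ≤ P.H → 0 < Θ (t, x))
            (_ : ∀ t ∈ Set.Icc 0 T, ∀ x : BallisticFV.Space n,
              |x (Fin.last n)| = P.H → Θ (t, x) = θB (t, x))
            (ψ : ℝ → ℝ) (_ : BallisticFV.MemW12 T ψ) (_ : ∀ t ∈ Set.Icc 0 T, 0 ≤ ψ t)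
            (_ : ψ T = 0),
            -(C (BallisticFV.Lam P.H T θB ρlo ρhi θlo θhi uhi Clo Chi)
                (BallisticFV.normW2Inf P.H T Θ)
              * BallisticFV.normW12 T ψ
              * (D.h ^ ((1 - P.alpha) / 2) + D.h ^ ((1 + P.alpha) / 2)))
              ≤ F.errorBE θB χ Θ ψ := by
  choose! C hC using fun (Λ N : ℝ) (hΛ : 1 ≤ Λ) (hN : 0 ≤ N) =>
    BallisticFV.Controlled.exists_errorBE_ge P hΛ hN
  choose! A hA0 hA using fun (Λ : ℝ) (hΛ : 1 ≤ Λ) =>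
    BallisticFV.Controlled.exists_integral_chiFun_le P hΛ
  refine ⟨C, fun Λ => (max 1 Λ ^ 2)⁻¹, fun _ => 1, fun Λ h => A Λ * h, fun Λ => ?_, fun Λ => ?_, ?_⟩
  · have : 0 < max 1 Λ := lt_max_of_lt_left one_pos
    positivity
  · have h1 : Tendsto (fun h : ℝ => A Λ * h) (𝓝 0) (𝓝 (A Λ * 0)) := tendsto_id.const_mul _
    rw [mul_zero] at h1
    exact h1.mono_left nhdsWithin_le_nhds
  intro T hT θB hθB hθBpos ρlo ρhi θlo θhi uhi Clo Chi hρlo hθlo hClo D _ hdt ρ₀ u₀ θ₀ _ _ _ F hF hB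
  obtain ⟨hΛ, hctrl⟩ := BallisticFV.Controlled.of_isSolution hT hθB hθBpos hρlo hθlo hClo hdt hF hB
  set Λ := BallisticFV.Lam P.H T θB ρlo ρhi θlo θhi uhi Clo Chi
  refine ⟨F.chiFun Λ θB, F.measurable_chiFun Λ θB, fun z => ?_, hA Λ hΛ hctrl, ?_⟩
  · have h := F.chiFun_mem hΛ θB z
    rw [← max_eq_right hΛ] at h
    simpa only [max_eq_right hΛ] using h
  · intro Θ hΘ hΘpos hbd ψ hψ hψ0 hψT
    obtain ⟨fe, G, hf⟩ := hΘ.exists_regularRep P.H_pos hT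
    exact hC Λ _ hΛ hf.nonneg hctrl hΘ rfl hΘpos hbd hψ hψ0 hψT
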